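/- **Theorem 1.** Weighted Connected Vertex Cover can be solved deterministically in $O(2^k k(|V|+|E|))$ time and $O(2^k k)$ space. That is: let an instance consist of a finite undirected simple graph $G=(V,E)$, given by adjacency lists (in any order), a weight function $\omega : V \to \mathbb{R}$ with positive values, and an integer $k\ge 0$. A connected vertex cover of $G$ is a set $X\subseteq V$ that contains at least one endpoint of every edge and for which $G[X]$ is connected (the empty set counts as connected). There are a single deterministic program and a constant $C$ such that, on every instance, the program halts and outputs a connected vertex cover $X$ with $|X|\le k$ whose weight $\sum_{v\in X}\omega(v)$ is minimum among all connected vertex covers of cardinality at most $k$, or reports (correctly) that no connected vertex cover of cardinality at most $k$ exists; it takes at most $C\,(2^k k(|V|+|E|)+1)$ steps, and each of the constantly many arrays in its working memory has at most $C\,(2^k k+1)$ cells. The machine is a unit-cost random access machine with a read-only input. It works with words, on which it has comparison, addition, truncated subtraction, multiplication, division with remainder and bitwise and/or, and with real numbers, which can only be read from the input, copied, added and compared with each other (in particular they are never converted to words). Every word that occurs is a natural number less than $C\,(2^k k+|V|+|E|+1)$, i.e. it has at most $\log_2(2^k k+|V|+|E|+1)+O(1)$ bits. -/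

import Mathlib

/-! # A deterministic random access machine with words and real numbers

The machine has finitely many word registers, finitely many arrays of words and finitely many arrays
of real numbers (a program is a finite object, so it mentions finitely many of each), and a read-only
input. Words are natural numbers below a fixed bound. Real numbers can only be read from the input,
copied, added and compared; in particular a real number is never converted into a word. Programs are
built from assignments by sequencing, branching and looping, and every elementary operation takes one
step. -/

namespace RealRAM

/-- The read-only input: some arrays of words and one array of real numbers. -/
structure Input where
  words : List (List ℕ)
  reals : List ℝ

/-- The resources of a machine: every array has `cells` cells, and every word is below `word`. -/
structure Limits where
  cells : ℕ
  word : ℕ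

/-- The working memory: registers, arrays of words, and arrays of real numbers. -/
structure State where
  reg : ℕ → ℕ
  mem : ℕ → ℕ → ℕ
  rmem : ℕ → ℕ → ℝ

/-- The memory before the computation starts. -/
def State.init : State := ⟨fun _ => 0, fun _ _ => 0, fun _ _ => 0⟩

/-- The operations on words. -/
inductive WordOp
  | add | sub | mul | div | mod | land | lor

/-- The value of an operation on words (subtraction is truncated at `0`). -/
def WordOp.eval : WordOp → ℕ → ℕ → ℕ
  | .add, x, y => x + y
  | .sub, x, y => x - y
  | .mul, x, y => x * y
  | .div, x, y => x / y
  | .mod, x, y => x % y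
  | .land, x, y => x &&& y
  | .lor, x, y => x ||| y

/-- Expressions for words. -/
inductive Expr
  /-- a constant -/
  | const (c : ℕ)
  /-- the content of register `x` -/
  | reg (x : ℕ)
  /-- the content of cell `i` of the array `a` of words -/
  | load (a : ℕ) (i : Expr)
  /-- entry `i` of the input array `a` of words -/
  | input (a : ℕ) (i : Expr)
  /-- an operation on words -/
  | op (o : WordOp) (e₁ e₂ : Expr)

/-- Expressions for real numbers. -/
inductive RExpr
  /-- the constant `0` -/
  | zero
  /-- the content of cell `i` of the array `a` of real numbers -/
  | load (a : ℕ) (i : Expr)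
  /-- entry `i` of the input array of real numbers -/
  | input (i : Expr)
  /-- addition -/
  | add (r₁ r₂ : RExpr)

/-- Conditions. -/
inductive Cond
  /-- comparison of two words -/
  | lt (e₁ e₂ : Expr)
  /-- comparison of two real numbers -/
  | rlt (r₁ r₂ : RExpr)
  /-- negation -/
  | not (b : Cond)
  /-- conjunction -/
  | and (b₁ b₂ : Cond)

/-- Programs. -/
inductive Prog
  /-- do nothing -/
  | skip
  /-- register `x` receives the value of `e` -/
  | assign (x : ℕ) (e : Expr)
  /-- cell `i` of the array `a` of words receives the value of `e` -/
  | store (a : ℕ) (i e : Expr)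
  /-- cell `i` of the array `a` of real numbers receives the value of `r` -/
  | rstore (a : ℕ) (i : Expr) (r : RExpr)
  /-- `p`, then `q` -/
  | seq (p q : Prog)
  /-- `p` if `b` holds, otherwise `q` -/
  | ite (b : Cond) (p q : Prog)
  /-- repeat `p` as long as `b` holds -/
  | loop (b : Cond) (p : Prog)

/-- The number of elementary operations in the evaluation of an expression. -/
def Expr.cost : Expr → ℕ
  | .const _ => 1
  | .reg _ => 1
  | .load _ i => i.cost + 1
  | .input _ i => i.cost + 1
  | .op _ e₁ e₂ => e₁.cost + e₂.cost + 1

/-- The number of elementary operations in the evaluation of an expression. -/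
def RExpr.cost : RExpr → ℕ
  | .zero => 1
  | .load _ i => i.cost + 1
  | .input i => i.cost + 1
  | .add r₁ r₂ => r₁.cost + r₂.cost + 1

/-- The number of elementary operations in the evaluation of a condition. -/
def Cond.cost : Cond → ℕ
  | .lt e₁ e₂ => e₁.cost + e₂.cost + 1
  | .rlt r₁ r₂ => r₁.cost + r₂.cost + 1
  | .not b => b.cost + 1
  | .and b₁ b₂ => b₁.cost + b₂.cost + 1

/-- A number that does not fit into a word is an error. -/
def Limits.fit (L : Limits) (v : ℕ) : Option ℕ := if v < L.word then some v else none

/-- An index outside of an array of the working memory is an error. -/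
def Limits.index (L : Limits) (i : ℕ) : Option ℕ := if i < L.cells then some i else none

/-- The value of an expression; `none` is an error: an access outside of the memory or of the input,
or a number that does not fit into a word. -/
def Expr.eval (L : Limits) (I : Input) (σ : State) : Expr → Option ℕ
  | .const c => L.fit c
  | .reg x => some (σ.reg x)
  | .load a i => do
      let j ← L.index (← i.eval L I σ)
      return σ.mem a j
  | .input a i => do
      let j ← i.eval L I σ
      let A ← I.words[a]?
      let v ← A[j]?
      L.fit v
  | .op o e₁ e₂ => do
      let x ← e₁.eval L I σ
      let y ← e₂.eval L I σ
      L.fit (o.eval x y)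

/-- The value of an expression for real numbers. -/
noncomputable def RExpr.eval (L : Limits) (I : Input) (σ : State) : RExpr → Option ℝ
  | .zero => some 0
  | .load a i => do
      let j ← L.index (← i.eval L I σ)
      return σ.rmem a j
  | .input i => do
      let j ← i.eval L I σ
      I.reals[j]?
  | .add r₁ r₂ => do
      let x ← r₁.eval L I σ
      let y ← r₂.eval L I σ
      return x + y

open Classical in
/-- The value of a condition. -/
noncomputable def Cond.eval (L : Limits) (I : Input) (σ : State) : Cond → Option Bool
  | .lt e₁ e₂ => do
      let x ← e₁.eval L I σ
      let y ← e₂.eval L I σ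
      return decide (x < y)
  | .rlt r₁ r₂ => do
      let x ← r₁.eval L I σ
      let y ← r₂.eval L I σ
      return decide (x < y)
  | .not b => do
      let x ← b.eval L I σ
      return !x
  | .and b₁ b₂ => do
      let x ← b₁.eval L I σ
      let y ← b₂.eval L I σ
      return x && y

/-- The memory after writing the word `v` into register `x`. -/
def State.setReg (σ : State) (x v : ℕ) : State :=
  { σ with reg := Function.update σ.reg x v }

/-- The memory after writing the word `v` into cell `i` of the array `a` of words. -/
def State.setMem (σ : State) (a i v : ℕ) : State :=
  { σ with mem := Function.update σ.mem a (Function.update (σ.mem a) i v) }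

/-- The memory after writing `v` into cell `i` of the array `a` of real numbers. -/
noncomputable def State.setRMem (σ : State) (a i : ℕ) (v : ℝ) : State :=
  { σ with rmem := Function.update σ.rmem a (Function.update (σ.rmem a) i v) }

/-- `Exec L I p σ τ t`: on a machine with resources `L` and with input `I`, the program `p`, started
with memory `σ`, halts without error with memory `τ` after exactly `t` steps. -/
inductive Exec (L : Limits) (I : Input) : Prog → State → State → ℕ → Prop
  | skip (σ : State) : Exec L I .skip σ σ 1
  | assign (σ : State) (x : ℕ) (e : Expr) (v : ℕ) (hv : e.eval L I σ = some v) :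
      Exec L I (.assign x e) σ (σ.setReg x v) (e.cost + 1)
  | store (σ : State) (a : ℕ) (i e : Expr) (j v : ℕ) (hi : i.eval L I σ = some j)
      (hj : j < L.cells) (hv : e.eval L I σ = some v) :
      Exec L I (.store a i e) σ (σ.setMem a j v) (i.cost + e.cost + 1)
  | rstore (σ : State) (a : ℕ) (i : Expr) (r : RExpr) (j : ℕ) (v : ℝ)
      (hi : i.eval L I σ = some j) (hj : j < L.cells) (hv : r.eval L I σ = some v) :
      Exec L I (.rstore a i r) σ (σ.setRMem a j v) (i.cost + r.cost + 1)
  | seq (σ₁ σ₂ σ₃ : State) (p q : Prog) (t₁ t₂ : ℕ) (hp : Exec L I p σ₁ σ₂ t₁)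
      (hq : Exec L I q σ₂ σ₃ t₂) : Exec L I (.seq p q) σ₁ σ₃ (t₁ + t₂)
  | ite_true (σ τ : State) (b : Cond) (p q : Prog) (t : ℕ) (hb : b.eval L I σ = some true)
      (hp : Exec L I p σ τ t) : Exec L I (.ite b p q) σ τ (b.cost + 1 + t)
  | ite_false (σ τ : State) (b : Cond) (p q : Prog) (t : ℕ) (hb : b.eval L I σ = some false)
      (hq : Exec L I q σ τ t) : Exec L I (.ite b p q) σ τ (b.cost + 1 + t)
  | loop_true (σ₁ σ₂ σ₃ : State) (b : Cond) (p : Prog) (t₁ t₂ : ℕ)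
      (hb : b.eval L I σ₁ = some true) (hp : Exec L I p σ₁ σ₂ t₁)
      (hl : Exec L I (.loop b p) σ₂ σ₃ t₂) : Exec L I (.loop b p) σ₁ σ₃ (b.cost + 1 + t₁ + t₂)
  | loop_false (σ : State) (b : Cond) (p : Prog) (hb : b.eval L I σ = some false) :
      Exec L I (.loop b p) σ σ (b.cost + 1)

end RealRAM

/-! # Weighted Connected Vertex Cover -/

namespace WCVC

/-- `X` is a connected vertex cover: it contains an endpoint of every edge, and any two of its
vertices are joined by a path inside `X` (so the empty set counts as connected). -/
def IsConnectedVertexCover {V : Type*} (G : SimpleGraph V) (X : Finset V) : Prop :=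
  G.IsVertexCover (X : Set V) ∧ (G.induce (X : Set V)).Preconnected

/-- `X` is a minimum weight connected vertex cover of cardinality at most `k`. -/
def IsSolution {V : Type*} (G : SimpleGraph V) (ω : V → ℝ) (k : ℕ) (X : Finset V) : Prop :=
  IsConnectedVertexCover G X ∧ X.card ≤ k ∧
    ∀ Y : Finset V, IsConnectedVertexCover G Y → Y.card ≤ k → ∑ v ∈ X, ω v ≤ ∑ v ∈ Y, ω v

/-- `nb v` lists the neighbours of `v`, each once, in some order, for every vertex `v`. -/
def IsAdjacencyLists {n : ℕ} (G : SimpleGraph (Fin n)) (nb : Fin n → List (Fin n)) : Prop :=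
  ∀ v, (nb v).Nodup ∧ ∀ u, u ∈ nb v ↔ G.Adj v u

/-- The instance `(G, ω, k)` as an input of a machine. The three input arrays of words hold: the
numbers `|V|`, `|E|` and `k`; for each `i ≤ n` the position where the list of vertex `i` starts (for
`i = n`, the total length); the concatenated adjacency lists. The input array of real numbers holds
the weights. -/
noncomputable def encode {n : ℕ} (G : SimpleGraph (Fin n)) (nb : Fin n → List (Fin n))
    (ω : Fin n → ℝ) (k : ℕ) : RealRAM.Input where
  words :=
    [[n, G.edgeSet.ncard, k],
      List.ofFn fun i : Fin (n + 1) => ∑ v : Fin n with v.val < i.val, (nb v).length,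
      (List.ofFn nb).flatten.map Fin.val]
  reals := List.ofFn ω

/-- The machine reports the vertex set `X`: register `0` holds `1`, register `1` holds `|X|`, and the
first `|X|` cells of the array `0` of words list the elements of `X`. -/
def Reports {n : ℕ} (σ : RealRAM.State) (X : Finset (Fin n)) : Prop :=
  σ.reg 0 = 1 ∧ σ.reg 1 = X.card ∧
    (Finset.range X.card).image (σ.mem 0) = X.map Fin.valEmbedding

/-- The machine reports that there is no solution: register `0` holds `0`. -/
def ReportsNone (σ : RealRAM.State) : Prop := σ.reg 0 = 0

end WCVC

/-! # A deterministic algorithm for Weighted Connected Vertex Cover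

**Shortening a connected vertex cover.** Growing a connected set by edges that share no vertex yields
a list that is both the vertex set of a matching and a connected vertex cover, or a proof that there
is no connected vertex cover of size at most `k`: a matching of more than `k` edges
(`Net.Ordered.le_card`) or an edge in another component (`Net.Ordered.not_cvc`). The list has at most
`2 k + 2` vertices, and each of them but the first one has an earlier neighbour. Contract its first
`sh + 1` vertices into one and look for a connected vertex cover that contains them and has at most
`k + sh` vertices. If there is a connected vertex cover `Y` with `|Y| ≤ k`, then adding the contracted
vertices keeps it connected, and it meets them if there are at least two (`Net.Ordered.exists_union`),
so a cover as desired exists. It replaces the list, and `sh` decreases by one; hence the list never has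
more than `s = k + 1` items, counting the contracted vertices as a single one. Once `sh = 0`, nothing
is contracted, and the same search returns a solution of minimum weight. There are `O(k)` rounds.

**Searching relative to the list.** A round tries all choices `A` of items of the list. The vertices
outside of the list form an independent set; those with a neighbour that is not chosen are forced into
the cover. What remains is to connect the components of the forest that the tree of the list induces
on the chosen items. For this it suffices to use items one by one, each of which touches the component
reached so far: such chains describe connected vertex covers (`Net.Layout.cvc_of_chain`), and every
connected vertex cover yields one (`Net.Layout.exists_chain`) which is not more expensive
(`Net.Layout.sum_chain_le`). Cheapest chains are found by dynamic programming over the sets of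
components (`ChainTable`). In the last round the number of additional vertices is a part of the state,
because weight and cardinality matter; in the other rounds only the cardinality does.

**Resources.** If `c A` is the number of components of the choice `A`, then the sum of `2 ^ c A` over
the choices that cover the edges of the tree is at most `2 ^ (s + 1)` (`sum_two_pow_tops_le`): each
further item has two options, no matter whether its parent is chosen. As a state is treated in time
`O(|V|)`, a round takes `O(2 ^ k (|V| + |E|))` steps, and the last one `k` times as many. No array is
indexed by the vertices of the graph. Instead, vertices outside of the list with the same neighbours in
it are merged into one item (`Net.item`), so there are `O(2 ^ k)` items and `O(2 ^ k k)` incidences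
between them and the list; membership in the list is tested by linear search.

**Programs.** The statement `Runs L I p σ Q` is computed from the program `p` like a weakest
precondition; `Frame` says which registers and arrays a program leaves alone. The states of the
computation are described by the structures `BuildState`, `EvalState`, `TableState` and `BestState`. -/

/-! ### Verification conditions for programs -/

namespace RealRAM

/-- Entry `i` of the input array `a` of words, `0` outside of the input. -/
def Input.word (I : Input) (a i : ℕ) : ℕ := (I.words.getD a []).getD i 0

/-- Entry `i` of the input array `a` of words exists. -/
def Input.HasWord (I : Input) (a i : ℕ) : Prop := a < I.words.length ∧ i < (I.words.getD a []).length

/-- The value of an expression, regardless of errors. -/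
def Expr.val (I : Input) (σ : State) : Expr → ℕ
  | .const c => c
  | .reg x => σ.reg x
  | .load a i => σ.mem a (i.val I σ)
  | .input a i => I.word a (i.val I σ)
  | .op o e₁ e₂ => o.eval (e₁.val I σ) (e₂.val I σ)

/-- The evaluation of an expression runs into no error. -/
def Expr.Safe (L : Limits) (I : Input) (σ : State) : Expr → Prop
  | .const c => c < L.word
  | .reg _ => True
  | .load _ i => i.Safe L I σ ∧ i.val I σ < L.cells
  | .input a i => i.Safe L I σ ∧ I.HasWord a (i.val I σ) ∧ I.word a (i.val I σ) < L.word
  | .op o e₁ e₂ => e₁.Safe L I σ ∧ e₂.Safe L I σ ∧ o.eval (e₁.val I σ) (e₂.val I σ) < L.word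

/-- The value of an expression for real numbers, regardless of errors. -/
noncomputable def RExpr.val (I : Input) (σ : State) : RExpr → ℝ
  | .zero => 0
  | .load a i => σ.rmem a (i.val I σ)
  | .input i => I.reals.getD (i.val I σ) 0
  | .add r₁ r₂ => r₁.val I σ + r₂.val I σ

/-- The evaluation of an expression for real numbers runs into no error. -/
def RExpr.Safe (L : Limits) (I : Input) (σ : State) : RExpr → Prop
  | .zero => True
  | .load _ i => i.Safe L I σ ∧ i.val I σ < L.cells
  | .input i => i.Safe L I σ ∧ i.val I σ < I.reals.length
  | .add r₁ r₂ => r₁.Safe L I σ ∧ r₂.Safe L I σ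

/-- The truth of a condition, regardless of errors. -/
def Cond.Holds (I : Input) (σ : State) : Cond → Prop
  | .lt e₁ e₂ => e₁.val I σ < e₂.val I σ
  | .rlt r₁ r₂ => r₁.val I σ < r₂.val I σ
  | .not b => ¬ b.Holds I σ
  | .and b₁ b₂ => b₁.Holds I σ ∧ b₂.Holds I σ

/-- The evaluation of a condition runs into no error. -/
def Cond.Safe (L : Limits) (I : Input) (σ : State) : Cond → Prop
  | .lt e₁ e₂ => e₁.Safe L I σ ∧ e₂.Safe L I σ
  | .rlt r₁ r₂ => r₁.Safe L I σ ∧ r₂.Safe L I σ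
  | .not b => b.Safe L I σ
  | .and b₁ b₂ => b₁.Safe L I σ ∧ b₂.Safe L I σ

variable {L : Limits} {I : Input}

theorem Expr.eval_eq_some {σ : State} {e : Expr} {v : ℕ} :
    e.eval L I σ = some v ↔ e.Safe L I σ ∧ e.val I σ = v := by
  induction e generalizing v with
  | const c => simp [Expr.eval, Expr.Safe, Expr.val, Limits.fit]
  | reg x => simp [Expr.eval, Expr.Safe, Expr.val]
  | load a i ih =>
    simp only [Expr.eval, Expr.Safe, Expr.val, Limits.index, Option.bind_eq_bind,
      Option.bind_eq_some_iff, ih]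
    constructor
    · rintro ⟨x, ⟨h1, rfl⟩, y, h2, h3⟩
      split_ifs at h2 with h
      simp_all
    · rintro ⟨⟨h1, h2⟩, rfl⟩
      exact ⟨_, ⟨h1, rfl⟩, _, if_pos h2, rfl⟩
  | input a i ih =>
    simp only [Expr.eval, Expr.Safe, Expr.val, Limits.fit, Option.bind_eq_bind,
      Option.bind_eq_some_iff, ih, Input.word, Input.HasWord, List.getD_eq_getElem?_getD]
    constructor
    · rintro ⟨x, ⟨h1, rfl⟩, A, hA, w, hw, h2⟩
      split_ifs at h2 with h
      obtain ⟨ha, rfl⟩ := List.getElem?_eq_some_iff.1 hA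
      obtain ⟨hb, rfl⟩ := List.getElem?_eq_some_iff.1 hw
      simp_all
    · rintro ⟨⟨h1, ⟨h2, h3⟩, h4⟩, rfl⟩
      simp only [List.getElem?_eq_getElem h2, Option.getD_some] at h3 h4 ⊢
      simp only [List.getElem?_eq_getElem h3, Option.getD_some] at h4 ⊢
      exact ⟨_, ⟨h1, rfl⟩, _, rfl, _, List.getElem?_eq_getElem h3, by simp [h4]⟩
  | op o e₁ e₂ ih₁ ih₂ =>
    simp only [Expr.eval, Expr.Safe, Expr.val, Limits.fit, Option.bind_eq_bind,
      Option.bind_eq_some_iff, ih₁, ih₂]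
    constructor
    · rintro ⟨x, ⟨h1, rfl⟩, y, ⟨h2, rfl⟩, h3⟩
      split_ifs at h3 with h
      simp_all
    · rintro ⟨⟨h1, h2, h3⟩, rfl⟩
      exact ⟨_, ⟨h1, rfl⟩, _, ⟨h2, rfl⟩, if_pos h3⟩

theorem RExpr.eval_eq_some {σ : State} {r : RExpr} {v : ℝ} :
    r.eval L I σ = some v ↔ r.Safe L I σ ∧ r.val I σ = v := by
  induction r generalizing v with
  | zero => simp [RExpr.eval, RExpr.Safe, RExpr.val]
  | load a i =>
    simp only [RExpr.eval, RExpr.Safe, RExpr.val, Limits.index, Option.bind_eq_bind,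
      Option.bind_eq_some_iff, Expr.eval_eq_some]
    constructor
    · rintro ⟨x, ⟨h1, rfl⟩, y, h2, h3⟩
      split_ifs at h2 with h
      simp_all
    · rintro ⟨⟨h1, h2⟩, rfl⟩
      exact ⟨_, ⟨h1, rfl⟩, _, if_pos h2, rfl⟩
  | input i =>
    simp only [RExpr.eval, RExpr.Safe, RExpr.val, Option.bind_eq_bind,
      Option.bind_eq_some_iff, Expr.eval_eq_some, List.getD_eq_getElem?_getD]
    constructor
    · rintro ⟨x, ⟨h1, rfl⟩, hA⟩
      obtain ⟨ha, rfl⟩ := List.getElem?_eq_some_iff.1 hA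
      simp_all
    · rintro ⟨⟨h1, h2⟩, rfl⟩
      exact ⟨_, ⟨h1, rfl⟩, by simp [List.getElem?_eq_getElem h2]⟩
  | add r₁ r₂ ih₁ ih₂ =>
    simp only [RExpr.eval, RExpr.Safe, RExpr.val, Option.bind_eq_bind,
      Option.bind_eq_some_iff, ih₁, ih₂]
    constructor
    · rintro ⟨x, ⟨h1, rfl⟩, y, ⟨h2, rfl⟩, h3⟩
      simp_all
    · rintro ⟨⟨h1, h2⟩, rfl⟩
      exact ⟨_, ⟨h1, rfl⟩, _, ⟨h2, rfl⟩, rfl⟩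

theorem Cond.eval_eq_some {σ : State} {b : Cond} {v : Bool} :
    b.eval L I σ = some v ↔ b.Safe L I σ ∧ (b.Holds I σ ↔ v = true) := by
  induction b generalizing v with
  | lt e₁ e₂ =>
    simp only [Cond.eval, Cond.Safe, Cond.Holds, Option.bind_eq_bind,
      Option.bind_eq_some_iff, Expr.eval_eq_some]
    constructor
    · rintro ⟨x, ⟨h1, rfl⟩, y, ⟨h2, rfl⟩, h3⟩
      have := Option.some.inj h3
      subst this
      simp_all
    · rintro ⟨⟨h1, h2⟩, h⟩
      refine ⟨_, ⟨h1, rfl⟩, _, ⟨h2, rfl⟩, congrArg some ?_⟩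
      cases v <;> simp_all
  | rlt e₁ e₂ =>
    simp only [Cond.eval, Cond.Safe, Cond.Holds, Option.bind_eq_bind,
      Option.bind_eq_some_iff, RExpr.eval_eq_some]
    constructor
    · rintro ⟨x, ⟨h1, rfl⟩, y, ⟨h2, rfl⟩, h3⟩
      have := Option.some.inj h3
      subst this
      simp_all
    · rintro ⟨⟨h1, h2⟩, h⟩
      refine ⟨_, ⟨h1, rfl⟩, _, ⟨h2, rfl⟩, congrArg some ?_⟩
      cases v <;> simp_all
  | not b ih =>
    simp only [Cond.eval, Cond.Safe, Cond.Holds, Option.bind_eq_bind,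
      Option.bind_eq_some_iff, ih]
    constructor
    · rintro ⟨x, ⟨h1, h2⟩, h3⟩
      have := Option.some.inj h3
      subst this
      cases x <;> simp_all
    · rintro ⟨h1, h⟩
      refine ⟨!v, ⟨h1, ?_⟩, by simp⟩
      cases v <;> simp_all
  | and b₁ b₂ ih₁ ih₂ =>
    simp only [Cond.eval, Cond.Safe, Cond.Holds, Option.bind_eq_bind,
      Option.bind_eq_some_iff, ih₁, ih₂]
    constructor
    · rintro ⟨x, ⟨h1, h2⟩, y, ⟨h3, h4⟩, h5⟩
      have := Option.some.inj h5
      subst this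
      simp_all
    · rintro ⟨⟨h1, h2⟩, h⟩
      classical
      refine ⟨decide (b₁.Holds I σ), ⟨h1, by simp⟩, decide (b₂.Holds I σ), ⟨h2, by simp⟩, congrArg some ?_⟩
      cases v <;> simp_all

/-- Started with memory `σ`, the program `p` halts without error, and the final memory together
with the number of steps satisfies `Q`. -/
def Runs (L : Limits) (I : Input) (p : Prog) (σ : State) (Q : State → ℕ → Prop) : Prop :=
  ∃ τ t, Exec L I p σ τ t ∧ Q τ t

/-- The registers to which a program may write. -/
def Prog.regs : Prog → List ℕ
  | .skip => []
  | .assign x _ => [x]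
  | .store _ _ _ => []
  | .rstore _ _ _ => []
  | .seq p q => p.regs ++ q.regs
  | .ite _ p q => p.regs ++ q.regs
  | .loop _ p => p.regs

/-- The arrays of words to which a program may write. -/
def Prog.mems : Prog → List ℕ
  | .skip => []
  | .assign _ _ => []
  | .store a _ _ => [a]
  | .rstore _ _ _ => []
  | .seq p q => p.mems ++ q.mems
  | .ite _ p q => p.mems ++ q.mems
  | .loop _ p => p.mems

/-- The arrays of real numbers to which a program may write. -/
def Prog.rmems : Prog → List ℕ
  | .skip => []
  | .assign _ _ => []
  | .store _ _ _ => []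
  | .rstore a _ _ => [a]
  | .seq p q => p.rmems ++ q.rmems
  | .ite _ p q => p.rmems ++ q.rmems
  | .loop _ p => p.rmems

/-- The memories `σ` and `τ` differ at most in what `p` may write to. -/
structure Frame (p : Prog) (σ τ : State) : Prop where
  reg : ∀ x, x ∉ p.regs → τ.reg x = σ.reg x
  mem : ∀ a, a ∉ p.mems → τ.mem a = σ.mem a
  rmem : ∀ a, a ∉ p.rmems → τ.rmem a = σ.rmem a

@[simp] theorem setReg_reg (σ : State) (x v y : ℕ) :
    (σ.setReg x v).reg y = if y = x then v else σ.reg y := by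
  simp [State.setReg, Function.update_apply]
@[simp] theorem setReg_mem (σ : State) (x v : ℕ) : (σ.setReg x v).mem = σ.mem := rfl
@[simp] theorem setReg_rmem (σ : State) (x v : ℕ) : (σ.setReg x v).rmem = σ.rmem := rfl
@[simp] theorem setMem_reg (σ : State) (a i v : ℕ) : (σ.setMem a i v).reg = σ.reg := rfl
@[simp] theorem setMem_mem (σ : State) (a i v b : ℕ) :
    (σ.setMem a i v).mem b = if b = a then Function.update (σ.mem a) i v else σ.mem b := by
  simp [State.setMem, Function.update_apply]
@[simp] theorem setMem_rmem (σ : State) (a i v : ℕ) : (σ.setMem a i v).rmem = σ.rmem := rfl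
@[simp] theorem setRMem_reg (σ : State) (a i : ℕ) (v : ℝ) : (σ.setRMem a i v).reg = σ.reg := rfl
@[simp] theorem setRMem_mem (σ : State) (a i : ℕ) (v : ℝ) : (σ.setRMem a i v).mem = σ.mem := rfl
@[simp] theorem setRMem_rmem (σ : State) (a i : ℕ) (v : ℝ) (b : ℕ) :
    (σ.setRMem a i v).rmem b = if b = a then Function.update (σ.rmem a) i v else σ.rmem b := by
  simp [State.setRMem, Function.update_apply]

theorem Frame.refl (p : Prog) (σ : State) : Frame p σ σ :=
  ⟨fun _ _ => rfl, fun _ _ => rfl, fun _ _ => rfl⟩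

theorem Frame.trans {p : Prog} {σ τ υ : State} (h : Frame p σ τ) (h' : Frame p τ υ) :
    Frame p σ υ :=
  ⟨fun x hx => (h'.reg x hx).trans (h.reg x hx), fun x hx => (h'.mem x hx).trans (h.mem x hx),
    fun x hx => (h'.rmem x hx).trans (h.rmem x hx)⟩

theorem Frame.mono {p q : Prog} {σ τ : State} (h : Frame p σ τ) (hr : p.regs ⊆ q.regs)
    (hm : p.mems ⊆ q.mems) (hq : p.rmems ⊆ q.rmems) : Frame q σ τ :=
  ⟨fun x hx => h.reg x fun h' => hx (hr h'), fun x hx => h.mem x fun h' => hx (hm h'),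
    fun x hx => h.rmem x fun h' => hx (hq h')⟩

/-- A program changes only what occurs on the left-hand side of one of its assignments. -/
theorem Exec.frame {p : Prog} {σ τ : State} {t : ℕ} (h : Exec L I p σ τ t) : Frame p σ τ := by
  induction h with
  | skip σ => exact .refl _ _
  | assign σ x e v hv => constructor <;> simp +contextual [Prog.regs]
  | store σ a i e j v hi hj hv => constructor <;> simp +contextual [Prog.mems]
  | rstore σ a i r j v hi hj hv => constructor <;> simp +contextual [Prog.rmems]
  | seq σ₁ σ₂ σ₃ p q t₁ t₂ hp hq ih₁ ih₂ =>
    exact (ih₁.mono (by simp [Prog.regs]) (by simp [Prog.mems]) (by simp [Prog.rmems])).trans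
      (ih₂.mono (by simp [Prog.regs]) (by simp [Prog.mems]) (by simp [Prog.rmems]))
  | ite_true σ τ b p q t hb hp ih =>
    exact ih.mono (by simp [Prog.regs]) (by simp [Prog.mems]) (by simp [Prog.rmems])
  | ite_false σ τ b p q t hb hp ih =>
    exact ih.mono (by simp [Prog.regs]) (by simp [Prog.mems]) (by simp [Prog.rmems])
  | loop_true σ₁ σ₂ σ₃ b p t₁ t₂ hb hp hl ih₁ ih₂ =>
    exact (ih₁.mono (by simp [Prog.regs]) (by simp [Prog.mems]) (by simp [Prog.rmems])).trans ih₂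
  | loop_false σ b p hb => exact .refl _ _

/-- Weakening of the postcondition, where the frame condition is available. -/
theorem Runs.mono {p : Prog} {σ : State} {Q Q' : State → ℕ → Prop} (h : Runs L I p σ Q)
    (h' : ∀ τ t, Frame p σ τ → Q τ t → Q' τ t) : Runs L I p σ Q' := by
  obtain ⟨τ, t, he, hq⟩ := h
  exact ⟨τ, t, he, h' τ t he.frame hq⟩

theorem runs_skip {σ : State} {Q : State → ℕ → Prop} : Runs L I .skip σ Q ↔ Q σ 1 := by
  constructor
  · rintro ⟨τ, t, h, hq⟩
    cases h
    exact hq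
  · exact fun h => ⟨_, _, .skip σ, h⟩

theorem runs_assign {σ : State} {x : ℕ} {e : Expr} {Q : State → ℕ → Prop} :
    Runs L I (.assign x e) σ Q ↔ e.Safe L I σ ∧ Q (σ.setReg x (e.val I σ)) (e.cost + 1) := by
  constructor
  · rintro ⟨τ, t, h, hq⟩
    cases h with
    | assign _ _ _ v hv =>
      obtain ⟨h1, rfl⟩ := Expr.eval_eq_some.1 hv
      exact ⟨h1, hq⟩
  · exact fun h => ⟨_, _, .assign σ x e _ (Expr.eval_eq_some.2 ⟨h.1, rfl⟩), h.2⟩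

theorem runs_store {σ : State} {a : ℕ} {i e : Expr} {Q : State → ℕ → Prop} :
    Runs L I (.store a i e) σ Q ↔ i.Safe L I σ ∧ i.val I σ < L.cells ∧ e.Safe L I σ ∧
      Q (σ.setMem a (i.val I σ) (e.val I σ)) (i.cost + e.cost + 1) := by
  constructor
  · rintro ⟨τ, t, h, hq⟩
    cases h with
    | store _ _ _ _ j v hi hj hv =>
      obtain ⟨h1, rfl⟩ := Expr.eval_eq_some.1 hv
      obtain ⟨h2, rfl⟩ := Expr.eval_eq_some.1 hi
      exact ⟨h2, hj, h1, hq⟩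
  · exact fun h => ⟨_, _, .store σ a i e _ _ (Expr.eval_eq_some.2 ⟨h.1, rfl⟩) h.2.1
      (Expr.eval_eq_some.2 ⟨h.2.2.1, rfl⟩), h.2.2.2⟩

theorem runs_rstore {σ : State} {a : ℕ} {i : Expr} {r : RExpr} {Q : State → ℕ → Prop} :
    Runs L I (.rstore a i r) σ Q ↔ i.Safe L I σ ∧ i.val I σ < L.cells ∧ r.Safe L I σ ∧
      Q (σ.setRMem a (i.val I σ) (r.val I σ)) (i.cost + r.cost + 1) := by
  constructor
  · rintro ⟨τ, t, h, hq⟩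
    cases h with
    | rstore _ _ _ _ j v hi hj hv =>
      obtain ⟨h1, rfl⟩ := RExpr.eval_eq_some.1 hv
      obtain ⟨h2, rfl⟩ := Expr.eval_eq_some.1 hi
      exact ⟨h2, hj, h1, hq⟩
  · exact fun h => ⟨_, _, .rstore σ a i r _ _ (Expr.eval_eq_some.2 ⟨h.1, rfl⟩) h.2.1
      (RExpr.eval_eq_some.2 ⟨h.2.2.1, rfl⟩), h.2.2.2⟩

theorem runs_seq {σ : State} {p q : Prog} {Q : State → ℕ → Prop} :
    Runs L I (.seq p q) σ Q ↔
      Runs L I p σ fun τ t => Runs L I q τ fun τ' t' => Q τ' (t + t') := by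
  constructor
  · rintro ⟨τ, t, h, hq⟩
    cases h with
    | seq _ υ _ _ _ t₁ t₂ h₁ h₂ => exact ⟨υ, t₁, h₁, τ, t₂, h₂, hq⟩
  · rintro ⟨υ, t₁, h₁, τ, t₂, h₂, hq⟩
    exact ⟨_, _, .seq _ _ _ _ _ _ _ h₁ h₂, hq⟩

theorem runs_ite {σ : State} {b : Cond} {p q : Prog} {Q : State → ℕ → Prop} :
    Runs L I (.ite b p q) σ Q ↔ b.Safe L I σ ∧
      (b.Holds I σ → Runs L I p σ fun τ t => Q τ (b.cost + 1 + t)) ∧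
      (¬ b.Holds I σ → Runs L I q σ fun τ t => Q τ (b.cost + 1 + t)) := by
  constructor
  · rintro ⟨τ, t, h, hq⟩
    cases h with
    | ite_true _ _ _ _ _ t hb hp =>
      obtain ⟨h1, h2⟩ := Cond.eval_eq_some.1 hb
      exact ⟨h1, fun _ => ⟨_, _, hp, hq⟩, fun h => absurd (h2.2 rfl) h⟩
    | ite_false _ _ _ _ _ t hb hp =>
      obtain ⟨h1, h2⟩ := Cond.eval_eq_some.1 hb
      exact ⟨h1, fun h => by simp at h2; exact absurd h h2, fun _ => ⟨_, _, hp, hq⟩⟩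
  · rintro ⟨h1, h2, h3⟩
    by_cases h : b.Holds I σ
    · obtain ⟨τ, t, hp, hq⟩ := h2 h
      exact ⟨_, _, .ite_true _ _ _ _ _ _ (Cond.eval_eq_some.2 ⟨h1, by simp [h]⟩) hp, hq⟩
    · obtain ⟨τ, t, hp, hq⟩ := h3 h
      exact ⟨_, _, .ite_false _ _ _ _ _ _ (Cond.eval_eq_some.2 ⟨h1, by simp [h]⟩) hp, hq⟩

/-- A loop with an invariant, a variant that bounds the number of rounds, and a bound for the
duration of a round. -/
theorem Runs.loop {b : Cond} {p : Prog} {σ : State} {Q : State → ℕ → Prop}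
    (Inv : State → Prop) (var : State → ℕ) (T : ℕ) (h0 : Inv σ)
    (hb : ∀ τ, Frame p σ τ → Inv τ → b.Safe L I τ)
    (hs : ∀ τ, Frame p σ τ → Inv τ → b.Holds I τ →
      Runs L I p τ fun τ' t => t ≤ T ∧ Inv τ' ∧ var τ' < var τ)
    (hQ : ∀ τ t, Frame p σ τ → Inv τ → ¬ b.Holds I τ →
      t ≤ var σ * (T + b.cost + 1) + (b.cost + 1) → Q τ t) :
    Runs L I (.loop b p) σ Q := by
  generalize hv : var σ = m at hQ
  induction m using Nat.strong_induction_on generalizing σ Q with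
  | _ m ih =>
  by_cases h : b.Holds I σ
  · obtain ⟨τ, t, he, ht, hi, hlt⟩ := hs σ (.refl _ _) h0 h
    obtain ⟨υ, t', he', hq'⟩ := ih (var τ) (hv ▸ hlt) (σ := τ)
      (Q := fun υ t' => Frame p τ υ ∧ Inv υ ∧ ¬ b.Holds I υ ∧
        t' ≤ var τ * (T + b.cost + 1) + (b.cost + 1)) hi
      (fun υ h1 h2 => hb υ (he.frame.trans h1) h2)
      (fun υ h1 h2 => hs υ (he.frame.trans h1) h2) rfl
      (fun υ t h1 h2 h3 h4 => ⟨h1, h2, h3, h4⟩)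
    refine ⟨_, _, .loop_true _ _ _ _ _ _ _
      (Cond.eval_eq_some.2 ⟨hb σ (.refl _ _) h0, by simp [h]⟩) he he',
      hQ _ _ (he.frame.trans hq'.1) hq'.2.1 hq'.2.2.1 ?_⟩
    have h4 := hq'.2.2.2
    have : (var τ + 1) * (T + b.cost + 1) ≤ m * (T + b.cost + 1) :=
      Nat.mul_le_mul_right _ (by omega)
    rw [Nat.add_mul] at this
    omega
  · exact ⟨_, _, .loop_false _ _ _ (Cond.eval_eq_some.2 ⟨hb σ (.refl _ _) h0, by simp [h]⟩),
      hQ _ _ (.refl _ _) h0 h (by omega)⟩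

instance : Add Expr := ⟨.op .add⟩
instance : Sub Expr := ⟨.op .sub⟩
instance : Mul Expr := ⟨.op .mul⟩
instance : Div Expr := ⟨.op .div⟩
instance : Mod Expr := ⟨.op .mod⟩
instance : Add RExpr := ⟨.add⟩

/-- The condition `e₁ = e₂`. -/
def Cond.eq (e₁ e₂ : Expr) : Cond := .and (.not (.lt e₁ e₂)) (.not (.lt e₂ e₁))

/-- Run `p` with the register `x` counting from the value of `lo` up to the value of register
`h`, exclusively. -/
def Prog.for (x : ℕ) (lo : Expr) (h : ℕ) (p : Prog) : Prog :=
  .seq (.assign x lo) (.loop (.lt (.reg x) (.reg h)) (.seq p (.assign x (.reg x + .const 1))))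

section Rules
variable {σ : State}

theorem val_const (c : ℕ) : (Expr.const c).val I σ = c := rfl
theorem val_reg (x : ℕ) : (Expr.reg x).val I σ = σ.reg x := rfl
theorem val_load (a : ℕ) (i : Expr) : (Expr.load a i).val I σ = σ.mem a (i.val I σ) := rfl
theorem val_input (a : ℕ) (i : Expr) : (Expr.input a i).val I σ = I.word a (i.val I σ) := rfl
theorem val_add (e f : Expr) : (e + f).val I σ = e.val I σ + f.val I σ := rfl
theorem val_sub (e f : Expr) : (e - f).val I σ = e.val I σ - f.val I σ := rfl
theorem val_mul (e f : Expr) : (e * f).val I σ = e.val I σ * f.val I σ := rfl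
theorem val_div (e f : Expr) : (e / f).val I σ = e.val I σ / f.val I σ := rfl
theorem val_mod (e f : Expr) : (e % f).val I σ = e.val I σ % f.val I σ := rfl
theorem val_land (e f : Expr) : (Expr.op .land e f).val I σ = e.val I σ &&& f.val I σ := rfl
theorem val_lor (e f : Expr) : (Expr.op .lor e f).val I σ = e.val I σ ||| f.val I σ := rfl

theorem safe_const (c : ℕ) : (Expr.const c).Safe L I σ ↔ c < L.word := Iff.rfl
theorem safe_reg (x : ℕ) : (Expr.reg x).Safe L I σ ↔ True := Iff.rfl
theorem safe_load (a : ℕ) (i : Expr) :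
    (Expr.load a i).Safe L I σ ↔ i.Safe L I σ ∧ i.val I σ < L.cells := Iff.rfl
theorem safe_input (a : ℕ) (i : Expr) : (Expr.input a i).Safe L I σ ↔
    i.Safe L I σ ∧ I.HasWord a (i.val I σ) ∧ I.word a (i.val I σ) < L.word := Iff.rfl
theorem safe_add (e f : Expr) : (e + f).Safe L I σ ↔
    e.Safe L I σ ∧ f.Safe L I σ ∧ e.val I σ + f.val I σ < L.word := Iff.rfl
theorem safe_sub (e f : Expr) : (e - f).Safe L I σ ↔
    e.Safe L I σ ∧ f.Safe L I σ ∧ e.val I σ - f.val I σ < L.word := Iff.rfl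
theorem safe_mul (e f : Expr) : (e * f).Safe L I σ ↔
    e.Safe L I σ ∧ f.Safe L I σ ∧ e.val I σ * f.val I σ < L.word := Iff.rfl
theorem safe_div (e f : Expr) : (e / f).Safe L I σ ↔
    e.Safe L I σ ∧ f.Safe L I σ ∧ e.val I σ / f.val I σ < L.word := Iff.rfl
theorem safe_mod (e f : Expr) : (e % f).Safe L I σ ↔
    e.Safe L I σ ∧ f.Safe L I σ ∧ e.val I σ % f.val I σ < L.word := Iff.rfl
theorem safe_land (e f : Expr) : (Expr.op .land e f).Safe L I σ ↔
    e.Safe L I σ ∧ f.Safe L I σ ∧ e.val I σ &&& f.val I σ < L.word := Iff.rfl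
theorem safe_lor (e f : Expr) : (Expr.op .lor e f).Safe L I σ ↔
    e.Safe L I σ ∧ f.Safe L I σ ∧ e.val I σ ||| f.val I σ < L.word := Iff.rfl

theorem cost_const (c : ℕ) : (Expr.const c).cost = 1 := rfl
theorem cost_reg (x : ℕ) : (Expr.reg x).cost = 1 := rfl
theorem cost_load (a : ℕ) (i : Expr) : (Expr.load a i).cost = i.cost + 1 := rfl
theorem cost_input (a : ℕ) (i : Expr) : (Expr.input a i).cost = i.cost + 1 := rfl
theorem cost_add (e f : Expr) : (e + f).cost = e.cost + f.cost + 1 := rfl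
theorem cost_sub (e f : Expr) : (e - f).cost = e.cost + f.cost + 1 := rfl
theorem cost_mul (e f : Expr) : (e * f).cost = e.cost + f.cost + 1 := rfl
theorem cost_div (e f : Expr) : (e / f).cost = e.cost + f.cost + 1 := rfl
theorem cost_mod (e f : Expr) : (e % f).cost = e.cost + f.cost + 1 := rfl
theorem cost_op (o : WordOp) (e f : Expr) : (Expr.op o e f).cost = e.cost + f.cost + 1 := rfl

theorem rval_zero : RExpr.zero.val I σ = 0 := rfl
theorem rval_load (a : ℕ) (i : Expr) : (RExpr.load a i).val I σ = σ.rmem a (i.val I σ) := rfl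
theorem rval_input (i : Expr) : (RExpr.input i).val I σ = I.reals.getD (i.val I σ) 0 := rfl
theorem rval_add (e f : RExpr) : (e + f).val I σ = e.val I σ + f.val I σ := rfl
theorem rsafe_zero : RExpr.zero.Safe L I σ ↔ True := Iff.rfl
theorem rsafe_load (a : ℕ) (i : Expr) :
    (RExpr.load a i).Safe L I σ ↔ i.Safe L I σ ∧ i.val I σ < L.cells := Iff.rfl
theorem rsafe_input (i : Expr) : (RExpr.input i).Safe L I σ ↔
    i.Safe L I σ ∧ i.val I σ < I.reals.length := Iff.rfl
theorem rsafe_add (e f : RExpr) : (e + f).Safe L I σ ↔ e.Safe L I σ ∧ f.Safe L I σ := Iff.rfl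
theorem rcost_zero : RExpr.zero.cost = 1 := rfl
theorem rcost_load (a : ℕ) (i : Expr) : (RExpr.load a i).cost = i.cost + 1 := rfl
theorem rcost_input (i : Expr) : (RExpr.input i).cost = i.cost + 1 := rfl
theorem rcost_add (e f : RExpr) : (e + f).cost = e.cost + f.cost + 1 := rfl

theorem holds_lt (e f : Expr) : (Cond.lt e f).Holds I σ ↔ e.val I σ < f.val I σ := Iff.rfl
theorem holds_rlt (e f : RExpr) : (Cond.rlt e f).Holds I σ ↔ e.val I σ < f.val I σ := Iff.rfl
theorem holds_not (b : Cond) : (Cond.not b).Holds I σ ↔ ¬ b.Holds I σ := Iff.rfl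
theorem holds_and (b c : Cond) : (Cond.and b c).Holds I σ ↔ b.Holds I σ ∧ c.Holds I σ := Iff.rfl
theorem holds_eq (e f : Expr) : (Cond.eq e f).Holds I σ ↔ e.val I σ = f.val I σ := by
  simp only [Cond.eq, Cond.Holds]
  omega
theorem csafe_lt (e f : Expr) : (Cond.lt e f).Safe L I σ ↔ e.Safe L I σ ∧ f.Safe L I σ := Iff.rfl
theorem csafe_rlt (e f : RExpr) : (Cond.rlt e f).Safe L I σ ↔ e.Safe L I σ ∧ f.Safe L I σ :=
  Iff.rfl
theorem csafe_not (b : Cond) : (Cond.not b).Safe L I σ ↔ b.Safe L I σ := Iff.rfl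
theorem csafe_and (b c : Cond) : (Cond.and b c).Safe L I σ ↔ b.Safe L I σ ∧ c.Safe L I σ := Iff.rfl
theorem csafe_eq (e f : Expr) : (Cond.eq e f).Safe L I σ ↔ e.Safe L I σ ∧ f.Safe L I σ := by
  simp only [Cond.eq, Cond.Safe]
  tauto
theorem ccost_lt (e f : Expr) : (Cond.lt e f).cost = e.cost + f.cost + 1 := rfl
theorem ccost_rlt (e f : RExpr) : (Cond.rlt e f).cost = e.cost + f.cost + 1 := rfl
theorem ccost_not (b : Cond) : (Cond.not b).cost = b.cost + 1 := rfl
theorem ccost_and (b c : Cond) : (Cond.and b c).cost = b.cost + c.cost + 1 := rfl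
theorem ccost_eq (e f : Expr) : (Cond.eq e f).cost = 2 * (e.cost + f.cost + 2) + 1 := by
  simp only [Cond.eq, Cond.cost]
  omega

theorem regs_for (x : ℕ) (lo : Expr) (h : ℕ) (p : Prog) :
    (Prog.for x lo h p).regs = x :: (p.regs ++ [x]) := rfl
theorem mems_for (x : ℕ) (lo : Expr) (h : ℕ) (p : Prog) :
    (Prog.for x lo h p).mems = p.mems ++ [] := rfl
theorem rmems_for (x : ℕ) (lo : Expr) (h : ℕ) (p : Prog) :
    (Prog.for x lo h p).rmems = p.rmems ++ [] := rfl

end Rules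

/-- The rule for counting loops, with a bound for the duration of every single round. -/
theorem Runs.for {x : ℕ} {lo : Expr} {h : ℕ} {p : Prog} {σ : State} {Q : State → ℕ → Prop}
    (a b : ℕ) (Inv : ℕ → State → Prop) (T : ℕ → ℕ)
    (hlo : lo.Safe L I σ) (ha : lo.val I σ = a) (hb : σ.reg h = b) (hab : a ≤ b)
    (hw : b < L.word) (hhx : h ≠ x) (hh : h ∉ p.regs) (hx : x ∉ p.regs)
    (h0 : Inv a (σ.setReg x a))
    (hs : ∀ i τ, a ≤ i → i < b → Frame (Prog.for x lo h p) σ τ → τ.reg x = i → Inv i τ →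
      Runs L I p τ fun τ' t => t ≤ T i ∧ Inv (i + 1) (τ'.setReg x (i + 1)))
    (hQ : ∀ τ t, Frame (Prog.for x lo h p) σ τ → τ.reg x = b → Inv b τ →
      t ≤ ∑ i ∈ Finset.Ico a b, (T i + 8) + (lo.cost + 5) → Q τ t) :
    Runs L I (Prog.for x lo h p) σ Q := by
  have key : ∀ d i, i + d = b → a ≤ i → ∀ τ, Frame (Prog.for x lo h p) σ τ → τ.reg x = i →
      Inv i τ →
      Runs L I (.loop (.lt (.reg x) (.reg h)) (.seq p (.assign x (.reg x + .const 1)))) τ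
        fun τ' t => Frame (Prog.for x lo h p) σ τ' ∧ τ'.reg x = b ∧ Inv b τ' ∧
          t ≤ ∑ i ∈ Finset.Ico i b, (T i + 8) + 4 := by
    intro d
    induction d with
    | zero =>
      intro i hi _ τ hf hτ hI
      have hτh : τ.reg h = b := by rw [hf.reg h (by simp [regs_for, hhx, hh]), hb]
      obtain rfl : i = b := by omega
      refine ⟨τ, _, .loop_false _ _ _ (Cond.eval_eq_some.2 ⟨⟨trivial, trivial⟩, ?_⟩), hf, hτ, hI, ?_⟩
      · simp [Cond.Holds, Expr.val, hτ, hτh]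
      · simp [Cond.cost, Expr.cost]
    | succ d ih =>
      intro i hi hai τ hf hτ hI
      have hτh : τ.reg h = b := by rw [hf.reg h (by simp [regs_for, hhx, hh]), hb]
      obtain ⟨υ, t, he, ht, hI'⟩ := hs i τ hai (by omega) hf hτ hI
      have hυ : υ.reg x = i := by rw [he.frame.reg x hx, hτ]
      have hf' : Frame (Prog.for x lo h p) σ (υ.setReg x (i + 1)) := by
        refine hf.trans ⟨fun y hy => ?_, fun y hy => ?_, fun y hy => ?_⟩
        · simp only [regs_for, List.mem_cons, List.mem_append, not_or] at hy
          simp [hy.1, he.frame.reg y hy.2.1]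
        · simp only [mems_for, List.append_nil] at hy
          simp [he.frame.mem y hy]
        · simp only [rmems_for, List.append_nil] at hy
          simp [he.frame.rmem y hy]
      obtain ⟨υ', t', he', h1, h2, h3, h4⟩ := ih (i + 1) (by omega) (by omega) _ hf' (by simp) hI'
      refine ⟨υ', _, .loop_true _ _ _ _ _ _ _ (Cond.eval_eq_some.2 ⟨⟨trivial, trivial⟩, ?_⟩)
        (.seq _ _ _ _ _ _ _ he (.assign _ _ _ (i + 1) (Expr.eval_eq_some.2 ⟨?_, ?_⟩))) he',
        h1, h2, h3, ?_⟩
      · simp [Cond.Holds, Expr.val, hτ, hτh]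
        omega
      · simp only [safe_add, safe_reg, safe_const, val_reg, val_const, hυ, true_and]
        omega
      · simp [val_add, val_reg, val_const, hυ]
      · rw [Finset.sum_eq_sum_Ico_succ_bot (by omega)]
        simp only [ccost_lt, cost_reg, cost_add, cost_const]
        omega
  have hf0 : Frame (Prog.for x lo h p) σ (σ.setReg x a) := by
    refine ⟨fun y hy => ?_, fun y hy => rfl, fun y hy => rfl⟩
    simp only [regs_for, List.mem_cons, not_or] at hy
    simp [hy.1]
  rw [Prog.for, runs_seq, runs_assign]
  refine ⟨hlo, ?_⟩
  rw [ha]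
  refine (key (b - a) a (by omega) le_rfl _ hf0 (by simp) h0).mono ?_
  rintro τ t - ⟨h1, h2, h3, h4⟩
  exact hQ _ _ h1 h2 h3 (by omega)

/-- The rule for counting loops, with one bound for the duration of all rounds. -/
theorem Runs.for_const {x : ℕ} {lo : Expr} {h : ℕ} {p : Prog} {σ : State} {Q : State → ℕ → Prop}
    (a b : ℕ) (Inv : ℕ → State → Prop) (T : ℕ)
    (hlo : lo.Safe L I σ) (ha : lo.val I σ = a) (hb : σ.reg h = b) (hab : a ≤ b)
    (hw : b < L.word) (hhx : h ≠ x) (hh : h ∉ p.regs) (hx : x ∉ p.regs)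
    (h0 : Inv a (σ.setReg x a))
    (hs : ∀ i τ, a ≤ i → i < b → Frame (Prog.for x lo h p) σ τ → τ.reg x = i → Inv i τ →
      Runs L I p τ fun τ' t => t ≤ T ∧ Inv (i + 1) (τ'.setReg x (i + 1)))
    (hQ : ∀ τ t, Frame (Prog.for x lo h p) σ τ → τ.reg x = b → Inv b τ →
      t ≤ (b - a) * (T + 8) + (lo.cost + 5) → Q τ t) :
    Runs L I (Prog.for x lo h p) σ Q :=
  Runs.for a b Inv (fun _ => T) hlo ha hb hab hw hhx hh hx h0 hs
    fun τ t h1 h2 h3 h4 => hQ τ t h1 h2 h3 (by simpa using h4)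

end RealRAM

namespace RealRAM

attribute [simp] val_const val_reg val_load val_input val_add val_sub val_mul val_div val_mod
  val_land val_lor safe_const safe_reg safe_load safe_input safe_add safe_sub safe_mul safe_div
  safe_mod safe_land safe_lor cost_const cost_reg cost_load cost_input cost_add cost_sub cost_mul
  cost_div cost_mod cost_op rval_zero rval_load rval_input rval_add rsafe_zero rsafe_load
  rsafe_input rsafe_add rcost_zero rcost_load rcost_input rcost_add holds_lt holds_rlt holds_not
  holds_and holds_eq csafe_lt csafe_rlt csafe_not csafe_and csafe_eq ccost_lt ccost_rlt ccost_not
  ccost_and ccost_eq regs_for mems_for rmems_for runs_skip runs_assign runs_store runs_rstore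
  runs_seq runs_ite Prog.regs Prog.mems Prog.rmems

infixr:60 " ;; " => Prog.seq

end RealRAM

/-! ### Connected vertex covers relative to a given one -/

namespace WCVC

/-- A weighted graph on the natural numbers below `n`, given by duplicate-free adjacency lists. -/
structure Net where
  n : ℕ
  nbr : ℕ → List ℕ
  ω : ℕ → ℝ
  lt : ∀ {u v}, u ∈ nbr v → u < n
  symm : ∀ {u v}, u ∈ nbr v → v ∈ nbr u
  irrefl : ∀ v, v ∉ nbr v
  nodup : ∀ v, (nbr v).Nodup
  pos : ∀ v < n, 0 < ω v

variable (H : Net)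

/-- `X` induces a connected subgraph: a set that meets `X` and is closed under adjacency inside `X`
contains `X`. -/
def Net.Conn (X : Finset ℕ) : Prop :=
  ∀ R : Set ℕ, (∃ r ∈ X, r ∈ R) → (∀ a ∈ X, a ∈ R → ∀ b ∈ X, b ∈ H.nbr a → b ∈ R) → ∀ x ∈ X, x ∈ R

/-- Connected vertex covers, for graphs given by adjacency lists. -/
structure Net.CVC (X : Finset ℕ) : Prop where
  lt : ∀ v ∈ X, v < H.n
  cover : ∀ u v, u ∈ H.nbr v → u ∈ X ∨ v ∈ X
  conn : H.Conn X

/-- `v` is one of the first `L` entries of `xs`. -/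
def In (xs : ℕ → ℕ) (L v : ℕ) : Prop := ∃ p < L, xs p = v

/-- The distinct vertices `xs 0, …, xs (L - 1)` are listed in such an order that each of them but
the first one has an earlier neighbour, namely the one at position `par p`. -/
structure Net.Ordered (xs par : ℕ → ℕ) (L : ℕ) : Prop where
  lt : ∀ p < L, xs p < H.n
  inj : ∀ p < L, ∀ q < L, xs p = xs q → p = q
  par_lt : ∀ p < L, 1 ≤ p → par p < p
  adj : ∀ p < L, 1 ≤ p → xs (par p) ∈ H.nbr (xs p)

/-- A vertex cover `xs 0, …, xs (L - 1)`, ordered as in `Net.Ordered`, whose first `sh + 1` vertices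
are regarded as contracted into one. Position `p` belongs to item `p - sh`, so the contracted
vertices form item `0`. -/
structure Net.Layout (xs par : ℕ → ℕ) (L sh : ℕ) : Prop extends H.Ordered xs par L where
  two_le : 2 ≤ L
  sh_lt : sh < L
  cover : ∀ u v, u ∈ H.nbr v → In xs L u ∨ In xs L v

/-- `v` has a neighbour in item `j`. -/
def Net.Hits (xs : ℕ → ℕ) (L sh v j : ℕ) : Prop := ∃ p < L, xs p ∈ H.nbr v ∧ p - sh = j

open Classical in
/-- The set of items in which `v` has neighbours, as a bit mask. -/
noncomputable def Net.nmask (xs : ℕ → ℕ) (L sh v : ℕ) : ℕ :=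
  Nat.ofBits fun j : Fin (L - sh) => decide (H.Hits xs L sh v j)

open Classical in
/-- The item of a vertex. Vertices outside of the list `xs` share an item if they have neighbours in
the same items. -/
noncomputable def Net.item (xs : ℕ → ℕ) (L sh v : ℕ) : ℕ :=
  if h : ∃ p < L, xs p = v then Nat.find h - sh else (L - sh) + H.nmask xs L sh v

/-- If exactly those items of the list are chosen whose bit is set in `A`, then the vertex `v`
belongs to every vertex cover: it is chosen itself, or it is outside of the list and has a neighbour
which is not chosen. -/
def Net.Base (xs : ℕ → ℕ) (L sh A v : ℕ) : Prop :=
  (In xs L v ∧ A.testBit (H.item xs L sh v)) ∨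
    (¬ In xs L v ∧ ∃ j, H.Hits xs L sh v j ∧ A.testBit j = false)

variable {H} {xs par : ℕ → ℕ} {L sh : ℕ}

theorem Net.nmask_lt (v : ℕ) : H.nmask xs L sh v < 2 ^ (L - sh) := Nat.ofBits_lt_two_pow _

theorem Net.Layout.hits_lt (S : H.Layout xs par L sh) {v j : ℕ} (h : H.Hits xs L sh v j) :
    j < L - sh := by
  obtain ⟨p, hp, -, rfl⟩ := h
  have := S.sh_lt
  omega

theorem Net.Layout.testBit_nmask (S : H.Layout xs par L sh) (v j : ℕ) :
    (H.nmask xs L sh v).testBit j = true ↔ H.Hits xs L sh v j := by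
  rw [Net.nmask]
  by_cases h : j < L - sh
  · rw [Nat.testBit_ofBits_lt _ _ h]
    simp
  · rw [Nat.testBit_ofBits_ge _ _ (by omega)]
    simpa using fun h' => h (S.hits_lt h')

theorem Net.Ordered.item_xs (S : H.Ordered xs par L) {p : ℕ} (hp : p < L) :
    H.item xs L sh (xs p) = p - sh := by
  classical
  have h : ∃ q < L, xs q = xs p := ⟨p, hp, rfl⟩
  rw [Net.item, dif_pos h]
  have := Nat.find_spec h
  rw [S.inj _ this.1 _ hp this.2]

theorem Net.item_of_not_in {v : ℕ} (h : ¬ In xs L v) :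
    H.item xs L sh v = (L - sh) + H.nmask xs L sh v := dif_neg h

theorem Net.Layout.item_lt_iff (S : H.Layout xs par L sh) {v : ℕ} :
    H.item xs L sh v < L - sh ↔ In xs L v := by
  constructor
  · intro h
    by_contra hv
    rw [Net.item_of_not_in hv] at h
    omega
  · rintro ⟨p, hp, rfl⟩
    rw [S.item_xs hp]
    have := S.sh_lt
    omega

theorem Net.Layout.hits_congr (S : H.Layout xs par L sh) {v w j : ℕ} (hv : ¬ In xs L v)
    (h : H.item xs L sh v = H.item xs L sh w) : H.Hits xs L sh v j ↔ H.Hits xs L sh w j := by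
  have hw : ¬ In xs L w := by rwa [← S.item_lt_iff, ← h, S.item_lt_iff]
  rw [Net.item_of_not_in hv, Net.item_of_not_in hw] at h
  rw [← S.testBit_nmask, ← S.testBit_nmask, Nat.add_left_cancel h]

theorem Net.Layout.eq_of_item_eq (S : H.Layout xs par L sh) {v w : ℕ} (hv : In xs L v)
    (h : H.item xs L sh v = H.item xs L sh w) (h0 : sh = 0 ∨ H.item xs L sh v ≠ 0) : v = w := by
  obtain ⟨q, hq, rfl⟩ : In xs L w := by rwa [← S.item_lt_iff, ← h, S.item_lt_iff]
  obtain ⟨p, hp, rfl⟩ := hv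
  rw [S.item_xs hp, S.item_xs hq] at h
  rw [S.item_xs hp] at h0
  congr 1
  omega

/-- Item `j` is chosen, and it is the first one of its component of the forest that `par` induces on
the chosen items. -/
def Top (par : ℕ → ℕ) (sh A j : ℕ) : Prop :=
  A.testBit j = true ∧ (j = 0 ∨ A.testBit (par (j + sh) - sh) = false)

/-- `cb j` is the power of two that stands for the component of the chosen item `j` in the forest
that `par` induces on the chosen items; there are `c` components. -/
structure Comps (par : ℕ → ℕ) (s sh A c : ℕ) (cb : ℕ → ℕ) : Prop where
  pow : ∀ j < s, A.testBit j = true → ∃ b < c, cb j = 2 ^ b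
  tree : ∀ j < s, 1 ≤ j → A.testBit j = true → A.testBit (par (j + sh) - sh) = true →
    cb j = cb (par (j + sh) - sh)
  inj : ∀ j < s, ∀ j' < s, Top par sh A j → Top par sh A j' → cb j = cb j' → j = j'
  surj : ∀ b < c, ∃ j < s, Top par sh A j ∧ cb j = 2 ^ b

variable (H xs par L sh) in
/-- The data computed for a choice `A` of items of the list: `mask i` is the set of components of
chosen items that are adjacent to item `i` or contain it, and `kap i` is the number of additional
vertices that are needed in order to use item `i`. -/
structure Net.Eval (A c : ℕ) (cb mask kap : ℕ → ℕ) : Prop where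
  comps : Comps par (L - sh) sh A c cb
  mask : ∀ v < H.n, ∀ b, (mask (H.item xs L sh v)).testBit b = true ↔
    (In xs L v ∧ A.testBit (H.item xs L sh v) = true ∧ cb (H.item xs L sh v) = 2 ^ b) ∨
      ∃ w < H.n, H.item xs L sh w = H.item xs L sh v ∧
        ∃ j, H.Hits xs L sh w j ∧ A.testBit j = true ∧ cb j = 2 ^ b
  kap_eq_zero : ∀ v < H.n, kap (H.item xs L sh v) = 0 ↔ H.Base xs L sh A v
  kap_le : ∀ v < H.n, kap (H.item xs L sh v) ≤ 1

variable (H xs par L sh) in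
/-- The choice `A` of items of the list can be extended to a connected vertex cover, as far as this
can be seen from single vertices. -/
structure Net.Valid (A : ℕ) : Prop where
  root : A.testBit 0 = true ∨ sh = 0
  cover : ∀ v, In xs L v → ∀ j, H.Hits xs L sh v j →
    A.testBit (H.item xs L sh v) = true ∨ A.testBit j = true
  attached : ∀ v < H.n, ¬ In xs L v → H.Base xs L sh A v →
    ∃ j, H.Hits xs L sh v j ∧ A.testBit j = true

/-- The set `T` of components can be reached from component `0` by using the items in the list. -/
inductive Chain (It : ℕ → Prop) (mask : ℕ → ℕ) : List ℕ → ℕ → Prop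
  | nil : Chain It mask [] 1
  | cons {l : List ℕ} {T i : ℕ} (h : Chain It mask l T) (hi : It i) (hT : T &&& mask i ≠ 0)
      (hne : T ||| mask i ≠ T) : Chain It mask (i :: l) (T ||| mask i)

theorem Net.closed_iff {X : Finset ℕ} {R : Set ℕ}
    (hR : ∀ a ∈ X, a ∈ R → ∀ b ∈ X, b ∈ H.nbr a → b ∈ R) {a b : ℕ} (ha : a ∈ X) (hb : b ∈ X)
    (h : b ∈ H.nbr a) : a ∈ R ↔ b ∈ R :=
  ⟨fun h' => hR a ha h' b hb h, fun h' => hR b hb h' a ha (H.symm h)⟩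

theorem exists_testBit_of_and_ne_zero {a b : ℕ} (h : a &&& b ≠ 0) :
    ∃ i, a.testBit i = true ∧ b.testBit i = true := by
  obtain ⟨i, hi⟩ := Nat.exists_testBit_of_ne_zero h
  rw [Nat.testBit_and, Bool.and_eq_true] at hi
  exact ⟨i, hi⟩

theorem and_ne_zero_of_testBit {a b i : ℕ} (ha : a.testBit i = true) (hb : b.testBit i = true) :
    a &&& b ≠ 0 := by
  intro h
  have := Nat.testBit_and a b i
  rw [h, ha, hb] at this
  simp at this

section Sound

variable {A c : ℕ} {cb mask kap : ℕ → ℕ}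

/-- Every chosen position is connected to the first position of the first item of its component. -/
theorem Net.Layout.exists_top (S : H.Layout xs par L sh) (hc : Comps par (L - sh) sh A c cb)
    {X : Finset ℕ} {R : Set ℕ} (hX : ∀ p < L, A.testBit (p - sh) = true → xs p ∈ X)
    (hR : ∀ a ∈ X, a ∈ R → ∀ b ∈ X, b ∈ H.nbr a → b ∈ R) :
    ∀ p < L, A.testBit (p - sh) = true → ∃ q ≤ p, Top par sh A (q - sh) ∧ (q = 0 ∨ sh < q) ∧
      cb (p - sh) = cb (q - sh) ∧ (xs p ∈ R ↔ xs q ∈ R) := by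
  intro p
  induction p using Nat.strong_induction_on with
  | _ p ih =>
  intro hp hA
  rcases Nat.eq_zero_or_pos p with rfl | hp1
  · exact ⟨0, le_rfl, ⟨hA, Or.inl (by omega)⟩, Or.inl rfl, rfl, Iff.rfl⟩
  have hlt := S.par_lt p hp hp1
  by_cases hps : p ≤ sh
  · have e1 : p - sh = 0 := by omega
    have e2 : par p - sh = 0 := by omega
    have hA' : A.testBit (par p - sh) = true := by rwa [e2, ← e1]
    obtain ⟨q, hq, h1, h2, h3, h4⟩ := ih _ hlt (by omega) hA'
    refine ⟨q, by omega, h1, h2, by rw [e1, ← h3, e2], ?_⟩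
    rw [← h4]
    exact Net.closed_iff hR (hX p hp hA) (hX _ (by omega) hA') (S.adj p hp hp1)
  · have e : p - sh + sh = p := by omega
    by_cases hA' : A.testBit (par p - sh) = true
    · obtain ⟨q, hq, h1, h2, h3, h4⟩ := ih _ hlt (by omega) hA'
      refine ⟨q, by omega, h1, h2, ?_, ?_⟩
      · rw [← h3, hc.tree (p - sh) (by omega) (by omega) hA (by rwa [e]), e]
      · rw [← h4]
        exact Net.closed_iff hR (hX p hp hA) (hX _ (by omega) hA') (S.adj p hp hp1)
    · refine ⟨p, le_rfl, ⟨hA, Or.inr ?_⟩, Or.inr (by omega), rfl, Iff.rfl⟩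
      rw [e]
      simpa using hA'

theorem Net.Layout.mem_iff_of_cb_eq (S : H.Layout xs par L sh)
    (hc : Comps par (L - sh) sh A c cb)
    {X : Finset ℕ} {R : Set ℕ} (hX : ∀ p < L, A.testBit (p - sh) = true → xs p ∈ X)
    (hR : ∀ a ∈ X, a ∈ R → ∀ b ∈ X, b ∈ H.nbr a → b ∈ R) {p q : ℕ} (hp : p < L) (hq : q < L)
    (hpA : A.testBit (p - sh) = true) (hqA : A.testBit (q - sh) = true)
    (h : cb (p - sh) = cb (q - sh)) : xs p ∈ R ↔ xs q ∈ R := by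
  obtain ⟨p', h1, h2, h3, h4, h5⟩ := S.exists_top hc hX hR p hp hpA
  obtain ⟨q', g1, g2, g3, g4, g5⟩ := S.exists_top hc hX hR q hq hqA
  have hs := S.sh_lt
  have := hc.inj _ (by omega) _ (by omega) h2 g2 (by rw [← h4, h, g4])
  have : p' = q' := by omega
  rw [h5, g5, this]

/-- A vertex of `X` is connected to every component in its mask. -/
theorem Net.Layout.mem_iff_of_mask (S : H.Layout xs par L sh)
    (E : H.Eval xs par L sh A c cb mask kap) (hroot : A.testBit 0 = true ∨ sh = 0)
    {X : Finset ℕ} {R : Set ℕ} (hX : ∀ p < L, A.testBit (p - sh) = true → xs p ∈ X)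
    (hR : ∀ a ∈ X, a ∈ R → ∀ b ∈ X, b ∈ H.nbr a → b ∈ R) {x p b : ℕ} (hx : x ∈ X) (hxn : x < H.n)
    (hb : (mask (H.item xs L sh x)).testBit b = true) (hp : p < L)
    (hpA : A.testBit (p - sh) = true) (hpb : cb (p - sh) = 2 ^ b) : x ∈ R ↔ xs p ∈ R := by
  rcases (E.mask x hxn b).1 hb with ⟨⟨q, hq, rfl⟩, h2, h3⟩ | ⟨w, hw, h1, j, ⟨q, hq, h2, rfl⟩, h3, h4⟩
  · rw [S.item_xs hq] at h2 h3
    exact S.mem_iff_of_cb_eq E.comps hX hR hq hp h2 hpA (h3.trans hpb.symm)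
  · have e := S.mem_iff_of_cb_eq E.comps hX hR hq hp h3 hpA (h4.trans hpb.symm)
    rw [← e]
    by_cases hin : In xs L x
    · by_cases hA : A.testBit (H.item xs L sh x) = true
      · obtain ⟨r, hr, rfl⟩ := hin
        obtain ⟨r', hr', rfl⟩ : In xs L w := by
          rw [← S.item_lt_iff, h1, S.item_lt_iff]
          exact ⟨r, hr, rfl⟩
        rw [S.item_xs hr, S.item_xs hr'] at h1
        rw [S.item_xs hr] at hA
        rw [S.mem_iff_of_cb_eq E.comps hX hR hr hr' hA (by rwa [h1]) (by rw [h1])]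
        exact Net.closed_iff hR (hX _ hr' (by rwa [h1])) (hX _ hq h3) h2
      · have : x = w := S.eq_of_item_eq hin h1.symm (by
          rcases hroot with h | h
          · exact Or.inr fun h' => hA (by rwa [h'])
          · exact Or.inl h)
        subst this
        exact Net.closed_iff hR hx (hX _ hq h3) h2
    · obtain ⟨q', hq', g1, g2⟩ := (S.hits_congr hin h1.symm).2 ⟨q, hq, h2, rfl⟩
      rw [Net.closed_iff hR hx (hX _ hq' (by rwa [g2])) g1]
      exact S.mem_iff_of_cb_eq E.comps hX hR hq' hq (by rwa [g2]) h3 (by rw [g2])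

theorem Chain.mask_ne_zero {It : ℕ → Prop} {l : List ℕ} {T : ℕ} (h : Chain It mask l T) :
    ∀ i ∈ l, mask i ≠ 0 := by
  induction h with
  | nil => simp
  | cons h hi hT hne ih =>
    intro i hi
    rcases List.mem_cons.1 hi with rfl | hi
    · intro h0
      simp [h0] at hne
    · exact ih i hi

theorem Chain.it {It : ℕ → Prop} {l : List ℕ} {T : ℕ} (h : Chain It mask l T) :
    ∀ i ∈ l, It i := by
  induction h with
  | nil => simp
  | cons h hi hT hne ih =>
    intro i hi'
    rcases List.mem_cons.1 hi' with rfl | hi'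
    · exact hi
    · exact ih i hi'

variable (H xs L sh) in
/-- There is a vertex that belongs to item `i`. -/
def Net.IsItem (i : ℕ) : Prop := ∃ v < H.n, H.item xs L sh v = i

/-- The vertices described by a choice `A` of items of the list and by additional vertices. -/
def Net.IsDescribed (H : Net) (xs : ℕ → ℕ) (L sh A : ℕ) (B : ℕ → Prop) (X : Finset ℕ) : Prop :=
  ∀ v, v ∈ X ↔ v < H.n ∧ (H.Base xs L sh A v ∨ B v)

theorem Net.Layout.base_xs (S : H.Layout xs par L sh) {p : ℕ} (hp : p < L) :
    H.Base xs L sh A (xs p) ↔ A.testBit (p - sh) = true := by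
  have : In xs L (xs p) := ⟨p, hp, rfl⟩
  simp [Net.Base, this, S.item_xs hp]

theorem Net.Layout.cover_of_base (S : H.Layout xs par L sh) (hV : H.Valid xs L sh A)
    {u v : ℕ} (h : u ∈ H.nbr v) : H.Base xs L sh A u ∨ H.Base xs L sh A v := by
  have key : ∀ {u v}, u ∈ H.nbr v → In xs L v → H.Base xs L sh A u ∨ H.Base xs L sh A v := by
    rintro u v h ⟨p, hp, rfl⟩
    rw [S.base_xs hp]
    by_cases hA : A.testBit (p - sh) = true
    · exact Or.inr hA
    left
    by_cases hu : In xs L u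
    · obtain ⟨q, hq, rfl⟩ := hu
      rw [S.base_xs hq]
      have := hV.cover (xs p) ⟨p, hp, rfl⟩ (q - sh) ⟨q, hq, h, rfl⟩
      rw [S.item_xs hp] at this
      exact this.resolve_left hA
    · exact Or.inr ⟨hu, p - sh, ⟨p, hp, H.symm h, rfl⟩, by simpa using hA⟩
  rcases S.cover u v h with hu | hv
  · exact (key (H.symm h) hu).symm
  · exact key h hv

/-- A chain to the set of all components yields a connected vertex cover. -/
theorem Net.Layout.cvc_of_chain (S : H.Layout xs par L sh)
    (E : H.Eval xs par L sh A c cb mask kap) (hV : H.Valid xs L sh A) {l : List ℕ}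
    (hl : Chain (H.IsItem xs L sh) mask l (2 ^ c - 1)) {rep : ℕ → ℕ}
    (hrep : ∀ i ∈ l, rep i < H.n ∧ H.item xs L sh (rep i) = i) {X : Finset ℕ}
    (hXd : H.IsDescribed xs L sh A (fun v => ∃ i ∈ l, kap i = 1 ∧ rep i = v) X) : H.CVC X := by
  have hs := S.sh_lt
  have hX : ∀ p < L, A.testBit (p - sh) = true → xs p ∈ X := fun p hp hA =>
    (hXd _).2 ⟨S.lt p hp, Or.inl ((S.base_xs hp).2 hA)⟩
  refine ⟨fun v hv => ((hXd v).1 hv).1, fun u v h => ?_, ?_⟩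
  · rcases S.cover_of_base hV h with h' | h'
    · exact Or.inl ((hXd u).2 ⟨H.lt h, Or.inl h'⟩)
    · exact Or.inr ((hXd v).2 ⟨H.lt (H.symm h), Or.inl h'⟩)
  -- A closed set that contains the start of component `0` contains all of `X`.
  have key : ∀ R : Set ℕ, (∀ a ∈ X, a ∈ R → ∀ b ∈ X, b ∈ H.nbr a → b ∈ R) →
      (∀ p < L, A.testBit (p - sh) = true → cb (p - sh) = 2 ^ 0 → xs p ∈ R) → ∀ x ∈ X, x ∈ R := by
    intro R hR h0
    -- Every item that is used connects the new components to those reached before.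
    have step : ∀ (l' : List ℕ) T, Chain (H.IsItem xs L sh) mask l' T → (∀ i ∈ l', i ∈ l) →
        ∀ p < L, A.testBit (p - sh) = true → ∀ b, cb (p - sh) = 2 ^ b → T.testBit b = true →
        xs p ∈ R := by
      intro l' T h
      induction h with
      | nil =>
        intro _ p hp hA b hb hT
        rw [show (1 : ℕ) = 2 ^ 0 from rfl, Nat.testBit_two_pow, decide_eq_true_eq] at hT
        subst hT
        exact h0 p hp hA hb
      | @cons l' T i h hi hT hne ih =>
        intro hsub p hp hA b hb hT'
        have ih := ih fun i hi => hsub i (List.mem_cons_of_mem _ hi)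
        rw [Nat.testBit_or, Bool.or_eq_true] at hT'
        rcases hT' with hT' | hT'
        · exact ih p hp hA b hb hT'
        obtain ⟨x, hxn, hxX, hxi⟩ : ∃ x < H.n, x ∈ X ∧ H.item xs L sh x = i := by
          obtain ⟨v, hv, hvi⟩ := hi
          rcases Nat.le_one_iff_eq_zero_or_eq_one.1 (E.kap_le v hv) with h' | h'
          · exact ⟨v, hv, (hXd v).2 ⟨hv, Or.inl ((E.kap_eq_zero v hv).1 h')⟩, hvi⟩
          · rw [hvi] at h'
            have := hrep i (hsub i (by simp))
            exact ⟨rep i, this.1, (hXd _).2 ⟨this.1, Or.inr ⟨i, hsub i (by simp), h', rfl⟩⟩, this.2⟩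
        obtain ⟨b₀, hb₀, hb₀'⟩ := exists_testBit_of_and_ne_zero hT
        obtain ⟨q, hq, hqA, hqb⟩ : ∃ q < L, A.testBit (q - sh) = true ∧ cb (q - sh) = 2 ^ b₀ := by
          rcases (E.mask x hxn b₀).1 (by rwa [hxi]) with ⟨⟨q, hq, rfl⟩, h2, h3⟩ |
            ⟨w, hw, h1, j, ⟨q, hq, h2, rfl⟩, h3, h4⟩
          · rw [S.item_xs hq] at h2 h3
            exact ⟨q, hq, h2, h3⟩
          · exact ⟨q, hq, h3, h4⟩
        have hxR : x ∈ R := (S.mem_iff_of_mask E hV.root hX hR hxX hxn (by rwa [hxi]) hq hqA hqb).2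
          (ih q hq hqA b₀ hqb hb₀)
        exact (S.mem_iff_of_mask E hV.root hX hR hxX hxn (by rwa [hxi]) hp hA hb).1 hxR
    have full : ∀ p < L, A.testBit (p - sh) = true → xs p ∈ R := by
      intro p hp hA
      obtain ⟨b, hb, hbc⟩ := E.comps.pow (p - sh) (by omega) hA
      exact step l _ hl (fun _ h => h) p hp hA b hbc (by simp [Nat.testBit_two_pow_sub_one, hb])
    -- As all components are reached, a vertex that touches a component lies in `R`.
    have att : ∀ x ∈ X, x < H.n → mask (H.item xs L sh x) ≠ 0 → x ∈ R := by
      intro x hx hxn h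
      obtain ⟨b, hb⟩ := Nat.exists_testBit_of_ne_zero h
      rcases (E.mask x hxn b).1 hb with ⟨⟨q, hq, rfl⟩, h2, h3⟩ |
        ⟨w, hw, h1, j, ⟨q, hq, h2, rfl⟩, h3, h4⟩
      · rw [S.item_xs hq] at h2
        exact full q hq h2
      · exact (S.mem_iff_of_mask E hV.root hX hR hx hxn hb hq h3 h4).2 (full q hq h3)
    intro x hx
    obtain ⟨hxn, hb | ⟨i, hi, -, rfl⟩⟩ := (hXd x).1 hx
    · by_cases hin : In xs L x
      · obtain ⟨p, hp, rfl⟩ := hin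
        exact full p hp ((S.base_xs hp).1 hb)
      · obtain ⟨j, hj, hjA⟩ := hV.attached x hxn hin hb
        obtain ⟨b, hb, hbc⟩ := E.comps.pow j (S.hits_lt hj) hjA
        refine att x hx hxn fun h => ?_
        have := (E.mask x hxn b).2 (Or.inr ⟨x, hxn, rfl, j, hj, hjA, hbc⟩)
        simp [h] at this
    · refine att _ hx hxn ?_
      rw [(hrep i hi).2]
      exact hl.mask_ne_zero i hi
  intro R ⟨r, hrX, hrR⟩ hR
  -- If `R` misses component `0`, the same argument applies to its complement.
  by_cases h : ∀ p < L, A.testBit (p - sh) = true → cb (p - sh) = 2 ^ 0 → xs p ∈ R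
  · exact key R hR h
  · push Not at h
    obtain ⟨p, hp, hpA, hpb, hpR⟩ := h
    refine absurd hrR (key Rᶜ (fun a ha haR b hb hab hbR => haR ?_) ?_ r hrX)
    · exact (Net.closed_iff hR ha hb hab).2 hbR
    · intro q hq hqA hqb hqR
      exact hpR ((S.mem_iff_of_cb_eq E.comps hX hR hp hq hpA hqA (hpb.trans hqb.symm)).2 hqR)

end Sound

end WCVC

namespace WCVC

variable {H : Net} {xs par : ℕ → ℕ} {L sh : ℕ} {A c : ℕ} {cb mask kap : ℕ → ℕ}

variable (xs L sh) in
/-- `A` is the set of those items of the list that meet `Y`. -/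
def IsTrace (A : ℕ) (Y : Finset ℕ) : Prop :=
  ∀ j, A.testBit j = true ↔ ∃ p < L, p - sh = j ∧ xs p ∈ Y

section Complete

variable {Y : Finset ℕ}

theorem mem_of_trace (hA : IsTrace xs L sh A Y)
    (hU : sh = 0 ∨ ∀ p ≤ sh, xs p ∈ Y) {p : ℕ} (h : A.testBit (p - sh) = true) :
    xs p ∈ Y := by
  obtain ⟨q, hq, h1, h2⟩ := (hA _).1 h
  by_cases hps : p ≤ sh ∧ sh ≠ 0
  · exact hU.resolve_left hps.2 p hps.1
  · have : q = p := by omega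
    rwa [← this]

theorem Net.Layout.base_subset (S : H.Layout xs par L sh) (hY : H.CVC Y)
    (hA : IsTrace xs L sh A Y) (hU : sh = 0 ∨ ∀ p ≤ sh, xs p ∈ Y) {v : ℕ}
    (h : H.Base xs L sh A v) : v ∈ Y := by
  rcases h with ⟨⟨p, hp, rfl⟩, h⟩ | ⟨hv, j, ⟨p, hp, h, rfl⟩, hj⟩
  · rw [S.item_xs hp] at h
    exact mem_of_trace hA hU h
  · refine (hY.cover _ _ h).resolve_left fun h' => ?_
    have := (hA (p - sh)).2 ⟨p, hp, rfl, h'⟩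
    simp [hj] at this

theorem Net.Layout.exists_mem (S : H.Layout xs par L sh) (hY : H.CVC Y) :
    ∃ p < L, xs p ∈ Y := by
  have h2 := S.two_le
  have h1 := S.par_lt 1 (by omega) le_rfl
  have := S.adj 1 (by omega) le_rfl
  rcases hY.cover _ _ this with h | h
  · exact ⟨_, by omega, h⟩
  · exact ⟨1, by omega, h⟩

theorem Net.Layout.valid_of_trace (S : H.Layout xs par L sh) (hY : H.CVC Y)
    (hA : IsTrace xs L sh A Y) (hU : sh = 0 ∨ ∀ p ≤ sh, xs p ∈ Y) : H.Valid xs L sh A := by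
  have hs := S.sh_lt
  refine ⟨?_, ?_, ?_⟩
  · rcases hU with h | h
    · exact Or.inr h
    · exact Or.inl ((hA 0).2 ⟨0, by omega, by omega, h 0 (by omega)⟩)
  · rintro v ⟨p, hp, rfl⟩ j ⟨q, hq, h, rfl⟩
    rw [S.item_xs hp]
    rcases hY.cover _ _ h with h' | h'
    · exact Or.inr ((hA _).2 ⟨q, hq, rfl, h'⟩)
    · exact Or.inl ((hA _).2 ⟨p, hp, rfl, h'⟩)
  · intro v hv hin hb
    have hvY := S.base_subset hY hA hU hb
    by_contra hno
    push Not at hno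
    obtain ⟨p, hp, hpY⟩ := S.exists_mem hY
    have : xs p = v := hY.conn {v} ⟨v, hvY, rfl⟩ (fun a ha hav b hb hab => by
      exfalso
      rw [Set.mem_singleton_iff] at hav
      subst hav
      rcases S.cover _ _ hab with ⟨q, hq, rfl⟩ | h'
      · exact hno (q - sh) ⟨q, hq, hab, rfl⟩ ((hA _).2 ⟨q, hq, rfl, hb⟩)
      · exact hin h') _ hpY
    exact hin ⟨p, hp, this⟩

theorem Comps.mask_lt (S : H.Layout xs par L sh) (E : H.Eval xs par L sh A c cb mask kap) {v : ℕ}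
    (hv : v < H.n) : mask (H.item xs L sh v) < 2 ^ c := by
  refine Nat.lt_pow_two_of_testBit _ fun b hb => ?_
  by_contra h
  have h : (mask (H.item xs L sh v)).testBit b = true := by simpa using h
  obtain ⟨j, hj, hjA, hjb⟩ : ∃ j < L - sh, A.testBit j = true ∧ cb j = 2 ^ b := by
    rcases (E.mask v hv b).1 h with ⟨h1, h2, h3⟩ | ⟨w, hw, h1, j, h2, h3, h4⟩
    · exact ⟨_, S.item_lt_iff.2 h1, h2, h3⟩
    · exact ⟨j, S.hits_lt h2, h3, h4⟩
  obtain ⟨b', hb', h'⟩ := E.comps.pow j hj hjA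
  have := Nat.pow_right_injective le_rfl (hjb.symm.trans h')
  omega

theorem Chain.testBit_zero {It : ℕ → Prop} {l : List ℕ} {T : ℕ} (h : Chain It mask l T) :
    T.testBit 0 = true := by
  induction h with
  | nil => simp
  | cons h hi hT hne ih => rw [Nat.testBit_or, ih, Bool.true_or]

theorem Chain.or_mask {It : ℕ → Prop} {l : List ℕ} {T : ℕ} (h : Chain It mask l T) :
    ∀ i ∈ l, T ||| mask i = T := by
  induction h with
  | nil => simp
  | @cons l T i h hi hT hne ih =>
    intro i' hi'
    rcases List.mem_cons.1 hi' with rfl | hi'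
    · rw [Nat.or_assoc, Nat.or_self]
    · rw [Nat.or_right_comm, ih _ hi']

theorem Chain.nodup {It : ℕ → Prop} {l : List ℕ} {T : ℕ} (h : Chain It mask l T) : l.Nodup := by
  induction h with
  | nil => simp
  | cons h hi hT hne ih => exact List.nodup_cons.2 ⟨fun h' => hne (h.or_mask _ h'), ih⟩

/-- A connected vertex cover yields a chain to the set of all components, which uses only items that
meet the cover. -/
theorem Net.Layout.exists_chain (S : H.Layout xs par L sh) (hY : H.CVC Y)
    (hA : IsTrace xs L sh A Y) (E : H.Eval xs par L sh A c cb mask kap) :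
    ∃ l, Chain (H.IsItem xs L sh) mask l (2 ^ c - 1) ∧
      ∀ i ∈ l, kap i ≠ 0 → ∃ y ∈ Y, H.item xs L sh y = i := by
  have hs := S.sh_lt
  have hc : 0 < c := by
    obtain ⟨p, hp, hpY⟩ := S.exists_mem hY
    obtain ⟨b, hb, -⟩ := E.comps.pow (p - sh) (by omega) ((hA _).2 ⟨p, hp, rfl, hpY⟩)
    omega
  -- As long as a component is missing, some vertex of the cover makes progress.
  have key : ∀ d T l, T + d = 2 ^ c - 1 → Chain (H.IsItem xs L sh) mask l T →
      (∀ i ∈ l, kap i ≠ 0 → ∃ y ∈ Y, H.item xs L sh y = i) →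
      ∃ l, Chain (H.IsItem xs L sh) mask l (2 ^ c - 1) ∧
      ∀ i ∈ l, kap i ≠ 0 → ∃ y ∈ Y, H.item xs L sh y = i := by
    intro d
    induction d using Nat.strong_induction_on with
    | _ d ih =>
    intro T l hd hch hl
    rcases Nat.eq_zero_or_pos d with rfl | hd0
    · exact ⟨l, by rwa [← hd, Nat.add_zero], hl⟩
    by_cases hext : ∃ v < H.n, T &&& mask (H.item xs L sh v) ≠ 0 ∧
        T ||| mask (H.item xs L sh v) ≠ T ∧ v ∈ Y
    · obtain ⟨v, hv, h1, h2, h3⟩ := hext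
      have hch' := hch.cons ⟨v, hv, rfl⟩ h1 h2
      have hlt : T ||| mask (H.item xs L sh v) < 2 ^ c :=
        Nat.or_lt_two_pow (by omega) (Comps.mask_lt S E hv)
      have hle : T ≤ T ||| mask (H.item xs L sh v) := Nat.left_le_or
      refine ih (2 ^ c - 1 - (T ||| mask (H.item xs L sh v))) (by omega) _ _ (by omega) hch' ?_
      intro i hi
      rcases List.mem_cons.1 hi with rfl | hi
      · exact fun _ => ⟨v, h3, rfl⟩
      · exact hl i hi
    exfalso
    push Not at hext
    -- The vertices of the cover that touch a reached component form a closed set.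
    obtain ⟨b, hb, hbT⟩ : ∃ b < c, T.testBit b = false := by
      by_contra h
      push Not at h
      have : T = 2 ^ c - 1 := Nat.eq_of_testBit_eq fun i => by
        rw [Nat.testBit_two_pow_sub_one]
        by_cases hi : i < c
        · simpa [hi] using h i hi
        · simp only [hi, decide_false]
          exact Nat.testBit_lt_two_pow (lt_of_lt_of_le (by omega : T < 2 ^ c)
            (Nat.pow_le_pow_right (by omega) (by omega)))
      omega
    obtain ⟨j, hj, hjt, hjb⟩ := E.comps.surj b hb
    obtain ⟨p, hp, rfl, hpY⟩ := (hA j).1 hjt.1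
    obtain ⟨j₀, hj₀, hjt₀, hjb₀⟩ := E.comps.surj 0 hc
    obtain ⟨p₀, hp₀, rfl, hpY₀⟩ := (hA j₀).1 hjt₀.1
    let R : Set ℕ := {v | ∃ b, T.testBit b = true ∧ (mask (H.item xs L sh v)).testBit b = true}
    have own : ∀ q < L, xs q ∈ Y → ∀ b, cb (q - sh) = 2 ^ b →
        (mask (H.item xs L sh (xs q))).testBit b = true := by
      intro q hq hqY b hb
      refine (E.mask _ (S.lt q hq) b).2 (Or.inl ?_)
      rw [S.item_xs hq]
      exact ⟨⟨q, hq, rfl⟩, (hA _).2 ⟨q, hq, rfl, hqY⟩, hb⟩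
    have sub : ∀ v ∈ Y, v ∈ R → ∀ b, (mask (H.item xs L sh v)).testBit b = true →
        T.testBit b = true := by
      rintro v hv ⟨b₁, h1, h2⟩ b hb
      by_contra h
      refine hext v (hY.lt v hv) (and_ne_zero_of_testBit h1 h2) (fun h' => h ?_) hv
      rw [← h', Nat.testBit_or, hb, Bool.or_true]
    have hmem : xs p ∈ R := by
      refine hY.conn R ⟨xs p₀, hpY₀, 0, hch.testBit_zero, own p₀ hp₀ hpY₀ 0 hjb₀⟩ ?_ _ hpY
      intro a ha haR a' ha' haa'
      rcases S.cover _ _ haa' with ⟨q, hq, rfl⟩ | ⟨q, hq, rfl⟩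
      · have hqA := (hA (q - sh)).2 ⟨q, hq, rfl, ha'⟩
        obtain ⟨b', hb', hcb'⟩ := E.comps.pow (q - sh) (by omega) hqA
        refine ⟨b', sub a ha haR b' ?_, own q hq ha' b' hcb'⟩
        exact (E.mask a (hY.lt a ha) b').2
          (Or.inr ⟨a, hY.lt a ha, rfl, q - sh, ⟨q, hq, haa', rfl⟩, hqA, hcb'⟩)
      · have hqA := (hA (q - sh)).2 ⟨q, hq, rfl, ha⟩
        obtain ⟨b', hb', hcb'⟩ := E.comps.pow (q - sh) (by omega) hqA
        refine ⟨b', sub _ ha haR b' (own q hq ha b' hcb'), ?_⟩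
        exact (E.mask a' (hY.lt a' ha') b').2
          (Or.inr ⟨a', hY.lt a' ha', rfl, q - sh, ⟨q, hq, H.symm haa', rfl⟩, hqA, hcb'⟩)
    have := sub _ hpY hmem b (own p hp hpY b hjb)
    simp [hbT] at this
  have h2 : 2 ^ 1 ≤ 2 ^ c := Nat.pow_le_pow_right (by omega) hc
  exact key (2 ^ c - 1 - 1) 1 [] (by omega) .nil (by simp)

end Complete

section Sums

variable (H xs L sh) in
/-- The items that contain vertices. -/
noncomputable def Net.items : Finset ℕ := (Finset.range H.n).image (H.item xs L sh)

open Classical in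
variable (H xs L sh) in
/-- The vertices of `Net.Base` as a finite set. -/
noncomputable def Net.baseSet (A : ℕ) : Finset ℕ := {v ∈ Finset.range H.n | H.Base xs L sh A v}

variable (H xs L sh) in
/-- The cardinality, a vertex of minimum weight, its weight, and the total weight of every item; the
contracted vertices count as one. Weights matter only if nothing is contracted. -/
structure Net.Counts (cn rp : ℕ → ℕ) (mw sw : ℕ → ℝ) : Prop where
  cnt : ∀ i ∈ H.items xs L sh, cn i + (if i = 0 then sh else 0) =
    ({w ∈ Finset.range H.n | H.item xs L sh w = i} : Finset ℕ).card
  rep : ∀ i ∈ H.items xs L sh, rp i < H.n ∧ H.item xs L sh (rp i) = i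
  sumw : sh = 0 → ∀ i ∈ H.items xs L sh,
    sw i = ∑ w ∈ Finset.range H.n with H.item xs L sh w = i, H.ω w
  minw : sh = 0 → ∀ i ∈ H.items xs L sh, mw i = H.ω (rp i)
  minw_le : sh = 0 → ∀ v < H.n, mw (H.item xs L sh v) ≤ H.ω v

theorem Net.mem_items {i : ℕ} : i ∈ H.items xs L sh ↔ H.IsItem xs L sh i := by
  simp [Net.items, Net.IsItem]

theorem Net.Eval.sum_base {M : Type*} [AddCommMonoid M] (E : H.Eval xs par L sh A c cb mask kap)
    (f : ℕ → M) : ∑ i ∈ H.items xs L sh with kap i = 0,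
      ∑ w ∈ Finset.range H.n with H.item xs L sh w = i, f w = ∑ v ∈ H.baseSet xs L sh A, f v := by
  classical
  rw [← Finset.sum_fiberwise_of_maps_to (s := H.baseSet xs L sh A)
    (t := (H.items xs L sh).filter fun i => kap i = 0) (g := H.item xs L sh)]
  · refine Finset.sum_congr rfl fun i hi => Finset.sum_congr ?_ fun _ _ => rfl
    rw [Finset.mem_filter] at hi
    ext w
    simp only [Net.baseSet, Finset.mem_filter, Finset.mem_range]
    constructor
    · rintro ⟨h1, rfl⟩
      exact ⟨⟨h1, (E.kap_eq_zero w h1).1 hi.2⟩, rfl⟩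
    · rintro ⟨⟨h1, _⟩, rfl⟩
      exact ⟨h1, rfl⟩
  · intro v hv
    simp only [Net.baseSet, Finset.mem_filter, Finset.mem_range] at hv
    rw [Finset.mem_filter, Net.mem_items]
    exact ⟨⟨v, hv.1, rfl⟩, (E.kap_eq_zero v hv.1).2 hv.2⟩

theorem Net.Layout.zero_mem_items (S : H.Layout xs par L sh) : 0 ∈ H.items xs L sh := by
  have := S.sh_lt
  rw [Net.mem_items]
  exact ⟨xs 0, S.lt 0 (by omega), by rw [S.item_xs (by omega)]; omega⟩

theorem Net.Layout.card_base (S : H.Layout xs par L sh) (E : H.Eval xs par L sh A c cb mask kap)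
    (hroot : A.testBit 0 = true ∨ sh = 0) {cnt rep : ℕ → ℕ} {minw sumw : ℕ → ℝ}
    (hC : H.Counts xs L sh cnt rep minw sumw) :
    ∑ i ∈ H.items xs L sh with kap i = 0, cnt i + sh = (H.baseSet xs L sh A).card := by
  have hs := S.sh_lt
  rw [Finset.card_eq_sum_ones, ← E.sum_base]
  have : ∀ i ∈ (H.items xs L sh).filter (fun i => kap i = 0),
      ∑ w ∈ Finset.range H.n with H.item xs L sh w = i, 1 = cnt i + (if i = 0 then sh else 0) := by
    intro i hi
    rw [hC.cnt i (Finset.mem_filter.1 hi).1, Finset.card_eq_sum_ones]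
  rw [Finset.sum_congr rfl this, Finset.sum_add_distrib, Finset.sum_ite_eq']
  split_ifs with h
  · rfl
  · rcases hroot with h0 | h0
    · refine absurd (Finset.mem_filter.2 ⟨S.zero_mem_items, ?_⟩) h
      have := (E.kap_eq_zero (xs 0) (S.lt 0 (by omega))).2 ((S.base_xs (by omega)).2 (by
        rwa [Nat.zero_sub]))
      rwa [S.item_xs (by omega), Nat.zero_sub] at this
    · rw [h0]

theorem Net.Layout.weight_base (E : H.Eval xs par L sh A c cb mask kap)
    {cnt rep : ℕ → ℕ} {minw sumw : ℕ → ℝ} (hC : H.Counts xs L sh cnt rep minw sumw)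
    (h0 : sh = 0) :
    ∑ i ∈ H.items xs L sh with kap i = 0, sumw i = ∑ v ∈ H.baseSet xs L sh A, H.ω v := by
  rw [← E.sum_base]
  exact Finset.sum_congr rfl fun i hi => hC.sumw h0 i (Finset.mem_filter.1 hi).1

theorem list_map_sum_eq {M : Type*} [AddCommMonoid M] {l : List ℕ} (hl : l.Nodup) (f : ℕ → M)
    (kap : ℕ → ℕ) (hf : ∀ i ∈ l, kap i = 0 → f i = 0) :
    (l.map f).sum = ∑ i ∈ l.toFinset with kap i ≠ 0, f i := by
  rw [← List.sum_toFinset f hl, Finset.sum_filter_of_ne]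
  intro i hi hfi h0
  exact hfi (hf i (List.mem_toFinset.1 hi) h0)

/-- The described vertices are not more, and not heavier, than computed. -/
theorem Net.IsDescribed.sum_le {l : List ℕ} (hl : l.Nodup) {rep : ℕ → ℕ} {X : Finset ℕ}
    (hXd : H.IsDescribed xs L sh A (fun v => ∃ i ∈ l, kap i = 1 ∧ rep i = v) X) {f : ℕ → ℝ}
    (hf : ∀ v < H.n, 0 ≤ f v) (hrep : ∀ i ∈ l, rep i < H.n) {g : ℕ → ℝ}
    (hg : ∀ i ∈ l, g i = if kap i = 0 then 0 else f (rep i)) :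
    ∑ v ∈ X, f v ≤ ∑ v ∈ H.baseSet xs L sh A, f v + (l.map g).sum := by
  classical
  rw [list_map_sum_eq hl g kap (fun i hi h => by rw [hg i hi, if_pos h])]
  have h1 : ∑ i ∈ l.toFinset with kap i ≠ 0, g i = ∑ i ∈ l.toFinset with kap i ≠ 0, f (rep i) := by
    refine Finset.sum_congr rfl fun i hi => ?_
    rw [Finset.mem_filter, List.mem_toFinset] at hi
    rw [hg i hi.1, if_neg hi.2]
  rw [h1]
  have h2 : X ⊆ H.baseSet xs L sh A ∪ ((l.toFinset).filter fun i => kap i ≠ 0).image rep := by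
    intro v hv
    obtain ⟨hvn, h | ⟨i, hi, hk, rfl⟩⟩ := (hXd v).1 hv
    · exact Finset.mem_union_left _ (by simp [Net.baseSet, hvn, h])
    · refine Finset.mem_union_right _ (Finset.mem_image_of_mem _ ?_)
      simp [hi, hk]
  have hpos : ∀ v ∈ H.baseSet xs L sh A ∪ ((l.toFinset).filter fun i => kap i ≠ 0).image rep,
      0 ≤ f v := by
    intro v hv
    rw [Finset.mem_union, Finset.mem_image] at hv
    rcases hv with hv | ⟨i, hi, rfl⟩
    · simp only [Net.baseSet, Finset.mem_filter, Finset.mem_range] at hv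
      exact hf v hv.1
    · simp only [Finset.mem_filter, List.mem_toFinset] at hi
      exact hf _ (hrep i hi.1)
  refine (Finset.sum_le_sum_of_subset_of_nonneg h2 fun v hv _ => hpos v hv).trans ?_
  have h3 : ∑ v ∈ ((l.toFinset).filter fun i => kap i ≠ 0).image rep, f v ≤
      ∑ i ∈ (l.toFinset).filter fun i => kap i ≠ 0, f (rep i) :=
    Finset.sum_image_le_of_nonneg fun i hi => hpos _ (Finset.mem_union_right _ hi)
  have h4 := Finset.sum_union_inter (f := f) (s₁ := H.baseSet xs L sh A)
    (s₂ := ((l.toFinset).filter fun i => kap i ≠ 0).image rep)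
  have h5 : 0 ≤ ∑ v ∈ H.baseSet xs L sh A ∩ ((l.toFinset).filter fun i => kap i ≠ 0).image rep,
      f v := Finset.sum_nonneg fun v hv =>
    hpos v (Finset.mem_union_left _ (Finset.mem_inter.1 hv).1)
  linarith

/-- A chain whose items meet a connected vertex cover is not more expensive than the cover. -/
theorem Net.Layout.sum_chain_le (S : H.Layout xs par L sh)
    (E : H.Eval xs par L sh A c cb mask kap) {Y : Finset ℕ} (hY : H.CVC Y)
    (hA : IsTrace xs L sh A Y) (hU : sh = 0 ∨ ∀ p ≤ sh, xs p ∈ Y) {l : List ℕ} (hl : l.Nodup)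
    (hlY : ∀ i ∈ l, kap i ≠ 0 → ∃ y ∈ Y, H.item xs L sh y = i) {f : ℕ → ℝ}
    (hf : ∀ v < H.n, 0 ≤ f v) {g : ℕ → ℝ} (hg0 : ∀ i ∈ l, kap i = 0 → g i = 0)
    (hg : ∀ v ∈ Y, H.item xs L sh v ∈ l → kap (H.item xs L sh v) ≠ 0 →
      g (H.item xs L sh v) ≤ f v) :
    ∑ v ∈ H.baseSet xs L sh A, f v + (l.map g).sum ≤ ∑ v ∈ Y, f v := by
  classical
  rw [list_map_sum_eq hl g kap hg0]
  -- The vertices `y i` of the cover are distinct, and none of them is forced or chosen.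
  choose! y hyY hyi using hlY
  have h1 : ∑ i ∈ l.toFinset with kap i ≠ 0, g i ≤ ∑ i ∈ l.toFinset with kap i ≠ 0, f (y i) := by
    refine Finset.sum_le_sum fun i hi => ?_
    rw [Finset.mem_filter, List.mem_toFinset] at hi
    have := hg (y i) (hyY i hi.1 hi.2) (by rw [hyi i hi.1 hi.2]; exact hi.1)
      (by rw [hyi i hi.1 hi.2]; exact hi.2)
    rwa [hyi i hi.1 hi.2] at this
  have h2 : ∑ i ∈ l.toFinset with kap i ≠ 0, f (y i) =
      ∑ v ∈ ((l.toFinset).filter fun i => kap i ≠ 0).image y, f v := by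
    rw [Finset.sum_image]
    intro i hi j hj hij
    simp only [Finset.coe_filter, List.mem_toFinset, Set.mem_ofPred_eq] at hi hj
    rw [← hyi i hi.1 hi.2, ← hyi j hj.1 hj.2, hij]
  have h3 : Disjoint (H.baseSet xs L sh A) (((l.toFinset).filter fun i => kap i ≠ 0).image y) := by
    rw [Finset.disjoint_left]
    intro v hv hv'
    obtain ⟨i, hi, rfl⟩ := Finset.mem_image.1 hv'
    simp only [Finset.mem_filter, List.mem_toFinset] at hi
    simp only [Net.baseSet, Finset.mem_filter, Finset.mem_range] at hv
    have := (E.kap_eq_zero _ hv.1).2 hv.2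
    rw [hyi i hi.1 hi.2] at this
    exact hi.2 this
  refine (add_le_add_right (h1.trans_eq h2) _).trans ?_
  rw [← Finset.sum_union h3]
  refine Finset.sum_le_sum_of_subset_of_nonneg (fun v hv => ?_) fun v hv _ => hf v (hY.lt v hv)
  rcases Finset.mem_union.1 hv with hv | hv
  · simp only [Net.baseSet, Finset.mem_filter, Finset.mem_range] at hv
    exact S.base_subset hY hA hU hv.2
  · obtain ⟨i, hi, rfl⟩ := Finset.mem_image.1 hv
    simp only [Finset.mem_filter, List.mem_toFinset] at hi
    exact hyY i hi.1 hi.2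

end Sums

section TopCount

open Classical in
variable (par sh) in
/-- The number of components of the forest that `par` induces on the chosen ones of the first `s`
items. -/
noncomputable def tops (A s : ℕ) : ℕ := ((Finset.range s).filter fun j => Top par sh A j).card

variable (par sh) in
/-- At least one end of every edge of the tree given by `par` is chosen. -/
def TreeValid (A s : ℕ) : Prop :=
  ∀ j < s, 1 ≤ j → A.testBit j = true ∨ A.testBit (par (j + sh) - sh) = true

open Classical in
theorem tops_congr {A A' s : ℕ} (hpar : ∀ j < s, 1 ≤ j → par (j + sh) - sh < j)
    (h : ∀ j < s, A.testBit j = A'.testBit j) : tops par sh A s = tops par sh A' s := by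
  unfold tops
  congr 1
  refine Finset.filter_congr fun j hj => ?_
  rw [Finset.mem_range] at hj
  rcases Nat.eq_zero_or_pos j with rfl | hj1
  · simp [Top, h 0 hj]
  · have := hpar j hj hj1
    simp [Top, h j hj, h _ (this.trans hj)]

theorem treeValid_congr {A A' s : ℕ} (hpar : ∀ j < s, 1 ≤ j → par (j + sh) - sh < j)
    (h : ∀ j < s, A.testBit j = A'.testBit j) : TreeValid par sh A s ↔ TreeValid par sh A' s := by
  refine forall_congr' fun j => forall_congr' fun hj => forall_congr' fun hj1 => ?_
  have := hpar j hj hj1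
  rw [h j hj, h _ (this.trans hj)]

theorem tops_zero (A : ℕ) : tops par sh A 0 = 0 := by
  unfold tops
  rw [Finset.range_zero, Finset.card_eq_zero]
  ext
  simp

theorem tops_succ (A s : ℕ) : tops par sh A (s + 1) =
    tops par sh A s + (open Classical in if Top par sh A s then 1 else 0) := by
  classical
  unfold tops
  rw [Finset.range_add_one, Finset.filter_insert]
  split_ifs
  · rw [Finset.card_insert_of_notMem (by simp)]
  · rfl

theorem treeValid_succ (A s : ℕ) (hs : 1 ≤ s) : TreeValid par sh A (s + 1) ↔
    TreeValid par sh A s ∧ (A.testBit s = true ∨ A.testBit (par (s + sh) - sh) = true) := by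
  constructor
  · exact fun h => ⟨fun j hj => h j (by omega), h s (by omega) hs⟩
  · rintro ⟨h1, h2⟩ j hj hj1
    rcases Nat.lt_succ_iff_lt_or_eq.1 hj with h | rfl
    · exact h1 j h hj1
    · exact h2

open Classical in
/-- Every item but the first one has two options once its parent is fixed: if the parent is not
chosen, then it is chosen and starts a component, which may or may not be picked; otherwise it is
chosen, and belongs to the component of its parent, or it is not chosen. This bounds the number of
pairs of a choice and a set of its components. -/
theorem sum_two_pow_tops_le (s : ℕ) (hs : 1 ≤ s)
    (hpar : ∀ j < s, 1 ≤ j → par (j + sh) - sh < j) :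
    ∑ A ∈ Finset.range (2 ^ s), (if TreeValid par sh A s then 2 ^ tops par sh A s else 0) ≤
      2 ^ (s + 1) := by
  -- The sum is `3 / 2 * 2 ^ s`: it is `3` for one item, and doubles with every further item.
  suffices h : 2 * ∑ A ∈ Finset.range (2 ^ s),
      (if TreeValid par sh A s then 2 ^ tops par sh A s else 0) = 3 * 2 ^ s by
    rw [pow_succ]
    omega
  induction s, hs using Nat.le_induction with
  | base =>
    have h0 : ∀ A, tops par sh A 1 = if A.testBit 0 = true then 1 else 0 := by
      intro A
      rw [tops_succ]
      rw [tops_zero]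
      simp [Top]
    have h1 : ∀ A, TreeValid par sh A 1 := fun A j hj hj1 => by omega
    simp [Finset.sum_range_succ, h0, h1]
  | succ s hs ih =>
    have hp := hpar s (by omega) hs
    have ih := ih fun j hj => hpar j (by omega)
    have hpar' : ∀ j < s, 1 ≤ j → par (j + sh) - sh < j := fun j hj => hpar j (by omega)
    have e : ∑ A ∈ Finset.range (2 ^ (s + 1)),
        (if TreeValid par sh A (s + 1) then 2 ^ tops par sh A (s + 1) else 0) =
        ∑ A ∈ Finset.range (2 ^ s),
          2 * (if TreeValid par sh A s then 2 ^ tops par sh A s else 0) := by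
      rw [pow_succ, mul_two, Finset.sum_range_add, ← Finset.sum_add_distrib]
      refine Finset.sum_congr rfl fun A hA => ?_
      rw [Finset.mem_range] at hA
      have b1 : A.testBit s = false := Nat.testBit_lt_two_pow hA
      have b2 : (2 ^ s + A).testBit s = true := by rw [Nat.testBit_two_pow_add_eq, b1]; rfl
      have b3 : ∀ j < s, (2 ^ s + A).testBit j = A.testBit j := fun j hj =>
        Nat.testBit_two_pow_add_gt hj A
      rw [tops_succ, tops_succ, treeValid_succ _ _ hs, treeValid_succ _ _ hs, b1, b2,
        treeValid_congr hpar' b3, tops_congr hpar' b3]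
      simp only [Top, b1, b2, b3 _ hp]
      have hs0 : s ≠ 0 := by omega
      by_cases hv : TreeValid par sh A s <;> by_cases hb : A.testBit (par (s + sh) - sh) = true <;>
        simp [hv, hb, hs0, pow_succ] <;> omega
    rw [e, ← Finset.mul_sum, ih, pow_succ]
    ring

end TopCount

end WCVC

/-! ### Cheapest chains -/

namespace WCVC

/-- `(a, x)` precedes or equals `(b, y)` lexicographically. -/
def LexLe (a : ℕ) (x : ℝ) (b : ℕ) (y : ℝ) : Prop := a < b ∨ a = b ∧ x ≤ y

/-- Item `i` can be used in state `st` and makes progress. A state `st` stands for the set `st / D`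
of components. -/
def Usable (mask : ℕ → ℕ) (D st i : ℕ) : Prop :=
  st / D &&& mask i ≠ 0 ∧ st / D ||| mask i ≠ st / D

/-- The state reached from `st` by using item `i`. The remainder modulo `D` is the number of
additional vertices, capped at `D - 1`. -/
def target (mask kap : ℕ → ℕ) (D st i : ℕ) : ℕ :=
  (st / D ||| mask i) * D + min (st % D + kap i) (D - 1)

/-- The invariant of the computation of cheapest chains: `cn st - 1` and `f st` are the number of
additional vertices and the weight of the best known chain to state `st`, where `cn st = 0` means
that no chain is known; `ps st` and `pi st` are its last but one state and its last item. All items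
have been tried in the states before `cur`, and the items in `Dn` in the state `cur`. -/
structure ChainTable (It : ℕ → Prop) (mask kap : ℕ → ℕ) (cw : ℕ → ℝ) (D M cur : ℕ) (Dn : ℕ → Prop)
    (cn : ℕ → ℕ) (f : ℕ → ℝ) (ps pi : ℕ → ℕ) : Prop where
  init : cn D = 1 ∧ f D = 0
  sound : ∀ st < M, st ≠ D → cn st ≠ 0 → ps st < st ∧ ps st ≤ cur ∧ cn (ps st) ≠ 0 ∧ It (pi st) ∧
    Usable mask D (ps st) (pi st) ∧ st / D = (ps st / D) ||| mask (pi st) ∧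
    cn st = cn (ps st) + kap (pi st) ∧ f st = f (ps st) + cw (pi st)
  idx : ∀ st < M, cn st ≠ 0 → st % D = min (cn st - 1) (D - 1)
  complete : ∀ st < M, cn st ≠ 0 → ∀ i, It i → (st < cur ∨ st = cur ∧ Dn i) → Usable mask D st i →
    cn (target mask kap D st i) ≠ 0 ∧
    LexLe (cn (target mask kap D st i)) (f (target mask kap D st i)) (cn st + kap i) (f st + cw i)

variable {It Dn : ℕ → Prop} {mask kap : ℕ → ℕ} {cw : ℕ → ℝ} {D c cur i : ℕ}
  {cn : ℕ → ℕ} {f : ℕ → ℝ} {ps pi : ℕ → ℕ}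

theorem lt_target (hD : 0 < D) (h : Usable mask D cur i) : cur < target mask kap D cur i := by
  have h1 : cur / D < cur / D ||| mask i := lt_of_le_of_ne Nat.left_le_or (Ne.symm h.2)
  have h2 : (cur / D + 1) * D ≤ (cur / D ||| mask i) * D := Nat.mul_le_mul_right _ h1
  have h3 := Nat.lt_div_mul_add (a := cur) hD
  have : (cur / D + 1) * D = cur / D * D + D := by ring
  unfold target
  omega

theorem target_div (hD : 0 < D) : target mask kap D cur i / D = cur / D ||| mask i := by
  unfold target
  rw [Nat.mul_comm, Nat.mul_add_div hD,
    Nat.div_eq_of_lt (show min (cur % D + kap i) (D - 1) < D by omega), Nat.add_zero]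

theorem target_mod (hD : 0 < D) : target mask kap D cur i % D = min (cur % D + kap i) (D - 1) := by
  unfold target
  rw [Nat.mul_add_mod_self_right, Nat.mod_eq_of_lt (by omega)]

theorem target_lt (hD : 0 < D) (hcur : cur < 2 ^ c * D) (hm : mask i < 2 ^ c) :
    target mask kap D cur i < 2 ^ c * D := by
  rw [← Nat.div_lt_iff_lt_mul hD, target_div hD]
  exact Nat.or_lt_two_pow ((Nat.div_lt_iff_lt_mul hD).2 hcur) hm

theorem ChainTable.step_skip (h : ChainTable It mask kap cw D (2 ^ c * D) cur Dn cn f ps pi)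
    (hi : ¬ Usable mask D cur i) :
    ChainTable It mask kap cw D (2 ^ c * D) cur (fun j => Dn j ∨ j = i) cn f ps pi := by
  refine ⟨h.init, h.sound, h.idx, fun st hst hc j hj hcur hu => ?_⟩
  rcases hcur with h' | ⟨rfl, h' | rfl⟩
  · exact h.complete st hst hc j hj (Or.inl h') hu
  · exact h.complete st hst hc j hj (Or.inr ⟨rfl, h'⟩) hu
  · exact absurd hu hi

theorem ChainTable.step_worse (h : ChainTable It mask kap cw D (2 ^ c * D) cur Dn cn f ps pi)
    (hw : cn (target mask kap D cur i) ≠ 0 ∧ LexLe (cn (target mask kap D cur i))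
      (f (target mask kap D cur i)) (cn cur + kap i) (f cur + cw i)) :
    ChainTable It mask kap cw D (2 ^ c * D) cur (fun j => Dn j ∨ j = i) cn f ps pi := by
  refine ⟨h.init, h.sound, h.idx, fun st hst hc j hj hcur hu => ?_⟩
  rcases hcur with h' | ⟨rfl, h' | rfl⟩
  · exact h.complete st hst hc j hj (Or.inl h') hu
  · exact h.complete st hst hc j hj (Or.inr ⟨rfl, h'⟩) hu
  · exact hw

theorem ChainTable.step_better (h : ChainTable It mask kap cw D (2 ^ c * D) cur Dn cn f ps pi)
    (hD : 0 < D) (hcur : cur < 2 ^ c * D) (hcD : D ≤ cur) (hc : cn cur ≠ 0) (hi : It i)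
    (hu : Usable mask D cur i)
    (hb : cn (target mask kap D cur i) ≠ 0 → LexLe (cn cur + kap i) (f cur + cw i)
      (cn (target mask kap D cur i)) (f (target mask kap D cur i))) :
    ChainTable It mask kap cw D (2 ^ c * D) cur (fun j => Dn j ∨ j = i)
      (Function.update cn (target mask kap D cur i) (cn cur + kap i))
      (Function.update f (target mask kap D cur i) (f cur + cw i))
      (Function.update ps (target mask kap D cur i) cur)
      (Function.update pi (target mask kap D cur i) i) := by
  have hlt := lt_target (kap := kap) hD hu
  generalize htg : target mask kap D cur i = tg at hlt hb
  refine ⟨?_, ?_, ?_, ?_⟩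
  · rw [Function.update_of_ne (by omega), Function.update_of_ne (by omega)]
    exact h.init
  · intro st hst hne hc'
    by_cases hs : st = tg
    · subst hs
      simp only [Function.update_self]
      rw [Function.update_of_ne (by omega), Function.update_of_ne (by omega)]
      exact ⟨hlt, le_rfl, hc, hi, hu, by rw [← htg, target_div hD], rfl, rfl⟩
    · rw [Function.update_of_ne hs] at hc'
      have hp := h.sound st hst hne hc'
      have hne : ps st ≠ tg := by omega
      rw [Function.update_of_ne hs, Function.update_of_ne hs, Function.update_of_ne hs,
        Function.update_of_ne hs, Function.update_of_ne hne, Function.update_of_ne hne]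
      exact hp
  · intro st hst hc'
    by_cases hs : st = tg
    · subst hs
      rw [Function.update_self, ← htg, target_mod hD, h.idx cur hcur hc]
      omega
    · rw [Function.update_of_ne hs] at hc' ⊢
      exact h.idx st hst hc'
  · intro st hst hc' j hj hcj hu'
    have hs : st ≠ tg := by omega
    rw [Function.update_of_ne hs] at hc'
    rw [Function.update_of_ne hs, Function.update_of_ne hs]
    by_cases ht : target mask kap D st j = tg
    · rw [ht, Function.update_self, Function.update_self]
      refine ⟨by omega, ?_⟩
      by_cases hnew : st = cur ∧ j = i
      · obtain ⟨rfl, rfl⟩ := hnew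
        exact Or.inr ⟨rfl, le_rfl⟩
      have := h.complete st hst hc' j hj (by tauto) hu'
      rw [ht] at this
      have hb := hb this.1
      rcases this.2 with h1 | ⟨h1, h2⟩ <;> rcases hb with h3 | ⟨h3, h4⟩
      · exact Or.inl (by omega)
      · exact Or.inl (by omega)
      · exact Or.inl (by omega)
      · exact Or.inr ⟨by omega, h4.trans h2⟩
    · rw [Function.update_of_ne ht, Function.update_of_ne ht]
      refine h.complete st hst hc' j hj ?_ hu'
      rcases hcj with h' | ⟨rfl, h' | rfl⟩
      · exact Or.inl h'
      · exact Or.inr ⟨rfl, h'⟩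
      · exact absurd htg ht

theorem ChainTable.next {M : ℕ} (h : ChainTable It mask kap cw D M cur Dn cn f ps pi)
    (hDn : cn cur ≠ 0 → ∀ i, It i → Dn i) :
    ChainTable It mask kap cw D M (cur + 1) (fun _ => False) cn f ps pi := by
  refine ⟨h.init, fun st hst hne hc => ?_, h.idx, fun st hst hc i hi hcur hu => ?_⟩
  · have := h.sound st hst hne hc
    exact ⟨this.1, by omega, this.2.2⟩
  · refine h.complete st hst hc i hi ?_ hu
    rcases hcur with h' | h'
    · rcases Nat.lt_succ_iff_lt_or_eq.1 h' with h' | rfl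
      · exact Or.inl h'
      · exact Or.inr ⟨rfl, hDn hc i hi⟩
    · exact absurd h'.2 id

/-- The items on the way back from a state to the initial state `D`. -/
inductive Path (ps pi : ℕ → ℕ) (D : ℕ) : List ℕ → ℕ → Prop
  | nil : Path ps pi D [] D
  | cons {l : List ℕ} {st : ℕ} (hne : st ≠ D) (h : Path ps pi D l (ps st)) :
      Path ps pi D (pi st :: l) st

theorem ChainTable.exists_path {M : ℕ} (h : ChainTable It mask kap cw D M cur Dn cn f ps pi)
    (hD : 0 < D) : ∀ st < M, cn st ≠ 0 → ∃ l, Path ps pi D l st ∧ Chain It mask l (st / D) ∧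
      (l.map kap).sum + 1 = cn st ∧ (l.map cw).sum = f st := by
  intro st
  induction st using Nat.strong_induction_on with
  | _ st ih =>
  intro hst hc
  by_cases hs : st = D
  · subst hs
    exact ⟨[], .nil, by rw [Nat.div_self hD]; exact .nil, by simp [h.init.1], by simp [h.init.2]⟩
  · obtain ⟨h1, -, h2, h3, h4, h5, h6, h7⟩ := h.sound st hst hs hc
    obtain ⟨l, g1, g2, g3, g4⟩ := ih _ h1 (by omega) h2
    refine ⟨pi st :: l, .cons hs g1, h5 ▸ .cons g2 h3 h4.1 h4.2, ?_, ?_⟩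
    · rw [List.map_cons, List.sum_cons, h6]
      omega
    · rw [List.map_cons, List.sum_cons, h7, g4, add_comm]

theorem ChainTable.lexLe (h : ChainTable It mask kap cw D (2 ^ c * D) (2 ^ c * D) Dn cn f ps pi)
    (hD : 0 < D) {l : List ℕ} {T : ℕ} (hl : Chain It mask l T) (hT : T < 2 ^ c) :
    cn (T * D + min (l.map kap).sum (D - 1)) ≠ 0 ∧
      LexLe (cn (T * D + min (l.map kap).sum (D - 1))) (f (T * D + min (l.map kap).sum (D - 1)))
        ((l.map kap).sum + 1) (l.map cw).sum := by
  induction hl with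
  | nil => simp [h.init.1, h.init.2, LexLe]
  | @cons l T i hl hi h1 h2 ih =>
    have hT' : T < 2 ^ c := lt_of_le_of_lt Nat.left_le_or hT
    obtain ⟨g1, g2⟩ := ih hT'
    set st := T * D + min (l.map kap).sum (D - 1) with hst
    have hdiv : st / D = T := by
      rw [hst, Nat.mul_comm, Nat.mul_add_div hD, Nat.div_eq_of_lt (by omega), Nat.add_zero]
    have hmod : st % D = min (l.map kap).sum (D - 1) := by
      rw [hst, Nat.mul_add_mod_self_right, Nat.mod_eq_of_lt (by omega)]
    have hlt : st < 2 ^ c * D := by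
      rw [← Nat.div_lt_iff_lt_mul hD, hdiv]
      exact hT'
    have htg : target mask kap D st i =
        (T ||| mask i) * D + min ((i :: l).map kap).sum (D - 1) := by
      rw [target, hdiv, hmod, List.map_cons, List.sum_cons]
      omega
    obtain ⟨e1, e2⟩ := h.complete st hlt g1 i hi (Or.inl hlt) ⟨by rwa [hdiv], by rwa [hdiv]⟩
    rw [htg] at e1 e2
    refine ⟨e1, ?_⟩
    generalize cn ((T ||| mask i) * D + min ((i :: l).map kap).sum (D - 1)) = a at e2 ⊢
    generalize f ((T ||| mask i) * D + min ((i :: l).map kap).sum (D - 1)) = b at e2 ⊢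
    rw [List.map_cons, List.sum_cons, List.map_cons, List.sum_cons]
    rcases g2 with g2 | ⟨g2, g3⟩ <;> rcases e2 with e2 | ⟨e2, e3⟩
    · exact Or.inl (by omega)
    · exact Or.inl (by omega)
    · exact Or.inl (by omega)
    · exact Or.inr ⟨by omega, by linarith⟩

/-! ### Enlarging covers, and reasons for their absence -/

variable {H : Net} {xs par : ℕ → ℕ} {L : ℕ}

theorem Net.Ordered.mono (S : H.Ordered xs par L) {L' : ℕ} (h : L' ≤ L) : H.Ordered xs par L' :=
  ⟨fun p hp => S.lt p (by omega), fun p hp q hq => S.inj p (by omega) q (by omega),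
    fun p hp => S.par_lt p (by omega), fun p hp => S.adj p (by omega)⟩

theorem Net.Ordered.exists_mem (S : H.Ordered xs par L) (hL : 2 ≤ L) {Y : Finset ℕ}
    (hY : H.CVC Y) : ∃ p < L, xs p ∈ Y := by
  have h1 := S.par_lt 1 (by omega) le_rfl
  rcases hY.cover _ _ (S.adj 1 (by omega) le_rfl) with h | h
  · exact ⟨_, by omega, h⟩
  · exact ⟨1, by omega, h⟩

theorem Net.Ordered.exists_nbr (S : H.Ordered xs par L) (hL : 2 ≤ L) {p : ℕ} (hp : p < L) :
    ∃ u, u ∈ H.nbr (xs p) := by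
  rcases Nat.eq_zero_or_pos p with rfl | h
  · have h1 := S.par_lt 1 (by omega) le_rfl
    have h2 := S.adj 1 (by omega) le_rfl
    rw [show par 1 = 0 by omega] at h2
    exact ⟨_, H.symm h2⟩
  · exact ⟨_, S.adj p hp h⟩

/-- Adding a connected set with at least two vertices to a connected vertex cover keeps it connected,
because every vertex is in the cover or has all its neighbours there. -/
theorem Net.Ordered.exists_union (S : H.Ordered xs par L) (hL : 2 ≤ L) {Y : Finset ℕ}
    (hY : H.CVC Y) : ∃ Z, H.CVC Z ∧ (∀ p < L, xs p ∈ Z) ∧ Z.card + 1 ≤ Y.card + L := by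
  refine ⟨Y ∪ (Finset.range L).image xs, ⟨?_, ?_, ?_⟩, ?_, ?_⟩
  · intro v hv
    rcases Finset.mem_union.1 hv with h | h
    · exact hY.lt v h
    · obtain ⟨p, hp, rfl⟩ := Finset.mem_image.1 h
      exact S.lt p (Finset.mem_range.1 hp)
  · intro u v h
    rcases hY.cover u v h with h | h
    · exact Or.inl (Finset.mem_union_left _ h)
    · exact Or.inr (Finset.mem_union_left _ h)
  · rintro R ⟨r, hr, hrR⟩ hR
    -- Every listed vertex has an edge, one end of which lies in `Y`.
    have att : ∀ v ∈ Y ∪ (Finset.range L).image xs, v ∈ Y ∨ ∃ u ∈ Y, u ∈ H.nbr v := by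
      intro v hv
      rcases Finset.mem_union.1 hv with h | h
      · exact Or.inl h
      · obtain ⟨p, hp, rfl⟩ := Finset.mem_image.1 h
        obtain ⟨u, hu⟩ := S.exists_nbr hL (Finset.mem_range.1 hp)
        rcases hY.cover _ _ hu with h | h
        · exact Or.inr ⟨u, h, hu⟩
        · exact Or.inl h
    have sub : ∀ x ∈ Y, x ∈ R := by
      refine hY.conn R ?_ fun a ha haR b hb hab =>
        hR a (Finset.mem_union_left _ ha) haR b (Finset.mem_union_left _ hb) hab
      rcases att r hr with h | ⟨u, hu, hur⟩
      · exact ⟨r, h, hrR⟩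
      · exact ⟨u, hu, hR r hr hrR u (Finset.mem_union_left _ hu) hur⟩
    intro x hx
    rcases att x hx with h | ⟨u, hu, hux⟩
    · exact sub x h
    · exact hR u (Finset.mem_union_left _ hu) (sub u hu) x hx (H.symm hux)
  · exact fun p hp => Finset.mem_union_right _ (Finset.mem_image_of_mem _ (Finset.mem_range.2 hp))
  · obtain ⟨p, hp, hpY⟩ := S.exists_mem hL hY
    have h1 := Finset.card_union_add_card_inter Y ((Finset.range L).image xs)
    have h2 : 0 < (Y ∩ (Finset.range L).image xs).card := Finset.card_pos.2 ⟨xs p,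
      Finset.mem_inter.2 ⟨hpY, Finset.mem_image_of_mem _ (Finset.mem_range.2 hp)⟩⟩
    have h3 : ((Finset.range L).image xs).card ≤ L := Finset.card_image_le.trans (by simp)
    omega

/-- A matching is not larger than a vertex cover. -/
theorem Net.Ordered.le_card (S : H.Ordered xs par L) {g : ℕ} (hL : L = 2 * g)
    (hm : ∀ i < g, xs (2 * i) ∈ H.nbr (xs (2 * i + 1))) {Y : Finset ℕ} (hY : H.CVC Y) :
    g ≤ Y.card := by
  have h : ∀ i < g, ∃ p, (p = 2 * i ∨ p = 2 * i + 1) ∧ xs p ∈ Y := by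
    intro i hi
    rcases hY.cover _ _ (hm i hi) with h | h
    · exact ⟨_, Or.inl rfl, h⟩
    · exact ⟨_, Or.inr rfl, h⟩
  choose! q hq hqY using h
  have : ((Finset.range g).image fun i => xs (q i)).card = g := by
    rw [Finset.card_image_of_injOn, Finset.card_range]
    intro i hi j hj hij
    simp only [Finset.coe_range, Set.mem_Iio] at hi hj
    have h1 := hq i hi
    have h2 := hq j hj
    have := S.inj (q i) (by omega) (q j) (by omega) hij
    omega
  rw [← this]
  refine Finset.card_le_card fun v hv => ?_
  obtain ⟨i, hi, rfl⟩ := Finset.mem_image.1 hv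
  exact hqY i (Finset.mem_range.1 hi)

/-- If no vertex outside of the list has both a neighbour in the list and one outside of it, then an
edge outside of the list belongs to another component of the graph. -/
theorem Net.Ordered.not_cvc (S : H.Ordered xs par L) (hL : 2 ≤ L)
    (hst : ∀ v u w, ¬ In xs L v → u ∈ H.nbr v → In xs L u → w ∈ H.nbr v → In xs L w)
    {v w : ℕ} (hvw : w ∈ H.nbr v) (hv : ¬ In xs L v) (hw : ¬ In xs L w) (Y : Finset ℕ) :
    ¬ H.CVC Y := by
  intro hY
  obtain ⟨p, hp, hpY⟩ := S.exists_mem hL hY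
  -- The ends of edges outside of the list are closed under adjacency.
  have : xs p ∈ {a | ¬ In xs L a ∧ ∃ b ∈ H.nbr a, ¬ In xs L b} := by
    refine hY.conn _ ?_ ?_ _ hpY
    · rcases hY.cover _ _ hvw with h | h
      · exact ⟨w, h, hw, v, H.symm hvw, hv⟩
      · exact ⟨v, h, hv, w, hvw, hw⟩
    · rintro a - ⟨ha, b, hab, hb⟩ b' - hab'
      refine ⟨fun h' => ?_, a, H.symm hab', ha⟩
      exact hb (hst a b' b ha hab' h' hab)
  exact this.1 ⟨p, hp, rfl⟩

end WCVC

/-! ### Scanning adjacency lists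

Registers `2` and `3` hold the number of vertices and the parameter, registers `4` and `5` the length of
the list and the number `sh`. The arrays `1` and `2` hold the list and the positions of the earlier
neighbours, array `3` powers of two. The other arrays of words hold the output (`0`), the incidences of
items (`5`, `6`), the cardinality and a vertex of minimum weight of every item (`7`, `8`), the
components of the chosen items (`9`), the components touched by an item and the number of vertices that
it needs (`10`, `11`), the length, the predecessor and the last item of the chain to a state
(`12`, `13`, `14`), the additional vertices of the best cover (`15`) and the items in use (`16`). The
arrays of real numbers hold the minimum and the total weight of every item (`0`, `1`), the weight of the
chain to a state (`2`), the weight of the forced and chosen vertices (`3`), the weight that an item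
adds (`4`) and the weight of the best cover (`5`). -/

namespace WCVC

open RealRAM

/-- The `d`-th neighbour of `v`. -/
def Net.nth (H : Net) (v d : ℕ) : ℕ := (H.nbr v).getD d 0

/-- The degree of `v`. -/
def Net.deg (H : Net) (v : ℕ) : ℕ := (H.nbr v).length

theorem Net.mem_nbr {H : Net} {u v : ℕ} : u ∈ H.nbr v ↔ ∃ d < H.deg v, H.nth v d = u := by
  rw [List.mem_iff_getElem]
  constructor
  · rintro ⟨d, hd, rfl⟩
    exact ⟨d, hd, List.getD_eq_getElem _ _ hd⟩
  · rintro ⟨d, hd, rfl⟩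
    exact ⟨d, hd, (List.getD_eq_getElem _ _ hd).symm⟩

theorem Net.nth_mem {H : Net} {v d : ℕ} (h : d < H.deg v) : H.nth v d ∈ H.nbr v :=
  Net.mem_nbr.2 ⟨d, h, rfl⟩

/-- The input `I` holds the graph `H` with `m` edges and the parameter `k`; the adjacency list of `v`
starts at position `off v`. The resources suffice. -/
structure Setup (M : Limits) (I : Input) (H : Net) (m k : ℕ) (off : ℕ → ℕ) : Prop where
  k_pos : 1 ≤ k
  n_pos : 1 ≤ H.n
  off_has : ∀ v ≤ H.n, I.HasWord 1 v
  off_eq : ∀ v ≤ H.n, I.word 1 v = off v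
  off_zero : off 0 = 0
  off_succ : ∀ v < H.n, off (v + 1) = off v + H.deg v
  off_n : off H.n = 2 * m
  flat_has : ∀ v < H.n, ∀ d < H.deg v, I.HasWord 2 (off v + d)
  flat_eq : ∀ v < H.n, ∀ d < H.deg v, I.word 2 (off v + d) = H.nth v d
  real_has : ∀ v < H.n, v < I.reals.length
  real_eq : ∀ v < H.n, I.reals.getD v 0 = H.ω v
  word_le : 100 * (H.n + 2 * m + 1) ≤ M.word
  cells_le : M.cells ≤ M.word
  le_cells : 100 * (2 ^ k * k) ≤ M.cells

variable {M : Limits} {I : Input} {H : Net} {m k : ℕ} {off : ℕ → ℕ}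

theorem Setup.off_le (S : Setup M I H m k off) {v : ℕ} (hv : v ≤ H.n) : off v ≤ 2 * m := by
  have : ∀ d v, v + d = H.n → off v ≤ 2 * m := by
    intro d
    induction d with
    | zero => intro v h; rw [show v = H.n by omega, S.off_n]
    | succ d ih =>
      intro v h
      have := ih (v + 1) (by omega)
      rw [S.off_succ v (by omega)] at this
      omega
  exact this (H.n - v) v (by omega)

theorem Setup.sum_deg (S : Setup M I H m k off) : ∑ v ∈ Finset.range H.n, H.deg v = 2 * m := by
  have : ∀ j ≤ H.n, ∑ v ∈ Finset.range j, H.deg v = off j := by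
    intro j
    induction j with
    | zero => simp [S.off_zero]
    | succ j ih =>
      intro h
      rw [Finset.sum_range_succ, ih (by omega), S.off_succ j (by omega)]
  rw [this _ le_rfl, S.off_n]

/-- Run `p` with register `9` passing through the neighbours of the vertex in register `6`. -/
def nbrLoop (p : Prog) : Prog :=
  .assign 8 (.input 1 (.reg 6 + .const 1)) ;;
  .for 7 (.input 1 (.reg 6)) 8 (.assign 9 (.input 2 (.reg 7)) ;; p)

@[simp] theorem nbrLoop_regs (p : Prog) : (nbrLoop p).regs = 8 :: 7 :: 9 :: (p.regs ++ [7]) := rfl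
@[simp] theorem nbrLoop_mems (p : Prog) : (nbrLoop p).mems = p.mems ++ [] := rfl
@[simp] theorem nbrLoop_rmems (p : Prog) : (nbrLoop p).rmems = p.rmems ++ [] := rfl

theorem Setup.runs_nbrLoop (S : Setup M I H m k off) {p : Prog} {σ : State}
    {Q : State → ℕ → Prop} {v : ℕ} (hv : σ.reg 6 = v) (hvn : v < H.n) (Inv : ℕ → State → Prop)
    (T : ℕ) (h7 : 7 ∉ p.regs) (h8 : 8 ∉ p.regs)
    (h0 : ∀ a b, Inv 0 ((σ.setReg 8 a).setReg 7 b))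
    (hs : ∀ d τ, d < H.deg v → Frame (nbrLoop p) σ τ → Inv d τ →
      Runs M I p (τ.setReg 9 (H.nth v d)) fun τ' t => t ≤ T ∧ ∀ a, Inv (d + 1) (τ'.setReg 7 a))
    (hQ : ∀ τ t, Frame (nbrLoop p) σ τ → Inv (H.deg v) τ →
      t ≤ H.deg v * (T + 11) + 12 → Q τ t) :
    Runs M I (nbrLoop p) σ Q := by
  have hw := S.word_le
  have ho := S.off_le (v := v) (by omega)
  have ho' := S.off_le (v := v + 1) (by omega)
  have hsu := S.off_succ v hvn
  have hfr : ∀ τ, Frame (Prog.for 7 (.input 1 (.reg 6)) 8 (.assign 9 (.input 2 (.reg 7)) ;; p))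
      (σ.setReg 8 (off (v + 1))) τ → Frame (nbrLoop p) σ τ := by
    intro τ h
    refine ⟨fun x hx => ?_, fun x hx => ?_, fun x hx => ?_⟩
    · simp only [nbrLoop_regs, List.mem_cons, List.mem_append, not_or, List.not_mem_nil,
        not_false_eq_true, and_true] at hx
      rw [h.reg x (by simp; tauto)]
      simp [hx.1]
    · rw [h.mem x (by simpa using hx)]
      rfl
    · rw [h.rmem x (by simpa using hx)]
      rfl
  simp only [nbrLoop, runs_seq, runs_assign, safe_input, safe_add, safe_reg, safe_const, val_add,
    val_reg, val_const, val_input, hv, true_and]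
  rw [S.off_eq _ (by omega)]
  refine ⟨⟨⟨by omega, by omega⟩, S.off_has _ (by omega), by omega⟩, ?_⟩
  refine Runs.for_const (off v) (off (v + 1)) (fun i τ => Inv (i - off v) τ) (T + 3) ?_ ?_ ?_
    (by omega) (by omega) (by decide) (by simp [h8]) (by simp [h7]) ?_ ?_ ?_
  · simp only [safe_input, safe_reg, val_reg, setReg_reg, true_and]
    simp only [show (6 : ℕ) ≠ 8 by decide, if_false, hv]
    rw [S.off_eq _ (by omega)]
    exact ⟨S.off_has _ (by omega), by omega⟩
  · simp [hv, S.off_eq v (by omega)]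
  · simp
  · simpa using h0 _ _
  · intro i τ h1 h2 hf hi hI
    have hd : i - off v < H.deg v := by omega
    have e : off v + (i - off v) = i := by omega
    have e2 := S.flat_eq v hvn _ hd
    have e3 := S.flat_has v hvn _ hd
    rw [e] at e2 e3
    have := H.lt (Net.nth_mem hd)
    simp only [runs_seq, runs_assign, safe_input, safe_reg, val_reg, val_input, hi, e2, true_and]
    refine ⟨⟨e3, by omega⟩, (hs _ τ hd (hfr τ hf) hI).mono ?_⟩
    rintro τ' t - ⟨h3, h4⟩
    refine ⟨by simp; omega, ?_⟩
    rw [show i + 1 - off v = i - off v + 1 by omega]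
    exact h4 _
  · intro τ t hf _ hI ht
    rw [show off (v + 1) - off v = H.deg v by omega] at hI ht
    refine hQ τ _ (hfr τ hf) hI ?_
    simp only [cost_input, cost_add, cost_reg, cost_const] at ht ⊢
    have : H.deg v * (T + 3 + 8) = H.deg v * (T + 11) := rfl
    omega

/-- Search the list in array `1`, whose length is in register `4`, for the content of register `w`.
Register `11` receives a position, or the length of the list. -/
def find (w : ℕ) : Prog :=
  .assign 11 (.reg 4) ;;
  .for 10 (.const 0) 4 (.ite (.eq (.load 1 (.reg 10)) (.reg w)) (.assign 11 (.reg 10)) .skip)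

@[simp] theorem find_regs (w : ℕ) : (find w).regs = [11, 10, 11, 10] := rfl
@[simp] theorem find_mems (w : ℕ) : (find w).mems = [] := rfl
@[simp] theorem find_rmems (w : ℕ) : (find w).rmems = [] := rfl

/-- `p` is the result of searching `v` among the first `L` entries of `xs`. -/
def Found (xs : ℕ → ℕ) (L v p : ℕ) : Prop :=
  (p < L ∧ xs p = v) ∨ (p = L ∧ ¬ In xs L v)

theorem runs_find {w : ℕ} (hw : w ≠ 10 ∧ w ≠ 11) {σ : State} (h1 : σ.reg 4 < M.cells)
    (h2 : M.cells ≤ M.word) {Q : State → ℕ → Prop}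
    (hQ : ∀ τ t, Frame (find w) σ τ → Found (σ.mem 1) (σ.reg 4) (σ.reg w) (τ.reg 11) →
      t ≤ 22 * σ.reg 4 + 10 → Q τ t) : Runs M I (find w) σ Q := by
  have key : Runs M I (find w) σ fun τ t => Found (σ.mem 1) (σ.reg 4) (σ.reg w) (τ.reg 11) ∧
      t ≤ 22 * σ.reg 4 + 10 := by
    rw [find, runs_seq, runs_assign]
    refine ⟨trivial, ?_⟩
    refine Runs.for_const 0 (σ.reg 4) (fun i τ =>
      (τ.reg 11 < i ∧ σ.mem 1 (τ.reg 11) = σ.reg w) ∨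
        (τ.reg 11 = σ.reg 4 ∧ ∀ p < i, σ.mem 1 p ≠ σ.reg w)) 14
      (by simp; omega) rfl (by simp) (by omega) (by omega) (by decide) (by simp) (by simp)
      (by simp) ?_ ?_
    · intro i τ _ hi hf h10 hI
      have e1 : τ.reg w = σ.reg w := by rw [hf.reg w (by simp [hw])]; simp [hw.2]
      have e2 : τ.mem 1 = σ.mem 1 := by rw [hf.mem 1 (by simp)]; rfl
      simp only [runs_ite, runs_assign, runs_skip, csafe_eq, holds_eq, safe_load, safe_reg, val_reg,
        val_load, h10, e1, e2, ccost_eq, cost_load, cost_reg, true_and, and_true, setReg_reg]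
      refine ⟨by omega, fun h => ⟨by norm_num, Or.inl ⟨?_, ?_⟩⟩, fun h => ⟨by norm_num, ?_⟩⟩
      · simp
      · simpa using h
      · simp only [show (11 : ℕ) ≠ 10 by decide, if_false]
        rcases hI with h3 | h3
        · exact Or.inl ⟨by omega, h3.2⟩
        · refine Or.inr ⟨h3.1, fun p hp => ?_⟩
          rcases Nat.lt_succ_iff_lt_or_eq.1 hp with hp | rfl
          · exact h3.2 p hp
          · exact h
    · intro τ t hf _ hI ht
      refine ⟨?_, by simp at ht ⊢; omega⟩
      rcases hI with h3 | h3
      · exact Or.inl h3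
      · exact Or.inr ⟨h3.1, fun ⟨p, hp, h⟩ => h3.2 p hp h⟩
  exact key.mono fun τ t hf h => hQ τ t hf h.1 h.2

end WCVC

namespace WCVC

open RealRAM

variable {M : Limits} {I : Input} {H : Net} {m k : ℕ} {off : ℕ → ℕ}

theorem Setup.two_pow_le (S : Setup M I H m k off) : 100 * 2 ^ k ≤ M.cells :=
  (Nat.mul_le_mul_left 100 (Nat.le_mul_of_pos_right _ S.k_pos)).trans S.le_cells

theorem Setup.k_le (S : Setup M I H m k off) : 100 * k ≤ M.cells :=
  (Nat.mul_le_mul_left 100 (Nat.le_mul_of_pos_left _ (by positivity))).trans S.le_cells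

/-- A loop over all vertices, with the vertex in register `6`. -/
theorem Setup.runs_vertices (S : Setup M I H m k off) {p : Prog} {σ : State}
    {Q : State → ℕ → Prop} (Inv : ℕ → State → Prop) (B : ℕ) (hn : σ.reg 2 = H.n)
    (h2 : 2 ∉ p.regs) (h6 : 6 ∉ p.regs) (h0 : Inv 0 (σ.setReg 6 0))
    (hs : ∀ v τ, v < H.n → Frame (Prog.for 6 (.const 0) 2 p) σ τ → τ.reg 6 = v → Inv v τ →
      Runs M I p τ fun τ' t => t ≤ (H.deg v + 1) * B ∧ Inv (v + 1) (τ'.setReg 6 (v + 1)))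
    (hQ : ∀ τ t, Frame (Prog.for 6 (.const 0) 2 p) σ τ → Inv H.n τ →
      t ≤ (H.n + 2 * m) * (B + 8) + 6 → Q τ t) :
    Runs M I (.for 6 (.const 0) 2 p) σ Q := by
  have hw := S.word_le
  refine Runs.for 0 H.n Inv (fun v => (H.deg v + 1) * B) (by simp; omega) rfl hn (by omega)
    (by omega) (by decide) h2 h6 h0 (fun v τ _ => hs v τ) fun τ t hf _ hI ht =>
    hQ τ t hf hI (ht.trans ?_)
  rw [← Finset.range_eq_Ico, Finset.sum_add_distrib, ← Finset.sum_mul, Finset.sum_add_distrib,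
    S.sum_deg]
  simp only [Finset.sum_const, Finset.card_range, smul_eq_mul, cost_const]
  nlinarith

/-- Scan the neighbours of the vertex in register `6`. Register `12` receives the position of a
neighbour in the list (or the length of the list), register `13` a neighbour outside of the list, plus
one (or zero), and register `14` the mask of the neighbours in the list, where register `5` is the
number of additional positions contracted into the first one. -/
def nbscan : Prog :=
  .assign 12 (.reg 4) ;; .assign 13 (.const 0) ;; .assign 14 (.const 0) ;;
  nbrLoop (find 9 ;; .ite (.lt (.reg 11) (.reg 4))
    (.assign 12 (.reg 11) ;; .assign 14 (.op .lor (.reg 14) (.load 3 (.reg 11 - .reg 5))))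
    (.assign 13 (.reg 9 + .const 1)))

@[simp] theorem nbscan_regs : nbscan.regs = [12, 13, 14, 8, 7, 9, 11, 10, 11, 10, 12, 14, 13, 7] :=
  rfl
@[simp] theorem nbscan_mems : nbscan.mems = [] := rfl
@[simp] theorem nbscan_rmems : nbscan.rmems = [] := rfl

/-- The results of `nbscan` for the vertex `v`. -/
structure Scanned (H : Net) (xs : ℕ → ℕ) (L sh v : ℕ) (τ : State) : Prop where
  hit : (τ.reg 12 = L ∧ ∀ u ∈ H.nbr v, ¬ In xs L u) ∨ (τ.reg 12 < L ∧ xs (τ.reg 12) ∈ H.nbr v)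
  out : (τ.reg 13 = 0 ∧ ∀ u ∈ H.nbr v, In xs L u) ∨
    ∃ u ∈ H.nbr v, τ.reg 13 = u + 1 ∧ ¬ In xs L u
  mask : ∀ j, (τ.reg 14).testBit j = true ↔ H.Hits xs L sh v j

theorem Setup.runs_nbscan (S : Setup M I H m k off) {σ : State} {Q : State → ℕ → Prop}
    (hv : σ.reg 6 < H.n) (h4 : σ.reg 4 < M.cells)
    (h5 : ∀ p < σ.reg 4, p - σ.reg 5 ≤ k + 1) (hpw : ∀ j ≤ k + 1, σ.mem 3 j = 2 ^ j)
    (hinj : ∀ p < σ.reg 4, ∀ q < σ.reg 4, σ.mem 1 p = σ.mem 1 q → p = q)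
    (hQ : ∀ τ t, Frame nbscan σ τ → Scanned H (σ.mem 1) (σ.reg 4) (σ.reg 5) (σ.reg 6) τ →
      t ≤ H.deg (σ.reg 6) * (22 * σ.reg 4 + 50) + 20 → Q τ t) :
    Runs M I nbscan σ Q := by
  have hw := S.word_le
  have hcw := S.cells_le
  have hk := S.k_le
  have hk1 := S.k_pos
  have hp := S.two_pow_le
  set v := σ.reg 6 with hv6
  set L := σ.reg 4 with hL
  set sh := σ.reg 5 with hsh
  set xs := σ.mem 1 with hxs
  have key : Runs M I nbscan σ fun τ t => Scanned H xs L sh v τ ∧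
      t ≤ H.deg v * (22 * L + 50) + 20 := by
    simp only [nbscan, runs_seq, runs_assign, safe_reg, safe_const, val_reg, val_const, true_and,
      cost_reg, cost_const]
    refine ⟨by omega, by omega, ?_⟩
    refine S.runs_nbrLoop (v := v) (by simp [hv6]) hv (fun d τ =>
      ((τ.reg 12 = L ∧ ∀ e < d, ¬ In xs L (H.nth v e)) ∨
        (τ.reg 12 < L ∧ xs (τ.reg 12) ∈ H.nbr v)) ∧
      ((τ.reg 13 = 0 ∧ ∀ e < d, In xs L (H.nth v e)) ∨
        ∃ u ∈ H.nbr v, τ.reg 13 = u + 1 ∧ ¬ In xs L u) ∧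
      (∀ j, (τ.reg 14).testBit j = true ↔ ∃ p < L, (∃ e < d, H.nth v e = xs p) ∧ p - sh = j) ∧
      τ.reg 14 < 2 ^ (k + 2)) (22 * L + 39) (by simp) (by simp) ?_ ?_ ?_
    · intro a b
      simp [hL]
    · intro d τ hd hf hI
      have e4 : τ.reg 4 = L := by rw [hf.reg 4 (by simp)]; simp [hL]
      have e5 : τ.reg 5 = sh := by rw [hf.reg 5 (by simp)]; simp [hsh]
      have e1 : τ.mem 1 = xs := by rw [hf.mem 1 (by simp)]; simp [hxs]
      have e3 : τ.mem 3 = σ.mem 3 := by rw [hf.mem 3 (by simp)]; simp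
      obtain ⟨i1, i2, i3, i4⟩ := hI
      have hu := Net.nth_mem hd
      have hun := H.lt hu
      rw [runs_seq]
      refine runs_find (by decide) (by simpa [e4] using h4) hcw ?_
      intro υ t hfυ hF ht
      simp only [setReg_mem, setReg_reg, e1, e4, if_true, show (4 : ℕ) ≠ 9 by decide, if_false] at hF ht
      have f4 : υ.reg 4 = L := by rw [hfυ.reg 4 (by simp)]; simp [e4]
      have f5 : υ.reg 5 = sh := by rw [hfυ.reg 5 (by simp)]; simp [e5]
      have f9 : υ.reg 9 = H.nth v d := by rw [hfυ.reg 9 (by simp)]; simp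
      have f3 : υ.mem 3 = σ.mem 3 := by rw [hfυ.mem 3 (by simp)]; simp [e3]
      have f12 : υ.reg 12 = τ.reg 12 := by rw [hfυ.reg 12 (by simp)]; simp
      have f13 : υ.reg 13 = τ.reg 13 := by rw [hfυ.reg 13 (by simp)]; simp
      have f14 : υ.reg 14 = τ.reg 14 := by rw [hfυ.reg 14 (by simp)]; simp
      simp only [runs_ite, runs_seq, runs_assign, csafe_lt, holds_lt, safe_reg, safe_lor, safe_load,
        safe_sub, safe_add, safe_const, val_reg, val_lor, val_load, val_sub, val_add, val_const,
        setReg_reg, setReg_mem, f4, f5, f9, f3, f12, f13, f14, true_and, ccost_lt, cost_reg, cost_op,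
        cost_load, cost_sub, cost_add, cost_const]
      refine ⟨fun h => ?_, fun h => ?_⟩
      · have hF : xs (υ.reg 11) = H.nth v d := by
          rcases hF with hF | hF
          · exact hF.2
          · omega
        have hp5 := h5 _ h
        have hpw' := hpw _ hp5
        have hlt : 2 ^ (υ.reg 11 - sh) < 2 ^ (k + 2) := Nat.pow_lt_pow_right (by omega) (by omega)
        have hor := Nat.or_lt_two_pow i4 hlt
        have h4k : 2 ^ (k + 2) = 4 * 2 ^ k := by rw [pow_add]; ring
        norm_num
        rw [hpw']
        refine ⟨⟨⟨by omega, by omega⟩, by omega⟩, by omega, Or.inr ⟨h, by rwa [hF]⟩, ?_, ?_, hor⟩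
        · rcases i2 with ⟨i2, i2'⟩ | i2
          · refine Or.inl ⟨i2, fun e he => ?_⟩
            rcases Nat.lt_or_eq_of_le he with he | rfl
            · exact i2' e he
            · exact ⟨_, h, hF⟩
          · exact Or.inr i2
        · intro j
          have i3 := i3 j
          rw [i3, Nat.testBit_two_pow, decide_eq_true_eq]
          constructor
          · rintro (⟨p, hp, ⟨e, he, h1⟩, h2⟩ | h1)
            · exact ⟨p, hp, ⟨e, by omega, h1⟩, h2⟩
            · exact ⟨_, h, ⟨d, by omega, hF.symm⟩, h1⟩
          · rintro ⟨p, hp, ⟨e, he, h1⟩, h2⟩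
            rcases Nat.lt_or_eq_of_le he with he | rfl
            · exact Or.inl ⟨p, hp, ⟨e, he, h1⟩, h2⟩
            · exact Or.inr (by rw [hinj _ h _ hp (hF.trans h1), h2])
      · have hF : ¬ In xs L (H.nth v d) := by
          rcases hF with hF | hF
          · omega
          · exact hF.2
        norm_num
        refine ⟨⟨by omega, by omega⟩, by omega, ?_, ⟨_, hu, rfl, hF⟩, ?_, i4⟩
        · rcases i1 with ⟨i1, i1'⟩ | i1
          · refine Or.inl ⟨i1, fun e he => ?_⟩
            rcases Nat.lt_or_eq_of_le he with he | rfl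
            · exact i1' e he
            · exact hF
          · exact Or.inr i1
        · intro j
          rw [i3]
          constructor
          · rintro ⟨p, hp, ⟨e, he, h1⟩, h2⟩
            exact ⟨p, hp, ⟨e, by omega, h1⟩, h2⟩
          · rintro ⟨p, hp, ⟨e, he, h1⟩, h2⟩
            rcases Nat.lt_or_eq_of_le he with he | rfl
            · exact ⟨p, hp, ⟨e, he, h1⟩, h2⟩
            · exact absurd ⟨p, hp, h1.symm⟩ hF
    · rintro τ t hf ⟨i1, i2, i3, -⟩ ht
      refine ⟨⟨?_, ?_, fun j => ?_⟩, ?_⟩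
      · rcases i1 with ⟨i1, i1'⟩ | i1
        · refine Or.inl ⟨i1, fun u hu => ?_⟩
          obtain ⟨e, he, rfl⟩ := Net.mem_nbr.1 hu
          exact i1' e he
        · exact Or.inr i1
      · rcases i2 with ⟨i2, i2'⟩ | i2
        · refine Or.inl ⟨i2, fun u hu => ?_⟩
          obtain ⟨e, he, rfl⟩ := Net.mem_nbr.1 hu
          exact i2' e he
        · exact Or.inr i2
      · rw [i3]
        constructor
        · rintro ⟨p, hp, ⟨e, he, h1⟩, h2⟩
          exact ⟨p, hp, h1 ▸ Net.nth_mem he, h2⟩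
        · rintro ⟨p, hp, h1, h2⟩
          exact ⟨p, hp, Net.mem_nbr.1 h1, h2⟩
      · have : H.deg v * (22 * L + 39 + 11) = H.deg v * (22 * L + 50) := rfl
        omega
  exact key.mono fun τ t hf h => hQ τ t hf h.1 h.2

end WCVC

/-! ### A connected vertex cover of size at most `2 k` -/

namespace WCVC

open RealRAM

variable {M : Limits} {I : Input} {H : Net} {m k : ℕ} {off : ℕ → ℕ} {xs par : ℕ → ℕ} {L : ℕ}

theorem Net.Ordered.le_n (S : H.Ordered xs par L) : L ≤ H.n := by
  have h := Finset.card_le_card_of_injOn (s := Finset.range L) (t := Finset.range H.n) xs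
    (fun p hp => by simpa using S.lt p (by simpa using hp))
    (fun p hp q hq h => S.inj p (by simpa using hp) q (by simpa using hq) h)
  simpa using h

theorem in_update_of_in {v w : ℕ} (h : In xs L w) : In (Function.update xs L v) (L + 1) w := by
  obtain ⟨p, hp, rfl⟩ := h
  exact ⟨p, by omega, by rw [Function.update_of_ne (by omega)]⟩

theorem in_update_iff {v w : ℕ} :
    In (Function.update xs L v) (L + 1) w ↔ In xs L w ∨ w = v := by
  constructor
  · rintro ⟨p, hp, rfl⟩
    by_cases h : p = L
    · subst h
      simp
    · rw [Function.update_of_ne h]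
      exact Or.inl ⟨p, by omega, rfl⟩
  · rintro (h | rfl)
    · exact in_update_of_in h
    · exact ⟨L, by omega, by simp⟩

theorem Net.Ordered.append (S : H.Ordered xs par L) {v p : ℕ} (hv : ¬ In xs L v) (hp : p < L)
    (h : xs p ∈ H.nbr v) :
    H.Ordered (Function.update xs L v) (Function.update par L p) (L + 1) := by
  have e : ∀ q < L, Function.update xs L v q = xs q := fun q hq =>
    Function.update_of_ne (by omega) _ _
  have e' : ∀ q < L, Function.update par L p q = par q := fun q hq =>
    Function.update_of_ne (by omega) _ _
  refine ⟨fun q hq => ?_, fun q hq r hr => ?_, fun q hq h1 => ?_, fun q hq h1 => ?_⟩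
  · rcases Nat.lt_succ_iff_lt_or_eq.1 hq with hq | rfl
    · rw [e q hq]
      exact S.lt q hq
    · rw [Function.update_self]
      exact H.lt (H.symm h)
  · rcases Nat.lt_succ_iff_lt_or_eq.1 hq with hq | rfl <;>
      rcases Nat.lt_succ_iff_lt_or_eq.1 hr with hr | rfl
    · rw [e q hq, e r hr]
      exact S.inj q hq r hr
    · rw [e q hq, Function.update_self]
      exact fun h => absurd ⟨q, hq, h⟩ hv
    · rw [e r hr, Function.update_self]
      exact fun h => absurd ⟨r, hr, h.symm⟩ hv
    · exact fun _ => rfl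
  · rcases Nat.lt_succ_iff_lt_or_eq.1 hq with hq | rfl
    · rw [e' q hq]
      exact S.par_lt q hq h1
    · rw [Function.update_self]
      exact hp
  · rcases Nat.lt_succ_iff_lt_or_eq.1 hq with hq | rfl
    · have := S.par_lt q hq h1
      rw [e' q hq, e q hq, e _ (by omega)]
      exact S.adj q hq h1
    · rw [Function.update_self, Function.update_self, e _ hp]
      exact h

variable (H) in
/-- A list as in `Net.Ordered` which arises by adding edges one by one, so that it is the vertex set
of a matching. -/
structure Net.Grown (xs par : ℕ → ℕ) (L : ℕ) : Prop extends H.Ordered xs par L where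
  two_le : 2 ≤ L
  even : L % 2 = 0
  edge : ∀ i, 2 * i < L → xs (2 * i) ∈ H.nbr (xs (2 * i + 1))

theorem Net.Grown.append (S : H.Grown xs par L) {v w p : ℕ} (hv : ¬ In xs L v) (hp : p < L)
    (h : xs p ∈ H.nbr v) (hw : ¬ In xs L w) (hvw : w ∈ H.nbr v) :
    H.Grown (Function.update (Function.update xs L v) (L + 1) w)
      (Function.update (Function.update par L p) (L + 1) L) (L + 2) := by
  have h2 := S.two_le
  have h3 := S.even
  refine ⟨(S.toOrdered.append hv hp h).append ?_ (Nat.lt_succ_self L) ?_, by omega, by omega, ?_⟩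
  · rw [in_update_iff]
    rintro (h' | rfl)
    · exact hw h'
    · exact H.irrefl _ hvw
  · rw [Function.update_self]
    exact H.symm hvw
  · intro i hi
    by_cases hL : 2 * i < L
    · rw [Function.update_of_ne (by omega), Function.update_of_ne (by omega),
        Function.update_of_ne (by omega), Function.update_of_ne (by omega)]
      exact S.edge i hL
    · obtain rfl : L = 2 * i := by omega
      rw [Function.update_self, Function.update_of_ne (by omega), Function.update_self]
      exact H.symm hvw

theorem Setup.exists_first (S : Setup M I H m k off) (hm : 1 ≤ m) :
    ∃ v < H.n, 0 < H.deg v ∧ off v = 0 := by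
  have hex : ∃ v, v < H.n ∧ 0 < H.deg v := by
    by_contra h
    push Not at h
    have := S.sum_deg
    rw [Finset.sum_eq_zero fun v hv => Nat.le_zero.1 (h v (Finset.mem_range.1 hv))] at this
    omega
  classical
  obtain ⟨h1, h2⟩ := Nat.find_spec hex
  refine ⟨Nat.find hex, h1, h2, ?_⟩
  have : ∀ j ≤ Nat.find hex, off j = 0 := by
    intro j
    induction j with
    | zero => exact fun _ => S.off_zero
    | succ j ih =>
      intro hj
      have := Nat.find_min hex (Nat.lt_of_succ_le hj)
      rw [S.off_succ j (by omega), ih (by omega)]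
      omega
  exact this _ le_rfl

/-- Add the vertex in register `6` and a neighbour to the list, if both are outside of the list, the
vertex has a neighbour in the list, and the list is not too long. Register `16` becomes `1` if there
is an edge outside of the list, and register `17` becomes `1` if the list changes. -/
def growBody : Prog :=
  find 6 ;; .assign 15 (.reg 11) ;; nbscan ;;
  .ite (.and (.not (.lt (.reg 15) (.reg 4))) (.lt (.const 0) (.reg 13)))
    (.assign 16 (.const 1) ;;
      .ite (.and (.lt (.reg 12) (.reg 4)) (.not (.lt (.reg 3 + .reg 3) (.reg 4))))
        (.store 1 (.reg 4) (.reg 6) ;; .store 2 (.reg 4) (.reg 12) ;;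
          .store 1 (.reg 4 + .const 1) (.reg 13 - .const 1) ;;
          .store 2 (.reg 4 + .const 1) (.reg 4) ;;
          .assign 4 (.reg 4 + .const 2) ;; .assign 17 (.const 1)) .skip) .skip

@[simp] theorem growBody_regs : growBody.regs =
    [11, 10, 11, 10, 15] ++ nbscan.regs ++ [16, 4, 17] := rfl
@[simp] theorem growBody_mems : growBody.mems = [1, 2, 1, 2] := rfl

/-- The registers and arrays that are never changed after the start. -/
structure Consts (H : Net) (k : ℕ) (σ : State) : Prop where
  reg_n : σ.reg 2 = H.n
  reg_k : σ.reg 3 = k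
  pw : ∀ j ≤ k + 1, σ.mem 3 j = 2 ^ j

theorem Consts.frame {p : Prog} {σ τ : State} (h : Consts H k σ) (hf : Frame p σ τ)
    (h2 : 2 ∉ p.regs) (h3 : 3 ∉ p.regs) (hm : 3 ∉ p.mems) : Consts H k τ :=
  ⟨by rw [hf.reg 2 h2, h.reg_n], by rw [hf.reg 3 h3, h.reg_k], by rw [hf.mem 3 hm]; exact h.pw⟩

/-- The invariant of a round of the growth of the list: `b` is the length at the start of the round,
and the vertices below `v` have been considered. -/
structure GrowInv (H : Net) (k b v : ℕ) (σ : State) : Prop where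
  grown : H.Grown (σ.mem 1) (σ.mem 2) (σ.reg 4)
  le : b ≤ σ.reg 4
  le' : σ.reg 4 ≤ 2 * k + 2
  changed : σ.reg 17 = 0 ∨ σ.reg 17 = 1 ∧ b + 2 ≤ σ.reg 4
  edge : σ.reg 16 = 0 ∨ σ.reg 16 = 1
  stable : σ.reg 17 = 0 → 2 * k < σ.reg 4 ∨
    ((σ.reg 16 = 1 → ∃ w, ¬ In (σ.mem 1) (σ.reg 4) w ∧
      ∃ u ∈ H.nbr w, ¬ In (σ.mem 1) (σ.reg 4) u) ∧
    ∀ w < v, ¬ In (σ.mem 1) (σ.reg 4) w → (∃ u ∈ H.nbr w, ¬ In (σ.mem 1) (σ.reg 4) u) →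
      σ.reg 16 = 1 ∧ ∀ u ∈ H.nbr w, ¬ In (σ.mem 1) (σ.reg 4) u)

theorem Setup.runs_growBody (S : Setup M I H m k off) {σ : State} {b v : ℕ}
    (hC : Consts H k σ) (h5 : σ.reg 5 = H.n) (hv : σ.reg 6 = v) (hvn : v < H.n)
    (hI : GrowInv H k b v σ) :
    Runs M I growBody σ fun τ t => t ≤ (H.deg v + 1) * (100 * k + 200) ∧ GrowInv H k b (v + 1) τ := by
  have hw := S.word_le
  have hcw := S.cells_le
  have hk := S.k_le
  have hk1 := S.k_pos
  have hLn := hI.grown.le_n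
  have hL' := hI.le'
  rw [growBody, runs_seq]
  refine runs_find (by decide) (by omega) hcw fun τ t hf hF ht => ?_
  have e4 : τ.reg 4 = σ.reg 4 := hf.reg 4 (by simp)
  have e1 : τ.mem 1 = σ.mem 1 := hf.mem 1 (by simp)
  rw [runs_seq, runs_assign, runs_seq]
  refine ⟨trivial, ?_⟩
  have e6 : τ.reg 6 = v := by rw [hf.reg 6 (by simp), hv]
  have e5 : τ.reg 5 = H.n := by rw [hf.reg 5 (by simp), h5]
  refine S.runs_nbscan (by simp [e6, hvn]) (by simp [e4]; omega) ?_ ?_ ?_ fun υ t' hf' hS ht' => ?_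
  · intro p hp
    simp [e4, e5] at hp ⊢
    omega
  · simp only [setReg_mem]
    rw [hf.mem 3 (by simp)]
    exact hC.pw
  · simp only [setReg_mem, setReg_reg, e1, e4]
    simpa using hI.grown.inj
  simp only [setReg_mem, setReg_reg, e1, e4, e5, e6, show (4 : ℕ) ≠ 15 by decide, if_false,
    show (5 : ℕ) ≠ 15 by decide, show (6 : ℕ) ≠ 15 by decide] at hS ht'
  have g4 : υ.reg 4 = σ.reg 4 := by rw [hf'.reg 4 (by simp)]; simp [e4]
  have g3 : υ.reg 3 = k := by rw [hf'.reg 3 (by simp)]; simp [hf.reg 3, hC.reg_k]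
  have g6 : υ.reg 6 = v := by rw [hf'.reg 6 (by simp)]; simp [e6]
  have g15 : υ.reg 15 = τ.reg 11 := by rw [hf'.reg 15 (by simp)]; simp
  have g16 : υ.reg 16 = σ.reg 16 := by rw [hf'.reg 16 (by simp)]; simp [hf.reg 16]
  have g17 : υ.reg 17 = σ.reg 17 := by rw [hf'.reg 17 (by simp)]; simp [hf.reg 17]
  have g1 : υ.mem 1 = σ.mem 1 := by rw [hf'.mem 1 (by simp)]; simp [e1]
  have g2 : υ.mem 2 = σ.mem 2 := by rw [hf'.mem 2 (by simp)]; simp [hf.mem 2]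
  rw [hv] at hF
  have htime : t + t' + 60 ≤ (H.deg v + 1) * (100 * k + 200) := by
    have h1 : H.deg v * (22 * σ.reg 4 + 50) ≤ H.deg v * (100 * k + 200) :=
      Nat.mul_le_mul_left _ (by omega)
    rw [Nat.add_mul, Nat.one_mul]
    omega
  have hnew : ¬ τ.reg 11 < σ.reg 4 → ¬ In (σ.mem 1) (σ.reg 4) v := by
    intro h
    rcases hF with hF | hF
    · exact absurd hF.1 h
    · exact hF.2
  simp only [runs_ite, runs_seq, runs_assign, runs_store, runs_skip, csafe_and, csafe_not, csafe_lt,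
    safe_reg, safe_const, safe_add, safe_sub, holds_and, holds_not, holds_lt, val_reg, val_const,
    val_add, val_sub, setReg_reg, setMem_reg, g4, g3, g6, g15, true_and,
    and_true, cost_reg, cost_const, cost_add, cost_sub, ccost_and, ccost_not, ccost_lt]
  norm_num
  refine ⟨by omega, fun h1 h2 => ⟨by omega, by omega, fun h3 h4 => ?_, fun h3 => ?_⟩, fun h1 => ?_⟩
  · obtain ⟨u, hu, hu', huI⟩ : ∃ u ∈ H.nbr v, υ.reg 13 = u + 1 ∧ ¬ In (σ.mem 1) (σ.reg 4) u := by
      rcases hS.out with h | h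
      · omega
      · exact h
    have hun := H.lt hu
    refine ⟨by omega, by omega, by omega, by omega, by omega, by omega, by omega, ?_⟩
    have hhit : σ.mem 1 (υ.reg 12) ∈ H.nbr v := by
      rcases hS.hit with h | h
      · omega
      · exact h.2
    have := hI.grown.append (hnew (by omega)) h3 hhit huI hu
    refine ⟨by omega, by omega, ⟨?_, ?_, ?_, ?_, ?_, ?_⟩⟩
    · simpa [g1, g2, hu'] using this
    · have := hI.le
      simp
      omega
    · simp
      omega
    · have := hI.le
      simp
      omega
    · simp
    · simp
  · refine ⟨by omega, ⟨?_, ?_, ?_, ?_, ?_, ?_⟩⟩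
    · simpa [g1, g2, g4] using hI.grown
    · simpa [g4] using hI.le
    · simpa [g4] using hI.le'
    · simpa [g4, g17] using hI.changed
    · simp
    · simp only [setReg_reg, setReg_mem, g1, g4, g17]
      norm_num
      intro h0
      by_cases hk2 : 2 * k < σ.reg 4
      · exact Or.inl hk2
      obtain ⟨u, hu, hu', huI⟩ : ∃ u ∈ H.nbr v, υ.reg 13 = u + 1 ∧ ¬ In (σ.mem 1) (σ.reg 4) u := by
        rcases hS.out with h | h
        · omega
        · exact h
      refine Or.inr ⟨⟨v, hnew (by omega), u, hu, huI⟩, fun w hw hwI u' hu' hu'I => ?_⟩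
      rcases Nat.lt_or_eq_of_le hw with hw | rfl
      · exact ((hI.stable h0).resolve_left hk2).2 w hw hwI ⟨u', hu', hu'I⟩ |>.2
      · rcases hS.hit with h | h
        · exact h.2
        · exact absurd (h3 h.1) (by omega)
  · refine ⟨by omega, ⟨?_, ?_, ?_, ?_, ?_, ?_⟩⟩
    · simpa [g1, g2, g4] using hI.grown
    · simpa [g4] using hI.le
    · simpa [g4] using hI.le'
    · simpa [g4, g17] using hI.changed
    · simpa [g16] using hI.edge
    · simp only [g1, g4, g16, g17]
      intro h0
      by_cases hk2 : 2 * k < σ.reg 4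
      · exact Or.inl hk2
      obtain ⟨s1, s2⟩ := (hI.stable h0).resolve_left hk2
      refine Or.inr ⟨s1, fun w hw hwI hwu => ?_⟩
      rcases Nat.lt_succ_iff_lt_or_eq.1 hw with hw | rfl
      · exact s2 w hw hwI hwu
      · exfalso
        rcases hF with hF | hF
        · exact hwI ⟨_, hF⟩
        · rcases hS.out with h | h
          · obtain ⟨u, hu, huI⟩ := hwu
            exact huI (h.2 u hu)
          · obtain ⟨u, hu, hu', huI⟩ := h
            have := h1 (by omega)
            omega

/-- Compute a connected vertex cover that is the vertex set of a matching. Register `0` becomes `1`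
if it exists and has at most `2 k` vertices. -/
def growth : Prog :=
  .assign 5 (.reg 2) ;; .assign 17 (.const 1) ;; .assign 16 (.const 0) ;;
  .store 1 (.const 0) (.input 2 (.const 0)) ;;
  .store 1 (.const 1) (.input 2 (.input 1 (.load 1 (.const 0)))) ;;
  .store 2 (.const 1) (.const 0) ;; .assign 4 (.const 2) ;;
  .loop (.lt (.const 0) (.reg 17))
    (.assign 17 (.const 0) ;; .assign 16 (.const 0) ;; .for 6 (.const 0) 2 growBody) ;;
  .ite (.and (.not (.lt (.reg 3 + .reg 3) (.reg 4))) (.lt (.reg 16) (.const 1)))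
    (.assign 0 (.const 1)) (.assign 0 (.const 0))

@[simp] theorem growth_regs : growth.regs =
    [5, 17, 16, 4, 17, 16, 6, 11, 10, 11, 10, 15] ++ nbscan.regs ++ [16, 4, 17, 6, 0, 0] := rfl
@[simp] theorem growth_mems : growth.mems = [1, 1, 2, 1, 2, 1, 2] := rfl

/-- If the list is too long, it is a matching with more than `k` edges; if an edge is left over, the
graph has two components with edges. Every round but the last one lengthens the list. -/
theorem Setup.runs_growth (S : Setup M I H m k off) (hm : 1 ≤ m) {σ : State} (hC : Consts H k σ) :
    Runs M I growth σ fun τ t => t ≤ (2 * k + 4) * ((H.n + 2 * m) * (100 * k + 220)) + 50 ∧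
      ((τ.reg 0 = 0 ∧ ∀ Y, H.CVC Y → k < Y.card) ∨
       (τ.reg 0 = 1 ∧ τ.reg 4 ≤ 2 * k + 2 ∧ 2 ≤ τ.reg 4 ∧
         H.Ordered (τ.mem 1) (τ.mem 2) (τ.reg 4) ∧
         ∀ u v, u ∈ H.nbr v → In (τ.mem 1) (τ.reg 4) u ∨ In (τ.mem 1) (τ.reg 4) v)) := by
  have hw := S.word_le
  have hcw := S.cells_le
  have hk := S.k_le
  have hk1 := S.k_pos
  have hn1 := S.n_pos
  obtain ⟨v₀, hv₀, hdeg, hoff⟩ := S.exists_first hm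
  have f1 := S.flat_has v₀ hv₀ 0 hdeg
  have f2 := S.flat_eq v₀ hv₀ 0 hdeg
  rw [hoff, Nat.zero_add] at f1 f2
  set y := H.nth v₀ 0 with hy
  have hyv : y ∈ H.nbr v₀ := Net.nth_mem hdeg
  have hyn := H.lt hyv
  have hdegy : 0 < H.deg y := List.length_pos_of_mem (H.symm hyv)
  have g1 := S.flat_has y hyn 0 hdegy
  have g2 := S.flat_eq y hyn 0 hdegy
  rw [Nat.add_zero] at g1 g2
  set x := H.nth y 0 with hx
  have hxy : x ∈ H.nbr y := Net.nth_mem hdegy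
  have hxn := H.lt hxy
  have hoy := S.off_le (v := y) hyn.le
  have hxy' : y ≠ x := fun h => H.irrefl y (by rwa [← h] at hxy)
  rw [growth, runs_seq]
  simp only [runs_seq (p := Prog.assign _ _), runs_seq (p := Prog.store _ _ _), runs_assign,
    runs_store, safe_reg, safe_const, safe_input, safe_load, val_reg, val_const, val_input, val_load,
    setMem_mem, if_true, Function.update_self, f2, true_and,
    S.off_eq y hyn.le, g2, cost_reg, cost_const, cost_input, cost_load]
  refine ⟨by omega, by omega, by omega, by omega, ⟨by omega, f1, by omega⟩, by omega, by omega,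
    ⟨⟨⟨by omega, by omega⟩, S.off_has y hyn.le, by omega⟩, g1, by omega⟩, by omega, by omega,
    by omega, by omega, ?_⟩
  rw [runs_seq]
  norm_num
  refine Runs.loop (fun τ => ∃ b, GrowInv H k b H.n τ ∧ Consts H k τ ∧ τ.reg 5 = H.n)
    (fun τ => 2 * k + 4 - τ.reg 4 + τ.reg 17) ((H.n + 2 * m) * (100 * k + 208) + 20) ?_ ?_ ?_ ?_
  · refine ⟨0, ⟨⟨⟨?_, ?_, ?_, ?_⟩, ?_, ?_, ?_⟩, ?_, ?_, ?_, ?_, ?_⟩, ⟨?_, ?_, ?_⟩, ?_⟩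
    · intro p hp
      simp at hp ⊢
      interval_cases p <;> simp <;> omega
    · intro p hp q hq
      simp at hp hq ⊢
      interval_cases p <;> interval_cases q <;> simp [hxy', hxy'.symm]
    · intro p hp hp1
      simp at hp ⊢
      interval_cases p
      simp
    · intro p hp hp1
      simp at hp ⊢
      interval_cases p
      simpa using H.symm hxy
    · simp
    · simp
    · intro i hi
      simp at hi
      obtain rfl : i = 0 := by omega
      simpa using H.symm hxy
    · simp
    · simp
    · simp
    · simp
    · simp
    · simpa using hC.reg_n
    · simpa using hC.reg_k
    · simpa using hC.pw
    · simpa using hC.reg_n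
  · intro τ hf h
    simp
    omega
  · rintro τ hf ⟨b, hI, hC', h5⟩ hlt
    simp only [runs_seq, runs_assign, safe_const, val_const, cost_const]
    refine ⟨by omega, by omega, ?_⟩
    refine S.runs_vertices (fun v υ => GrowInv H k (τ.reg 4) v υ ∧ Consts H k υ ∧ υ.reg 5 = H.n)
      (100 * k + 200) (by simpa using hC'.reg_n) (by simp) (by simp) ?_ ?_ ?_
    · refine ⟨⟨?_, ?_, ?_, ?_, ?_, ?_⟩, ⟨?_, ?_, ?_⟩, ?_⟩
      · simpa using hI.grown
      · simp
      · simpa using hI.le'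
      · simp
      · simp
      · simp
      · simpa using hC'.reg_n
      · simpa using hC'.reg_k
      · simpa using hC'.pw
      · simpa using h5
    · rintro v υ hv - h6 ⟨hG, hC'', h5'⟩
      refine (S.runs_growBody hC'' h5' h6 hv hG).mono fun ρ t hfρ ⟨ht, hG'⟩ => ⟨ht, ⟨?_, ?_, ?_, ?_, ?_, ?_⟩,
        ⟨?_, ?_, ?_⟩, ?_⟩
      · simpa using hG'.grown
      · simpa using hG'.le
      · simpa using hG'.le'
      · simpa using hG'.changed
      · simpa using hG'.edge
      · simpa using hG'.stable
      · simpa [hfρ.reg 2] using hC''.reg_n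
      · simpa [hfρ.reg 3] using hC''.reg_k
      · simpa [hfρ.mem 3] using hC''.pw
      · simpa [hfρ.reg 5] using h5'
    · rintro υ t hfυ ⟨hG, hC'', h5'⟩ ht
      refine ⟨?_, ⟨_, hG, hC'', h5'⟩, ?_⟩
      · have : (H.n + 2 * m) * (100 * k + 200 + 8) = (H.n + 2 * m) * (100 * k + 208) := rfl
        omega
      · have h1 := hG.le
        have h2 := hG.changed
        have h3 := hG.le'
        simp at hlt
        omega
  · rintro τ t hf ⟨b, hI, hC', h5⟩ hlt ht
    simp at hlt
    have hL' := hI.le'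
    have hle2 := hI.grown.two_le
    have hstab := hI.stable hlt
    have hcard : 2 * k < τ.reg 4 → ∀ Y, H.CVC Y → k < Y.card := by
      intro h Y hY
      have h1 := hI.grown.even
      have := hI.grown.toOrdered.le_card (g := τ.reg 4 / 2) (by omega)
        (fun i hi => hI.grown.edge i (by omega)) hY
      omega
    have htime : t + 40 ≤ (2 * k + 4) * ((H.n + 2 * m) * (100 * k + 220)) + 50 := by
      simp at ht
      have h1 : (H.n + 2 * m) * (100 * k + 208) + 20 + 4 ≤ (H.n + 2 * m) * (100 * k + 220) + 12 := by
        nlinarith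
      have h3 : (2 * k + 3) * ((H.n + 2 * m) * (100 * k + 208) + 20 + 3 + 1) ≤
          (2 * k + 3) * ((H.n + 2 * m) * (100 * k + 220) + 12) := Nat.mul_le_mul_left _ (by omega)
      nlinarith
    simp only [hC'.reg_k]
    refine ⟨by omega, fun h1 h2 => ⟨by omega, by omega, by omega, hle2, hI.grown.toOrdered, ?_⟩,
      fun h1 => ⟨by omega, by omega, ?_⟩⟩
    · intro u v huv
      by_contra hno
      push Not at hno
      have := (hstab.resolve_left (by omega)).2 v (H.lt (H.symm huv)) hno.2 ⟨u, huv, hno.1⟩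
      omega
    · intro Y hY
      by_cases h : 2 * k < τ.reg 4
      · exact hcard h Y hY
      · exfalso
        obtain ⟨s1, s2⟩ := hstab.resolve_left h
        have h16 : τ.reg 16 = 1 := by
          have := h1 (by omega)
          have := hI.edge
          omega
        obtain ⟨w, hw, u, hu, huI⟩ := s1 h16
        refine hI.grown.toOrdered.not_cvc hle2 ?_ hu hw huI Y hY
        intro v u' w' hv hu' hu'I hw'
        by_contra hw'I
        exact (s2 v (H.lt (H.symm hu')) hv ⟨w', hw', hw'I⟩).2 u' hu' hu'I

end WCVC

/-! ### Merging vertices with the same neighbours in the list -/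

namespace WCVC

open RealRAM

variable {H : Net} {xs par : ℕ → ℕ} {L sh : ℕ}

/-- `(i, j)` is among the first `e` pairs of the list of incidences. -/
def Inc (incI incJ : ℕ → ℕ) (e i j : ℕ) : Prop := ∃ x < e, incI x = i ∧ incJ x = j

theorem inc_update_iff {incI incJ : ℕ → ℕ} {e a b i j : ℕ} :
    Inc (Function.update incI e a) (Function.update incJ e b) (e + 1) i j ↔
      Inc incI incJ e i j ∨ (i = a ∧ j = b) := by
  constructor
  · rintro ⟨x, hx, h1, h2⟩
    by_cases h : x = e
    · subst h
      rw [Function.update_self] at h1 h2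
      exact Or.inr ⟨h1.symm, h2.symm⟩
    · rw [Function.update_of_ne h] at h1 h2
      exact Or.inl ⟨x, by omega, h1, h2⟩
  · rintro (⟨x, hx, h1, h2⟩ | ⟨rfl, rfl⟩)
    · exact ⟨x, by omega, by rwa [Function.update_of_ne (by omega)],
        by rwa [Function.update_of_ne (by omega)]⟩
    · exact ⟨e, by omega, by simp, by simp⟩

open Classical in
/-- A vertex has at most `L` neighbours in a list of length `L`. -/
theorem Net.card_in_le {v d : ℕ} (hd : d ≤ H.deg v) :
    ((Finset.range d).filter fun e => In xs L (H.nth v e)).card ≤ L := by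
  have h1 : ((Finset.range d).filter fun e => In xs L (H.nth v e)).card ≤
      ((Finset.range L).image xs).card := by
    refine Finset.card_le_card_of_injOn (H.nth v) ?_ ?_
    · intro e he
      simp only [Finset.coe_filter, Finset.mem_range, Set.mem_ofPred_eq] at he
      obtain ⟨p, hp, h⟩ := he.2
      simpa using ⟨p, hp, h⟩
    · intro e he e' he' h
      simp only [Finset.coe_filter, Finset.mem_range, Set.mem_ofPred_eq] at he he'
      have h1 : e < (H.nbr v).length := he.1.trans_le hd
      have h2 : e' < (H.nbr v).length := he'.1.trans_le hd
      rw [Net.nth, Net.nth, List.getD_eq_getElem _ _ h1, List.getD_eq_getElem _ _ h2] at h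
      exact (H.nodup v).getElem_inj_iff.1 h
  exact h1.trans (Finset.card_image_le.trans (by simp))

variable (H xs L sh) in
open Classical in
/-- The invariant of the computation of the items: `lst` lists the `N` items found so far; `cn`,
`rp`, `mw`, `sw` are as in `Net.Counts`; the vertices of the list and the vertices below `v` have been
considered. -/
structure Net.BuildInv (v N : ℕ) (lst cn rp : ℕ → ℕ) (mw sw : ℕ → ℝ) : Prop where
  le_N : L - sh ≤ N
  lst_lt : ∀ t < L - sh, lst t = t
  lst_ge : ∀ t < N, L - sh ≤ t → ∃ w < v, ¬ In xs L w ∧ H.item xs L sh w = lst t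
  lst_inj : ∀ t < N, ∀ t' < N, lst t = lst t' → t = t'
  lst_surj : ∀ w < v, ¬ In xs L w → ∃ t < N, lst t = H.item xs L sh w
  cnt_lt : ∀ i < L - sh, cn i = 1
  cnt_ge : ∀ i < L - sh + 2 ^ (L - sh), L - sh ≤ i →
    cn i = ((Finset.range v).filter fun w => H.item xs L sh w = i).card
  rep_lt : ∀ i < L - sh, rp i = xs (sh + i)
  rep_ge : ∀ w < v, ¬ In xs L w → rp (H.item xs L sh w) < H.n ∧
    H.item xs L sh (rp (H.item xs L sh w)) = H.item xs L sh w ∧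
    mw (H.item xs L sh w) = H.ω (rp (H.item xs L sh w)) ∧ mw (H.item xs L sh w) ≤ H.ω w
  weight_lt : ∀ i < L - sh, mw i = H.ω (xs (sh + i)) ∧ sw i = H.ω (xs (sh + i))
  sumw_ge : ∀ w < v, ¬ In xs L w → sw (H.item xs L sh w) =
    ∑ u ∈ (Finset.range v).filter (fun u => H.item xs L sh u = H.item xs L sh w), H.ω u
  N_le : N ≤ L - sh + ((Finset.range v).filter fun w => ¬ In xs L w).card

theorem Net.item_not_in_lt {v : ℕ} (h : ¬ In xs L v) :
    L - sh ≤ H.item xs L sh v ∧ H.item xs L sh v < L - sh + 2 ^ (L - sh) := by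
  rw [Net.item_of_not_in h]
  have := H.nmask_lt (xs := xs) (L := L) (sh := sh) v
  omega

variable {v N : ℕ} {lst cn rp : ℕ → ℕ} {mw sw : ℕ → ℝ}

theorem Net.BuildInv.skip (hI : H.BuildInv xs L sh v N lst cn rp mw sw)
    (S : H.Layout xs par L sh) (hv : In xs L v) :
    H.BuildInv xs L sh (v + 1) N lst cn rp mw sw := by
  classical
  have hlt : ∀ {w}, w < v + 1 → ¬ In xs L w → w < v := by
    intro w hw hin
    rcases Nat.lt_succ_iff_lt_or_eq.1 hw with h | rfl
    · exact h
    · exact absurd hv hin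
  have hne : ∀ i, L - sh ≤ i → ¬ H.item xs L sh v = i := by
    rintro _ h rfl
    have := S.item_lt_iff.2 hv
    omega
  refine ⟨hI.le_N, hI.lst_lt, fun t ht hs => ?_, hI.lst_inj,
    fun w hw hin => hI.lst_surj w (hlt hw hin) hin, hI.cnt_lt, fun i hi hs => ?_, hI.rep_lt,
    fun w hw hin => hI.rep_ge w (hlt hw hin) hin, hI.weight_lt, fun w hw hin => ?_, ?_⟩
  · obtain ⟨w, hw, h⟩ := hI.lst_ge t ht hs
    exact ⟨w, by omega, h⟩
  · rw [Finset.range_add_one, Finset.filter_insert, if_neg (hne i hs)]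
    exact hI.cnt_ge i hi hs
  · rw [Finset.range_add_one, Finset.filter_insert, if_neg (hne _ (Net.item_not_in_lt hin).1)]
    exact hI.sumw_ge w (hlt hw hin) hin
  · rw [Finset.range_add_one, Finset.filter_insert, if_neg (by simpa using hv)]
    exact hI.N_le

theorem Net.BuildInv.cnt_eq_zero_iff (hI : H.BuildInv xs L sh v N lst cn rp mw sw)
    (S : H.Layout xs par L sh) (hv : ¬ In xs L v) :
    cn (H.item xs L sh v) = 0 ↔ ∀ w < v, ¬ In xs L w → H.item xs L sh w ≠ H.item xs L sh v := by
  classical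
  rw [hI.cnt_ge _ (Net.item_not_in_lt hv).2 (Net.item_not_in_lt hv).1, Finset.card_eq_zero,
    Finset.filter_eq_empty_iff]
  constructor
  · exact fun h w hw _ => h (Finset.mem_range.2 hw)
  · intro h w hw he
    refine h w (Finset.mem_range.1 hw) (fun hin => hv ?_) he
    rwa [← S.item_lt_iff, ← he, S.item_lt_iff]

theorem Net.BuildInv.new (hI : H.BuildInv xs L sh v N lst cn rp mw sw)
    (S : H.Layout xs par L sh) (hv : ¬ In xs L v) (hvn : v < H.n)
    (h0 : cn (H.item xs L sh v) = 0) :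
    H.BuildInv xs L sh (v + 1) (N + 1) (Function.update lst N (H.item xs L sh v))
      (Function.update cn (H.item xs L sh v) 1) (Function.update rp (H.item xs L sh v) v)
      (Function.update mw (H.item xs L sh v) (H.ω v))
      (Function.update sw (H.item xs L sh v) (H.ω v)) := by
  classical
  have hnew := (hI.cnt_eq_zero_iff S hv).1 h0
  have hit := Net.item_not_in_lt (sh := sh) (H := H) hv
  have hle := hI.le_N
  set i := H.item xs L sh v with hi
  have hlsti : ∀ t < N, lst t ≠ i := by
    intro t ht h
    by_cases hs : t < L - sh
    · rw [hI.lst_lt t hs] at h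
      omega
    · obtain ⟨w, hw, hin, he⟩ := hI.lst_ge t ht (by omega)
      exact hnew w hw hin (he.trans h)
  refine ⟨by omega, ?_, ?_, ?_, ?_, ?_, ?_, ?_, ?_, ?_, ?_, ?_⟩
  · intro t ht
    rw [Function.update_of_ne (by omega)]
    exact hI.lst_lt t ht
  · intro t ht hs
    by_cases h : t = N
    · subst h
      exact ⟨v, by omega, hv, by rw [Function.update_self]⟩
    · rw [Function.update_of_ne h]
      obtain ⟨w, hw, h'⟩ := hI.lst_ge t (by omega) hs
      exact ⟨w, by omega, h'⟩
  · intro t ht t' ht'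
    by_cases h : t = N <;> by_cases h' : t' = N
    · exact fun _ => h.trans h'.symm
    · rw [h, Function.update_self, Function.update_of_ne h']
      exact fun e => absurd e.symm (hlsti t' (by omega))
    · rw [h', Function.update_self, Function.update_of_ne h]
      exact fun e => absurd e (hlsti t (by omega))
    · rw [Function.update_of_ne h, Function.update_of_ne h']
      exact hI.lst_inj t (by omega) t' (by omega)
  · intro w hw hin
    rcases Nat.lt_succ_iff_lt_or_eq.1 hw with h | rfl
    · obtain ⟨t, ht, h'⟩ := hI.lst_surj w h hin
      exact ⟨t, by omega, by rw [Function.update_of_ne (by omega), h']⟩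
    · exact ⟨N, by omega, by rw [Function.update_self]⟩
  · intro j hj
    rw [Function.update_of_ne (by omega)]
    exact hI.cnt_lt j hj
  · intro j hj hs
    rw [Finset.range_add_one, Finset.filter_insert, ← hi]
    by_cases h : j = i
    · subst h
      rw [Function.update_self, if_pos rfl, Finset.card_insert_of_notMem (by simp),
        ← hI.cnt_ge i hj hs, h0]
    · rw [Function.update_of_ne h, if_neg (Ne.symm h)]
      exact hI.cnt_ge j hj hs
  · intro j hj
    rw [Function.update_of_ne (by omega)]
    exact hI.rep_lt j hj
  · intro w hw hin
    rcases Nat.lt_succ_iff_lt_or_eq.1 hw with h | rfl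
    · rw [Function.update_of_ne (hnew w h hin), Function.update_of_ne (hnew w h hin)]
      exact hI.rep_ge w h hin
    · rw [← hi, Function.update_self, Function.update_self]
      exact ⟨hvn, rfl, rfl, le_rfl⟩
  · intro j hj
    rw [Function.update_of_ne (by omega), Function.update_of_ne (by omega)]
    exact hI.weight_lt j hj
  · intro w hw hin
    rw [Finset.range_add_one, Finset.filter_insert, ← hi]
    rcases Nat.lt_succ_iff_lt_or_eq.1 hw with h | rfl
    · rw [Function.update_of_ne (hnew w h hin), if_neg (hnew w h hin).symm]
      exact hI.sumw_ge w h hin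
    · rw [← hi, Function.update_self, if_pos rfl, Finset.sum_insert (by simp)]
      rw [Finset.filter_eq_empty_iff.2, Finset.sum_empty, add_zero]
      intro u hu he
      have hu := Finset.mem_range.1 hu
      refine hnew u hu (fun hin' => hin ?_) he
      rwa [← S.item_lt_iff, ← hi, ← he, S.item_lt_iff]
  · rw [Finset.range_add_one, Finset.filter_insert, if_pos hv,
      Finset.card_insert_of_notMem (by simp)]
    have := hI.N_le
    omega

theorem Net.BuildInv.old (hI : H.BuildInv xs L sh v N lst cn rp mw sw)
    (S : H.Layout xs par L sh) (hv : ¬ In xs L v) (hvn : v < H.n)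
    (h0 : cn (H.item xs L sh v) ≠ 0) {rp' : ℕ → ℕ} {mw' : ℕ → ℝ}
    (hr : (H.ω v < mw (H.item xs L sh v) ∧ rp' = Function.update rp (H.item xs L sh v) v ∧
        mw' = Function.update mw (H.item xs L sh v) (H.ω v)) ∨
      (¬ H.ω v < mw (H.item xs L sh v) ∧ rp' = rp ∧ mw' = mw)) :
    H.BuildInv xs L sh (v + 1) N lst
      (Function.update cn (H.item xs L sh v) (cn (H.item xs L sh v) + 1)) rp' mw'
      (Function.update sw (H.item xs L sh v) (sw (H.item xs L sh v) + H.ω v)) := by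
  classical
  have hit := Net.item_not_in_lt (sh := sh) (H := H) hv
  have hle := hI.le_N
  obtain ⟨w₀, hw₀, hin₀, he₀⟩ : ∃ w < v, ¬ In xs L w ∧ H.item xs L sh w = H.item xs L sh v := by
    by_contra h
    push Not at h
    exact h0 ((hI.cnt_eq_zero_iff S hv).2 h)
  set i := H.item xs L sh v with hi
  refine ⟨hle, hI.lst_lt, ?_, hI.lst_inj, ?_, ?_, ?_, ?_, ?_, ?_, ?_, ?_⟩
  · intro t ht hs
    obtain ⟨w, hw, h⟩ := hI.lst_ge t ht hs
    exact ⟨w, by omega, h⟩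
  · intro w hw hin
    rcases Nat.lt_succ_iff_lt_or_eq.1 hw with h | rfl
    · exact hI.lst_surj w h hin
    · rw [← hi, ← he₀]
      exact hI.lst_surj _ hw₀ hin₀
  · intro j hj
    rw [Function.update_of_ne (by omega)]
    exact hI.cnt_lt j hj
  · intro j hj hs
    rw [Finset.range_add_one, Finset.filter_insert, ← hi]
    by_cases h : j = i
    · subst h
      rw [Function.update_self, if_pos rfl, Finset.card_insert_of_notMem (by simp),
        ← hI.cnt_ge i hj hs]
    · rw [Function.update_of_ne h, if_neg (Ne.symm h)]
      exact hI.cnt_ge j hj hs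
  · intro j hj
    rcases hr with ⟨-, rfl, -⟩ | ⟨-, rfl, -⟩
    · rw [Function.update_of_ne (by omega)]
      exact hI.rep_lt j hj
    · exact hI.rep_lt j hj
  · have hw : ∀ w < v + 1, ¬ In xs L w → ∃ w' < v, ¬ In xs L w' ∧
        H.item xs L sh w' = H.item xs L sh w ∧ (w' = w ∨ w = v) := by
      intro w hw hin
      rcases Nat.lt_succ_iff_lt_or_eq.1 hw with h | rfl
      · exact ⟨w, h, hin, rfl, Or.inl rfl⟩
      · exact ⟨w₀, hw₀, hin₀, he₀, Or.inr rfl⟩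
    intro w hwv hin
    obtain ⟨w', hw', hin', he, hor⟩ := hw w hwv hin
    have h1 := hI.rep_ge w' hw' hin'
    rw [he] at h1
    rcases hr with ⟨hlt, rfl, rfl⟩ | ⟨hge, rfl, rfl⟩
    · by_cases h : H.item xs L sh w = i
      · rw [h] at h1 ⊢
        rw [Function.update_self, Function.update_self]
        refine ⟨hvn, rfl, rfl, ?_⟩
        rcases hor with rfl | rfl
        · linarith [h1.2.2.2]
        · exact le_rfl
      · rw [Function.update_of_ne h, Function.update_of_ne h]
        refine ⟨h1.1, h1.2.1, h1.2.2.1, ?_⟩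
        rcases hor with rfl | rfl
        · exact h1.2.2.2
        · exact absurd rfl h
    · refine ⟨h1.1, h1.2.1, h1.2.2.1, ?_⟩
      rcases hor with rfl | rfl
      · exact h1.2.2.2
      · exact not_lt.1 hge
  · intro j hj
    rw [Function.update_of_ne (by omega)]
    refine ⟨?_, (hI.weight_lt j hj).2⟩
    rcases hr with ⟨-, -, rfl⟩ | ⟨-, -, rfl⟩
    · rw [Function.update_of_ne (by omega)]
      exact (hI.weight_lt j hj).1
    · exact (hI.weight_lt j hj).1
  · have hsw := hI.sumw_ge w₀ hw₀ hin₀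
    rw [he₀] at hsw
    intro w hwv hin
    rw [Finset.range_add_one, Finset.filter_insert, ← hi]
    by_cases h : H.item xs L sh w = i
    · rw [h, Function.update_self, if_pos rfl, Finset.sum_insert (by simp), hsw, add_comm]
    · rw [Function.update_of_ne h, if_neg (Ne.symm h)]
      rcases Nat.lt_succ_iff_lt_or_eq.1 hwv with h' | rfl
      · exact hI.sumw_ge w h' hin
      · exact absurd rfl h
  · rw [Finset.range_add_one, Finset.filter_insert, if_pos hv,
      Finset.card_insert_of_notMem (by simp)]
    have := hI.N_le
    omega

theorem Net.BuildInv.N_le_pow (hI : H.BuildInv xs L sh v N lst cn rp mw sw) :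
    N ≤ L - sh + 2 ^ (L - sh) := by
  have h := Finset.card_le_card_of_injOn (s := Finset.range N)
    (t := Finset.range (L - sh + 2 ^ (L - sh))) lst (fun t ht => ?_) (fun t ht t' ht' h =>
      hI.lst_inj t (by simpa using ht) t' (by simpa using ht') h)
  · simpa using h
  · have ht : t < N := by simpa using ht
    rw [Finset.coe_range, Set.mem_Iio]
    by_cases hs : t < L - sh
    · rw [hI.lst_lt t hs]
      exact lt_of_lt_of_le hs (Nat.le_add_right _ _)
    · obtain ⟨w, hw, hin, h⟩ := hI.lst_ge t ht (by omega)
      rw [← h]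
      exact (Net.item_not_in_lt hin).2

open Classical in
theorem Net.Ordered.card_in (S : H.Ordered xs par L) :
    ((Finset.range H.n).filter fun w => In xs L w).card = L ∧
    ∀ f : ℕ → ℕ, ∑ w ∈ (Finset.range H.n).filter (fun w => In xs L w), f w =
      ∑ p ∈ Finset.range L, f (xs p) := by
  have e : (Finset.range H.n).filter (fun w => In xs L w) = (Finset.range L).image xs := by
    ext w
    simp only [Finset.mem_filter, Finset.mem_range, Finset.mem_image]
    constructor
    · rintro ⟨-, h⟩
      exact h
    · rintro ⟨p, hp, rfl⟩
      exact ⟨S.lt p hp, p, hp, rfl⟩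
  have hinj : Set.InjOn xs (Finset.range L) := fun p hp q hq h =>
    S.inj p (by simpa using hp) q (by simpa using hq) h
  rw [e, Finset.card_image_of_injOn hinj, Finset.card_range]
  exact ⟨rfl, fun f => Finset.sum_image hinj⟩

theorem Net.BuildInv.N_le_n (hI : H.BuildInv xs L sh H.n N lst cn rp mw sw)
    (S : H.Layout xs par L sh) : N ≤ H.n := by
  classical
  have h1 := hI.N_le
  have h2 := S.card_in.1
  have h3 := Finset.card_filter_add_card_filter_not (s := Finset.range H.n) (fun w => In xs L w)
  rw [Finset.card_range] at h3
  omega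

/-- Once all vertices have been considered, the data of all items are correct. -/
theorem Net.BuildInv.counts (hI : H.BuildInv xs L sh H.n N lst cn rp mw sw)
    (S : H.Layout xs par L sh) : H.Counts xs L sh cn rp mw sw := by
  classical
  have hsh := S.sh_lt
  have hin : ∀ {w}, In xs L w → ∀ {i}, H.item xs L sh w = i → i < L - sh := by
    rintro w hw i rfl
    exact S.item_lt_iff.2 hw
  have single : ∀ i < L - sh, (i ≠ 0 ∨ sh = 0) →
      ((Finset.range H.n).filter fun w => H.item xs L sh w = i) = {xs (sh + i)} := by
    intro i hi h0
    have hx : H.item xs L sh (xs (sh + i)) = i := by rw [S.item_xs (by omega)]; omega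
    ext w
    rw [Finset.mem_filter, Finset.mem_singleton, Finset.mem_range]
    constructor
    · rintro ⟨-, h⟩
      refine S.eq_of_item_eq ?_ (h.trans hx.symm) ?_
      · rw [← S.item_lt_iff, h]
        exact hi
      · rw [h]
        exact h0.symm
    · rintro rfl
      exact ⟨S.lt _ (by omega), hx⟩
  have hge : ∀ i ∈ H.items xs L sh, L - sh ≤ i → ∃ w < H.n, ¬ In xs L w ∧ H.item xs L sh w = i := by
    intro i hi hs
    obtain ⟨w, hw, rfl⟩ := Net.mem_items.1 hi
    exact ⟨w, hw, fun h => by have := hin h rfl; omega, rfl⟩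
  refine ⟨fun i hi => ?_, fun i hi => ?_, fun h0 i hi => ?_, fun h0 i hi => ?_, fun h0 w hw => ?_⟩
  · by_cases hs : i < L - sh
    · rw [hI.cnt_lt i hs]
      by_cases h0 : i ≠ 0 ∨ sh = 0
      · rw [single i hs h0, Finset.card_singleton]
        split_ifs <;> omega
      · push Not at h0
        have e : (Finset.range H.n).filter (fun w => H.item xs L sh w = 0) =
            (Finset.range (sh + 1)).image xs := by
          ext w
          rw [Finset.mem_filter, Finset.mem_image, Finset.mem_range]
          constructor
          · rintro ⟨hw, h⟩
            obtain ⟨p, hp, rfl⟩ := S.item_lt_iff.1 (show H.item xs L sh w < L - sh by omega)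
            rw [S.item_xs hp] at h
            exact ⟨p, by rw [Finset.mem_range]; omega, rfl⟩
          · rintro ⟨p, hp, rfl⟩
            rw [Finset.mem_range] at hp
            exact ⟨S.lt p (by omega), by rw [S.item_xs (by omega)]; omega⟩
        rw [h0.1, if_pos rfl, e, Finset.card_image_of_injOn, Finset.card_range, add_comm]
        intro p hp q hq h
        simp only [Finset.coe_range, Set.mem_Iio] at hp hq
        exact S.inj p (by omega) q (by omega) h
    · obtain ⟨w, hw, hwin, rfl⟩ := hge i hi (by omega)
      rw [if_neg (by omega), Nat.add_zero]
      convert hI.cnt_ge (H.item xs L sh w) (Net.item_not_in_lt hwin).2 (Net.item_not_in_lt hwin).1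
  · by_cases hs : i < L - sh
    · rw [hI.rep_lt i hs, S.item_xs (by omega)]
      exact ⟨S.lt _ (by omega), by omega⟩
    · obtain ⟨w, hw, hwin, rfl⟩ := hge i hi (by omega)
      exact ⟨(hI.rep_ge w hw hwin).1, (hI.rep_ge w hw hwin).2.1⟩
  · by_cases hs : i < L - sh
    · have := single i hs (Or.inr h0)
      rw [(hI.weight_lt i hs).2]
      simp only [this, Finset.sum_singleton]
    · obtain ⟨w, hw, hwin, rfl⟩ := hge i hi (by omega)
      convert hI.sumw_ge w hw hwin
  · by_cases hs : i < L - sh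
    · rw [(hI.weight_lt i hs).1, hI.rep_lt i hs]
    · obtain ⟨w, hw, hwin, rfl⟩ := hge i hi (by omega)
      exact (hI.rep_ge w hw hwin).2.2.1
  · by_cases hwin : In xs L w
    · obtain ⟨p, hp, rfl⟩ := hwin
      rw [S.item_xs hp, (hI.weight_lt _ (by omega)).1, h0]
      simp
    · exact (hI.rep_ge w hw hwin).2.2.2

theorem Net.BuildInv.lst_items (hI : H.BuildInv xs L sh H.n N lst cn rp mw sw)
    (S : H.Layout xs par L sh) :
    (∀ t < N, lst t ∈ H.items xs L sh) ∧ ∀ i ∈ H.items xs L sh, ∃ t < N, lst t = i := by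
  have hsh := S.sh_lt
  have hle := hI.le_N
  refine ⟨fun t ht => ?_, fun i hi => ?_⟩
  · rw [Net.mem_items]
    by_cases hs : t < L - sh
    · rw [hI.lst_lt t hs]
      exact ⟨xs (sh + t), S.lt _ (by omega), by rw [S.item_xs (by omega)]; omega⟩
    · obtain ⟨w, hw, -, h⟩ := hI.lst_ge t ht (by omega)
      exact ⟨w, hw, h⟩
  · obtain ⟨w, hw, rfl⟩ := Net.mem_items.1 hi
    by_cases hin : In xs L w
    · have := S.item_lt_iff.2 hin
      exact ⟨_, by omega, hI.lst_lt _ this⟩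
    · exact hI.lst_surj w hw hin

end WCVC

/-! ### The program that computes the items -/

namespace WCVC

open RealRAM

variable {M : Limits} {I : Input} {H : Net} {m k : ℕ} {off : ℕ → ℕ} {xs par : ℕ → ℕ} {L sh : ℕ}

/-- Append the pairs of the item in register `21` and the items hit by the vertex in register `6` to
the list of incidences, whose length is in register `20`. -/
def appendInc : Prog :=
  nbrLoop (find 9 ;; .ite (.lt (.reg 11) (.reg 4))
    (.store 5 (.reg 20) (.reg 21) ;; .store 6 (.reg 20) (.reg 11 - .reg 5) ;;
      .assign 20 (.reg 20 + .const 1)) .skip)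

@[simp] theorem appendInc_regs : appendInc.regs = [8, 7, 9, 11, 10, 11, 10, 20, 7] := rfl
@[simp] theorem appendInc_mems : appendInc.mems = [5, 6] := rfl
@[simp] theorem appendInc_rmems : appendInc.rmems = [] := rfl

theorem Setup.runs_appendInc (S : Setup M I H m k off) {σ : State} {Q : State → ℕ → Prop} {v : ℕ}
    (hv : σ.reg 6 = v) (hvn : v < H.n) (hL : σ.reg 4 < M.cells)
    (he : σ.reg 20 + σ.reg 4 < M.cells)
    (hinj : ∀ p < σ.reg 4, ∀ q < σ.reg 4, σ.mem 1 p = σ.mem 1 q → p = q)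
    (hQ : ∀ τ t, Frame appendInc σ τ → τ.reg 20 ≤ σ.reg 20 + σ.reg 4 →
      τ.reg 20 ≤ σ.reg 20 + H.deg v →
      (∀ a b, Inc (τ.mem 5) (τ.mem 6) (τ.reg 20) a b ↔ Inc (σ.mem 5) (σ.mem 6) (σ.reg 20) a b ∨
        a = σ.reg 21 ∧ H.Hits (σ.mem 1) (σ.reg 4) (σ.reg 5) v b) →
      t ≤ H.deg v * (22 * σ.reg 4 + 50) + 12 → Q τ t) :
    Runs M I appendInc σ Q := by
  classical
  have hw := S.word_le
  have hcw := S.cells_le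
  set L := σ.reg 4 with hL4
  set sh := σ.reg 5 with hsh
  set xs := σ.mem 1 with hxs
  set e := σ.reg 20 with he20
  have key : Runs M I appendInc σ fun τ t => τ.reg 20 ≤ e + L ∧ τ.reg 20 ≤ e + H.deg v ∧
      (∀ a b, Inc (τ.mem 5) (τ.mem 6) (τ.reg 20) a b ↔ Inc (σ.mem 5) (σ.mem 6) e a b ∨
        a = σ.reg 21 ∧ H.Hits xs L sh v b) ∧ t ≤ H.deg v * (22 * L + 50) + 12 := by
    rw [appendInc]
    refine S.runs_nbrLoop hv hvn (fun d τ =>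
      τ.reg 20 = e + ((Finset.range d).filter fun x => In xs L (H.nth v x)).card ∧
      ∀ a b, Inc (τ.mem 5) (τ.mem 6) (τ.reg 20) a b ↔ Inc (σ.mem 5) (σ.mem 6) e a b ∨
        a = σ.reg 21 ∧ ∃ p < L, (∃ x < d, H.nth v x = xs p) ∧ p - sh = b)
      (22 * L + 39) (by simp) (by simp) ?_ ?_ ?_
    · intro a b
      simp [he20]
    · rintro d τ hd hf ⟨i1, i2⟩
      have e4 : τ.reg 4 = L := by rw [hf.reg 4 (by simp)]
      have e5 : τ.reg 5 = sh := by rw [hf.reg 5 (by simp)]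
      have e21 : τ.reg 21 = σ.reg 21 := by rw [hf.reg 21 (by simp)]
      have e1 : τ.mem 1 = xs := by rw [hf.mem 1 (by simp)]
      rw [runs_seq]
      refine runs_find (by decide) (by simpa [e4] using hL) hcw ?_
      intro υ t hfυ hF ht
      simp only [setReg_mem, setReg_reg, e1, e4, if_true, show (4 : ℕ) ≠ 9 by decide, if_false]
        at hF ht
      have f4 : υ.reg 4 = L := by rw [hfυ.reg 4 (by simp)]; simp [e4]
      have f5 : υ.reg 5 = sh := by rw [hfυ.reg 5 (by simp)]; simp [e5]
      have f20 : υ.reg 20 = τ.reg 20 := by rw [hfυ.reg 20 (by simp)]; simp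
      have f21 : υ.reg 21 = σ.reg 21 := by rw [hfυ.reg 21 (by simp)]; simp [e21]
      have fm5 : υ.mem 5 = τ.mem 5 := by rw [hfυ.mem 5 (by simp)]; simp
      have fm6 : υ.mem 6 = τ.mem 6 := by rw [hfυ.mem 6 (by simp)]; simp
      have hcard := H.card_in_le (xs := xs) (L := L) (v := v) hd
      rw [Finset.range_add_one, Finset.filter_insert] at hcard
      rw [Finset.range_add_one, Finset.filter_insert]
      simp only [runs_ite, runs_seq, runs_assign, runs_store, runs_skip, csafe_lt, holds_lt,
        safe_reg, safe_sub, safe_add, safe_const, val_reg, val_sub, val_add, val_const,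
        setReg_reg, setReg_mem, setMem_reg, setMem_mem, f4, f5, f20, f21, fm5, fm6, true_and,
        ccost_lt, cost_reg, cost_sub, cost_add, cost_const]
      refine ⟨fun h => ?_, fun h => ?_⟩
      · have hF : xs (υ.reg 11) = H.nth v d := by
          rcases hF with hF | hF
          · exact hF.2
          · omega
        have hIn : In xs L (H.nth v d) := ⟨_, h, hF⟩
        rw [if_pos hIn, Finset.card_insert_of_notMem (by simp)] at hcard ⊢
        norm_num
        refine ⟨by omega, by omega, by omega, by omega, by omega, fun a b => ?_⟩
        rw [inc_update_iff, i2]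
        constructor
        · rintro ((h1 | ⟨h1, p, hp, ⟨x, hx, h2⟩, h3⟩) | ⟨h1, h2⟩)
          · exact Or.inl h1
          · exact Or.inr ⟨h1, p, hp, ⟨x, by omega, h2⟩, h3⟩
          · exact Or.inr ⟨h1, _, h, ⟨d, by omega, hF.symm⟩, h2.symm⟩
        · rintro (h1 | ⟨h1, p, hp, ⟨x, hx, h2⟩, h3⟩)
          · exact Or.inl (Or.inl h1)
          · rcases Nat.lt_or_eq_of_le hx with hx | rfl
            · exact Or.inl (Or.inr ⟨h1, p, hp, ⟨x, by omega, h2⟩, h3⟩)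
            · by_cases hpe : p = υ.reg 11
              · subst hpe
                exact Or.inr ⟨h1, h3.symm⟩
              · exact absurd (hinj p hp _ h (h2.symm.trans hF.symm)) hpe
      · have hF : ¬ In xs L (H.nth v d) := by
          rcases hF with hF | hF
          · exact absurd hF.1 h
          · exact hF.2
        rw [if_neg hF]
        norm_num
        refine ⟨by omega, i1, fun a b => ?_⟩
        rw [i2]
        constructor
        · rintro (h1 | ⟨h1, p, hp, ⟨x, hx, h2⟩, h3⟩)
          · exact Or.inl h1
          · exact Or.inr ⟨h1, p, hp, ⟨x, by omega, h2⟩, h3⟩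
        · rintro (h1 | ⟨h1, p, hp, ⟨x, hx, h2⟩, h3⟩)
          · exact Or.inl h1
          · rcases Nat.lt_or_eq_of_le hx with hx | rfl
            · exact Or.inr ⟨h1, p, hp, ⟨x, by omega, h2⟩, h3⟩
            · exact absurd ⟨p, hp, h2.symm⟩ hF
    · rintro τ t hf ⟨i1, i2⟩ ht
      have h1 := H.card_in_le (xs := xs) (L := L) (v := v) le_rfl
      have h2 : ((Finset.range (H.deg v)).filter fun x => In xs L (H.nth v x)).card ≤ H.deg v :=
        (Finset.card_filter_le _ _).trans (by simp)
      refine ⟨by omega, by omega, fun a b => ?_, ?_⟩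
      · rw [i2]
        refine or_congr_right (and_congr_right fun _ => ?_)
        constructor
        · rintro ⟨p, hp, ⟨x, hx, h1⟩, h2⟩
          exact ⟨p, hp, h1 ▸ Net.nth_mem hx, h2⟩
        · rintro ⟨p, hp, h1, h2⟩
          exact ⟨p, hp, Net.mem_nbr.1 h1, h2⟩
      · have : H.deg v * (22 * L + 39 + 11) = H.deg v * (22 * L + 50) := rfl
        omega
  exact key.mono fun τ t hf h => hQ τ t hf h.1 h.2.1 h.2.2.1 h.2.2.2

/-- Consider the vertex in register `6` for the list of items. -/
def buildBody : Prog :=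
  find 6 ;; .ite (.lt (.reg 11) (.reg 4)) .skip
    (nbscan ;; .assign 21 (.reg 18 + .reg 14) ;;
      .ite (.lt (.const 0) (.load 7 (.reg 21)))
        (.store 7 (.reg 21) (.load 7 (.reg 21) + .const 1) ;;
          .rstore 1 (.reg 21) (.load 1 (.reg 21) + .input (.reg 6)) ;;
          .ite (.rlt (.input (.reg 6)) (.load 0 (.reg 21)))
            (.store 8 (.reg 21) (.reg 6) ;; .rstore 0 (.reg 21) (.input (.reg 6))) .skip)
        (.store 7 (.reg 21) (.const 1) ;; .store 8 (.reg 21) (.reg 6) ;;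
          .rstore 0 (.reg 21) (.input (.reg 6)) ;; .rstore 1 (.reg 21) (.input (.reg 6)) ;;
          .store 16 (.reg 19) (.reg 21) ;; .assign 19 (.reg 19 + .const 1) ;; appendInc))

@[simp] theorem buildBody_regs : buildBody.regs =
    [11, 10, 11, 10] ++ (nbscan.regs ++ (21 :: 19 :: appendInc.regs)) := rfl

variable (xs par L sh) in
open Classical in
/-- The state after all vertices of the list and the vertices below `v` have been considered. -/
structure BuildState (H : Net) (k v : ℕ) (σ : State) : Prop where
  consts : Consts H k σ
  reg_L : σ.reg 4 = L
  reg_sh : σ.reg 5 = sh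
  mem_xs : σ.mem 1 = xs
  mem_par : σ.mem 2 = par
  reg_s : σ.reg 18 = L - sh
  inv : H.BuildInv xs L sh v (σ.reg 19) (σ.mem 16) (σ.mem 7) (σ.mem 8) (σ.rmem 0) (σ.rmem 1)
  inc : ∀ a b, Inc (σ.mem 5) (σ.mem 6) (σ.reg 20) a b ↔
    (∃ q < L, q - sh = a ∧ H.Hits xs L sh (xs q) b) ∨
      ∃ w < v, ¬ In xs L w ∧ H.item xs L sh w = a ∧ H.Hits xs L sh w b
  le_list : σ.reg 20 ≤ L * L + L * (σ.reg 19 - (L - sh))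
  le_deg : σ.reg 20 ≤ ∑ w ∈ (Finset.range H.n).filter (fun w => In xs L w), H.deg w +
    ∑ w ∈ (Finset.range v).filter (fun w => ¬ In xs L w), H.deg w

theorem BuildState.setReg {v : ℕ} {σ : State} (h : BuildState xs par L sh H k v σ) {x : ℕ} (a : ℕ)
    (hx : x ∉ [2, 3, 4, 5, 18, 19, 20]) : BuildState xs par L sh H k v (σ.setReg x a) := by
  simp only [List.mem_cons, not_or, List.not_mem_nil, not_false_eq_true, and_true] at hx
  have e : ∀ y, y ≠ x → (σ.setReg x a).reg y = σ.reg y := fun y hy => by simp [hy]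
  have h20 : (σ.setReg x a).reg 20 = σ.reg 20 := e 20 (by omega)
  have h19 : (σ.setReg x a).reg 19 = σ.reg 19 := e 19 (by omega)
  refine ⟨⟨?_, ?_, h.consts.pw⟩, ?_, ?_, h.mem_xs, h.mem_par, ?_, ?_, ?_, ?_, ?_⟩
  · rw [e 2 (by omega), h.consts.reg_n]
  · rw [e 3 (by omega), h.consts.reg_k]
  · rw [e 4 (by omega), h.reg_L]
  · rw [e 5 (by omega), h.reg_sh]
  · rw [e 18 (by omega), h.reg_s]
  · rw [h19]
    exact h.inv
  · rw [h20]
    exact h.inc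
  · rw [h20, h19]
    exact h.le_list
  · rw [h20]
    exact h.le_deg

theorem BuildState.frame {v : ℕ} {σ τ : State} {p : Prog} (h : BuildState xs par L sh H k v σ)
    (hf : Frame p σ τ) (hr : ∀ x ∈ [2, 3, 4, 5, 18, 19, 20], x ∉ p.regs) (hm : p.mems = [])
    (hrm : p.rmems = []) : BuildState xs par L sh H k v τ := by
  have e : ∀ x, τ.mem x = σ.mem x := fun x => hf.mem x (by simp [hm])
  have e' : ∀ x, τ.rmem x = σ.rmem x := fun x => hf.rmem x (by simp [hrm])
  simp only [List.forall_mem_cons, List.not_mem_nil, false_imp_iff, implies_true,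
    and_true] at hr
  obtain ⟨r2, r3, r4, r5, r18, r19, r20⟩ := hr
  refine ⟨h.consts.frame hf r2 r3 (by simp [hm]), ?_, ?_, ?_, ?_, ?_, ?_, ?_, ?_, ?_⟩
  · rw [hf.reg _ r4, h.reg_L]
  · rw [hf.reg _ r5, h.reg_sh]
  · rw [e, h.mem_xs]
  · rw [e, h.mem_par]
  · rw [hf.reg _ r18, h.reg_s]
  · rw [hf.reg _ r19, e, e, e, e', e']
    exact h.inv
  · rw [hf.reg _ r20, e, e]
    exact h.inc
  · rw [hf.reg _ r20, hf.reg _ r19]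
    exact h.le_list
  · rw [hf.reg _ r20]
    exact h.le_deg

theorem BuildState.inc_le (h : 1 ≤ k) (hL : L ≤ 2 * k + 2) (hs : L - sh ≤ k + 1) {N e : ℕ}
    (he : e ≤ L * L + L * (N - (L - sh))) (hN : N ≤ L - sh + 2 ^ (L - sh)) :
    e ≤ 24 * (2 ^ k * k) := by
  have h1 : L ≤ 4 * k := by omega
  have h2 : 2 ^ (L - sh) ≤ 2 * 2 ^ k := by
    calc 2 ^ (L - sh) ≤ 2 ^ (k + 1) := Nat.pow_le_pow_right (by omega) hs
      _ = 2 * 2 ^ k := by ring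
  have h3 : L * L ≤ 4 * k * (4 * k) := Nat.mul_le_mul h1 h1
  have h4 : L * (N - (L - sh)) ≤ 4 * k * (2 * 2 ^ k) := Nat.mul_le_mul h1 (by omega)
  have h5 : k * k ≤ 2 ^ k * k := Nat.mul_le_mul_right _ Nat.lt_two_pow_self.le
  nlinarith

theorem Setup.runs_buildBody (S : Setup M I H m k off) {σ : State} {v : ℕ}
    (Y : H.Layout xs par L sh) (hL : L ≤ 2 * k + 2) (hs : L - sh ≤ k + 1)
    (hB : BuildState xs par L sh H k v σ) (hv : σ.reg 6 = v) (hvn : v < H.n) :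
    Runs M I buildBody σ fun τ t => t ≤ (H.deg v + 1) * (200 * k + 400) ∧
      BuildState xs par L sh H k (v + 1) τ := by
  classical
  have hw := S.word_le
  have hcw := S.cells_le
  have hk := S.k_le
  have hk1 := S.k_pos
  have hp := S.two_pow_le
  have hN := hB.inv.N_le_pow
  have hNl := hB.inv.le_N
  have h24 := BuildState.inc_le hk1 hL hs hB.le_list hN
  have hc := S.le_cells
  have hkc : k ≤ 2 ^ k * k := Nat.le_mul_of_pos_left _ (by positivity)
  have hpc : 2 ^ k ≤ 2 ^ k * k := Nat.le_mul_of_pos_right _ (by omega)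
  have h2s : 2 ^ (L - sh) ≤ 2 * 2 ^ k := by
    calc 2 ^ (L - sh) ≤ 2 ^ (k + 1) := Nat.pow_le_pow_right (by omega) hs
      _ = 2 * 2 ^ k := by ring
  rw [buildBody, runs_seq]
  refine runs_find (by decide) (by rw [hB.reg_L]; omega) hcw fun τ t hf hF ht => ?_
  have hBτ := hB.frame hf (by simp) (by simp) (by simp)
  have e6 : τ.reg 6 = v := by rw [hf.reg 6 (by simp), hv]
  rw [hB.mem_xs, hB.reg_L, hv] at hF
  rw [hB.reg_L] at ht
  have hd0 : 100 * k ≤ (H.deg v + 1) * (200 * k + 400) := by nlinarith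
  have hd1 : H.deg v * (22 * L + 50) + H.deg v * (22 * L + 50) + 22 * L + 200 ≤
      (H.deg v + 1) * (200 * k + 400) := by
    have h1 : H.deg v * (22 * L + 50) ≤ H.deg v * (44 * k + 94) := Nat.mul_le_mul_left _ (by omega)
    nlinarith
  rw [runs_ite]
  refine ⟨by simp, fun hlt => ?_, fun hlt => ?_⟩
  · rw [runs_skip]
    simp only [holds_lt, val_reg, hBτ.reg_L] at hlt
    have hin : In xs L v := by
      rcases hF with hF | hF
      · exact ⟨_, hF⟩
      · omega
    refine ⟨by simp; omega, ?_⟩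
    have hne : (Finset.range (v + 1)).filter (fun w => ¬ In xs L w) =
        (Finset.range v).filter (fun w => ¬ In xs L w) := by
      rw [Finset.range_add_one, Finset.filter_insert, if_neg (by simpa using hin)]
    refine ⟨hBτ.consts, hBτ.reg_L, hBτ.reg_sh, hBτ.mem_xs, hBτ.mem_par, hBτ.reg_s,
      hBτ.inv.skip Y hin, fun a b => ?_, hBτ.le_list, ?_⟩
    · rw [hBτ.inc]
      refine or_congr_right ⟨?_, ?_⟩
      · rintro ⟨w, hw, h⟩
        exact ⟨w, by omega, h⟩
      · rintro ⟨w, hw, h⟩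
        rcases Nat.lt_succ_iff_lt_or_eq.1 hw with hw | rfl
        · exact ⟨w, hw, h⟩
        · exact absurd hin h.1
    · rw [hne]
      exact hBτ.le_deg
  simp only [holds_lt, val_reg, hBτ.reg_L] at hlt
  have hin : ¬ In xs L v := by
    rcases hF with hF | hF
    · exact absurd hF.1 hlt
    · exact hF.2
  rw [runs_seq]
  refine S.runs_nbscan (by rw [e6]; exact hvn) (by rw [hBτ.reg_L]; omega) ?_ hBτ.consts.pw ?_
    fun υ t' hf' hS ht' => ?_
  · intro p hp
    rw [hBτ.reg_L] at hp
    rw [hBτ.reg_sh]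
    omega
  · rw [hBτ.reg_L, hBτ.mem_xs]
    exact Y.inj
  rw [hBτ.mem_xs, hBτ.reg_L, hBτ.reg_sh, e6] at hS
  rw [e6, hBτ.reg_L] at ht'
  have hBυ := hBτ.frame hf' (by simp) (by simp) (by simp)
  have f6 : υ.reg 6 = v := by rw [hf'.reg 6 (by simp), e6]
  have f14 : υ.reg 14 = H.nmask xs L sh v := by
    refine Nat.eq_of_testBit_eq fun j => ?_
    rw [Bool.eq_iff_iff, hS.mask, Y.testBit_nmask]
  have hitem := Net.item_of_not_in (H := H) (sh := sh) hin
  have hlt := Net.item_not_in_lt (H := H) (sh := sh) hin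
  have hcn := (hBυ.inv.cnt_ge _ hlt.2 hlt.1).trans_le (Finset.card_filter_le _ _)
  rw [Finset.card_range] at hcn
  have hreal := S.real_eq v hvn
  have hreal' := S.real_has v hvn
  have hNn : υ.reg 19 ≤ L - sh + 2 ^ (L - sh) := hBυ.inv.N_le_pow
  have hrange : (Finset.range (v + 1)).filter (fun w => ¬ In xs L w) =
      insert v ((Finset.range v).filter (fun w => ¬ In xs L w)) := by
    rw [Finset.range_add_one, Finset.filter_insert, if_pos hin]
  have hsum : ∑ w ∈ (Finset.range (v + 1)).filter (fun w => ¬ In xs L w), H.deg w =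
      H.deg v + ∑ w ∈ (Finset.range v).filter (fun w => ¬ In xs L w), H.deg w := by
    rw [hrange, Finset.sum_insert (by simp)]
  set i := H.item xs L sh v with hi
  simp only [runs_seq (p := Prog.assign _ _), runs_assign, safe_add, safe_reg, val_add, val_reg,
    hBυ.reg_s, f14, ← hitem, true_and]
  refine ⟨by omega, ?_⟩
  rw [runs_ite]
  simp only [csafe_lt, safe_const, safe_load, safe_reg, val_reg, holds_lt, val_const, val_load,
    setReg_reg, setReg_mem, if_true, true_and]
  refine ⟨by omega, fun hpos => ?_, fun hpos => ?_⟩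
  · have h0 : υ.mem 7 i ≠ 0 := by omega
    have hinc : ∀ a b, ((∃ q < L, q - sh = a ∧ H.Hits xs L sh (xs q) b) ∨
        ∃ w < v, ¬ In xs L w ∧ H.item xs L sh w = a ∧ H.Hits xs L sh w b) ↔
        ((∃ q < L, q - sh = a ∧ H.Hits xs L sh (xs q) b) ∨
        ∃ w < v + 1, ¬ In xs L w ∧ H.item xs L sh w = a ∧ H.Hits xs L sh w b) := by
      intro a b
      refine or_congr_right ⟨?_, ?_⟩
      · rintro ⟨w, hw, h⟩
        exact ⟨w, by omega, h⟩
      · rintro ⟨w, hw, h⟩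
        rcases Nat.lt_succ_iff_lt_or_eq.1 hw with hw | rfl
        · exact ⟨w, hw, h⟩
        · obtain ⟨w₀, hw₀, hin₀, he₀⟩ : ∃ w₀ < w, ¬ In xs L w₀ ∧
              H.item xs L sh w₀ = H.item xs L sh w := by
            by_contra hno
            push Not at hno
            exact h0 ((hBυ.inv.cnt_eq_zero_iff Y hin).2 hno)
          exact ⟨w₀, hw₀, hin₀, he₀.trans h.2.1, (Y.hits_congr hin₀ he₀).2 h.2.2⟩
    simp only [runs_ite, runs_seq, runs_store, runs_rstore, runs_skip, safe_add, safe_reg, safe_load,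
      safe_const, val_add, val_reg, val_load, val_const, setReg_reg, setReg_mem, setReg_rmem,
      rsafe_add, rsafe_load, rsafe_input, rval_add, rval_load, rval_input, setMem_reg,
      setMem_rmem, setRMem_reg, setRMem_rmem, csafe_rlt, holds_rlt, f6, hreal,
      show (6 : ℕ) ≠ 21 by decide, show (0 : ℕ) ≠ 1 by decide, if_true, if_false, true_and, ccost_lt,
      ccost_rlt,
      cost_reg, cost_const, cost_add, cost_load, rcost_add, rcost_load, rcost_input]
    have hB1 : ∀ (ρ : State), ρ.reg = (υ.setReg 21 i).reg →
        (∀ x, x ≠ 7 → x ≠ 8 → ρ.mem x = υ.mem x) →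
        ρ.mem 7 = Function.update (υ.mem 7) i (υ.mem 7 i + 1) →
        ρ.rmem 1 = Function.update (υ.rmem 1) i (υ.rmem 1 i + H.ω v) →
        ((H.ω v < υ.rmem 0 i ∧ ρ.mem 8 = Function.update (υ.mem 8) i v ∧
          ρ.rmem 0 = Function.update (υ.rmem 0) i (H.ω v)) ∨
        (¬ H.ω v < υ.rmem 0 i ∧ ρ.mem 8 = υ.mem 8 ∧ ρ.rmem 0 = υ.rmem 0)) →
        BuildState xs par L sh H k (v + 1) ρ := by
      intro ρ hr hm h7 h1 hor
      refine ⟨⟨?_, ?_, ?_⟩, ?_, ?_, ?_, ?_, ?_, ?_, fun a b => ?_, ?_, ?_⟩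
      · rw [hr]; simpa using hBυ.consts.reg_n
      · rw [hr]; simpa using hBυ.consts.reg_k
      · rw [hm 3 (by decide) (by decide)]; exact hBυ.consts.pw
      · rw [hr]; simpa using hBυ.reg_L
      · rw [hr]; simpa using hBυ.reg_sh
      · rw [hm 1 (by decide) (by decide)]; exact hBυ.mem_xs
      · rw [hm 2 (by decide) (by decide)]; exact hBυ.mem_par
      · rw [hr]; simpa using hBυ.reg_s
      · rw [hr, hm 16 (by decide) (by decide), h7, h1]
        simpa using hBυ.inv.old Y hin hvn h0 hor
      · rw [hr, hm 5 (by decide) (by decide), hm 6 (by decide) (by decide), ← hinc a b]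
        simpa using hBυ.inc a b
      · rw [hr]; simpa using hBυ.le_list
      · rw [hr, hsum]
        have := hBυ.le_deg
        simp
        omega
    refine ⟨by omega, by omega, by omega, ⟨by omega, hreal'⟩, ⟨hreal', by omega⟩,
      fun hlt' => ⟨by omega, by omega, hreal', by omega, hB1 _ rfl ?_ ?_ ?_ (Or.inl ⟨?_, ?_, ?_⟩)⟩,
      fun hlt' => ⟨by omega, hB1 _ rfl ?_ ?_ ?_ (Or.inr ⟨?_, ?_, ?_⟩)⟩⟩
    · intro x h7 h8
      simp [h7, h8]
    · simp
    · simp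
    · simpa using hlt'
    · simp
    · simp
    · intro x h7 h8
      simp [h7]
    · simp
    · simp
    · simpa using hlt'
    · simp
    · simp
  · have h0 : υ.mem 7 i = 0 := by omega
    have hnew := hBυ.inv.new Y hin hvn h0
    have hN' := hnew.N_le_pow
    have h24' := BuildState.inc_le hk1 hL hs hBυ.le_list hBυ.inv.N_le_pow
    simp only [runs_seq (p := Prog.assign _ _), runs_seq (p := Prog.store _ _ _),
      runs_seq (p := Prog.rstore _ _ _), runs_assign, runs_store, runs_rstore, safe_add, safe_reg,
      safe_const, val_add, val_reg, val_const, setReg_reg,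
      rsafe_input, rval_input, setMem_reg, setRMem_reg,
      f6, hreal, show (6 : ℕ) ≠ 21 by decide,
      show (19 : ℕ) ≠ 21 by decide, if_true, if_false, true_and, ccost_lt,
      cost_reg, cost_const, cost_add, cost_load, rcost_input]
    refine ⟨by omega, by omega, by omega, by omega, hreal', by omega, hreal', by omega, by omega,
      ?_⟩
    refine S.runs_appendInc (v := v) (by simp [f6]) hvn (by simp [hBυ.reg_L]; omega)
      (by simp [hBυ.reg_L]; omega) ?_ fun ρ t'' hfρ l1 l2 l3 ht'' => ?_
    · simp [hBυ.reg_L, hBυ.mem_xs]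
      exact Y.inj
    simp [hBυ.reg_L, hBυ.reg_sh, hBυ.mem_xs] at l1 l2 l3 ht''
    have hle := hBυ.le_list
    have hled := hBυ.le_deg
    have hNl' := hBυ.inv.le_N
    have g19 : ρ.reg 19 = υ.reg 19 + 1 := by rw [hfρ.reg 19 (by simp)]; simp
    refine ⟨by omega, ⟨⟨?_, ?_, ?_⟩, ?_, ?_, ?_, ?_, ?_, ?_, fun a b => ?_, ?_, ?_⟩⟩
    · rw [hfρ.reg 2 (by simp)]; simpa using hBυ.consts.reg_n
    · rw [hfρ.reg 3 (by simp)]; simpa using hBυ.consts.reg_k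
    · rw [hfρ.mem 3 (by simp)]; simpa using hBυ.consts.pw
    · rw [hfρ.reg 4 (by simp)]; simpa using hBυ.reg_L
    · rw [hfρ.reg 5 (by simp)]; simpa using hBυ.reg_sh
    · rw [hfρ.mem 1 (by simp)]; simpa using hBυ.mem_xs
    · rw [hfρ.mem 2 (by simp)]; simpa using hBυ.mem_par
    · rw [hfρ.reg 18 (by simp)]; simpa using hBυ.reg_s
    · rw [g19, hfρ.mem 16 (by simp), hfρ.mem 7 (by simp), hfρ.mem 8 (by simp),
        hfρ.rmem 0 (by simp), hfρ.rmem 1 (by simp)]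
      simpa using hnew
    · rw [l3, hBυ.inc]
      constructor
      · rintro ((h | ⟨w, hw, h⟩) | ⟨h1, h2⟩)
        · exact Or.inl h
        · exact Or.inr ⟨w, by omega, h⟩
        · exact Or.inr ⟨v, by omega, hin, h1.symm, h2⟩
      · rintro (h | ⟨w, hw, h⟩)
        · exact Or.inl (Or.inl h)
        · rcases Nat.lt_succ_iff_lt_or_eq.1 hw with hw | rfl
          · exact Or.inl (Or.inr ⟨w, hw, h⟩)
          · exact Or.inr ⟨h.2.1.symm, h.2.2⟩
    · rw [g19]
      have : υ.reg 19 + 1 - (L - sh) = υ.reg 19 - (L - sh) + 1 := by omega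
      rw [this, Nat.mul_add]
      omega
    · rw [hsum]
      omega

end WCVC

namespace WCVC

open RealRAM

variable {M : Limits} {I : Input} {H : Net} {m k : ℕ} {off : ℕ → ℕ} {xs par : ℕ → ℕ} {L sh : ℕ}

/-- Initialize the data of the items of the list. -/
def buildInit : Prog :=
  .assign 18 (.reg 4 - .reg 5) ;; .assign 19 (.reg 18) ;; .assign 20 (.const 0) ;;
  .assign 21 (.reg 18 + .load 3 (.reg 18)) ;;
  .for 22 (.const 0) 21 (.store 7 (.reg 22) (.const 0)) ;;
  .for 22 (.const 0) 18 (.store 7 (.reg 22) (.const 1) ;;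
    .store 8 (.reg 22) (.load 1 (.reg 5 + .reg 22)) ;;
    .rstore 0 (.reg 22) (.input (.load 1 (.reg 5 + .reg 22))) ;;
    .rstore 1 (.reg 22) (.input (.load 1 (.reg 5 + .reg 22))) ;;
    .store 16 (.reg 22) (.reg 22))

@[simp] theorem buildInit_regs : buildInit.regs = [18, 19, 20, 21, 22, 22, 22, 22] := rfl
@[simp] theorem buildInit_mems : buildInit.mems = [7, 7, 8, 16] := rfl

/-- Compute the items and the list of incidences. -/
def build : Prog :=
  buildInit ;;
  .for 22 (.const 0) 4 (.assign 6 (.load 1 (.reg 22)) ;; .assign 21 (.reg 22 - .reg 5) ;;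
    appendInc) ;;
  .for 6 (.const 0) 2 buildBody

@[simp] theorem build_regs : build.regs = buildInit.regs ++
    ((22 :: ((6 :: 21 :: appendInc.regs) ++ [22])) ++ (6 :: (buildBody.regs ++ [6]))) := rfl

theorem Setup.runs_buildInit (S : Setup M I H m k off) {σ : State}
    (Y : H.Layout (σ.mem 1) (σ.mem 2) (σ.reg 4) (σ.reg 5)) (hL : σ.reg 4 ≤ 2 * k + 2)
    (hs : σ.reg 4 - σ.reg 5 ≤ k + 1) (hC : Consts H k σ) :
    Runs M I buildInit σ fun τ t => t ≤ 40 * 2 ^ k + 100 * k + 200 ∧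
      τ.reg 18 = σ.reg 4 - σ.reg 5 ∧ τ.reg 20 = 0 ∧
      H.BuildInv (σ.mem 1) (σ.reg 4) (σ.reg 5) 0 (τ.reg 19) (τ.mem 16) (τ.mem 7) (τ.mem 8)
        (τ.rmem 0) (τ.rmem 1) ∧ τ.reg 19 = σ.reg 4 - σ.reg 5 := by
  have hw := S.word_le
  have hcw := S.cells_le
  have hk := S.k_le
  have hk1 := S.k_pos
  have hp := S.two_pow_le
  set L := σ.reg 4 with hL4
  set sh := σ.reg 5 with hsh
  set xs := σ.mem 1 with hxs
  have hY := Y.sh_lt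
  have h2s : 2 ^ (L - sh) ≤ 2 * 2 ^ k := by
    calc 2 ^ (L - sh) ≤ 2 ^ (k + 1) := Nat.pow_le_pow_right (by omega) hs
      _ = 2 * 2 ^ k := by ring
  have hpw := hC.pw (L - sh) hs
  rw [buildInit]
  simp only [runs_seq (p := Prog.assign _ _), runs_assign, safe_sub, safe_reg, safe_const, safe_add,
    safe_load, val_sub, val_reg, val_const, val_add, val_load, setReg_reg, setReg_mem, ← hL4, ← hsh,
    hpw, true_and, if_true, show (18 : ℕ) ≠ 20 by decide, show (18 : ℕ) ≠ 19 by decide, if_false]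
  refine ⟨by omega, by omega, by omega, ?_⟩
  rw [runs_seq]
  refine Runs.for_const 0 (L - sh + 2 ^ (L - sh)) (fun j τ => ∀ i < j, τ.mem 7 i = 0) 3 (by simp; omega) rfl
    (by simp) (by omega) (by omega) (by decide) (by simp) (by simp) (by simp) ?_ ?_
  · intro i τ _ hi hf h22 hI
    simp only [runs_store, safe_reg, safe_const, val_reg, val_const, h22, true_and, cost_reg,
      cost_const]
    refine ⟨by omega, by omega, by omega, fun j hj => ?_⟩
    simp only [setReg_mem, setMem_mem, if_true]
    by_cases h : j = i
    · subst h; simp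
    · rw [Function.update_of_ne h]
      exact hI j (by omega)
  intro τ t hf _ hI ht
  have e18 : τ.reg 18 = L - sh := by rw [hf.reg 18 (by simp)]; simp
  have e19 : τ.reg 19 = L - sh := by rw [hf.reg 19 (by simp)]; simp
  have e20 : τ.reg 20 = 0 := by rw [hf.reg 20 (by simp)]; simp
  have e5 : τ.reg 5 = sh := by rw [hf.reg 5 (by simp)]; simp [hsh]
  have e1 : τ.mem 1 = xs := by rw [hf.mem 1 (by simp)]; simp [hxs]
  refine Runs.for_const 0 (L - sh) (fun j υ => (∀ i < L - sh + 2 ^ (L - sh), L - sh ≤ i → υ.mem 7 i = 0) ∧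
    ∀ i < j, υ.mem 7 i = 1 ∧ υ.mem 8 i = xs (sh + i) ∧ υ.rmem 0 i = H.ω (xs (sh + i)) ∧
      υ.rmem 1 i = H.ω (xs (sh + i)) ∧ υ.mem 16 i = i) 28 (by simp; omega) rfl
    e18 (by omega) (by omega) (by decide) (by simp) (by simp) ?_ ?_ ?_
  · exact ⟨fun i hi _ => hI i hi, by simp⟩
  · rintro i υ _ hi hfυ h22 ⟨i1, i2⟩
    have f5 : υ.reg 5 = sh := by rw [hfυ.reg 5 (by simp), e5]
    have f1 : υ.mem 1 = xs := by rw [hfυ.mem 1 (by simp), e1]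
    have hlt := Y.lt (sh + i) (by omega)
    have hr := S.real_eq _ hlt
    have hr' := S.real_has _ hlt
    simp only [runs_seq, runs_store, runs_rstore, safe_reg, safe_const, safe_load, safe_add, val_reg,
      val_const, val_load, val_add, h22, rsafe_input, rval_input, setMem_reg, setMem_mem, setRMem_reg,
      setRMem_mem, f5, f1, if_false, show (1 : ℕ) ≠ 7 by decide, show (1 : ℕ) ≠ 8 by decide, hr,
      true_and, cost_reg, cost_const, cost_load, cost_add, rcost_input]
    refine ⟨by omega, by omega, by omega, by omega, by omega, ⟨by omega, hr'⟩, by omega, ⟨by omega, hr'⟩,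
      by omega, by omega, ?_, ?_⟩
    · intro j hj hjs
      simp only [setReg_mem, setMem_mem, setRMem_mem]
      norm_num
      rw [Function.update_of_ne (by omega)]
      exact i1 j hj hjs
    · intro j hj
      by_cases h : j = i
      · subst h
        simp
      · have := i2 j (by omega)
        simp [Function.update_of_ne h, this]
  · rintro υ t' hfυ _ ⟨i1, i2⟩ ht'
    have f19 : υ.reg 19 = L - sh := by rw [hfυ.reg 19 (by simp), e19]
    simp only [cost_const, cost_reg, cost_sub, cost_add, cost_load] at ht ht' ⊢
    refine ⟨by omega, by rw [hfυ.reg 18 (by simp), e18], by rw [hfυ.reg 20 (by simp), e20], ?_, f19⟩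
    refine ⟨by omega, fun t ht => (i2 t ht).2.2.2.2, fun t ht h => by omega, fun t ht t' ht' h => ?_,
      by simp, fun i hi => (i2 i hi).1, fun i hi hs => ?_, fun i hi => (i2 i hi).2.1, by simp,
      fun i hi => ⟨(i2 i hi).2.2.1, (i2 i hi).2.2.2.1⟩, by simp, by omega⟩
    · rwa [(i2 t (by omega)).2.2.2.2, (i2 t' (by omega)).2.2.2.2] at h
    · rw [i1 i hi hs]
      simp

theorem build_time {n t t' t'' : ℕ} (d : ℕ → ℕ) (hn : 1 ≤ n) (hL : L ≤ 2 * k + 2)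
    (hd : ∑ q ∈ Finset.range L, d q ≤ 2 * m) (ht : t ≤ 40 * 2 ^ k + 100 * k + 200)
    (ht' : t' ≤ ∑ p ∈ Finset.Ico 0 L, (d p * (22 * L + 50) + 30 + 8) + (1 + 5))
    (ht'' : t'' ≤ (n + 2 * m) * (200 * k + 400 + 8) + 6) :
    t + (t' + t'') ≤ 2000 * (2 ^ k * (n + 2 * m)) := by
  have h1 : ∑ p ∈ Finset.Ico 0 L, (d p * (22 * L + 50) + 30 + 8) ≤
      2 * m * (100 * k + 100) + 38 * L := by
    rw [← Finset.range_eq_Ico, Finset.sum_add_distrib, Finset.sum_add_distrib, ← Finset.sum_mul]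
    simp only [Finset.sum_const, Finset.card_range, smul_eq_mul]
    have := Nat.mul_le_mul hd (show 22 * L + 50 ≤ 100 * k + 100 by omega)
    omega
  have h2 : k + 1 ≤ 2 ^ k := Nat.lt_two_pow_self
  have h3 : (n + 2 * m) * (k + 1) ≤ (n + 2 * m) * 2 ^ k := Nat.mul_le_mul_left _ h2
  have h4 : 2 ^ k ≤ (n + 2 * m) * 2 ^ k := Nat.le_mul_of_pos_left _ (by omega)
  have h5 : 2 ^ k * (n + 2 * m) = (n + 2 * m) * 2 ^ k := mul_comm _ _
  have h6 : 2 * m * (100 * k + 100) ≤ 100 * ((n + 2 * m) * (k + 1)) := by nlinarith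
  have h7 : (n + 2 * m) * (200 * k + 400 + 8) ≤ 408 * ((n + 2 * m) * (k + 1)) := by nlinarith
  omega

theorem Setup.runs_build (S : Setup M I H m k off) {σ : State}
    (Y : H.Layout (σ.mem 1) (σ.mem 2) (σ.reg 4) (σ.reg 5)) (hL : σ.reg 4 ≤ 2 * k + 2)
    (hs : σ.reg 4 - σ.reg 5 ≤ k + 1) (hC : Consts H k σ) :
    Runs M I build σ fun τ t => t ≤ 2000 * (2 ^ k * (H.n + 2 * m)) ∧
      BuildState (σ.mem 1) (σ.mem 2) (σ.reg 4) (σ.reg 5) H k H.n τ := by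
  classical
  have hw := S.word_le
  have hcw := S.cells_le
  have hk := S.k_le
  have hk1 := S.k_pos
  have hc := S.le_cells
  rw [build, runs_seq]
  refine (S.runs_buildInit Y hL hs hC).mono ?_
  rintro τ t hf ⟨ht, e18, e20, hB, e19⟩
  have e4 : τ.reg 4 = σ.reg 4 := hf.reg 4 (by simp)
  have e5 : τ.reg 5 = σ.reg 5 := hf.reg 5 (by simp)
  have e1 : τ.mem 1 = σ.mem 1 := hf.mem 1 (by simp)
  have e2 : τ.mem 2 = σ.mem 2 := hf.mem 2 (by simp)
  set L := σ.reg 4 with hL4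
  set sh := σ.reg 5 with hsh
  set xs := σ.mem 1 with hxs
  set par := σ.mem 2 with hpar
  have hCτ : Consts H k τ := hC.frame hf (by simp) (by simp) (by simp)
  have hcard := Y.card_in
  have hLL := BuildState.inc_le (N := L - sh) hk1 hL hs (e := L * L) (by simp) (by simp)
  rw [runs_seq]
  refine Runs.for 0 L (fun p υ =>
      υ.reg 20 ≤ L * p ∧ υ.reg 20 ≤ ∑ q ∈ Finset.range p, H.deg (xs q) ∧
      ∀ a b, Inc (υ.mem 5) (υ.mem 6) (υ.reg 20) a b ↔
        ∃ q < p, q - sh = a ∧ H.Hits xs L sh (xs q) b)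
    (fun p => H.deg (xs p) * (22 * L + 50) + 30) (by simp; omega) rfl e4 (by omega) (by omega)
    (by decide) (by simp) (by simp) ?_ ?_ ?_
  · refine ⟨by simp [e20], by simp [e20], fun a b => ?_⟩
    simp [e20, Inc]
  · rintro p υ _ hp hfυ h22 ⟨i1, i2, i3⟩
    have f4 : υ.reg 4 = L := by rw [hfυ.reg 4 (by simp), e4]
    have f5 : υ.reg 5 = sh := by rw [hfυ.reg 5 (by simp), e5]
    have f1 : υ.mem 1 = xs := by rw [hfυ.mem 1 (by simp), e1]
    have hLp : L * p + L ≤ L * L := by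
      rw [← Nat.mul_succ]
      exact Nat.mul_le_mul_left _ hp
    have hlt := Y.lt p hp
    simp only [runs_seq (p := Prog.assign _ _), runs_assign, safe_load, safe_reg, safe_sub, val_load,
      val_reg, val_sub, h22, f1, f5, setReg_reg, setReg_mem, true_and,
      show (22 : ℕ) ≠ 6 by decide, show (5 : ℕ) ≠ 6 by decide, if_false]
    refine ⟨by omega, by omega, ?_⟩
    refine S.runs_appendInc (v := xs p) (by simp) hlt (by simp [f4]; omega) (by simp [f4]; omega) ?_
      fun ρ t'' hfρ l1 l2 l3 ht'' => ?_
    · simpa [f4, f1] using Y.inj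
    simp [f4, f1, f5] at l1 l2 l3 ht''
    refine ⟨by simp; omega, ?_, ?_, fun a b => ?_⟩
    · simp [Nat.mul_add]; omega
    · simp [Finset.sum_range_succ]; omega
    · simp [l3, i3]
      constructor
      · rintro (⟨q, hq, h⟩ | ⟨h1, h2⟩)
        · exact ⟨q, by omega, h⟩
        · exact ⟨p, le_rfl, h1.symm, h2⟩
      · rintro ⟨q, hq, h⟩
        rcases Nat.lt_or_eq_of_le hq with hq | rfl
        · exact Or.inl ⟨q, hq, h⟩
        · exact Or.inr ⟨h.1.symm, h.2⟩
  rintro υ t' hfυ _ ⟨i1, i2, i3⟩ ht'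
  have hsumle : ∑ q ∈ Finset.range L, H.deg (xs q) ≤ 2 * m := by
    rw [← hcard.2, ← S.sum_deg]
    exact Finset.sum_le_sum_of_subset (Finset.filter_subset _ _)
  have hCυ : Consts H k υ := hCτ.frame hfυ (by simp) (by simp) (by simp)
  have f19 : υ.reg 19 = τ.reg 19 := hfυ.reg 19 (by simp)
  have f18 : υ.reg 18 = τ.reg 18 := hfυ.reg 18 (by simp)
  have hB0 : BuildState xs par L sh H k 0 υ := by
    refine ⟨hCυ, by rw [hfυ.reg 4 (by simp), e4], by rw [hfυ.reg 5 (by simp), e5],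
      by rw [hfυ.mem 1 (by simp), e1], by rw [hfυ.mem 2 (by simp), e2], by rw [f18, e18], ?_,
      fun a b => ?_, ?_, ?_⟩
    · rw [f19, hfυ.mem 16 (by simp), hfυ.mem 7 (by simp), hfυ.mem 8 (by simp), hfυ.rmem 0 (by simp),
        hfυ.rmem 1 (by simp)]
      exact hB
    · rw [i3]
      simp
    · omega
    · rw [hcard.2]
      omega
  refine S.runs_vertices (BuildState xs par L sh H k) (200 * k + 400) hCυ.reg_n (by simp) (by simp)
    (hB0.setReg _ (by simp)) ?_ ?_
  · intro v ρ hv hfρ h6 hBρ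
    exact (S.runs_buildBody Y hL hs hBρ h6 hv).mono fun ρ' t _ h => ⟨h.1, h.2.setReg _ (by simp)⟩
  · intro ρ t'' _ hBρ ht''
    refine ⟨?_, hBρ⟩
    simp only [cost_const] at ht'
    exact build_time (fun p => H.deg (xs p)) S.n_pos hL hsumle ht ht' ht''

theorem BuildState.inc_iff {σ : State} (h : BuildState xs par L sh H k H.n σ)
    (Y : H.Layout xs par L sh) (a b : ℕ) : Inc (σ.mem 5) (σ.mem 6) (σ.reg 20) a b ↔
      ∃ w < H.n, H.item xs L sh w = a ∧ H.Hits xs L sh w b := by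
  rw [h.inc]
  constructor
  · rintro (⟨q, hq, rfl, h⟩ | ⟨w, hw, -, h⟩)
    · exact ⟨xs q, Y.lt q hq, Y.item_xs hq, h⟩
    · exact ⟨w, hw, h⟩
  · rintro ⟨w, hw, h⟩
    by_cases hin : In xs L w
    · obtain ⟨q, hq, rfl⟩ := hin
      rw [Y.item_xs hq] at h
      exact Or.inl ⟨q, hq, h⟩
    · exact Or.inr ⟨w, hw, hin, h⟩

theorem BuildState.inc_le_deg {σ : State} (h : BuildState xs par L sh H k H.n σ)
    (S : Setup M I H m k off) : σ.reg 20 ≤ 2 * m := by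
  classical
  have h1 := h.le_deg
  have h2 := Finset.sum_filter_add_sum_filter_not (Finset.range H.n) (fun w => In xs L w) H.deg
  rw [S.sum_deg] at h2
  convert h1.trans_eq h2

end WCVC

/-! ### Evaluating a choice of items: correctness -/

namespace WCVC

open RealRAM

variable {H : Net} {xs par : ℕ → ℕ} {L sh A s : ℕ}

open Classical in
theorem tops_le : tops par sh A s ≤ s := by
  rw [tops]
  exact (Finset.card_filter_le _ _).trans (by simp)

/-- The components of the first `j` items have been determined; `pc` is the power of two for the
next component. -/
structure CompsInv (par : ℕ → ℕ) (sh A j pc : ℕ) (cb : ℕ → ℕ) : Prop where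
  pc_eq : pc = 2 ^ tops par sh A j
  comps : Comps par j sh A (tops par sh A j) cb
  zero : ∀ i < j, A.testBit i = false → cb i = 0

theorem CompsInv.eq_zero_iff {j pc : ℕ} {cb : ℕ → ℕ} (h : CompsInv par sh A j pc cb) {i : ℕ}
    (hi : i < j) : cb i = 0 ↔ A.testBit i = false := by
  refine ⟨fun h0 => ?_, h.zero i hi⟩
  by_contra hb
  obtain ⟨b, -, h1⟩ := h.comps.pow i hi (by simpa using hb)
  have := Nat.two_pow_pos b
  omega

theorem Comps.update {j c x : ℕ} {cb : ℕ → ℕ} (h : Comps par j sh A c cb)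
    (hpar : ∀ i < j, 1 ≤ i → par (i + sh) - sh < i) :
    Comps par j sh A c (Function.update cb j x) := by
  have e : ∀ i < j, Function.update cb j x i = cb i := fun i hi => Function.update_of_ne (by omega) _ _
  refine ⟨fun i hi hb => ?_, fun i hi h1 hb hb' => ?_, fun i hi i' hi' ht ht' => ?_, fun b hb => ?_⟩
  · rw [e i hi]
    exact h.pow i hi hb
  · have := hpar i hi h1
    rw [e i hi, e _ (by omega)]
    exact h.tree i hi h1 hb hb'
  · rw [e i hi, e i' hi']
    exact h.inj i hi i' hi' ht ht'
  · obtain ⟨i, hi, h1, h2⟩ := h.surj b hb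
    exact ⟨i, hi, h1, by rw [e i hi, h2]⟩

theorem CompsInv.first : CompsInv par sh A 1 (1 + A % 2) (Function.update cb 0 (A % 2)) := by
  classical
  have e : tops par sh A 1 = A % 2 := by
    rw [tops_succ, tops_zero]
    have h : Top par sh A 0 ↔ A.testBit 0 = true := by simp [Top]
    rw [Nat.testBit_zero, decide_eq_true_eq] at h
    by_cases hA : A % 2 = 1
    · rw [if_pos (h.2 hA), hA]
    · rw [if_neg (fun h' => hA (h.1 h'))]
      omega
  have hbit : A.testBit 0 = true ↔ A % 2 = 1 := by rw [Nat.testBit_zero, decide_eq_true_eq]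
  refine ⟨?_, ?_, ?_⟩
  · rw [e]
    rcases Nat.mod_two_eq_zero_or_one A with h | h <;> rw [h] <;> rfl
  · rw [e]
    refine ⟨fun j hj hb => ?_, fun j hj h1 => by omega, fun j hj j' hj' _ _ _ => by omega,
      fun b hb => ?_⟩
    · obtain rfl : j = 0 := by omega
      exact ⟨0, by have := hbit.1 hb; omega, by simpa using hbit.1 hb⟩
    · have hA : A % 2 = 1 := by omega
      obtain rfl : b = 0 := by omega
      exact ⟨0, by omega, ⟨hbit.2 hA, Or.inl rfl⟩, by simp [hA]⟩
  · intro i hi hb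
    obtain rfl : i = 0 := by omega
    rw [Function.update_self]
    have : ¬ A % 2 = 1 := fun h => by rw [hbit.2 h] at hb; simp at hb
    omega

/-- The next item is not chosen. -/
theorem CompsInv.skip {j pc : ℕ} {cb : ℕ → ℕ} (h : CompsInv par sh A j pc cb)
    (hpar : ∀ i < j + 1, 1 ≤ i → par (i + sh) - sh < i) (hb : A.testBit j = false) :
    CompsInv par sh A (j + 1) pc (Function.update cb j 0) := by
  classical
  have hnt : ¬ Top par sh A j := fun ht => by rw [ht.1] at hb; simp at hb
  have e : tops par sh A (j + 1) = tops par sh A j := by rw [tops_succ, if_neg hnt, Nat.add_zero]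
  have h' := h.comps.update (x := 0) (fun i hi => hpar i (by omega))
  refine ⟨by rw [e, h.pc_eq], ?_, fun i hi hi' => ?_⟩
  · rw [e]
    have hlt : ∀ {i}, i < j + 1 → A.testBit i = true → i < j := by
      intro i hi hi'
      rcases Nat.lt_succ_iff_lt_or_eq.1 hi with hi | rfl
      · exact hi
      · rw [hb] at hi'
        simp at hi'
    refine ⟨fun i hi hi' => h'.pow i (hlt hi hi') hi', fun i hi h1 hi' => h'.tree i (hlt hi hi') h1 hi',
      fun i hi i' hi' ht ht' => h'.inj i (hlt hi ht.1) i' (hlt hi' ht'.1) ht ht', fun b hb => ?_⟩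
    obtain ⟨i, hi, h1⟩ := h'.surj b hb
    exact ⟨i, by omega, h1⟩
  · by_cases hij : i = j
    · rw [hij, Function.update_self]
    · rw [Function.update_of_ne hij]
      exact h.zero i (by omega) hi'

/-- The next item belongs to the component of its parent. -/
theorem CompsInv.old {j pc : ℕ} {cb : ℕ → ℕ} (h : CompsInv par sh A j pc cb) (hj : 1 ≤ j)
    (hpar : ∀ i < j + 1, 1 ≤ i → par (i + sh) - sh < i) (hb : A.testBit j = true)
    (hb' : A.testBit (par (j + sh) - sh) = true) :
    CompsInv par sh A (j + 1) pc (Function.update cb j (cb (par (j + sh) - sh))) := by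
  classical
  have hnt : ¬ Top par sh A j := by
    rintro ⟨-, rfl | ht⟩
    · omega
    · rw [hb'] at ht
      simp at ht
  have hp := hpar j (by omega) hj
  have e : tops par sh A (j + 1) = tops par sh A j := by rw [tops_succ, if_neg hnt, Nat.add_zero]
  have h' := h.comps.update (x := cb (par (j + sh) - sh)) (fun i hi => hpar i (by omega))
  refine ⟨by rw [e, h.pc_eq], ?_, fun i hi hi' => ?_⟩
  · rw [e]
    have hlt : ∀ {i}, i < j + 1 → Top par sh A i → i < j := by
      intro i hi ht
      rcases Nat.lt_succ_iff_lt_or_eq.1 hi with hi | rfl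
      · exact hi
      · exact absurd ht hnt
    refine ⟨fun i hi hi' => ?_, fun i hi h1 hi' hi'' => ?_,
      fun i hi i' hi' ht ht' => h'.inj i (hlt hi ht) i' (hlt hi' ht') ht ht', fun b hb => ?_⟩
    · rcases Nat.lt_succ_iff_lt_or_eq.1 hi with hi | rfl
      · exact h'.pow i hi hi'
      · rw [Function.update_self]
        exact h.comps.pow _ hp hb'
    · rcases Nat.lt_succ_iff_lt_or_eq.1 hi with hi | rfl
      · exact h'.tree i hi h1 hi' hi''
      · rw [Function.update_self, Function.update_of_ne (by omega)]
    · obtain ⟨i, hi, h1⟩ := h'.surj b hb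
      exact ⟨i, by omega, h1⟩
  · by_cases hij : i = j
    · rw [hij, hb] at hi'
      simp at hi'
    · rw [Function.update_of_ne hij]
      exact h.zero i (by omega) hi'

/-- The next item starts a component. -/
theorem CompsInv.new {j pc : ℕ} {cb : ℕ → ℕ} (h : CompsInv par sh A j pc cb) (hj : 1 ≤ j)
    (hpar : ∀ i < j + 1, 1 ≤ i → par (i + sh) - sh < i) (hb : A.testBit j = true)
    (hb' : A.testBit (par (j + sh) - sh) = false) :
    CompsInv par sh A (j + 1) (pc + pc) (Function.update cb j pc) := by
  classical
  have ht : Top par sh A j := ⟨hb, Or.inr hb'⟩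
  have e : tops par sh A (j + 1) = tops par sh A j + 1 := by rw [tops_succ, if_pos ht]
  have h' := h.comps.update (x := pc) (fun i hi => hpar i (by omega))
  have hne : ∀ i < j, Top par sh A i → Function.update cb j pc i ≠ pc := by
    intro i hi hti heq
    obtain ⟨b, hbt, h1⟩ := h'.pow i hi hti.1
    rw [h1, h.pc_eq] at heq
    have := Nat.pow_right_injective le_rfl heq
    omega
  refine ⟨by rw [e, h.pc_eq]; ring, ?_, fun i hi hi' => ?_⟩
  · rw [e]
    refine ⟨fun i hi hi' => ?_, fun i hi h1 hi' hi'' => ?_, fun i hi i' hi' hti hti' heq => ?_,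
      fun b hb => ?_⟩
    · rcases Nat.lt_succ_iff_lt_or_eq.1 hi with hi | rfl
      · obtain ⟨b, hb, h1⟩ := h'.pow i hi hi'
        exact ⟨b, by omega, h1⟩
      · exact ⟨_, Nat.lt_succ_self _, by rw [Function.update_self, h.pc_eq]⟩
    · rcases Nat.lt_succ_iff_lt_or_eq.1 hi with hi | rfl
      · exact h'.tree i hi h1 hi' hi''
      · rw [hb'] at hi''
        simp at hi''
    · rcases Nat.lt_succ_iff_lt_or_eq.1 hi with hi | rfl <;>
        rcases Nat.lt_succ_iff_lt_or_eq.1 hi' with hi' | rfl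
      · exact h'.inj i hi i' hi' hti hti' heq
      · rw [Function.update_self] at heq
        exact absurd heq (hne i hi hti)
      · rw [Function.update_self] at heq
        exact absurd heq.symm (hne i' hi' hti')
      · rfl
    · rcases Nat.lt_succ_iff_lt_or_eq.1 hb with hb | rfl
      · obtain ⟨i, hi, h1⟩ := h'.surj b hb
        exact ⟨i, by omega, h1⟩
      · exact ⟨j, by omega, ht, by rw [Function.update_self, h.pc_eq]⟩
  · by_cases hij : i = j
    · rw [hij, hb] at hi'
      simp at hi'
    · rw [Function.update_of_ne hij]
      exact h.zero i (by omega) hi'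

theorem inc_succ_iff {incI incJ : ℕ → ℕ} {e i j : ℕ} :
    Inc incI incJ (e + 1) i j ↔ Inc incI incJ e i j ∨ (incI e = i ∧ incJ e = j) := by
  constructor
  · rintro ⟨x, hx, h⟩
    rcases Nat.lt_succ_iff_lt_or_eq.1 hx with hx | rfl
    · exact Or.inl ⟨x, hx, h⟩
    · exact Or.inr h
  · rintro (⟨x, hx, h⟩ | h)
    · exact ⟨x, by omega, h⟩
    · exact ⟨e, by omega, h⟩

/-- The invariant of the computation of `mask` and `kap`, after the pairs in `R` have been considered:
the items in `It` have correct values, and `bad` is set if an edge inside of the list is not covered. -/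
structure MaskInv (It : ℕ → Prop) (A s : ℕ) (cb : ℕ → ℕ) (R : ℕ → ℕ → Prop) (bad : ℕ)
    (mask kap : ℕ → ℕ) : Prop where
  mask : ∀ i, It i → ∀ b, (mask i).testBit b = true ↔
    (i < s ∧ A.testBit i = true ∧ cb i = 2 ^ b) ∨ ∃ j, R i j ∧ A.testBit j = true ∧ cb j = 2 ^ b
  kap_le : ∀ i, It i → kap i ≤ 1
  kap : ∀ i, It i → (kap i = 0 ↔ (i < s ∧ A.testBit i = true) ∨
    s ≤ i ∧ ∃ j, R i j ∧ A.testBit j = false)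
  bad : bad = 0 ↔ ∀ i j, R i j → i < s → A.testBit i = true ∨ A.testBit j = true

variable {It : ℕ → Prop} {cb mask kap : ℕ → ℕ} {R : ℕ → ℕ → Prop} {bad i j : ℕ}

theorem MaskInv.congr (h : MaskInv It A s cb R bad mask kap) {R' : ℕ → ℕ → Prop}
    (hR : ∀ i j, R' i j ↔ R i j) : MaskInv It A s cb R' bad mask kap := by
  obtain rfl : R' = R := by
    funext i j
    exact propext (hR i j)
  exact h

theorem MaskInv.chosen (h : MaskInv It A s cb R bad mask kap) (hj : A.testBit j = true) {b : ℕ}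
    (hb : cb j = 2 ^ b) : MaskInv It A s cb (fun i' j' => R i' j' ∨ (i = i' ∧ j = j')) bad
      (Function.update mask i (mask i ||| cb j)) kap := by
  refine ⟨fun i' hi' b' => ?_, h.kap_le, fun i' hi' => ?_, ?_⟩
  · by_cases hii : i' = i
    · subst hii
      rw [Function.update_self, Nat.testBit_or, Bool.or_eq_true, h.mask i' hi', hb,
        Nat.testBit_two_pow, decide_eq_true_eq]
      constructor
      · rintro ((h1 | ⟨j', h1, h2⟩) | rfl)
        · exact Or.inl h1
        · exact Or.inr ⟨j', Or.inl h1, h2⟩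
        · exact Or.inr ⟨j, Or.inr ⟨rfl, rfl⟩, hj, hb⟩
      · rintro (h1 | ⟨j', h1 | ⟨-, rfl⟩, h2⟩)
        · exact Or.inl (Or.inl h1)
        · exact Or.inl (Or.inr ⟨j', h1, h2⟩)
        · exact Or.inr (Nat.pow_right_injective le_rfl (hb.symm.trans h2.2))
    · rw [Function.update_of_ne hii, h.mask i' hi']
      simp only [Ne.symm hii, false_and, or_false]
  · rw [h.kap i' hi']
    refine or_congr_right (and_congr_right fun _ => exists_congr fun j' => ?_)
    constructor
    · exact fun h1 => ⟨Or.inl h1.1, h1.2⟩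
    · rintro ⟨h1 | ⟨-, rfl⟩, h2⟩
      · exact ⟨h1, h2⟩
      · rw [hj] at h2
        simp at h2
  · rw [h.bad]
    constructor
    · rintro h1 i' j' (h2 | ⟨rfl, rfl⟩) h3
      · exact h1 i' j' h2 h3
      · exact Or.inr hj
    · exact fun h1 i' j' h2 => h1 i' j' (Or.inl h2)

theorem MaskInv.mask_congr (h : MaskInv It A s cb R bad mask kap) (hj : A.testBit j = false)
    (i' : ℕ) (hi' : It i') (b : ℕ) : (mask i').testBit b = true ↔
    (i' < s ∧ A.testBit i' = true ∧ cb i' = 2 ^ b) ∨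
      ∃ j', (R i' j' ∨ (i = i' ∧ j = j')) ∧ A.testBit j' = true ∧ cb j' = 2 ^ b := by
  rw [h.mask i' hi']
  refine or_congr_right (exists_congr fun j' => ?_)
  constructor
  · exact fun h1 => ⟨Or.inl h1.1, h1.2⟩
  · rintro ⟨h1 | ⟨-, rfl⟩, h2⟩
    · exact ⟨h1, h2⟩
    · rw [hj] at h2
      simp at h2

/-- A pair of two items of the list, the second one of which is not chosen. -/
theorem MaskInv.inner (h : MaskInv It A s cb R bad mask kap) (hj : A.testBit j = false)
    (hi : i < s) : MaskInv It A s cb (fun i' j' => R i' j' ∨ (i = i' ∧ j = j'))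
      (if A.testBit i = true then bad else 1) mask kap := by
  refine ⟨h.mask_congr hj, h.kap_le, fun i' hi' => ?_, ?_⟩
  · rw [h.kap i' hi']
    refine or_congr_right (and_congr_right fun hs => exists_congr fun j' => ?_)
    constructor
    · exact fun h1 => ⟨Or.inl h1.1, h1.2⟩
    · rintro ⟨h1 | ⟨rfl, rfl⟩, h2⟩
      · exact ⟨h1, h2⟩
      · omega
  · split_ifs with hb
    · rw [h.bad]
      constructor
      · rintro h1 i' j' (h2 | ⟨rfl, rfl⟩) h3
        · exact h1 i' j' h2 h3
        · exact Or.inl hb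
      · exact fun h1 i' j' h2 => h1 i' j' (Or.inl h2)
    · refine iff_of_false (by simp) fun h1 => ?_
      rcases h1 i j (Or.inr ⟨rfl, rfl⟩) hi with h2 | h2
      · exact hb h2
      · rw [hj] at h2
        simp at h2

/-- A pair of an item outside of the list and an item that is not chosen. -/
theorem MaskInv.outer (h : MaskInv It A s cb R bad mask kap) (hj : A.testBit j = false)
    (hi : s ≤ i) : MaskInv It A s cb (fun i' j' => R i' j' ∨ (i = i' ∧ j = j')) bad mask
      (Function.update kap i 0) := by
  refine ⟨h.mask_congr hj, fun i' hi' => ?_, fun i' hi' => ?_, ?_⟩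
  · by_cases hii : i' = i
    · rw [hii, Function.update_self]
      omega
    · rw [Function.update_of_ne hii]
      exact h.kap_le i' hi'
  · by_cases hii : i' = i
    · subst hii
      rw [Function.update_self]
      exact iff_of_true rfl (Or.inr ⟨hi, j, Or.inr ⟨rfl, rfl⟩, hj⟩)
    · rw [Function.update_of_ne hii, h.kap i' hi']
      simp only [Ne.symm hii, false_and, or_false]
  · rw [h.bad]
    constructor
    · rintro h1 i' j' (h2 | ⟨rfl, rfl⟩) h3
      · exact h1 i' j' h2 h3
      · omega
    · exact fun h1 i' j' h2 => h1 i' j' (Or.inl h2)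

section Final

variable {pc : ℕ} (Y : H.Layout xs par L sh) (hc : CompsInv par sh A (L - sh) pc cb)
  (hR : ∀ i j, R i j ↔ ∃ w < H.n, H.item xs L sh w = i ∧ H.Hits xs L sh w j)
include Y hc hR

theorem MaskInv.eval (h : MaskInv (H.IsItem xs L sh) A (L - sh) cb R bad mask kap) :
    H.Eval xs par L sh A (tops par sh A (L - sh)) cb mask kap := by
  refine ⟨hc.comps, fun v hv b => ?_, fun v hv => ?_, fun v hv => h.kap_le _ ⟨v, hv, rfl⟩⟩
  · rw [h.mask _ ⟨v, hv, rfl⟩, Y.item_lt_iff]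
    refine or_congr_right ⟨?_, ?_⟩
    · rintro ⟨j, hj, h1⟩
      obtain ⟨w, hw, h2, h3⟩ := (hR _ _).1 hj
      exact ⟨w, hw, h2, j, h3, h1⟩
    · rintro ⟨w, hw, h2, j, h3, h1⟩
      exact ⟨j, (hR _ _).2 ⟨w, hw, h2, h3⟩, h1⟩
  · rw [h.kap _ ⟨v, hv, rfl⟩, Y.item_lt_iff, Net.Base]
    refine or_congr_right ?_
    rw [← not_lt, Y.item_lt_iff]
    refine and_congr_right fun hin => exists_congr fun j => and_congr_left fun _ => ?_
    rw [hR]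
    constructor
    · rintro ⟨w, hw, h2, h3⟩
      exact (Y.hits_congr hin h2.symm).2 h3
    · exact fun h => ⟨v, hv, rfl, h⟩

theorem MaskInv.valid_iff (h : MaskInv (H.IsItem xs L sh) A (L - sh) cb R bad mask kap) :
    H.Valid xs L sh A ↔ (A.testBit 0 = true ∨ sh = 0) ∧ bad = 0 ∧
      ∀ i, H.IsItem xs L sh i → kap i = 0 → mask i ≠ 0 := by
  have E := h.eval Y hc hR
  have hcb : ∀ j < L - sh, A.testBit j = true → ∃ b, cb j = 2 ^ b := fun j hj hA => by
    obtain ⟨b, -, h⟩ := hc.comps.pow j hj hA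
    exact ⟨b, h⟩
  constructor
  · intro hV
    refine ⟨hV.root, ?_, ?_⟩
    · rw [h.bad]
      intro i j hij hi
      obtain ⟨w, hw, rfl, h2⟩ := (hR _ _).1 hij
      exact hV.cover w (Y.item_lt_iff.1 hi) j h2
    · rintro i ⟨v, hv, rfl⟩ hk h0
      rw [E.kap_eq_zero v hv] at hk
      have hb : ∀ b, ¬ (mask (H.item xs L sh v)).testBit b = true := fun b => by simp [h0]
      by_cases hin : In xs L v
      · have hA : A.testBit (H.item xs L sh v) = true := by
          rcases hk with hk | hk
          · exact hk.2
          · exact absurd hin hk.1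
        obtain ⟨b, h1⟩ := hcb _ (Y.item_lt_iff.2 hin) hA
        exact hb b ((E.mask v hv b).2 (Or.inl ⟨hin, hA, h1⟩))
      · obtain ⟨j, h1, h2⟩ := hV.attached v hv hin hk
        obtain ⟨b, h3⟩ := hcb j (Y.hits_lt h1) h2
        exact hb b ((E.mask v hv b).2 (Or.inr ⟨v, hv, rfl, j, h1, h2, h3⟩))
  · rintro ⟨h1, h2, h3⟩
    refine ⟨h1, fun v hin j hj => ?_, fun v hv hin hB => ?_⟩
    · obtain ⟨p, hp, rfl⟩ := hin
      exact h.bad.1 h2 _ j ((hR _ _).2 ⟨xs p, Y.lt p hp, rfl, hj⟩) (Y.item_lt_iff.2 ⟨p, hp, rfl⟩)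
    · have := h3 _ ⟨v, hv, rfl⟩ ((E.kap_eq_zero v hv).2 hB)
      obtain ⟨b, hb⟩ := Nat.exists_testBit_of_ne_zero this
      rcases (E.mask v hv b).1 hb with h4 | ⟨w, hw, h4, j, h5, h6, -⟩
      · exact absurd h4.1 hin
      · exact ⟨j, (Y.hits_congr hin h4.symm).2 h5, h6⟩

end Final

theorem Net.Layout.par_lt' (Y : H.Layout xs par L sh) :
    ∀ j < L - sh, 1 ≤ j → par (j + sh) - sh < j := by
  intro j hj h1
  have := Y.par_lt (j + sh) (by omega) (by omega)
  omega

/-- A valid choice covers the edges of the tree, so `sum_two_pow_tops_le` applies. -/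
theorem Net.Valid.treeValid (hV : H.Valid xs L sh A) (Y : H.Layout xs par L sh) :
    TreeValid par sh A (L - sh) := by
  intro j hj h1
  have hp := Y.par_lt (j + sh) (by omega) (by omega)
  have ha := Y.adj (j + sh) (by omega) (by omega)
  have := hV.cover (xs (j + sh)) ⟨j + sh, by omega, rfl⟩ (par (j + sh) - sh)
    ⟨par (j + sh), by omega, ha, rfl⟩
  rwa [Y.item_xs (by omega), Nat.add_sub_cancel] at this

end WCVC

/-! ### The program that evaluates a choice of items -/

namespace WCVC

open RealRAM

variable {M : Limits} {I : Input} {H : Net} {m k : ℕ} {off : ℕ → ℕ} {xs par : ℕ → ℕ} {L sh A : ℕ}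

theorem BuildState.frame_of_disjoint {v : ℕ} {σ τ : State} {p : Prog}
    (h : BuildState xs par L sh H k v σ) (hf : Frame p σ τ)
    (hr : ∀ x ∈ [2, 3, 4, 5, 18, 19, 20], x ∉ p.regs)
    (hm : ∀ x ∈ [1, 2, 3, 5, 6, 7, 8, 16], x ∉ p.mems) (hrm : ∀ x ∈ [0, 1], x ∉ p.rmems) :
    BuildState xs par L sh H k v τ := by
  simp only [List.forall_mem_cons, List.not_mem_nil, false_imp_iff, implies_true,
    and_true] at hr hm hrm
  obtain ⟨r2, r3, r4, r5, r18, r19, r20⟩ := hr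
  obtain ⟨m1, m2, m3, m5, m6, m7, m8, m16⟩ := hm
  refine ⟨h.consts.frame hf r2 r3 m3, ?_, ?_, ?_, ?_, ?_, ?_, ?_, ?_, ?_⟩
  · rw [hf.reg _ r4, h.reg_L]
  · rw [hf.reg _ r5, h.reg_sh]
  · rw [hf.mem _ m1, h.mem_xs]
  · rw [hf.mem _ m2, h.mem_par]
  · rw [hf.reg _ r18, h.reg_s]
  · rw [hf.reg _ r19, hf.mem _ m16, hf.mem _ m7, hf.mem _ m8, hf.rmem _ hrm.1, hf.rmem _ hrm.2]
    exact h.inv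
  · rw [hf.reg _ r20, hf.mem _ m5, hf.mem _ m6]
    exact h.inc
  · rw [hf.reg _ r20, hf.reg _ r19]
    exact h.le_list
  · rw [hf.reg _ r20]
    exact h.le_deg

/-- Bounds for the length of the list and for the number of items of the list. -/
structure Small (H : Net) (k : ℕ) (xs par : ℕ → ℕ) (L sh : ℕ) : Prop extends
    H.Layout xs par L sh where
  le_L : L ≤ 2 * k + 2
  le_s : L - sh ≤ k + 1

theorem Small.two_pow_le (Y : Small H k xs par L sh) : 2 ^ (L - sh) ≤ 2 * 2 ^ k := by
  calc 2 ^ (L - sh) ≤ 2 ^ (k + 1) := Nat.pow_le_pow_right (by omega) Y.le_s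
    _ = 2 * 2 ^ k := by ring

theorem Net.item_lt (Y : H.Layout xs par L sh) (v : ℕ) :
    H.item xs L sh v < L - sh + 2 ^ (L - sh) := by
  by_cases hin : In xs L v
  · exact lt_of_lt_of_le (Y.item_lt_iff.2 hin) (Nat.le_add_right _ _)
  · exact (Net.item_not_in_lt hin).2

theorem Net.IsItem.lt {i : ℕ} (h : H.IsItem xs L sh i) (Y : H.Layout xs par L sh) :
    i < L - sh + 2 ^ (L - sh) := by
  obtain ⟨v, -, rfl⟩ := h
  exact Net.item_lt Y v

/-- Find the components of the chosen items; the choice is in register `23`. -/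
def evalComps : Prog :=
  .store 9 (.const 0) (.reg 23 % .const 2) ;; .assign 25 (.const 1 + .reg 23 % .const 2) ;;
  .for 27 (.const 1) 18
    (.ite (.lt (.reg 23 / .load 3 (.reg 27) % .const 2) (.const 1)) (.store 9 (.reg 27) (.const 0))
      (.ite (.lt (.const 0) (.load 9 (.load 2 (.reg 27 + .reg 5) - .reg 5)))
        (.store 9 (.reg 27) (.load 9 (.load 2 (.reg 27 + .reg 5) - .reg 5)))
        (.store 9 (.reg 27) (.reg 25) ;; .assign 25 (.reg 25 + .reg 25))))

@[simp] theorem evalComps_regs : evalComps.regs = [25, 27, 25, 27] := rfl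
@[simp] theorem evalComps_mems : evalComps.mems = [9, 9, 9, 9] := rfl
@[simp] theorem evalComps_rmems : evalComps.rmems = [] := rfl

theorem Setup.runs_evalComps (S : Setup M I H m k off) (Y : Small H k xs par L sh) {σ : State}
    (hB : BuildState xs par L sh H k H.n σ) (hA : σ.reg 23 = A) (hA2 : A < 2 ^ (L - sh)) :
    Runs M I evalComps σ fun τ t => t ≤ 60 * H.n + 20 ∧
      CompsInv par sh A (L - sh) (τ.reg 25) (τ.mem 9) := by
  have hw := S.word_le
  have hcw := S.cells_le
  have hk := S.k_le
  have hp := S.two_pow_le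
  have h2 := Y.two_pow_le
  have hs := Y.le_s
  have hL := Y.le_L
  have hsh := Y.sh_lt
  have hn1 := S.n_pos
  have hLn := Y.le_n
  have hA3 : A % 2 < 2 := Nat.mod_lt _ (by omega)
  rw [evalComps]
  simp only [runs_seq (p := Prog.assign _ _), runs_seq (p := Prog.store _ _ _), runs_assign,
    runs_store, safe_reg, safe_const, safe_add, safe_mod, val_reg, val_const, val_add, val_mod,
    setMem_reg, hA, true_and, cost_reg, cost_const, cost_mod, cost_add]
  refine ⟨by omega, by omega, ⟨by omega, by omega⟩, ⟨by omega, ⟨by omega, by omega⟩, by omega⟩, ?_⟩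
  refine Runs.for_const 1 (L - sh) (fun j τ => CompsInv par sh A j (τ.reg 25) (τ.mem 9)) 35
    (by simp; omega) rfl (by simp [hB.reg_s]) (by omega) (by omega) (by decide) (by simp) (by simp)
    ?_ ?_ ?_
  · simpa using CompsInv.first (par := par) (sh := sh) (A := A) (cb := σ.mem 9)
  · intro j τ hj1 hj hf h27 hI
    have e23 : τ.reg 23 = A := by rw [hf.reg 23 (by simp)]; simp [hA]
    have e5 : τ.reg 5 = sh := by rw [hf.reg 5 (by simp)]; simp [hB.reg_sh]
    have e2 : τ.mem 2 = par := by rw [hf.mem 2 (by simp)]; simp [hB.mem_par]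
    have e3 : τ.mem 3 j = 2 ^ j := by
      rw [hf.mem 3 (by simp)]
      simpa using hB.consts.pw j (by omega)
    have hpar := Y.par_lt'
    have hpj := hpar j hj hj1
    have hpj' := Y.par_lt (j + sh) (by omega) (by omega)
    have hpar' : ∀ i < j + 1, 1 ≤ i → par (i + sh) - sh < i := fun i hi => hpar i (by omega)
    have h2j : 2 ^ j ≤ 2 ^ (L - sh) := Nat.pow_le_pow_right (by omega) (by omega)
    have hpc : τ.reg 25 ≤ 2 ^ (L - sh) := by
      rw [hI.pc_eq]
      exact Nat.pow_le_pow_right (by omega) (tops_le.trans (by omega))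
    have hdiv : A / 2 ^ j ≤ A := Nat.div_le_self _ _
    have hmod : A / 2 ^ j % 2 < 2 := Nat.mod_lt _ (by omega)
    have hbit : A.testBit j = true ↔ A / 2 ^ j % 2 = 1 := by
      rw [Nat.testBit_eq_decide_div_mod_eq, decide_eq_true_eq]
    have hzero := hI.eq_zero_iff hpj
    have hcb : τ.mem 9 (par (j + sh) - sh) < M.word := by
      by_cases h : A.testBit (par (j + sh) - sh) = true
      · obtain ⟨b, hb, h1⟩ := hI.comps.pow _ hpj h
        rw [h1]
        have : 2 ^ b ≤ 2 ^ (L - sh) := Nat.pow_le_pow_right (by omega) (by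
          have := tops_le (par := par) (sh := sh) (A := A) (s := j); omega)
        omega
      · rw [hzero.2 (by simpa using h)]
        omega
    simp only [runs_ite, runs_seq, runs_store, runs_assign, csafe_lt, holds_lt, safe_reg, safe_const,
      safe_add, safe_sub, safe_div, safe_mod, safe_load, val_reg, val_const, val_add, val_sub, val_div,
      val_mod, val_load, h27, e23, e5, e2, e3, setMem_reg, true_and, ccost_lt, cost_reg, cost_const,
      cost_add, cost_sub, cost_div, cost_mod, cost_load]
    refine ⟨⟨⟨⟨by omega, by omega⟩, by omega, by omega⟩, by omega⟩,
      fun h0 => ⟨by omega, by omega, by omega, ?_⟩,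
      fun h0 => ⟨⟨by omega, ⟨⟨by omega, by omega⟩, by omega⟩, by omega⟩, fun h1 => ?_, fun h1 => ?_⟩⟩
    · have hb : A.testBit j = false := by
        rw [← Bool.not_eq_true, hbit]
        omega
      simpa using hI.skip hpar' hb
    · have hb' : A.testBit (par (j + sh) - sh) = true := by
        rw [← Bool.not_eq_false, ← hzero]
        omega
      refine ⟨by omega, ⟨⟨by omega, by omega⟩, by omega⟩, by omega, ?_⟩
      simpa using hI.old hj1 hpar' (hbit.2 (by omega)) hb'
    · have hb' := hzero.1 (by omega)
      refine ⟨by omega, by omega, by omega, ?_⟩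
      simpa using hI.new hj1 hpar' (hbit.2 (by omega)) hb'
  · intro τ t hf _ hI ht
    have : (L - sh - 1) * (35 + 8) ≤ 43 * H.n := by omega
    simp only [cost_const] at ht
    exact ⟨by omega, hI⟩

theorem CompsInv.cb_lt {s pc : ℕ} {cb : ℕ → ℕ} (h : CompsInv par sh A s pc cb) {j : ℕ}
    (hj : j < s) : cb j < 2 ^ s := by
  by_cases hA : A.testBit j = true
  · obtain ⟨b, hb, h1⟩ := h.comps.pow j hj hA
    rw [h1]
    have := tops_le (par := par) (sh := sh) (A := A) (s := s)
    exact Nat.pow_lt_pow_right (by omega) (by omega)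
  · rw [h.zero j hj (by simpa using hA)]
    positivity

/-- Initialize the masks of the items in the list `16`. Register `24` will be set if the choice is
not valid. -/
def evalInit : Prog :=
  .assign 24 (.const 0) ;;
  .for 27 (.const 0) 19 (.assign 28 (.load 16 (.reg 27)) ;;
    .ite (.lt (.reg 28) (.reg 18))
      (.store 10 (.reg 28) (.load 9 (.reg 28)) ;;
        .ite (.lt (.const 0) (.load 9 (.reg 28))) (.store 11 (.reg 28) (.const 0))
          (.store 11 (.reg 28) (.const 1)))
      (.store 10 (.reg 28) (.const 0) ;; .store 11 (.reg 28) (.const 1)))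

@[simp] theorem evalInit_regs : evalInit.regs = [24, 27, 28, 27] := rfl
@[simp] theorem evalInit_mems : evalInit.mems = [10, 11, 11, 10, 11] := rfl
@[simp] theorem evalInit_rmems : evalInit.rmems = [] := rfl

theorem MaskInv.insert {It It' : ℕ → Prop} {cb : ℕ → ℕ} {bad i s : ℕ} {mask kap : ℕ → ℕ}
    (h : MaskInv It A s cb (fun _ _ => False) bad mask kap) (hIt : ∀ i', It' i' → i' = i ∨ It i')
    {x y : ℕ} (hx : ∀ b, x.testBit b = true ↔ i < s ∧ A.testBit i = true ∧ cb i = 2 ^ b)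
    (hy1 : y ≤ 1) (hy : y = 0 ↔ i < s ∧ A.testBit i = true) :
    MaskInv It' A s cb (fun _ _ => False) bad (Function.update mask i x)
      (Function.update kap i y) := by
  refine ⟨fun i' hi' b => ?_, fun i' hi' => ?_, fun i' hi' => ?_, h.bad⟩ <;>
    by_cases hii : i' = i
  · subst hii
    rw [Function.update_self, hx]
    simp
  · rw [Function.update_of_ne hii]
    exact h.mask i' ((hIt i' hi').resolve_left hii) b
  · rwa [hii, Function.update_self]
  · rw [Function.update_of_ne hii]
    exact h.kap_le i' ((hIt i' hi').resolve_left hii)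
  · subst hii
    rw [Function.update_self, hy]
    simp
  · rw [Function.update_of_ne hii]
    exact h.kap i' ((hIt i' hi').resolve_left hii)

theorem Setup.runs_evalInit (S : Setup M I H m k off) (Y : Small H k xs par L sh) {σ : State}
    (hB : BuildState xs par L sh H k H.n σ)
    (hc : CompsInv par sh A (L - sh) (σ.reg 25) (σ.mem 9)) :
    Runs M I evalInit σ fun τ t => t ≤ 50 * H.n + 20 ∧
      MaskInv (H.IsItem xs L sh) A (L - sh) (σ.mem 9) (fun _ _ => False) (τ.reg 24) (τ.mem 10)
        (τ.mem 11) ∧ ∀ i, H.IsItem xs L sh i → τ.mem 10 i < 2 ^ (L - sh) := by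
  have hw := S.word_le
  have hcw := S.cells_le
  have hk := S.k_le
  have hp := S.two_pow_le
  have h2 := Y.two_pow_le
  have hs := Y.le_s
  have hNn := hB.inv.N_le_n Y.toLayout
  have hlst := hB.inv.lst_items Y.toLayout
  have hNc := hB.inv.N_le_pow
  have hk1 := S.k_pos
  set N := σ.reg 19 with hN
  set lst := σ.mem 16 with hl
  rw [evalInit]
  simp only [runs_seq (p := Prog.assign _ _), runs_assign, safe_const, val_const]
  refine ⟨by omega, ?_⟩
  refine Runs.for_const 0 N (fun t τ => MaskInv (fun i => ∃ x < t, lst x = i) A (L - sh) (σ.mem 9)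
      (fun _ _ => False) (τ.reg 24) (τ.mem 10) (τ.mem 11) ∧
      ∀ x < t, τ.mem 10 (lst x) < 2 ^ (L - sh)) 30 (by simp; omega) rfl (by simp [hN]) (by omega)
    (by omega) (by decide) (by simp) (by simp) ?_ ?_ ?_
  · refine ⟨⟨?_, ?_, ?_, ?_⟩, ?_⟩ <;> simp
  · rintro t τ _ ht hf h27 ⟨i1, i2⟩
    have e18 : τ.reg 18 = L - sh := by rw [hf.reg 18 (by simp)]; simp [hB.reg_s]
    have e16 : τ.mem 16 = lst := by rw [hf.mem 16 (by simp)]; simp [hl]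
    have e9 : τ.mem 9 = σ.mem 9 := by rw [hf.mem 9 (by simp)]; simp
    have hi := (Net.mem_items.1 (hlst.1 t ht)).lt Y.toLayout
    set i := lst t with hi'
    have hIt : ∀ i', (∃ x < t + 1, lst x = i') → i' = i ∨ ∃ x < t, lst x = i' := by
      rintro i' ⟨x, hx, rfl⟩
      rcases Nat.lt_succ_iff_lt_or_eq.1 hx with hx | rfl
      · exact Or.inr ⟨x, hx, rfl⟩
      · exact Or.inl rfl
    have hup : ∀ y < 2 ^ (L - sh), ∀ x < t + 1,
        Function.update (τ.mem 10) i y (lst x) < 2 ^ (L - sh) := by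
      intro y hy x hx
      by_cases h : lst x = i
      · rwa [h, Function.update_self]
      · rw [Function.update_of_ne h]
        rcases Nat.lt_succ_iff_lt_or_eq.1 hx with hx | rfl
        · exact i2 x hx
        · exact absurd rfl h
    simp only [runs_ite, runs_seq, runs_store, runs_assign, csafe_lt, holds_lt, safe_reg, safe_const,
      safe_load, val_reg, val_const, val_load, h27, e18, e16, e9, setReg_reg, setReg_mem, setMem_mem,
      setMem_reg, show (18 : ℕ) ≠ 28 by decide, show (9 : ℕ) ≠ 10 by decide, if_false, if_true,
      true_and, ccost_lt, cost_reg, cost_const, cost_load, ← hi']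
    refine ⟨by omega, fun his => ?_, fun his => ?_⟩
    · have hcb := hc.cb_lt his
      refine ⟨by omega, by omega, by omega, fun h0 => ⟨by omega, by omega, by omega, ?_, ?_⟩,
        fun h0 => ⟨by omega, by omega, by omega, ?_, ?_⟩⟩
      · have hA : A.testBit i = true := by
          rw [← Bool.not_eq_false, ← hc.eq_zero_iff his]
          omega
        obtain ⟨b, -, hb⟩ := hc.comps.pow i his hA
        have := i1.insert hIt (x := σ.mem 9 i) (y := 0) (fun b' => ?_) (by omega)
          (iff_of_true rfl ⟨his, hA⟩)
        · simpa using this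
        · rw [hb, Nat.testBit_two_pow, decide_eq_true_eq]
          exact ⟨fun h => ⟨his, hA, by rw [h]⟩, fun h => Nat.pow_right_injective le_rfl h.2.2⟩
      · simpa using hup _ hcb
      · have hz : σ.mem 9 i = 0 := by omega
        have hA : A.testBit i = false := (hc.eq_zero_iff his).1 hz
        have := i1.insert hIt (x := σ.mem 9 i) (y := 1) (fun b' => ?_) (by omega)
          (iff_of_false (by omega) (by simp [hA]))
        · simpa using this
        · rw [hz]
          simp [hA]
      · simpa using hup _ hcb
    · refine ⟨by omega, by omega, by omega, by omega, by omega, ?_, ?_⟩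
      · have := i1.insert hIt (x := 0) (y := 1) (fun b' => ?_) (by omega)
          (iff_of_false (by omega) (by simp [his]))
        · simpa using this
        · simp [his]
      · simpa using hup 0 (by positivity)
  · rintro τ t hf _ ⟨i1, i2⟩ ht
    have hx : ∀ i, H.IsItem xs L sh i → ∃ x < N, lst x = i := fun i hi =>
      hlst.2 i (Net.mem_items.2 hi)
    simp only [cost_const] at ht ⊢
    refine ⟨by omega, ⟨fun i hi => i1.mask i (hx i hi), fun i hi => i1.kap_le i (hx i hi),
      fun i hi => i1.kap i (hx i hi), i1.bad⟩, fun i hi => ?_⟩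
    obtain ⟨x, hx, rfl⟩ := hx i hi
    exact i2 x hx

/-- Consider all incidences. -/
def evalInc : Prog :=
  .for 27 (.const 0) 20 (.assign 28 (.load 5 (.reg 27)) ;; .assign 29 (.load 6 (.reg 27)) ;;
    .ite (.lt (.const 0) (.load 9 (.reg 29)))
      (.store 10 (.reg 28) (.op .lor (.load 10 (.reg 28)) (.load 9 (.reg 29))))
      (.ite (.lt (.reg 28) (.reg 18))
        (.ite (.lt (.const 0) (.load 9 (.reg 28))) .skip (.assign 24 (.const 1)))
        (.store 11 (.reg 28) (.const 0))))

@[simp] theorem evalInc_regs : evalInc.regs = [27, 28, 29, 24, 27] := rfl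
@[simp] theorem evalInc_mems : evalInc.mems = [10, 11] := rfl
@[simp] theorem evalInc_rmems : evalInc.rmems = [] := rfl

theorem Setup.runs_evalInc (S : Setup M I H m k off) (Y : Small H k xs par L sh) {σ : State}
    (hB : BuildState xs par L sh H k H.n σ)
    (hc : CompsInv par sh A (L - sh) (σ.reg 25) (σ.mem 9))
    (hM : MaskInv (H.IsItem xs L sh) A (L - sh) (σ.mem 9) (fun _ _ => False) (σ.reg 24) (σ.mem 10)
        (σ.mem 11)) (hml : ∀ i, H.IsItem xs L sh i → σ.mem 10 i < 2 ^ (L - sh)) :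
    Runs M I evalInc σ fun τ t => t ≤ 80 * m + 20 ∧
      MaskInv (H.IsItem xs L sh) A (L - sh) (σ.mem 9) (Inc (σ.mem 5) (σ.mem 6) (σ.reg 20))
        (τ.reg 24) (τ.mem 10) (τ.mem 11) ∧
      ∀ i, H.IsItem xs L sh i → τ.mem 10 i < 2 ^ (L - sh) := by
  have hw := S.word_le
  have hcw := S.cells_le
  have hk := S.k_le
  have hp := S.two_pow_le
  have h2 := Y.two_pow_le
  have hs := Y.le_s
  have hle := hB.inc_le_deg S
  have hinc := hB.inc_iff Y.toLayout
  have h24 := BuildState.inc_le S.k_pos Y.le_L hs hB.le_list hB.inv.N_le_pow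
  have hc' := S.le_cells
  have hk1 := S.k_pos
  rw [evalInc]
  refine Runs.for_const 0 (σ.reg 20) (fun e τ => MaskInv (H.IsItem xs L sh) A (L - sh) (σ.mem 9)
      (Inc (σ.mem 5) (σ.mem 6) e) (τ.reg 24) (τ.mem 10) (τ.mem 11) ∧
      ∀ i, H.IsItem xs L sh i → τ.mem 10 i < 2 ^ (L - sh)) 32 (by simp; omega) rfl rfl (by omega)
    (by omega) (by decide) (by simp) (by simp) ?_ ?_ ?_
  · refine ⟨?_, by simpa using hml⟩
    simp only [setReg_mem, setReg_reg, show (24 : ℕ) ≠ 27 by decide, if_false]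
    exact hM.congr (by simp [Inc])
  · rintro e τ _ he hf h27 ⟨i1, i2⟩
    have e18 : τ.reg 18 = L - sh := by rw [hf.reg 18 (by simp)]; simp [hB.reg_s]
    have e5 : τ.mem 5 = σ.mem 5 := hf.mem 5 (by simp)
    have e6 : τ.mem 6 = σ.mem 6 := hf.mem 6 (by simp)
    have e9 : τ.mem 9 = σ.mem 9 := hf.mem 9 (by simp)
    obtain ⟨w, hw', hwi, hit⟩ := (hinc _ _).1 ⟨e, he, rfl, rfl⟩
    have hI : H.IsItem xs L sh (σ.mem 5 e) := ⟨w, hw', hwi⟩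
    have hi := hI.lt Y.toLayout
    have hj := Y.hits_lt hit
    set i := σ.mem 5 e with hi'
    set j := σ.mem 6 e with hj'
    have hcb := hc.cb_lt hj
    have hmi := i2 i hI
    have hor := Nat.or_lt_two_pow hmi hcb
    have hsucc : ∀ a b, Inc (σ.mem 5) (σ.mem 6) (e + 1) a b ↔ Inc (σ.mem 5) (σ.mem 6) e a b ∨
        (i = a ∧ j = b) := fun a b => inc_succ_iff
    simp only [runs_ite, runs_seq, runs_store, runs_assign, runs_skip, csafe_lt, holds_lt, safe_reg,
      safe_const, safe_load, safe_lor, val_reg, val_const, val_load, val_lor, h27, e18, e5, e6, e9,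
      setReg_reg, setReg_mem, show (18 : ℕ) ≠ 28 by decide, show (18 : ℕ) ≠ 29 by decide,
      show (27 : ℕ) ≠ 28 by decide, show (28 : ℕ) ≠ 29 by decide, if_false, if_true, true_and, ← hi',
      ← hj', ccost_lt, cost_reg, cost_const, cost_load, cost_op]
    refine ⟨by omega, by omega, by omega, fun h0 => ⟨by omega, ⟨by omega, by omega, by omega⟩,
      by omega, ?_, ?_⟩, fun h0 => ⟨fun his => ⟨by omega, fun h1 => ⟨by omega, ?_, ?_⟩,
        fun h1 => ⟨by omega, by omega, ?_, ?_⟩⟩, fun his => ⟨by omega, by omega, by omega, ?_, ?_⟩⟩⟩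
    · have hA : A.testBit j = true := by
        rw [← Bool.not_eq_false, ← hc.eq_zero_iff hj]
        omega
      obtain ⟨b, -, hb⟩ := hc.comps.pow j hj hA
      simpa using (i1.chosen (i := i) hA hb).congr hsucc
    · intro i' hi'
      simp
      by_cases h : i' = i
      · rw [h, Function.update_self]
        exact hor
      · rw [Function.update_of_ne h]
        exact i2 i' hi'
    · have hA := (hc.eq_zero_iff hj).1 (by omega)
      have hA' : A.testBit i = true := by
        rw [← Bool.not_eq_false, ← hc.eq_zero_iff his]
        omega
      have := (i1.inner hA his).congr hsucc
      rw [if_pos hA'] at this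
      simpa using this
    · simpa using i2
    · have hA := (hc.eq_zero_iff hj).1 (by omega)
      have hA' := (hc.eq_zero_iff his).1 (by omega)
      have := (i1.inner hA his).congr hsucc
      rw [if_neg (by simp [hA'])] at this
      simpa using this
    · simpa using i2
    · have hA := (hc.eq_zero_iff hj).1 (by omega)
      simpa using (i1.outer hA (not_lt.1 his)).congr hsucc
    · simpa using i2
  · rintro τ t hf _ ⟨i1, i2⟩ ht
    simp only [cost_const] at ht
    exact ⟨by omega, i1, i2⟩

end WCVC

namespace WCVC

open RealRAM

variable {M : Limits} {I : Input} {H : Net} {m k : ℕ} {off : ℕ → ℕ} {xs par : ℕ → ℕ} {L sh A : ℕ}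

/-- Determine the number and the weight of the vertices of `Net.Base`, and the additional weights. -/
def evalSum : Prog :=
  .assign 26 (.const 0) ;; .rstore 3 (.const 0) .zero ;;
  .for 27 (.const 0) 19 (.assign 28 (.load 16 (.reg 27)) ;;
    .ite (.lt (.const 0) (.load 11 (.reg 28))) (.rstore 4 (.reg 28) (.load 0 (.reg 28)))
      (.rstore 4 (.reg 28) .zero ;; .assign 26 (.reg 26 + .load 7 (.reg 28)) ;;
        .rstore 3 (.const 0) (.load 3 (.const 0) + .load 1 (.reg 28)) ;;
        .ite (.lt (.load 10 (.reg 28)) (.const 1)) (.assign 24 (.const 1)) .skip)) ;;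
  .ite (.and (.lt (.const 0) (.reg 5)) (.lt (.load 9 (.const 0)) (.const 1)))
    (.assign 24 (.const 1)) .skip


theorem Net.BuildInv.sum_lst {N : ℕ} {lst cn rp : ℕ → ℕ} {mw sw : ℕ → ℝ}
    (hI : H.BuildInv xs L sh H.n N lst cn rp mw sw) (Y : H.Layout xs par L sh)
    {R : Type*} [AddCommMonoid R] (f : ℕ → R) :
    ∑ t ∈ Finset.range N, f (lst t) = ∑ i ∈ H.items xs L sh, f i := by
  classical
  have h := hI.lst_items Y
  have e : H.items xs L sh = (Finset.range N).image lst := by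
    ext i
    rw [Finset.mem_image]
    constructor
    · intro hi
      obtain ⟨t, ht, h'⟩ := h.2 i hi
      exact ⟨t, Finset.mem_range.2 ht, h'⟩
    · rintro ⟨t, ht, rfl⟩
      exact h.1 t (Finset.mem_range.1 ht)
  rw [e, Finset.sum_image]
  intro t ht t' ht'
  exact hI.lst_inj t (by simpa using ht) t' (by simpa using ht')

theorem Net.Counts.sum_le {cn rp : ℕ → ℕ} {mw sw : ℕ → ℝ} (hC : H.Counts xs L sh cn rp mw sw) :
    ∑ i ∈ H.items xs L sh, cn i ≤ H.n := by
  classical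
  calc ∑ i ∈ H.items xs L sh, cn i
      ≤ ∑ i ∈ H.items xs L sh, ({w ∈ Finset.range H.n | H.item xs L sh w = i} : Finset ℕ).card :=
        Finset.sum_le_sum fun i hi => by rw [← hC.cnt i hi]; omega
    _ = (Finset.range H.n).card := by
        rw [Net.items, ← Finset.card_eq_sum_card_image]
    _ = H.n := Finset.card_range _

/-- The result of the evaluation of a choice. -/
structure EvalState (xs par : ℕ → ℕ) (L sh : ℕ) (H : Net) (k A : ℕ) (σ : State) : Prop where
  built : BuildState xs par L sh H k H.n σ
  reg_A : σ.reg 23 = A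
  pc : σ.reg 25 = 2 ^ tops par sh A (L - sh)
  eval : H.Eval xs par L sh A (tops par sh A (L - sh)) (σ.mem 9) (σ.mem 10) (σ.mem 11)
  valid : σ.reg 24 = 0 ↔ H.Valid xs L sh A
  cnt : σ.reg 26 = ∑ i ∈ H.items xs L sh with σ.mem 11 i = 0, σ.mem 7 i
  weight : σ.rmem 3 0 = ∑ i ∈ H.items xs L sh with σ.mem 11 i = 0, σ.rmem 1 i
  cw : ∀ i, H.IsItem xs L sh i → σ.rmem 4 i = if σ.mem 11 i = 0 then 0 else σ.rmem 0 i

theorem Setup.runs_evalSum (S : Setup M I H m k off) (Y : Small H k xs par L sh) {σ : State}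
    (hB : BuildState xs par L sh H k H.n σ) (hA : σ.reg 23 = A)
    (hc : CompsInv par sh A (L - sh) (σ.reg 25) (σ.mem 9))
    (hM : MaskInv (H.IsItem xs L sh) A (L - sh) (σ.mem 9) (Inc (σ.mem 5) (σ.mem 6) (σ.reg 20))
      (σ.reg 24) (σ.mem 10) (σ.mem 11)) :
    Runs M I evalSum σ fun τ t => t ≤ 60 * H.n + 40 ∧ EvalState xs par L sh H k A τ := by
  have hw := S.word_le
  have hcw := S.cells_le
  have hp := S.two_pow_le
  have hk := S.k_le
  have hk1 := S.k_pos
  have h2 := Y.two_pow_le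
  have hs := Y.le_s
  have hsh := Y.sh_lt
  have hNn := hB.inv.N_le_n Y.toLayout
  have hlst := hB.inv.lst_items Y.toLayout
  have hNc := hB.inv.N_le_pow
  have hC := hB.inv.counts Y.toLayout
  have hCs := hC.sum_le
  rw [← hB.inv.sum_lst Y.toLayout] at hCs
  have hv := hM.valid_iff Y.toLayout hc (hB.inc_iff Y.toLayout)
  have hE := hM.eval Y.toLayout hc (hB.inc_iff Y.toLayout)
  set N := σ.reg 19 with hN
  set lst := σ.mem 16 with hl
  rw [evalSum]
  simp only [runs_seq (p := Prog.assign _ _), runs_seq (p := Prog.rstore _ _ _), runs_assign,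
    runs_rstore, safe_const, val_const, rsafe_zero, rval_zero, true_and]
  refine ⟨by omega, by omega, by omega, ?_⟩
  rw [runs_seq]
  refine Runs.for_const 0 N (fun t τ =>
      τ.reg 26 = ∑ x ∈ Finset.range t, (if σ.mem 11 (lst x) = 0 then σ.mem 7 (lst x) else 0) ∧
      τ.rmem 3 0 = ∑ x ∈ Finset.range t, (if σ.mem 11 (lst x) = 0 then σ.rmem 1 (lst x) else 0) ∧
      (∀ x < t, τ.rmem 4 (lst x) = if σ.mem 11 (lst x) = 0 then 0 else σ.rmem 0 (lst x)) ∧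
      (τ.reg 24 = 0 ↔ σ.reg 24 = 0 ∧ ∀ x < t, σ.mem 11 (lst x) = 0 → σ.mem 10 (lst x) ≠ 0))
    45 (by simp; omega) rfl (by simp [hN]) (by omega)
    (by omega) (by decide) (by simp) (by simp) ?_ ?_ ?_
  · simp
  · rintro t τ _ ht hf h27 ⟨i1, i2, i3, i4⟩
    have e16 : τ.mem 16 = lst := by rw [hf.mem 16 (by simp)]; simp [hl]
    have e11 : τ.mem 11 = σ.mem 11 := by rw [hf.mem 11 (by simp)]; simp
    have e10 : τ.mem 10 = σ.mem 10 := by rw [hf.mem 10 (by simp)]; simp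
    have e7 : τ.mem 7 = σ.mem 7 := by rw [hf.mem 7 (by simp)]; simp
    have e0 : τ.rmem 0 = σ.rmem 0 := by rw [hf.rmem 0 (by simp)]; simp
    have e1 : τ.rmem 1 = σ.rmem 1 := by rw [hf.rmem 1 (by simp)]; simp
    have hi := (Net.mem_items.1 (hlst.1 t ht)).lt Y.toLayout
    have hsum : τ.reg 26 + σ.mem 7 (lst t) ≤ H.n := by
      refine le_trans ?_ hCs
      have h1 : ∑ x ∈ Finset.range (t + 1), σ.mem 7 (lst x) ≤ ∑ x ∈ Finset.range N, σ.mem 7 (lst x) :=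
        Finset.sum_le_sum_of_subset (Finset.range_subset_range.2 ht)
      refine le_trans ?_ h1
      rw [Finset.sum_range_succ, i1]
      refine Nat.add_le_add_right (Finset.sum_le_sum fun x _ => ?_) _
      split_ifs <;> omega
    have hinj : ∀ x < t, lst x ≠ lst t := fun x hx h => by
      have := hB.inv.lst_inj x (by omega) t ht h
      omega
    set i := lst t with hi'
    simp only [runs_ite, runs_seq, runs_rstore, runs_assign, runs_skip, csafe_lt, holds_lt,
      safe_reg, safe_const, safe_load, safe_add, val_reg, val_const, val_load, val_add, rsafe_load,
      rsafe_zero, rsafe_add, rval_load, rval_zero, rval_add, h27, e16, e11, e10, e7, e0, e1,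
      setReg_reg, setReg_mem, setReg_rmem, setRMem_mem, setRMem_reg, setRMem_rmem,
      show (26 : ℕ) ≠ 28 by decide, show (28 : ℕ) ≠ 26 by decide, show (3 : ℕ) ≠ 4 by decide,
      show (1 : ℕ) ≠ 4 by decide, if_false, if_true, true_and, ← hi',
      ccost_lt, cost_reg, cost_const, cost_load, cost_add, rcost_load, rcost_zero, rcost_add]
    have hforall : ∀ P : ℕ → Prop, (∀ x < t + 1, P x) ↔ (∀ x < t, P x) ∧ P t := by
      intro P
      constructor
      · exact fun h => ⟨fun x hx => h x (by omega), h t (by omega)⟩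
      · rintro ⟨h1, h2⟩ x hx
        rcases Nat.lt_succ_iff_lt_or_eq.1 hx with hx | rfl
        · exact h1 x hx
        · exact h2
    have hcw : ∀ (g : ℝ), (∀ x < t, Function.update (τ.rmem 4) i g (lst x) =
        if σ.mem 11 (lst x) = 0 then 0 else σ.rmem 0 (lst x)) := by
      intro g x hx
      rw [Function.update_of_ne (hinj x hx)]
      exact i3 x hx
    simp only [hforall] at i4 ⊢
    refine ⟨by omega, by omega, fun h0 => ⟨by omega, by omega, by omega, ?_⟩, fun h0 => ⟨by omega,
      by omega, by omega, by omega, by omega, by omega,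
      fun h1 => ⟨by omega, by omega, ?_⟩, fun h1 => ⟨by omega, ?_⟩⟩⟩
    · have hk0 : σ.mem 11 i ≠ 0 := by omega
      refine ⟨?_, ?_, ⟨?_, ?_⟩, ?_⟩
      · simp [Finset.sum_range_succ, i1, ← hi', hk0]
      · simp [Finset.sum_range_succ, i2, ← hi', hk0]
      · simpa using hcw _
      · simp [← hi', hk0]
      · simp [i4, ← hi', hk0]
    · have hk0 : σ.mem 11 i = 0 := by omega
      have hm0 : σ.mem 10 i = 0 := by omega
      refine ⟨?_, ?_, ⟨?_, ?_⟩, ?_⟩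
      · simp [Finset.sum_range_succ, i1, ← hi', hk0]
      · simp [Finset.sum_range_succ, i2, ← hi', hk0]
      · simpa using hcw _
      · simp [← hi', hk0]
      · simp [← hi', hk0, hm0]
    · have hk0 : σ.mem 11 i = 0 := by omega
      have hm0 : σ.mem 10 i ≠ 0 := by omega
      refine ⟨?_, ?_, ⟨?_, ?_⟩, ?_⟩
      · simp [Finset.sum_range_succ, i1, ← hi', hk0]
      · simp [Finset.sum_range_succ, i2, ← hi', hk0]
      · simpa using hcw _
      · simp [← hi', hk0]
      · simp [← hi', hk0, hm0, i4]
  · rintro τ t hf _ ⟨i1, i2, i3, i4⟩ ht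
    have hBτ : BuildState xs par L sh H k H.n τ := by
      have h1 := hB.setReg 0 (x := 26) (by simp)
      have h2 : BuildState xs par L sh H k H.n ((σ.setReg 26 0).setRMem 3 0 0) := by
        refine h1.frame_of_disjoint (p := .rstore 3 (.const 0) .zero) ⟨?_, ?_, ?_⟩ (by simp) (by simp)
          (by simp)
        · simp
        · simp
        · intro x hx
          simp at hx
          simp [hx]
      exact h2.frame_of_disjoint hf (by simp) (by simp) (by simp)
    have e9 : τ.mem 9 = σ.mem 9 := by rw [hf.mem 9 (by simp)]; simp
    have e10 : τ.mem 10 = σ.mem 10 := by rw [hf.mem 10 (by simp)]; simp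
    have e11 : τ.mem 11 = σ.mem 11 := by rw [hf.mem 11 (by simp)]; simp
    have e7 : τ.mem 7 = σ.mem 7 := by rw [hf.mem 7 (by simp)]; simp
    have e0 : τ.rmem 0 = σ.rmem 0 := by rw [hf.rmem 0 (by simp)]; simp
    have e1 : τ.rmem 1 = σ.rmem 1 := by rw [hf.rmem 1 (by simp)]; simp
    have e23 : τ.reg 23 = A := by rw [hf.reg 23 (by simp)]; simp [hA]
    have e25 : τ.reg 25 = σ.reg 25 := by rw [hf.reg 25 (by simp)]; simp
    have hE' : ∀ τ' : State, BuildState xs par L sh H k H.n τ' → (∀ x ≠ 24, τ'.reg x = τ.reg x) →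
        τ'.mem = τ.mem → τ'.rmem = τ.rmem → (τ'.reg 24 = 0 ↔ H.Valid xs L sh A) →
        EvalState xs par L sh H k A τ' := by
      intro τ' hB' hr hm hrm hval
      refine ⟨hB', by rw [hr 23 (by decide), e23], by rw [hr 25 (by decide), e25, hc.pc_eq], ?_, hval,
        ?_, ?_, ?_⟩
      · rw [hm, e9, e10, e11]
        exact hE
      · rw [hr 26 (by decide), hm, e11, e7, i1, Finset.sum_filter]
        exact hB.inv.sum_lst Y.toLayout (fun i => if σ.mem 11 i = 0 then σ.mem 7 i else 0)
      · rw [hrm, hm, e11, e1, i2, Finset.sum_filter]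
        exact hB.inv.sum_lst Y.toLayout (fun i => if σ.mem 11 i = 0 then σ.rmem 1 i else 0)
      · intro i hi
        obtain ⟨x, hx, rfl⟩ := hlst.2 i (Net.mem_items.2 hi)
        rw [hrm, hm, e11, e0, i3 x hx]
    have h4 : τ.reg 24 = 0 ↔ σ.reg 24 = 0 ∧ ∀ i, H.IsItem xs L sh i → σ.mem 11 i = 0 →
        σ.mem 10 i ≠ 0 := by
      rw [i4]
      refine and_congr_right fun _ => ⟨fun h i hi => ?_, fun h x hx => ?_⟩
      · obtain ⟨x, hx, rfl⟩ := hlst.2 i (Net.mem_items.2 hi)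
        exact h x hx
      · exact h _ (Net.mem_items.1 (hlst.1 x hx))
    have hz := hc.eq_zero_iff (i := 0) (by omega)
    simp only [cost_const] at ht
    simp only [runs_ite, runs_assign, runs_skip, csafe_and, csafe_lt, safe_const, safe_reg, safe_load,
      holds_and, holds_lt, val_const, val_reg, val_load, hBτ.reg_sh, e9, and_true, ccost_and, ccost_lt,
      cost_const, cost_reg, cost_load, rcost_zero]
    refine ⟨by omega, fun h => ⟨by omega, by omega, ?_⟩, fun h => ⟨by omega, ?_⟩⟩
    · refine hE' _ (hBτ.setReg _ (by simp)) (fun x hx => by simp [hx]) rfl rfl ?_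
      refine iff_of_false (by simp) fun hV => ?_
      have := hV.root
      rw [hz.1 (by omega)] at this
      simp at this
      omega
    · refine hE' _ hBτ (fun x hx => rfl) rfl rfl ?_
      rw [h4, hv]
      refine ⟨fun h' => ⟨?_, h'⟩, fun h' => h'.2⟩
      by_cases h0 : sh = 0
      · exact Or.inr h0
      · left
        rw [← Bool.not_eq_false, ← hz]
        omega

/-- Evaluate the choice in register `23`. -/
def evalAll : Prog := evalComps ;; evalInit ;; evalInc ;; evalSum

@[simp] theorem evalAll_regs : evalAll.regs =
    [25, 27, 25, 27, 24, 27, 28, 27, 27, 28, 29, 24, 27, 26, 27, 28, 26, 24, 27, 24] := rfl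
@[simp] theorem evalAll_mems : evalAll.mems = [9, 9, 9, 9, 10, 11, 11, 10, 11, 10, 11] := rfl
@[simp] theorem evalAll_rmems : evalAll.rmems = [3, 4, 4, 3] := rfl

theorem Setup.runs_evalAll (S : Setup M I H m k off) (Y : Small H k xs par L sh) {σ : State}
    (hB : BuildState xs par L sh H k H.n σ) (hA : σ.reg 23 = A) (hA2 : A < 2 ^ (L - sh)) :
    Runs M I evalAll σ fun τ t => t ≤ 300 * (H.n + 2 * m) ∧ EvalState xs par L sh H k A τ := by
  have hn := S.n_pos
  rw [evalAll, runs_seq]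
  refine (S.runs_evalComps Y hB hA hA2).mono ?_
  rintro τ t hf ⟨ht, hc⟩
  have hBτ := hB.frame_of_disjoint hf (by simp) (by simp) (by simp)
  rw [runs_seq]
  refine (S.runs_evalInit Y hBτ hc).mono ?_
  rintro υ t' hf' ⟨ht', hM, hl⟩
  have hBυ := hBτ.frame_of_disjoint hf' (by simp) (by simp) (by simp)
  rw [← hf'.mem 9 (by simp)] at hc hM
  rw [← hf'.reg 25 (by simp)] at hc
  rw [runs_seq]
  refine (S.runs_evalInc Y hBυ hc hM hl).mono ?_
  rintro ρ t'' hf'' ⟨ht'', hM', -⟩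
  have hBρ := hBυ.frame_of_disjoint hf'' (by simp) (by simp) (by simp)
  rw [← hf''.mem 9 (by simp)] at hc hM'
  rw [← hf''.reg 25 (by simp)] at hc
  rw [← hf''.mem 5 (by simp), ← hf''.mem 6 (by simp), ← hf''.reg 20 (by simp)] at hM'
  refine (S.runs_evalSum Y hBρ ?_ hc hM').mono ?_
  · rw [hf''.reg 23 (by simp), hf'.reg 23 (by simp), hf.reg 23 (by simp), hA]
  · rintro π t3 - ⟨h1, h2⟩
    exact ⟨by omega, h2⟩

end WCVC

/-! ### The program that computes cheapest chains -/

namespace WCVC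

open RealRAM

variable {M : Limits} {I : Input} {H : Net} {m k : ℕ} {off : ℕ → ℕ} {xs par : ℕ → ℕ} {L sh A : ℕ}

theorem EvalState.frame_of_disjoint {σ τ : State} {p : Prog} (h : EvalState xs par L sh H k A σ)
    (hf : Frame p σ τ) (hr : ∀ x ∈ [2, 3, 4, 5, 18, 19, 20, 23, 24, 25, 26], x ∉ p.regs)
    (hm : ∀ x ∈ [1, 2, 3, 5, 6, 7, 8, 9, 10, 11, 16], x ∉ p.mems)
    (hrm : ∀ x ∈ [0, 1, 3, 4], x ∉ p.rmems) : EvalState xs par L sh H k A τ := by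
  have hB := h.built.frame_of_disjoint hf (fun x hx => hr x (by simp at hx ⊢; tauto))
    (fun x hx => hm x (by simp at hx ⊢; tauto)) (fun x hx => hrm x (by simp at hx ⊢; tauto))
  refine ⟨hB, ?_, ?_, ?_, ?_, ?_, ?_, ?_⟩
  · rw [hf.reg 23 (hr _ (by simp)), h.reg_A]
  · rw [hf.reg 25 (hr _ (by simp)), h.pc]
  · rw [hf.mem 9 (hm _ (by simp)), hf.mem 10 (hm _ (by simp)), hf.mem 11 (hm _ (by simp))]
    exact h.eval
  · rw [hf.reg 24 (hr _ (by simp))]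
    exact h.valid
  · rw [hf.reg 26 (hr _ (by simp)), hf.mem 11 (hm _ (by simp)), hf.mem 7 (hm _ (by simp))]
    exact h.cnt
  · rw [hf.rmem 3 (hrm _ (by simp)), hf.mem 11 (hm _ (by simp)), hf.rmem 1 (hrm _ (by simp))]
    exact h.weight
  · rw [hf.rmem 4 (hrm _ (by simp)), hf.mem 11 (hm _ (by simp)), hf.rmem 0 (hrm _ (by simp))]
    exact h.cw

section Table

variable {It Dn : ℕ → Prop} {mask kap : ℕ → ℕ} {cw : ℕ → ℝ} {D c cur i : ℕ}
  {cn : ℕ → ℕ} {f : ℕ → ℝ} {ps pi : ℕ → ℕ}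

theorem ChainTable.congr {N : ℕ} (h : ChainTable It mask kap cw D N cur Dn cn f ps pi)
    {Dn' : ℕ → Prop} (hD : ∀ i, Dn' i ↔ Dn i) :
    ChainTable It mask kap cw D N cur Dn' cn f ps pi := by
  obtain rfl : Dn' = Dn := by
    funext i
    exact propext (hD i)
  exact h

theorem ChainTable.cn_le {N : ℕ} (h : ChainTable It mask kap cw D N cur Dn cn f ps pi)
    (hD : 1 ≤ D) (hk : ∀ i, It i → kap i ≤ 1) : ∀ st < N, cn st ≤ st := by
  intro st
  induction st using Nat.strong_induction_on with
  | _ st ih =>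
  intro hst
  by_cases h0 : cn st = 0
  · omega
  by_cases hsD : st = D
  · rw [hsD, h.init.1]
    exact hD
  · obtain ⟨h1, -, -, h2, -, -, h3, -⟩ := h.sound st hst hsD h0
    have := ih _ h1 (by omega)
    have := hk _ h2
    omega

theorem ChainTable.start {N : ℕ} (hD : 1 ≤ D) (h1 : cn D = 1) (h2 : f D = 0)
    (h0 : ∀ st < N, st ≠ D → cn st = 0) :
    ChainTable It mask kap cw D N D (fun _ => False) cn f ps pi := by
  refine ⟨⟨h1, h2⟩, fun st hst hne h => absurd (h0 st hst hne) h, fun st hst h => ?_,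
    fun st hst h i _ h' => ?_⟩
  · obtain rfl : st = D := by
      by_contra hne
      exact h (h0 st hst hne)
    simp [h1]
  · obtain rfl : st = D := by
      by_contra hne
      exact h (h0 st hst hne)
    rcases h' with h' | ⟨-, h'⟩
    · omega
    · exact h'.elim

end Table

theorem lt_or_iff {a b : ℕ} : a < a ||| b ↔ a ||| b ≠ a :=
  ⟨fun h => h.ne', fun h => lt_of_le_of_ne Nat.left_le_or h.symm⟩

/-- Put the capped number of additional vertices of the next state into register `35`. -/
def chainCap : Prog :=
  .assign 35 (.reg 32 % .reg 30 + .load 11 (.reg 28)) ;;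
  .ite (.lt (.reg 35) (.reg 30)) .skip (.assign 35 (.reg 30 - .const 1))

@[simp] theorem chainCap_regs : chainCap.regs = [35, 35] := rfl
@[simp] theorem chainCap_mems : chainCap.mems = [] := rfl
@[simp] theorem chainCap_rmems : chainCap.rmems = [] := rfl

theorem runs_chainCap {σ : State} (h1 : 1 ≤ σ.reg 30) (h2 : σ.reg 30 + 2 < M.word)
    (h3 : σ.reg 28 < M.cells) (h4 : σ.mem 11 (σ.reg 28) ≤ 1) :
    Runs M I chainCap σ fun τ t => t ≤ 20 ∧
      τ.reg 35 = min (σ.reg 32 % σ.reg 30 + σ.mem 11 (σ.reg 28)) (σ.reg 30 - 1) := by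
  have hmod : σ.reg 32 % σ.reg 30 < σ.reg 30 := Nat.mod_lt _ (by omega)
  rw [chainCap]
  simp only [runs_seq, runs_ite, runs_assign, runs_skip, safe_add, safe_mod, safe_reg, safe_load,
    safe_sub, safe_const, csafe_lt, holds_lt, val_add, val_mod, val_reg, val_load, val_sub, val_const,
    setReg_reg, true_and, if_false, if_true, show (30 : ℕ) ≠ 35 by decide, ccost_lt, cost_reg,
    cost_mod, cost_add, cost_sub, cost_load, cost_const]
  omega

/-- Register `37` becomes `1` if the chain that uses the item in register `28` in the state in
register `32` is better than the one known for the state in register `35`. -/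
def chainCompare : Prog :=
  .assign 37 (.const 0) ;;
  .ite (.lt (.load 12 (.reg 35)) (.const 1)) (.assign 37 (.const 1))
    (.ite (.lt (.reg 36) (.load 12 (.reg 35))) (.assign 37 (.const 1))
      (.ite (.and (.not (.lt (.load 12 (.reg 35)) (.reg 36)))
          (.rlt (.load 2 (.reg 32) + .load 4 (.reg 28)) (.load 2 (.reg 35))))
        (.assign 37 (.const 1)) .skip))

@[simp] theorem chainCompare_regs : chainCompare.regs = [37, 37, 37, 37] := rfl
@[simp] theorem chainCompare_mems : chainCompare.mems = [] := rfl
@[simp] theorem chainCompare_rmems : chainCompare.rmems = [] := rfl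

theorem runs_chainCompare {σ : State} (h1 : 1 < M.word) (h2 : σ.reg 35 < M.cells)
    (h3 : σ.reg 28 < M.cells) (h4 : σ.reg 32 < M.cells) :
    Runs M I chainCompare σ fun τ t => t ≤ 40 ∧
      ((τ.reg 37 = 0 ∧ σ.mem 12 (σ.reg 35) ≠ 0 ∧ LexLe (σ.mem 12 (σ.reg 35)) (σ.rmem 2 (σ.reg 35))
        (σ.reg 36) (σ.rmem 2 (σ.reg 32) + σ.rmem 4 (σ.reg 28))) ∨
      (τ.reg 37 = 1 ∧ (σ.mem 12 (σ.reg 35) ≠ 0 → LexLe (σ.reg 36)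
        (σ.rmem 2 (σ.reg 32) + σ.rmem 4 (σ.reg 28)) (σ.mem 12 (σ.reg 35))
        (σ.rmem 2 (σ.reg 35))))) := by
  rw [chainCompare]
  simp only [runs_seq, runs_ite, runs_assign, runs_skip, safe_reg, safe_load, safe_const, csafe_lt,
    csafe_and, csafe_not, csafe_rlt, rsafe_load, rsafe_add, holds_lt, holds_and, holds_not, holds_rlt,
    rval_load, rval_add, val_reg, val_load, val_const, setReg_reg, setReg_mem, setReg_rmem,
    true_and, if_false, if_true, show (35 : ℕ) ≠ 37 by decide, show (36 : ℕ) ≠ 37 by decide,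
    show (32 : ℕ) ≠ 37 by decide, show (28 : ℕ) ≠ 37 by decide, and_true, ccost_lt, ccost_and, ccost_not,
    ccost_rlt, rcost_add, rcost_load, cost_reg, cost_load, cost_const]
  refine ⟨by omega, by omega, fun a1 => ⟨by omega, by omega, Or.inr fun h => by omega⟩,
    fun a1 => ⟨by omega, fun a2 => ⟨by omega, by omega, Or.inr fun _ => Or.inl a2⟩,
      fun a2 => ⟨by omega, fun a3 => ⟨by omega, by omega, Or.inr fun _ => Or.inr ⟨by omega,
        a3.2.le⟩⟩, fun a3 => ⟨by omega, Or.inl ⟨by omega, ?_⟩⟩⟩⟩⟩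
  by_cases h : σ.mem 12 (σ.reg 35) < σ.reg 36
  · exact Or.inl h
  · exact Or.inr ⟨by omega, not_lt.1 fun h' => a3 ⟨h, h'⟩⟩

/-- Try the item in register `28` in the state in register `32`. Register `30` holds the number of
states per set of components. -/
def chainStep : Prog :=
  .assign 33 (.reg 32 / .reg 30) ;; .assign 29 (.load 10 (.reg 28)) ;;
  .ite (.and (.lt (.const 0) (.op .land (.reg 33) (.reg 29)))
      (.lt (.reg 33) (.op .lor (.reg 33) (.reg 29))))
    (chainCap ;; .assign 35 (.op .lor (.reg 33) (.reg 29) * .reg 30 + .reg 35) ;;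
      .assign 36 (.load 12 (.reg 32) + .load 11 (.reg 28)) ;; chainCompare ;;
      .ite (.lt (.const 0) (.reg 37))
        (.store 12 (.reg 35) (.reg 36) ;;
          .rstore 2 (.reg 35) (.load 2 (.reg 32) + .load 4 (.reg 28)) ;;
          .store 13 (.reg 35) (.reg 32) ;; .store 14 (.reg 35) (.reg 28)) .skip) .skip

@[simp] theorem chainStep_regs : chainStep.regs = [33, 29, 35, 35, 35, 36, 37, 37, 37, 37] := rfl
@[simp] theorem chainStep_mems : chainStep.mems = [12, 13, 14] := rfl
@[simp] theorem chainStep_rmems : chainStep.rmems = [2] := rfl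

/-- The invariant of the computation of chains in terms of the memory. -/
def TableState (xs : ℕ → ℕ) (L sh : ℕ) (H : Net) (D N cur : ℕ) (Dn : ℕ → Prop) (σ : State) : Prop :=
  ChainTable (H.IsItem xs L sh) (σ.mem 10) (σ.mem 11) (σ.rmem 4) D N cur Dn (σ.mem 12) (σ.rmem 2)
    (σ.mem 13) (σ.mem 14)

theorem Setup.runs_chainStep (S : Setup M I H m k off) (Y : Small H k xs par L sh) {σ : State}
    {D cur i : ℕ} {Dn : ℕ → Prop} (hE : EvalState xs par L sh H k A σ)
    (hD1 : 1 ≤ D) (hD : 2 ^ (L - sh) * D ≤ 4 * (2 ^ k * k)) (h30 : σ.reg 30 = D)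
    (h32 : σ.reg 32 = cur) (hcD : D ≤ cur) (hcur : cur < 2 ^ tops par sh A (L - sh) * D)
    (h28 : σ.reg 28 = i) (hi : H.IsItem xs L sh i)
    (hT : TableState xs L sh H D (2 ^ tops par sh A (L - sh) * D) cur Dn σ) (hcn : σ.mem 12 cur ≠ 0) :
    Runs M I chainStep σ fun τ t => t ≤ 150 ∧
      TableState xs L sh H D (2 ^ tops par sh A (L - sh) * D) cur (fun j => Dn j ∨ j = i) τ ∧
      τ.mem 12 cur ≠ 0 := by
  have hw := S.word_le
  have hcw := S.cells_le
  have hp := S.two_pow_le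
  have hc := S.le_cells
  have h2 := Y.two_pow_le
  have hs := Y.le_s
  have hk := S.k_le
  have hk1 := S.k_pos
  have hil := hi.lt Y.toLayout
  obtain ⟨v, hv, hvi⟩ := hi
  have hml := Comps.mask_lt Y.toLayout hE.eval hv
  have hkl := hE.eval.kap_le v hv
  rw [hvi] at hml hkl
  have hi : H.IsItem xs L sh i := ⟨v, hv, hvi⟩
  have hpow : 2 ^ tops par sh A (L - sh) ≤ 2 ^ (L - sh) := Nat.pow_le_pow_right (by omega) tops_le
  set c := tops par sh A (L - sh) with hc'
  have hcD' : 2 ^ c * D ≤ 2 ^ (L - sh) * D := Nat.mul_le_mul_right _ hpow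
  have hcl := hT.cn_le hD1 (fun i ⟨v, hv, hvi⟩ => hvi ▸ hE.eval.kap_le v hv)
  have hclc := hcl cur hcur
  have hdiv : cur / D ≤ cur := Nat.div_le_self _ _
  have hmod : cur % D < D := Nat.mod_lt _ (by omega)
  have hdl : cur / D < 2 ^ c := by
    rw [Nat.div_lt_iff_lt_mul (by omega)]
    exact hcur
  have hor := Nat.or_lt_two_pow hdl hml
  have hand : cur / D &&& σ.mem 10 i ≤ cur / D := Nat.and_le_left
  have hDc : D ≤ 2 ^ c * D := Nat.le_mul_of_pos_left _ (by positivity)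
  rw [chainStep]
  simp only [runs_seq (p := Prog.assign _ _), runs_assign, safe_div, safe_reg, safe_load, val_div,
    val_reg, val_load, setReg_reg, setReg_mem, h30, h32, h28, true_and, if_false,
    show (28 : ℕ) ≠ 33 by decide]
  refine ⟨by omega, by omega, ?_⟩
  rw [runs_ite]
  simp only [csafe_and, csafe_lt, safe_const, safe_land, safe_lor, safe_reg, holds_and, holds_lt,
    val_const, val_land, val_lor, val_reg, setReg_reg, if_true, show (33 : ℕ) ≠ 29 by decide,
    if_false, true_and, ccost_and, ccost_lt, cost_const, cost_op, cost_reg, cost_div, cost_load]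
  refine ⟨by omega, fun hu => ?_, fun hu => ?_⟩
  · have hU : Usable (σ.mem 10) D cur i := ⟨by omega, lt_or_iff.1 hu.2⟩
    have htl := target_lt (kap := σ.mem 11) hD1 hcur hml
    have hlt := lt_target (kap := σ.mem 11) hD1 hU
    set tg := target (σ.mem 10) (σ.mem 11) D cur i with htg
    have htgc := hcl tg htl
    have htge : (cur / D ||| σ.mem 10 i) * D + min (cur % D + σ.mem 11 i) (D - 1) = tg := rfl
    rw [runs_seq]
    refine (runs_chainCap (by simp [h30, hD1]) (by simp [h30]; omega) (by simp [h28]; omega)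
      (by simpa [h28] using hkl)).mono fun τ t hf ht => ?_
    simp [h30, h32, h28] at ht
    have e28 : τ.reg 28 = i := by rw [hf.reg 28 (by simp)]; simp [h28]
    have e29 : τ.reg 29 = σ.mem 10 i := by rw [hf.reg 29 (by simp)]; simp
    have e30 : τ.reg 30 = D := by rw [hf.reg 30 (by simp)]; simp [h30]
    have e32 : τ.reg 32 = cur := by rw [hf.reg 32 (by simp)]; simp [h32]
    have e33 : τ.reg 33 = cur / D := by rw [hf.reg 33 (by simp)]; simp
    have em : τ.mem = σ.mem := by funext a; rw [hf.mem a (by simp)]; simp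
    have er : τ.rmem = σ.rmem := by funext a; rw [hf.rmem a (by simp)]; simp
    simp only [runs_seq (p := Prog.assign _ _), runs_assign, safe_add, safe_mul, safe_lor, safe_reg,
      safe_load, val_add, val_mul, val_lor, val_reg, val_load, setReg_reg, setReg_mem, e28, e29, e30,
      e32, e33, em, ht, htge, true_and, if_false, show (32 : ℕ) ≠ 35 by decide,
      show (28 : ℕ) ≠ 35 by decide, cost_add, cost_mul, cost_op, cost_reg, cost_load]
    refine ⟨⟨⟨by omega, by omega⟩, by omega⟩, ⟨by omega, by omega, by omega⟩, ?_⟩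
    rw [runs_seq]
    refine (runs_chainCompare (by omega) (by simp; omega) (by simp [e28]; omega)
      (by simp [e32]; omega)).mono fun υ t' hf' ht' => ?_
    simp [e28, e32, em, er] at ht'
    have f28 : υ.reg 28 = i := by rw [hf'.reg 28 (by simp)]; simp [e28]
    have f32 : υ.reg 32 = cur := by rw [hf'.reg 32 (by simp)]; simp [e32]
    have f35 : υ.reg 35 = tg := by rw [hf'.reg 35 (by simp)]; simp
    have f36 : υ.reg 36 = σ.mem 12 cur + σ.mem 11 i := by rw [hf'.reg 36 (by simp)]; simp
    have fm : υ.mem = σ.mem := by funext a; rw [hf'.mem a (by simp)]; simp [em]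
    have fr : υ.rmem = σ.rmem := by funext a; rw [hf'.rmem a (by simp)]; simp [er]
    obtain ⟨ht', hor'⟩ := ht'
    simp only [runs_ite, runs_seq, runs_store, runs_rstore, runs_skip, csafe_lt, holds_lt, safe_const,
      safe_reg, val_const, val_reg, rsafe_add, rsafe_load, rval_add, rval_load, setMem_reg, setMem_mem,
      setMem_rmem, setRMem_reg, setRMem_mem, f28, f32, f35, f36, fm, fr, true_and, and_true,
      ccost_lt, cost_const, cost_reg, rcost_add, rcost_load]
    refine ⟨by omega, fun h37 => ?_, fun h37 => ?_⟩
    · rcases hor' with ⟨h, -⟩ | ⟨-, hor'⟩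
      · omega
      refine ⟨by omega, by omega, by omega, by omega, by omega, by omega, ?_⟩
      have := hT.step_better hD1 hcur hcD hcn hi hU hor'
      rw [TableState]
      simp [fm, fr]
      rw [Function.update_of_ne (by omega)]
      exact ⟨this, hcn⟩
    · rcases hor' with ⟨-, hor'⟩ | ⟨h, -⟩
      · refine ⟨by omega, ?_, hcn⟩
        rw [TableState, fm, fr]
        exact hT.step_worse hor'
      · omega
  · have hU : ¬ Usable (σ.mem 10) D cur i := fun h => hu ⟨by have := h.1; omega, lt_or_iff.2 h.2⟩
    rw [runs_skip]
    refine ⟨by omega, ?_, by simpa using hcn⟩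
    exact hT.step_skip hU

/-- Compute cheapest chains. -/
def chains : Prog :=
  .assign 31 (.reg 25 * .reg 30) ;;
  .for 32 (.const 0) 31 (.store 12 (.reg 32) (.const 0)) ;;
  .store 12 (.reg 30) (.const 1) ;; .rstore 2 (.reg 30) .zero ;;
  .for 32 (.reg 30) 31
    (.ite (.lt (.const 0) (.load 12 (.reg 32)))
      (.for 27 (.const 0) 19 (.assign 28 (.load 16 (.reg 27)) ;; chainStep)) .skip)

@[simp] theorem chains_regs : chains.regs =
    [31, 32, 32, 32, 27, 28, 33, 29, 35, 35, 35, 36, 37, 37, 37, 37, 27, 32] := rfl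
@[simp] theorem chains_mems : chains.mems = [12, 12, 12, 13, 14] := rfl
@[simp] theorem chains_rmems : chains.rmems = [2, 2] := rfl

theorem Setup.runs_chains (S : Setup M I H m k off) (Y : Small H k xs par L sh) {σ : State} {D : ℕ}
    (hE : EvalState xs par L sh H k A σ) (hD1 : 1 ≤ D) (hD : 2 ^ (L - sh) * D ≤ 4 * (2 ^ k * k))
    (h30 : σ.reg 30 = D) (hc1 : 1 ≤ tops par sh A (L - sh)) :
    Runs M I chains σ fun τ t => t ≤ 2 ^ tops par sh A (L - sh) * D * (250 * H.n) ∧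
      EvalState xs par L sh H k A τ ∧
      TableState xs L sh H D (2 ^ tops par sh A (L - sh) * D) (2 ^ tops par sh A (L - sh) * D)
        (fun _ => False) τ := by
  have hw := S.word_le
  have hcw := S.cells_le
  have hp := S.two_pow_le
  have hc := S.le_cells
  have h2 := Y.two_pow_le
  have hs := Y.le_s
  have hk := S.k_le
  have hk1 := S.k_pos
  have hn1 := S.n_pos
  have hlst := hE.built.inv.lst_items Y.toLayout
  have hNn := hE.built.inv.N_le_n Y.toLayout
  have hNc := hE.built.inv.N_le_pow
  have hpow : 2 ^ tops par sh A (L - sh) ≤ 2 ^ (L - sh) := Nat.pow_le_pow_right (by omega) tops_le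
  have hpc := hE.pc
  set c := tops par sh A (L - sh) with hc'
  have h2c : 2 ≤ 2 ^ c := by
    calc 2 = 2 ^ 1 := rfl
      _ ≤ 2 ^ c := Nat.pow_le_pow_right (by omega) hc1
  have hcD' : 2 ^ c * D ≤ 2 ^ (L - sh) * D := Nat.mul_le_mul_right _ hpow
  have hDc : 2 * D ≤ 2 ^ c * D := Nat.mul_le_mul_right _ h2c
  set W := 2 ^ c * D with hW
  have hfr : ∀ τ, Frame chains σ τ → EvalState xs par L sh H k A τ := fun τ hf =>
    hE.frame_of_disjoint hf (by simp) (by simp) (by simp)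
  suffices hkey : Runs M I chains σ fun τ t => t ≤ W * (250 * H.n) ∧
      TableState xs L sh H D W W (fun _ => False) τ from
    hkey.mono fun τ t hf h => ⟨h.1, hfr τ hf, h.2⟩
  rw [chains]
  simp only [runs_seq (p := Prog.assign _ _), runs_assign, safe_mul, safe_reg, val_mul, val_reg, hpc, h30,
    true_and, ← hW]
  refine ⟨by omega, ?_⟩
  rw [runs_seq]
  refine Runs.for_const 0 W (fun j τ => ∀ st < j, τ.mem 12 st = 0) 3 (by simp; omega) rfl (by simp)
    (by omega) (by omega) (by decide) (by simp) (by simp) (by simp) ?_ ?_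
  · intro j τ _ hj hf h32 hI
    simp only [runs_store, safe_reg, safe_const, val_reg, val_const, h32, true_and, cost_reg,
      cost_const]
    refine ⟨by omega, by omega, by omega, fun st hst => ?_⟩
    simp only [setReg_mem, setMem_mem, if_true]
    by_cases h : st = j
    · subst h; simp
    · rw [Function.update_of_ne h]
      exact hI st (by omega)
  intro τ t hf _ hI ht
  have e30 : τ.reg 30 = D := by rw [hf.reg 30 (by simp)]; simp [h30]
  have e31 : τ.reg 31 = W := by rw [hf.reg 31 (by simp)]; simp
  have hEτ : EvalState xs par L sh H k A τ := by
    refine hfr τ ⟨fun x hx => ?_, fun x hx => ?_, fun x hx => ?_⟩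
    · simp at hx
      rw [hf.reg x (by simp; tauto)]
      simp; tauto
    · simp at hx
      rw [hf.mem x (by simp; tauto)]
      simp
    · rw [hf.rmem x (by simp)]
      simp
  have hm : ∀ a, a ≠ 12 → τ.mem a = σ.mem a := fun a ha => by rw [hf.mem a (by simp [ha])]; simp
  simp only [runs_seq (p := Prog.store _ _ _), runs_seq (p := Prog.rstore _ _ _), runs_store,
    runs_rstore, safe_reg, safe_const, val_reg, val_const, rsafe_zero, rval_zero, setMem_reg,
    e30, true_and]
  refine ⟨by omega, by omega, by omega, ?_⟩
  refine Runs.for_const D W (fun cur υ => TableState xs L sh H D W cur (fun _ => False) υ ∧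
      EvalState xs par L sh H k A υ) (170 * H.n + 30) trivial (by simp [e30])
    (by simp [e31]) (by omega) (by omega) (by decide) (by simp) (by simp) ?_ ?_ ?_
  · constructor
    · rw [TableState]
      refine ChainTable.start hD1 (by simp) (by simp) (fun st hst hne => ?_)
      simp [Function.update_of_ne hne, hI st hst]
    · refine hEτ.frame_of_disjoint (p := .store 12 (.const 0) (.const 0) ;; .rstore 2 (.const 0) .zero ;;
        .assign 32 (.const 0)) ⟨fun x hx => ?_, fun x hx => ?_, fun x hx => ?_⟩ (by simp) (by simp)
        (by simp)
      · simp at hx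
        simp [hx]
      · simp at hx
        simp [hx]
      · simp at hx
        simp [hx]
  · rintro cur υ hD' hcur hfυ h32 ⟨hT, hEυ⟩
    have g30 : υ.reg 30 = D := by rw [hfυ.reg 30 (by simp)]; simp [e30]
    simp only [runs_ite, csafe_lt, safe_const, safe_load, safe_reg, holds_lt, val_const, val_load,
      val_reg, h32, true_and]
    refine ⟨by omega, fun hpos => ?_, fun hpos => ?_⟩
    · have hcl : H.IsItem xs L sh = H.IsItem xs L sh := rfl
      refine Runs.for_const 0 (υ.reg 19) (fun x ρ => TableState xs L sh H D W cur
          (fun i => ∃ y < x, υ.mem 16 y = i) ρ ∧ ρ.mem 12 cur ≠ 0 ∧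
          EvalState xs par L sh H k A ρ) 156 (by simp; omega) rfl rfl (by omega)
          ?_ (by decide) (by simp) (by simp) ?_ ?_ ?_
      · have := hEυ.built.inv.N_le_n Y.toLayout
        omega
      · refine ⟨?_, by simp; omega, ?_⟩
        · exact ChainTable.congr hT (by simp)
        · refine hEυ.frame_of_disjoint (p := .assign 27 (.const 0)) ⟨fun x hx => ?_, fun x hx => ?_,
            fun x hx => ?_⟩ (by simp) (by simp) (by simp)
          · simp at hx
            simp [hx]
          · simp
          · simp
      · rintro x ρ _ hx hfρ h27 ⟨hTρ, hcρ, hEρ⟩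
        have k30 : ρ.reg 30 = D := by rw [hfρ.reg 30 (by simp), g30]
        have k32 : ρ.reg 32 = cur := by rw [hfρ.reg 32 (by simp), h32]
        have k16 : ρ.mem 16 = υ.mem 16 := hfρ.mem 16 (by simp)
        have hNp := hEυ.built.inv.N_le_pow
        have hitem := Net.mem_items.1 ((hEυ.built.inv.lst_items Y.toLayout).1 x hx)
        simp only [runs_seq (p := Prog.assign _ _), runs_assign, safe_load, safe_reg, val_load, val_reg,
          h27, k16, true_and]
        refine ⟨by omega, ?_⟩
        refine (S.runs_chainStep Y (σ := ρ.setReg 28 (υ.mem 16 x)) (D := D) (cur := cur)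
          (i := υ.mem 16 x) ?_ hD1 hD
          (by simp [k30]) (by simp [k32]) hD' hcur (by simp) hitem hTρ (by simpa using hcρ)).mono ?_
        · refine hEρ.frame_of_disjoint (p := .assign 28 (.const 0)) ⟨fun x hx => ?_, fun x hx => ?_,
            fun x hx => ?_⟩ (by simp) (by simp) (by simp)
          · simp at hx
            simp [hx]
          · simp
          · simp
        · rintro π t' hfπ ⟨ht', hTπ, hcπ⟩
          refine ⟨by simp; omega, ?_, by simpa using hcπ, ?_⟩
          · refine ChainTable.congr hTπ fun i => ?_
            constructor
            · rintro ⟨y, hy, h⟩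
              rcases Nat.lt_succ_iff_lt_or_eq.1 hy with hy | rfl
              · exact Or.inl ⟨y, hy, h⟩
              · exact Or.inr h.symm
            · rintro (⟨y, hy, h⟩ | h)
              · exact ⟨y, by omega, h⟩
              · exact ⟨x, by omega, h.symm⟩
          · refine hEρ.frame_of_disjoint (p := .assign 28 (.const 0) ;; chainStep ;; .assign 27 (.const 0))
              ⟨fun x hx => ?_, fun x hx => ?_, fun x hx => ?_⟩ (by simp) (by simp) (by simp)
            · simp at hx
              simp [hx, hfπ.reg]
            · simp at hx
              simp [hx, hfπ.mem]
            · simp at hx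
              simp [hx, hfπ.rmem]
      · rintro ρ t' hfρ _ ⟨hTρ, hcρ, hEρ⟩ ht'
        have hNn' := hEυ.built.inv.N_le_n Y.toLayout
        refine ⟨?_, ?_, ?_⟩
        · simp at ht' ⊢
          omega
        · refine ChainTable.next hTρ fun _ i hi => ?_
          exact (hEυ.built.inv.lst_items Y.toLayout).2 i (Net.mem_items.2 hi)
        · refine hEρ.frame_of_disjoint (p := .assign 32 (.const 0)) ⟨fun x hx => ?_, fun x hx => ?_,
            fun x hx => ?_⟩ (by simp) (by simp) (by simp)
          · simp at hx
            simp [hx]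
          · simp
          · simp
    · rw [runs_skip]
      refine ⟨by simp, ?_, ?_⟩
      · exact ChainTable.next hT fun h => absurd (Nat.eq_zero_of_not_pos hpos) h
      · refine hEυ.frame_of_disjoint (p := .assign 32 (.const 0)) ⟨fun x hx => ?_, fun x hx => ?_,
          fun x hx => ?_⟩ (by simp) (by simp) (by simp)
        · simp at hx
          simp [hx]
        · simp
        · simp
  · rintro υ t' _ _ ⟨hT, -⟩ ht'
    refine ⟨?_, hT⟩
    simp at ht ht' ⊢
    have h1 : (W - D) * (170 * H.n + 30 + 8) ≤ W * (208 * H.n) :=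
      Nat.mul_le_mul (by omega) (by omega)
    have h2 : W ≤ W * H.n := Nat.le_mul_of_pos_right _ (by omega)
    have h3 : W * (250 * H.n) = W * (208 * H.n) + 42 * (W * H.n) := by ring
    omega

end WCVC

/-! ### Covers and final states -/

namespace WCVC

open RealRAM

variable {M : Limits} {I : Input} {H : Net} {m k : ℕ} {off : ℕ → ℕ} {xs par : ℕ → ℕ} {L sh A D : ℕ}

theorem list_sum_map_cast (l : List ℕ) (g : ℕ → ℕ) :
    ((l.map g).sum : ℝ) = (l.map fun i => (g i : ℝ)).sum := by
  induction l with
  | nil => simp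
  | cons a l ih => simp [ih]

/-- Register `26` holds the number of forced and chosen vertices; the contracted ones count as one. -/
theorem EvalState.card_base {σ : State} (hE : EvalState xs par L sh H k A σ)
    (Y : H.Layout xs par L sh) (hV : H.Valid xs L sh A) :
    σ.reg 26 + sh = (H.baseSet xs L sh A).card := by
  rw [hE.cnt]
  exact Y.card_base hE.eval hV.root (hE.built.inv.counts Y)

theorem EvalState.weight_base {σ : State} (hE : EvalState xs par L sh H k A σ)
    (Y : H.Layout xs par L sh) (h0 : sh = 0) :
    σ.rmem 3 0 = ∑ v ∈ H.baseSet xs L sh A, H.ω v := by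
  rw [hE.weight]
  exact Net.Layout.weight_base hE.eval (hE.built.inv.counts Y) h0

theorem full_mul_add_lt {c j : ℕ} (hj : j < D) :
    2 ^ c * D - D ≤ (2 ^ c - 1) * D + j ∧ (2 ^ c - 1) * D + j < 2 ^ c * D := by
  have h1 : 1 ≤ 2 ^ c := Nat.one_le_two_pow
  have h2 : (2 ^ c - 1) * D = 2 ^ c * D - D := by rw [Nat.sub_mul, Nat.one_mul]
  have h3 : D ≤ 2 ^ c * D := Nat.le_mul_of_pos_left _ (by positivity)
  omega

theorem div_of_final {c st : ℕ} (h1 : 2 ^ c * D - D ≤ st) (h2 : st < 2 ^ c * D) :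
    st / D = 2 ^ c - 1 := by
  have h3 : 1 ≤ 2 ^ c := Nat.one_le_two_pow
  have h4 : (2 ^ c - 1) * D = 2 ^ c * D - D := by rw [Nat.sub_mul, Nat.one_mul]
  have h5 : (2 ^ c - 1 + 1) * D = 2 ^ c * D := by rw [Nat.sub_add_cancel h3]
  exact Nat.div_eq_of_lt_le (by omega) (by omega)

/-- Every small connected vertex cover is dominated by a final state. -/
theorem EvalState.exists_state {σ : State} (hE : EvalState xs par L sh H k A σ)
    (Y : H.Layout xs par L sh) (hD1 : 1 ≤ D) (hDk : sh = 0 → D = k + 1)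
    (hT : TableState xs L sh H D (2 ^ tops par sh A (L - sh) * D) (2 ^ tops par sh A (L - sh) * D)
      (fun _ => False) σ) {Z : Finset ℕ} (hZ : H.CVC Z) (hcard : Z.card ≤ k + sh)
    (hA : IsTrace xs L sh A Z) (hU : sh = 0 ∨ ∀ p ≤ sh, xs p ∈ Z) :
    ∃ st, 2 ^ tops par sh A (L - sh) * D - D ≤ st ∧ st < 2 ^ tops par sh A (L - sh) * D ∧
      σ.mem 12 st ≠ 0 ∧ σ.reg 26 + σ.mem 12 st ≤ k + 1 ∧
      (sh = 0 → σ.rmem 3 0 + σ.rmem 2 st ≤ ∑ v ∈ Z, H.ω v) := by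
  have hV := Y.valid_of_trace hZ hA hU
  have hcb := hE.card_base Y hV
  obtain ⟨l, hl, hlZ⟩ := Y.exists_chain hZ hA hE.eval
  set c := tops par sh A (L - sh) with hc
  obtain ⟨h1, h2⟩ := ChainTable.lexLe hT hD1 hl (Nat.sub_lt (by positivity) one_pos)
  have hlt := full_mul_add_lt (c := c) (D := D) (j := min (l.map (σ.mem 11)).sum (D - 1)) (by omega)
  set st := (2 ^ c - 1) * D + min (l.map (σ.mem 11)).sum (D - 1) with hst
  have hit : ∀ i ∈ l, ∃ v < H.n, H.item xs L sh v = i := hl.it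
  have hk1 := Y.sum_chain_le hE.eval hZ hA hU hl.nodup hlZ (f := fun _ => 1)
    (g := fun i => (σ.mem 11 i : ℝ)) (fun _ _ => zero_le_one) (fun i _ h => by simp [h])
    (fun v hv hvl _ => by
      have := hE.eval.kap_le v (hZ.lt v hv)
      exact_mod_cast this)
  rw [← list_sum_map_cast] at hk1
  simp only [Finset.sum_const, nsmul_eq_mul, mul_one] at hk1
  have hk2 : (H.baseSet xs L sh A).card + (l.map (σ.mem 11)).sum ≤ Z.card := by exact_mod_cast hk1
  have hle : σ.mem 12 st ≤ (l.map (σ.mem 11)).sum + 1 := by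
    rcases h2 with h2 | h2 <;> omega
  refine ⟨st, hlt.1, hlt.2, h1, by omega, fun h0 => ?_⟩
  have hC := hE.built.inv.counts Y
  have hw := Y.sum_chain_le hE.eval hZ hA hU hl.nodup hlZ (f := H.ω) (g := σ.rmem 4)
    (fun v hv => (H.pos v hv).le)
    (fun i hi h => by rw [hE.cw i (hit i hi), if_pos h])
    (fun v hv hvl hne => by
      rw [hE.cw _ ⟨v, hZ.lt v hv, rfl⟩, if_neg hne]
      exact hC.minw_le h0 v (hZ.lt v hv))
  rw [← hE.weight_base Y h0] at hw
  have hmod := ChainTable.idx hT st hlt.2 h1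
  have hmod2 : st % D = min (l.map (σ.mem 11)).sum (D - 1) := by
    rw [hst, Nat.add_comm, Nat.add_mul_mod_self_right, Nat.mod_eq_of_lt (by omega)]
  have hDk' := hDk h0
  rcases h2 with h2 | h2
  · omega
  · linarith [h2.2]

/-- A final state describes a connected vertex cover. -/
theorem EvalState.exists_cvc {σ : State} (hE : EvalState xs par L sh H k A σ)
    (Y : H.Layout xs par L sh) (hD1 : 1 ≤ D) (hV : H.Valid xs L sh A) {N : ℕ} {Dn : ℕ → Prop}
    (hT : TableState xs L sh H D (2 ^ tops par sh A (L - sh) * D) N Dn σ)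
    {st : ℕ} (h1 : 2 ^ tops par sh A (L - sh) * D - D ≤ st)
    (h2 : st < 2 ^ tops par sh A (L - sh) * D) (h0 : σ.mem 12 st ≠ 0)
    (hk : σ.reg 26 + σ.mem 12 st ≤ k + 1) :
    ∃ l, Path (σ.mem 13) (σ.mem 14) D l st ∧ l.length ≤ H.n ∧ (∀ i ∈ l, H.IsItem xs L sh i) ∧
      (l.map (σ.mem 11)).sum ≤ k ∧
      ∃ X, H.IsDescribed xs L sh A (fun v => ∃ i ∈ l, σ.mem 11 i = 1 ∧ σ.mem 8 i = v) X ∧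
        H.CVC X ∧ X.card ≤ k + sh ∧ (sh = 0 → ∑ v ∈ X, H.ω v ≤ σ.rmem 3 0 + σ.rmem 2 st) := by
  classical
  obtain ⟨l, hp, hl, hs1, hs2⟩ := ChainTable.exists_path hT hD1 st h2 h0
  rw [div_of_final h1 h2] at hl
  have hC := hE.built.inv.counts Y
  have hcb := hE.card_base Y hV
  have hit : ∀ i ∈ l, H.IsItem xs L sh i := hl.it
  have hrep : ∀ i ∈ l, σ.mem 8 i < H.n ∧ H.item xs L sh (σ.mem 8 i) = i := fun i hi =>
    hC.rep i (Net.mem_items.2 (hit i hi))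
  have hkl : ∀ i ∈ l, σ.mem 11 i ≤ 1 := by
    intro i hi
    obtain ⟨v, hv, rfl⟩ := hit i hi
    exact hE.eval.kap_le v hv
  refine ⟨l, hp, ?_, hit, by omega, ?_⟩
  · have : l.toFinset ⊆ H.items xs L sh := fun i hi =>
      Net.mem_items.2 (hit i (List.mem_toFinset.1 hi))
    have h3 := Finset.card_le_card this
    rw [List.toFinset_card_of_nodup hl.nodup] at h3
    exact h3.trans (Finset.card_image_le.trans (by simp))
  set X := (Finset.range H.n).filter fun v => H.Base xs L sh A v ∨
    ∃ i ∈ l, σ.mem 11 i = 1 ∧ σ.mem 8 i = v with hX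
  have hXd : H.IsDescribed xs L sh A (fun v => ∃ i ∈ l, σ.mem 11 i = 1 ∧ σ.mem 8 i = v) X := by
    intro v
    simp [hX]
  refine ⟨X, hXd, Y.cvc_of_chain hE.eval hV hl hrep hXd, ?_, fun hsh => ?_⟩
  · have := hXd.sum_le hl.nodup (f := fun _ => 1) (g := fun i => (σ.mem 11 i : ℝ))
      (fun _ _ => zero_le_one) (fun i hi => (hrep i hi).1) (fun i hi => by
        split_ifs with h
        · simp [h]
        · have := hkl i hi
          have : σ.mem 11 i = 1 := by omega
          simp [this])
    rw [← list_sum_map_cast] at this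
    simp only [Finset.sum_const, nsmul_eq_mul, mul_one] at this
    have h3 : X.card ≤ (H.baseSet xs L sh A).card + (l.map (σ.mem 11)).sum := by exact_mod_cast this
    omega
  · have := hXd.sum_le hl.nodup (f := H.ω) (g := σ.rmem 4)
      (fun v hv => (H.pos v hv).le) (fun i hi => (hrep i hi).1) (fun i hi => by
        rw [hE.cw i (hit i hi)]
        split_ifs with h
        · rfl
        · exact hC.minw hsh i (Net.mem_items.2 (hit i hi)))
    rw [hs2, ← hE.weight_base Y hsh] at this
    exact this

end WCVC

/-! ### The program that selects the best cover -/

namespace RealRAM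

/-- Unfolding of a loop, for loops that follow a path given in advance. -/
theorem Runs.loop_step {L : Limits} {I : Input} {b : Cond} {p : Prog} {σ : State}
    {Q : State → ℕ → Prop} (hs : b.Safe L I σ)
    (h1 : b.Holds I σ → Runs L I p σ fun τ t => Runs L I (.loop b p) τ fun υ t' =>
      Q υ (b.cost + 1 + t + t'))
    (h2 : ¬ b.Holds I σ → Q σ (b.cost + 1)) : Runs L I (.loop b p) σ Q := by
  by_cases h : b.Holds I σ
  · obtain ⟨τ, t, he, υ, t', he', hq⟩ := h1 h
    exact ⟨υ, _, .loop_true _ _ _ _ _ _ _ (Cond.eval_eq_some.2 ⟨hs, by simp [h]⟩) he he', hq⟩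
  · exact ⟨σ, _, .loop_false _ _ _ (Cond.eval_eq_some.2 ⟨hs, by simp [h]⟩), h2 h⟩

end RealRAM

namespace WCVC

open RealRAM

variable {M : Limits} {I : Input} {H : Net} {m k : ℕ} {off : ℕ → ℕ} {xs par : ℕ → ℕ} {L sh A D : ℕ}

/-- Go from the state in register `39` to its predecessor, and append the representative of the item
between them to array `15`, whose length is in register `42`, if it needs an additional vertex. -/
def traceStep : Prog :=
  .assign 28 (.load 14 (.reg 39)) ;; .assign 39 (.load 13 (.reg 39)) ;;
    .ite (.lt (.const 0) (.load 11 (.reg 28)))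
      (.store 15 (.reg 42) (.load 8 (.reg 28)) ;; .assign 42 (.reg 42 + .const 1)) .skip

/-- Follow the chain to the state in register `39` backwards. -/
def traceLoop : Prog := .loop (.not (.eq (.reg 39) (.reg 30))) traceStep

@[simp] theorem traceStep_regs : traceStep.regs = [28, 39, 42] := rfl
@[simp] theorem traceStep_mems : traceStep.mems = [15] := rfl
@[simp] theorem traceLoop_regs : traceLoop.regs = [28, 39, 42] := rfl
@[simp] theorem traceLoop_rmems : traceLoop.rmems = [] := rfl

theorem runs_traceStep {τ : State} {st : ℕ} (hcw : M.cells ≤ M.word) (h39 : τ.reg 39 = st)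
    (hst : st < M.cells) (hpi : τ.mem 14 st < M.cells) (hk : τ.mem 11 (τ.mem 14 st) ≤ 1)
    (hc : τ.reg 42 + τ.mem 11 (τ.mem 14 st) < M.cells) :
    Runs M I traceStep τ fun υ t => t ≤ 40 ∧ υ.reg 39 = τ.mem 13 st ∧
      υ.reg 42 = τ.reg 42 + τ.mem 11 (τ.mem 14 st) ∧
      ∀ v, In (υ.mem 15) (υ.reg 42) v ↔ In (τ.mem 15) (τ.reg 42) v ∨
        τ.mem 11 (τ.mem 14 st) = 1 ∧ τ.mem 8 (τ.mem 14 st) = v := by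
  rw [traceStep]
  simp only [runs_seq, runs_ite, runs_assign, runs_store, runs_skip, safe_load, safe_reg, safe_add,
    safe_const, csafe_lt, holds_lt, val_load, val_reg, val_add, val_const, setReg_reg, setReg_mem,
    setMem_reg, setMem_mem, h39, true_and, if_false, if_true,
    show (39 : ℕ) ≠ 28 by decide, show (28 : ℕ) ≠ 39 by decide, show (42 : ℕ) ≠ 28 by decide,
    show (42 : ℕ) ≠ 39 by decide, show (39 : ℕ) ≠ 42 by decide, ccost_lt, cost_load, cost_reg,
    cost_add, cost_const]
  refine ⟨by omega, by omega, ⟨by omega, by omega⟩, fun hpos => ?_, fun hpos => ?_⟩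
  · have hk : τ.mem 11 (τ.mem 14 st) = 1 := by omega
    refine ⟨by omega, by omega, by omega, by omega, by omega, fun v => ?_⟩
    rw [in_update_iff]
    simp only [hk, true_and]
    tauto
  · have hk : τ.mem 11 (τ.mem 14 st) = 0 := by omega
    exact ⟨by omega, by omega, fun v => by simp [hk]⟩

theorem runs_traceLoop {ps pi kap rep cn : ℕ → ℕ} {W : ℕ} (hW : W ≤ M.cells) (hcw : M.cells ≤ M.word)
    (hst : ∀ st < W, st ≠ D → cn st ≠ 0 → ps st < st ∧ cn (ps st) ≠ 0 ∧ pi st < M.cells ∧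
      kap (pi st) ≤ 1) {l : List ℕ} {st : ℕ} (hp : Path ps pi D l st) :
    ∀ τ : State, st < W → cn st ≠ 0 → τ.reg 30 = D → τ.reg 39 = st → τ.mem 13 = ps →
      τ.mem 14 = pi → τ.mem 11 = kap → τ.mem 8 = rep →
      τ.reg 42 + (l.map kap).sum < M.cells →
      Runs M I traceLoop τ fun υ t => t ≤ l.length * 60 + 20 ∧
        υ.reg 42 = τ.reg 42 + (l.map kap).sum ∧
        ∀ v, In (υ.mem 15) (υ.reg 42) v ↔ In (τ.mem 15) (τ.reg 42) v ∨
          ∃ i ∈ l, kap i = 1 ∧ rep i = v := by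
  induction hp with
  | nil =>
    intro τ _ _ h30 h39 _ _ _ _ hc
    refine Runs.loop_step (by simp) (fun h => ?_) fun _ => ?_
    · exact absurd (h39.trans h30.symm) (by simpa using h)
    · simp
  | @cons l st hne hp ih =>
    intro τ hlt h0 h30 h39 h13 h14 h11 h8 hc
    obtain ⟨hs1, hs2, hs3, hs4⟩ := hst st hlt hne h0
    rw [List.map_cons, List.sum_cons] at hc
    refine Runs.loop_step (by simp) (fun _ => ?_) fun h => ?_
    · refine (runs_traceStep hcw h39 (by omega) (by rw [h14]; exact hs3) (by rw [h11, h14]; exact hs4)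
        (by rw [h11, h14]; omega)).mono fun υ t hf hυ => ?_
      rw [h13, h14, h11, h8] at hυ
      obtain ⟨ht, g39, g42, hin⟩ := hυ
      have hm : ∀ a, a ≠ 15 → υ.mem a = τ.mem a := fun a ha => hf.mem a (by simp [ha])
      refine (ih υ (by omega) hs2 ((hf.reg 30 (by simp)).trans h30) g39 ((hm 13 (by decide)).trans h13)
        ((hm 14 (by decide)).trans h14) ((hm 11 (by decide)).trans h11)
        ((hm 8 (by decide)).trans h8) (by omega)).mono fun ρ t' _ hρ => ?_
      obtain ⟨ht', r42, hin'⟩ := hρ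
      refine ⟨?_, ?_, fun v => ?_⟩
      · simp only [ccost_not, ccost_eq, cost_reg, List.length_cons]
        omega
      · rw [List.map_cons, List.sum_cons]
        omega
      · rw [hin', hin, List.exists_mem_cons_iff, or_assoc]
    · simp only [holds_not, holds_eq, val_reg, h39, h30, not_not] at h
      exact absurd h hne

/-- A cover has been found: register `41` holds the choice, array `15` the additional vertices, whose
number is in register `42`, and `w` is a bound for the weight. -/
def Describes (xs : ℕ → ℕ) (L sh : ℕ) (H : Net) (k : ℕ) (σ : State) (w : ℝ) : Prop :=
  σ.reg 41 < 2 ^ (L - sh) ∧ σ.reg 42 ≤ k ∧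
    ∃ X, H.IsDescribed xs L sh (σ.reg 41) (fun v => In (σ.mem 15) (σ.reg 42) v) X ∧ H.CVC X ∧
      X.card ≤ k + sh ∧ (sh = 0 ∨ ∀ p ≤ sh, xs p ∈ X) ∧ (sh = 0 → ∑ v ∈ X, H.ω v ≤ w)

/-- Register `40` tells whether a cover has been found. -/
def BestState (xs : ℕ → ℕ) (L sh : ℕ) (H : Net) (k : ℕ) (σ : State) : Prop :=
  σ.reg 40 = 0 ∨ σ.reg 40 = 1 ∧ Describes xs L sh H k σ (σ.rmem 5 0)

/-- A cover has been found whose weight is recorded to be at most `w`. -/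
def Beats (σ : State) (w : ℝ) : Prop := σ.reg 40 = 1 ∧ σ.rmem 5 0 ≤ w

theorem BestState.congr {σ τ : State} (h : BestState xs L sh H k σ)
    (hr : ∀ x ∈ [40, 41, 42], τ.reg x = σ.reg x) (hm : τ.mem 15 = σ.mem 15)
    (hrm : τ.rmem 5 = σ.rmem 5) : BestState xs L sh H k τ := by
  rw [BestState, Describes, hm, hrm, hr 40 (by simp), hr 41 (by simp), hr 42 (by simp)]
  exact h

/-- Compare the cover described by the state in register `32` with the best known one. -/
def selectStep : Prog :=
  .ite (.and (.lt (.const 0) (.load 12 (.reg 32)))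
      (.lt (.reg 26 + .load 12 (.reg 32)) (.reg 3 + .const 2)))
    (.assign 43 (.const 0) ;;
      .ite (.lt (.reg 40) (.const 1)) (.assign 43 (.const 1))
        (.ite (.rlt (.load 3 (.const 0) + .load 2 (.reg 32)) (.load 5 (.const 0)))
          (.assign 43 (.const 1)) .skip) ;;
      .ite (.lt (.const 0) (.reg 43))
        (.assign 40 (.const 1) ;; .assign 41 (.reg 23) ;;
          .rstore 5 (.const 0) (.load 3 (.const 0) + .load 2 (.reg 32)) ;;
          .assign 42 (.const 0) ;; .assign 39 (.reg 32) ;; traceLoop) .skip) .skip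

@[simp] theorem selectStep_regs : selectStep.regs = [43, 43, 43, 40, 41, 42, 39, 28, 39, 42] := rfl
@[simp] theorem selectStep_mems : selectStep.mems = [15] := rfl
@[simp] theorem selectStep_rmems : selectStep.rmems = [5] := rfl

theorem Setup.runs_selectStep (S : Setup M I H m k off) (Y : Small H k xs par L sh) {σ : State}
    {st N : ℕ} {Dn : ℕ → Prop} (hE : EvalState xs par L sh H k A σ) (hA : A < 2 ^ (L - sh))
    (hD1 : 1 ≤ D) (hD : 2 ^ (L - sh) * D ≤ 4 * (2 ^ k * k)) (hV : H.Valid xs L sh A)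
    (hT : TableState xs L sh H D (2 ^ tops par sh A (L - sh) * D) N Dn σ)
    (h30 : σ.reg 30 = D) (h32 : σ.reg 32 = st)
    (h1 : 2 ^ tops par sh A (L - sh) * D - D ≤ st) (h2 : st < 2 ^ tops par sh A (L - sh) * D)
    (hB : BestState xs L sh H k σ) :
    Runs M I selectStep σ fun τ t => t ≤ 60 * H.n + 100 ∧ BestState xs L sh H k τ ∧
      (∀ w, Beats σ w → Beats τ w) ∧
      (σ.mem 12 st ≠ 0 → σ.reg 26 + σ.mem 12 st ≤ k + 1 → Beats τ (σ.rmem 3 0 + σ.rmem 2 st)) := by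
  have hw := S.word_le
  have hcw := S.cells_le
  have hk := S.k_le
  have hk1 := S.k_pos
  have hc := S.le_cells
  have hp := S.two_pow_le
  have h2s := Y.two_pow_le
  have hs := Y.le_s
  have hn1 := S.n_pos
  have hLn := Y.le_n
  have hreg3 := hE.built.consts.reg_k
  have hcnt : σ.reg 26 ≤ H.n := by
    rw [hE.cnt]
    exact (Finset.sum_le_sum_of_subset (Finset.filter_subset _ _)).trans
      (hE.built.inv.counts Y.toLayout).sum_le
  have hcl := hT.cn_le hD1 (fun i ⟨v, hv, hvi⟩ => hvi ▸ hE.eval.kap_le v hv) st h2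
  have hpow : 2 ^ tops par sh A (L - sh) ≤ 2 ^ (L - sh) := Nat.pow_le_pow_right (by omega) tops_le
  have hcD' : 2 ^ tops par sh A (L - sh) * D ≤ 2 ^ (L - sh) * D := Nat.mul_le_mul_right _ hpow
  have hword : 2 * k + 4 < M.word := by omega
  have hcw2 : σ.reg 26 + σ.mem 12 st < M.word := by
    have := Nat.add_le_add hcnt hcl
    -- both summands are at most half of the largest word
    have h3 : 100 * H.n ≤ M.word := by omega
    have h4 : 100 * (2 ^ k * k) ≤ M.word := by omega
    omega
  rw [selectStep, runs_ite]
  simp only [csafe_and, csafe_lt, safe_const, safe_load, safe_reg, safe_add, holds_and, holds_lt,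
    val_const, val_load, val_reg, val_add, h32, hreg3, true_and, ccost_and, ccost_lt, cost_const,
    cost_load, cost_reg, cost_add]
  refine ⟨by omega, fun hcond => ?_, fun hcond => ?_⟩
  · obtain ⟨l, hpath, hlen, hit, hsum, X, hXd, hX, hXk, hXw⟩ :=
      hE.exists_cvc Y.toLayout hD1 hV hT h1 h2 (by omega) (by omega)
    have hupd : ∀ ρ : State, Frame (.assign 43 (.const 0)) σ ρ →
        Runs M I (.assign 40 (.const 1) ;; .assign 41 (.reg 23) ;;
          .rstore 5 (.const 0) (.load 3 (.const 0) + .load 2 (.reg 32)) ;;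
          .assign 42 (.const 0) ;; .assign 39 (.reg 32) ;; traceLoop) ρ fun τ t =>
          t ≤ 60 * H.n + 50 ∧ BestState xs L sh H k τ ∧ Beats τ (σ.rmem 3 0 + σ.rmem 2 st) ∧
            τ.rmem 5 0 = σ.rmem 3 0 + σ.rmem 2 st := by
      intro ρ hf
      have er : ∀ x, x ≠ 43 → ρ.reg x = σ.reg x := fun x hx => hf.reg x (by simp [hx])
      have em : ρ.mem = σ.mem := by funext a; exact hf.mem a (by simp)
      have erm : ρ.rmem = σ.rmem := by funext a; exact hf.rmem a (by simp)
      simp only [runs_seq, runs_assign, runs_rstore, safe_const, safe_reg, val_const, val_reg,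
        rsafe_add, rsafe_load, rval_add, rval_load, setReg_reg, setReg_rmem, setRMem_reg, erm,
        true_and, if_false, show (23 : ℕ) ≠ 40 by decide, show (32 : ℕ) ≠ 42 by decide,
        show (32 : ℕ) ≠ 41 by decide, show (32 : ℕ) ≠ 40 by decide, er 23 (by decide),
        er 32 (by decide), h32, hE.reg_A, cost_const, cost_reg, rcost_add, rcost_load]
      refine ⟨by omega, by omega, by omega, by omega, by omega, ?_⟩
      refine (runs_traceLoop (cn := σ.mem 12) (rep := σ.mem 8) (kap := σ.mem 11)
        (by omega) hcw ?_ hpath _ h2 (by omega) ?_ ?_ ?_ ?_ ?_ ?_ ?_).mono ?_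
      · intro st' hst' hne hcn'
        obtain ⟨s1, -, s2, s3, -⟩ := hT.sound st' hst' hne hcn'
        have := s3.lt Y.toLayout
        obtain ⟨v, hv, hvi⟩ := s3
        exact ⟨s1, s2, by omega, hvi ▸ hE.eval.kap_le v hv⟩
      · simp [er, h30]
      · simp
      · simp [em]
      · simp [em]
      · simp [em]
      · simp [em]
      · simp; omega
      · rintro τ t hfτ ⟨ht, hr, hin⟩
        have g40 : τ.reg 40 = 1 := by rw [hfτ.reg 40 (by simp)]; simp
        have g41 : τ.reg 41 = A := by rw [hfτ.reg 41 (by simp)]; simp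
        have g5 : τ.rmem 5 0 = σ.rmem 3 0 + σ.rmem 2 st := by rw [hfτ.rmem 5 (by simp)]; simp
        refine ⟨?_, Or.inr ⟨g40, by rw [g41]; exact hA, ?_, X, ?_, hX, hXk, ?_, ?_⟩, ⟨g40, g5.le⟩, g5⟩
        · have : l.length * 60 ≤ H.n * 60 := Nat.mul_le_mul_right _ hlen
          omega
        · simp at hr
          omega
        · intro v
          rw [hXd, g41]
          refine and_congr_right fun _ => or_congr_right (Iff.trans ?_ (hin v).symm)
          simp [In]
        · refine hV.root.symm.imp_right fun h0 p hp => (hXd _).2 ⟨Y.lt p ?_, Or.inl ?_⟩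
          · have := Y.sh_lt
            omega
          · rw [Y.base_xs (by have := Y.sh_lt; omega), Nat.sub_eq_zero_of_le hp]
            exact h0
        · rw [g5]
          exact hXw
    have hmono : ∀ τ : State, τ.rmem 5 0 = σ.rmem 3 0 + σ.rmem 2 st → τ.reg 40 = 1 →
        (σ.reg 40 = 1 → σ.rmem 3 0 + σ.rmem 2 st < σ.rmem 5 0) → ∀ w, Beats σ w → Beats τ w := by
      intro τ h5 h40 hlt w hb
      refine ⟨h40, ?_⟩
      have := hlt hb.1
      rw [h5]
      linarith [hb.2]
    simp only [runs_seq (p := Prog.assign _ _), runs_assign, safe_const, val_const]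
    refine ⟨by omega, ?_⟩
    rw [runs_seq]
    -- the comparison has three outcomes
    have hcmp : Runs M I (.ite (.lt (.reg 40) (.const 1)) (.assign 43 (.const 1))
        (.ite (.rlt (.load 3 (.const 0) + .load 2 (.reg 32)) (.load 5 (.const 0)))
          (.assign 43 (.const 1)) .skip)) (σ.setReg 43 0) fun τ t => t ≤ 20 ∧
        ((τ.reg 43 = 1 ∧ (σ.reg 40 = 1 → σ.rmem 3 0 + σ.rmem 2 st < σ.rmem 5 0)) ∨
          (τ.reg 43 = 0 ∧ Beats σ (σ.rmem 3 0 + σ.rmem 2 st))) := by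
      simp only [runs_ite, runs_assign, runs_skip, csafe_lt, csafe_rlt, rsafe_add, rsafe_load,
        rval_add, rval_load, safe_const, safe_reg, holds_lt, holds_rlt, val_const, val_reg, setReg_reg,
        setReg_rmem, if_false, if_true, show (40 : ℕ) ≠ 43 by decide, show (32 : ℕ) ≠ 43 by decide, h32,
        true_and, ccost_lt, ccost_rlt, cost_reg, cost_const, rcost_add, rcost_load]
      refine ⟨by omega, fun a1 => ⟨by omega, by omega, Or.inl fun h => by omega⟩, fun a1 => ⟨by omega,
        fun a2 => ⟨by omega, by omega, Or.inl fun _ => a2⟩, fun a2 => ⟨by omega, Or.inr ⟨?_, not_lt.1 a2⟩⟩⟩⟩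
      rcases hB with h | h
      · omega
      · exact h.1
    refine hcmp.mono fun τ t hf ⟨ht, hor⟩ => ?_
    have er : ∀ x, x ≠ 43 → τ.reg x = σ.reg x := fun x hx => by rw [hf.reg x (by simp [hx])]; simp [hx]
    have em : τ.mem = σ.mem := by funext a; rw [hf.mem a (by simp)]; simp
    have erm : τ.rmem = σ.rmem := by funext a; rw [hf.rmem a (by simp)]; simp
    rw [runs_ite]
    simp only [csafe_lt, safe_const, safe_reg, holds_lt, val_const, val_reg, and_true, ccost_lt,
      cost_const, cost_reg]
    refine ⟨by omega, fun h43 => ?_, fun h43 => ?_⟩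
    · rcases hor with ⟨-, hor⟩ | ⟨h, -⟩
      · refine (hupd τ ⟨fun x hx => er x (by simpa using hx), fun _ _ => by rw [em],
          fun _ _ => by rw [erm]⟩).mono ?_
        rintro υ t' - ⟨ht', hB', hb, h5⟩
        exact ⟨by omega, hB', hmono υ h5 hb.1 hor, fun _ _ => hb⟩
      · omega
    · rcases hor with ⟨h, -⟩ | ⟨-, hor⟩
      · omega
      · rw [runs_skip]
        have hb : ∀ w, Beats σ w → Beats τ w := fun w h => by
          rw [Beats, er 40 (by decide), erm]
          exact h
        refine ⟨by omega, hB.congr (fun x hx => er x (by simp at hx; omega)) (by rw [em]) (by rw [erm]),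
          hb, fun _ _ => hb _ hor⟩
  · rw [runs_skip]
    exact ⟨by omega, hB, fun _ h => h, fun h3 h4 => absurd ⟨by omega, by omega⟩ hcond⟩

end WCVC

/-! ### The program that solves the problem relative to a list -/

namespace WCVC

open RealRAM

variable {M : Limits} {I : Input} {H : Net} {m k : ℕ} {off : ℕ → ℕ} {xs par : ℕ → ℕ} {L sh A D : ℕ}

/-- Register `40` tells that a cover has been found, and it is not heavier than `Z` if the weight
matters. -/
def Dominates (sh : ℕ) (H : Net) (σ : State) (Z : Finset ℕ) : Prop :=
  σ.reg 40 = 1 ∧ (sh = 0 → σ.rmem 5 0 ≤ ∑ v ∈ Z, H.ω v)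

theorem Dominates.mono {σ τ : State} {Z : Finset ℕ} (h : Dominates sh H σ Z)
    (hb : ∀ w, Beats σ w → Beats τ w) : Dominates sh H τ Z :=
  have h' := hb (σ.rmem 5 0) ⟨h.1, le_rfl⟩
  ⟨h'.1, fun h0 => h'.2.trans (h.2 h0)⟩

theorem Dominates.congr {σ τ : State} {Z : Finset ℕ} (h : Dominates sh H σ Z)
    (h40 : τ.reg 40 = σ.reg 40) (h5 : τ.rmem 5 = σ.rmem 5) : Dominates sh H τ Z := by
  rwa [Dominates, h40, h5]

/-- Compare the covers described by the final states with the best known cover. -/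
def select : Prog :=
  .assign 31 (.reg 25 * .reg 30) ;; .for 32 (.reg 31 - .reg 30) 31 selectStep

@[simp] theorem select_regs : select.regs = 31 :: 32 :: (selectStep.regs ++ [32]) := rfl
@[simp] theorem select_mems : select.mems = [15] := rfl
@[simp] theorem select_rmems : select.rmems = [5] := rfl

theorem Setup.runs_select (S : Setup M I H m k off) (Y : Small H k xs par L sh) {σ : State}
    (hE : EvalState xs par L sh H k A σ) (hA : A < 2 ^ (L - sh))
    (hD1 : 1 ≤ D) (hD : 2 ^ (L - sh) * D ≤ 4 * (2 ^ k * k)) (hDk : sh = 0 → D = k + 1)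
    (hV : H.Valid xs L sh A)
    (hT : TableState xs L sh H D (2 ^ tops par sh A (L - sh) * D) (2 ^ tops par sh A (L - sh) * D)
      (fun _ => False) σ) (h30 : σ.reg 30 = D) (hB : BestState xs L sh H k σ) :
    Runs M I select σ fun τ t => t ≤ 2 ^ tops par sh A (L - sh) * D * (200 * H.n) ∧
      BestState xs L sh H k τ ∧ (∀ w, Beats σ w → Beats τ w) ∧
      ∀ Z, H.CVC Z → Z.card ≤ k + sh → IsTrace xs L sh A Z → (sh = 0 ∨ ∀ p ≤ sh, xs p ∈ Z) →
        Dominates sh H τ Z := by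
  have hw := S.word_le
  have hcw := S.cells_le
  have hc := S.le_cells
  have hp := S.two_pow_le
  have hn1 := S.n_pos
  have hpow : 2 ^ tops par sh A (L - sh) ≤ 2 ^ (L - sh) := Nat.pow_le_pow_right (by omega) tops_le
  have hcD : 2 ^ tops par sh A (L - sh) * D ≤ 2 ^ (L - sh) * D := Nat.mul_le_mul_right _ hpow
  have hDW : D ≤ 2 ^ tops par sh A (L - sh) * D := Nat.le_mul_of_pos_left _ (by positivity)
  rw [select]
  simp only [runs_seq (p := Prog.assign _ _), runs_assign, safe_mul, safe_reg, val_mul, val_reg,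
    hE.pc, h30, true_and, cost_mul, cost_reg]
  set W := 2 ^ tops par sh A (L - sh) * D with hW
  refine ⟨by omega, ?_⟩
  have key : ∀ τ, Frame (Prog.for 32 (.reg 31 - .reg 30) 31 selectStep) (σ.setReg 31 W) τ →
      EvalState xs par L sh H k A τ ∧ TableState xs L sh H D W W (fun _ => False) τ ∧
      τ.reg 30 = D ∧ τ.reg 26 = σ.reg 26 ∧ τ.mem 12 = σ.mem 12 ∧ τ.rmem 2 = σ.rmem 2 ∧
      τ.rmem 3 = σ.rmem 3 := by
    intro τ hf
    have hf' : Frame select σ τ := by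
      refine ⟨fun x hx => ?_, fun x hx => ?_, fun x hx => ?_⟩
      · simp only [select_regs, List.mem_cons, not_or] at hx
        rw [hf.reg x (by simp only [regs_for, List.mem_cons, not_or]; exact hx.2)]
        simp [hx.1]
      · exact hf.mem x (by simpa using hx)
      · exact hf.rmem x (by simpa using hx)
    refine ⟨hE.frame_of_disjoint hf' (by simp) (by simp) (by simp), ?_, ?_, ?_, ?_, ?_, ?_⟩
    · rw [TableState, hf'.mem 10 (by simp), hf'.mem 11 (by simp), hf'.mem 12 (by simp),
        hf'.mem 13 (by simp), hf'.mem 14 (by simp), hf'.rmem 2 (by simp), hf'.rmem 4 (by simp)]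
      exact hT
    · rw [hf'.reg 30 (by simp), h30]
    · exact hf'.reg 26 (by simp)
    · exact hf'.mem 12 (by simp)
    · exact hf'.rmem 2 (by simp)
    · exact hf'.rmem 3 (by simp)
  refine Runs.for_const (W - D) W (fun st τ => BestState xs L sh H k τ ∧
      (∀ w, Beats σ w → Beats τ w) ∧ ∀ st' < st, W - D ≤ st' → σ.mem 12 st' ≠ 0 →
        σ.reg 26 + σ.mem 12 st' ≤ k + 1 → Beats τ (σ.rmem 3 0 + σ.rmem 2 st')) (60 * H.n + 100)
    (by simp [h30]; omega) (by simp [h30]) (by simp) (by omega) (by omega) (by decide) (by simp)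
    (by simp) ?_ ?_ ?_
  · exact ⟨hB.congr (by simp) rfl rfl, fun w h => by simpa [Beats] using h, fun st' h1 h2 => by omega⟩
  · rintro st τ h1 h2 hf h32 ⟨i1, i2, i3⟩
    obtain ⟨hE', hT', e30, e26, e12, e2, e3⟩ := key τ hf
    refine (S.runs_selectStep Y hE' hA hD1 hD hV hT' e30 h32 h1 h2 i1).mono ?_
    rintro υ t - ⟨ht, j1, j2, j3⟩
    rw [e12, e26, e3, e2] at j3
    have hb : ∀ w, Beats υ w → Beats (υ.setReg 32 (st + 1)) w := fun w h => by simpa [Beats] using h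
    refine ⟨ht, j1.congr (by simp) rfl rfl, fun w h => hb w (j2 w (i2 w h)), fun st' h3 h4 h5 h6 => ?_⟩
    rcases Nat.lt_succ_iff_lt_or_eq.1 h3 with h3 | rfl
    · exact hb _ (j2 _ (i3 st' h3 h4 h5 h6))
    · exact hb _ (j3 h5 h6)
  · rintro τ t hf - ⟨i1, i2, i3⟩ ht
    refine ⟨?_, i1, i2, fun Z hZ hcard hAZ hU => ?_⟩
    · rw [show W - (W - D) = D by omega] at ht
      simp only [cost_sub, cost_reg] at ht
      have h1 : D * (60 * H.n + 100 + 8) ≤ W * (168 * H.n) := Nat.mul_le_mul hDW (by omega)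
      have h2 : W ≤ W * H.n := Nat.le_mul_of_pos_right _ hn1
      have h3 : W * (200 * H.n) = W * (168 * H.n) + 32 * (W * H.n) := by ring
      omega
    · obtain ⟨st, h1, h2, h3, h4, h5⟩ :=
        hE.exists_state Y.toLayout hD1 hDk hT hZ hcard hAZ hU
      have := i3 st h2 h1 h3 h4
      exact ⟨this.1, fun h0 => this.2.trans (h5 h0)⟩

/-- Compare the covers for the choice in register `23` with the best known one, if the choice is valid
and has a component. -/
def choice : Prog :=
  evalAll ;; .ite (.and (.lt (.reg 24) (.const 1)) (.lt (.const 1) (.reg 25))) (chains ;; select) .skip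

@[simp] theorem choice_regs : choice.regs =
    evalAll.regs ++ ((chains.regs ++ select.regs) ++ []) := rfl
@[simp] theorem choice_mems : choice.mems = evalAll.mems ++ ((chains.mems ++ select.mems) ++ []) := rfl
@[simp] theorem choice_rmems : choice.rmems =
    evalAll.rmems ++ ((chains.rmems ++ select.rmems) ++ []) := rfl

theorem Net.Layout.one_le_tops (Y : H.Layout xs par L sh) {Z : Finset ℕ} (hZ : H.CVC Z)
    (hA : IsTrace xs L sh A Z) {c : ℕ} {cb : ℕ → ℕ} (hc : Comps par (L - sh) sh A c cb) : 1 ≤ c := by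
  obtain ⟨p, hp, hpZ⟩ := Y.exists_mem hZ
  have := Y.sh_lt
  obtain ⟨b, hb, -⟩ := hc.pow (p - sh) (by omega) ((hA _).2 ⟨p, hp, rfl, hpZ⟩)
  omega

open Classical in
theorem Setup.runs_choice (S : Setup M I H m k off) (Y : Small H k xs par L sh) {σ : State}
    (hB : BuildState xs par L sh H k H.n σ) (h23 : σ.reg 23 = A) (hA : A < 2 ^ (L - sh))
    (hD1 : 1 ≤ D) (hD : 2 ^ (L - sh) * D ≤ 4 * (2 ^ k * k)) (hDk : sh = 0 → D = k + 1)
    (h30 : σ.reg 30 = D) (hBest : BestState xs L sh H k σ) :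
    Runs M I choice σ fun τ t => t ≤ 320 * (H.n + 2 * m) +
        (if TreeValid par sh A (L - sh) then 2 ^ tops par sh A (L - sh) else 0) * (450 * (D * H.n)) ∧
      BestState xs L sh H k τ ∧ (∀ w, Beats σ w → Beats τ w) ∧
      ∀ Z, H.CVC Z → Z.card ≤ k + sh → IsTrace xs L sh A Z → (sh = 0 ∨ ∀ p ≤ sh, xs p ∈ Z) →
        Dominates sh H τ Z := by
  have hw := S.word_le
  have hn1 := S.n_pos
  rw [choice, runs_seq]
  refine (S.runs_evalAll Y hB h23 hA).mono ?_
  rintro τ t hf ⟨ht, hE⟩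
  have e30 : τ.reg 30 = D := by rw [hf.reg 30 (by simp), h30]
  have hBest' := hBest.congr (τ := τ) (fun x hx => hf.reg x (by simp at hx ⊢; omega))
    (hf.mem 15 (by simp)) (hf.rmem 5 (by simp))
  have hb : ∀ w, Beats σ w → Beats τ w := fun w h => by
    rwa [Beats, hf.reg 40 (by simp), hf.rmem 5 (by simp)]
  rw [runs_ite]
  simp only [csafe_and, csafe_lt, safe_reg, safe_const, holds_and, holds_lt, val_reg, val_const, hE.pc,
    true_and, and_true, ccost_and, ccost_lt, cost_reg, cost_const]
  refine ⟨by omega, fun ⟨h24, h25⟩ => ?_, fun hcond => ?_⟩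
  · have hV : H.Valid xs L sh A := hE.valid.1 (by omega)
    have htops : 1 ≤ tops par sh A (L - sh) := by
      by_contra h
      rw [show tops par sh A (L - sh) = 0 by omega] at h25
      omega
    -- A valid choice covers the edges of the tree, so that it is among those counted by the bound.
    rw [if_pos (hV.treeValid Y.toLayout), runs_seq]
    refine (S.runs_chains Y hE hD1 hD e30 htops).mono ?_
    rintro υ t' hf' ⟨ht', hE', hT⟩
    refine (S.runs_select Y hE' hA hD1 hD hDk hV hT (by rw [hf'.reg 30 (by simp), e30])
      (hBest'.congr (fun x hx => hf'.reg x (by simp at hx ⊢; omega)) (hf'.mem 15 (by simp))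
        (hf'.rmem 5 (by simp)))).mono ?_
    rintro ρ t'' - ⟨ht'', h1, h2, h3⟩
    refine ⟨?_, h1, fun w h => h2 w ?_, h3⟩
    · have : 2 ^ tops par sh A (L - sh) * (450 * (D * H.n)) =
        2 ^ tops par sh A (L - sh) * D * (250 * H.n) +
          2 ^ tops par sh A (L - sh) * D * (200 * H.n) := by ring
      omega
    · rw [Beats, hf'.reg 40 (by simp), hf'.rmem 5 (by simp)]
      exact hb w h
  · rw [runs_skip]
    refine ⟨by omega, hBest', hb, fun Z hZ hcard hAZ hU => absurd ⟨?_, ?_⟩ hcond⟩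
    · rw [hE.valid.2 (Y.valid_of_trace hZ hAZ hU)]
      exact one_pos
    · exact Nat.one_lt_two_pow (by have := Y.one_le_tops hZ hAZ hE.eval.comps; omega)

/-- Find the best cover that contains the contracted vertices. The number of states per set of
components, in register `30`, is `k + 1` if the weight matters, and `1` otherwise. -/
def choices : Prog :=
  .assign 40 (.const 0) ;; .assign 44 (.load 3 (.reg 18)) ;;
  .ite (.lt (.const 0) (.reg 5)) (.assign 30 (.const 1)) (.assign 30 (.reg 3 + .const 1)) ;;
  .for 23 (.const 0) 44 choice

@[simp] theorem choices_regs : choices.regs =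
    [40, 44, 30, 30] ++ (23 :: (choice.regs ++ [23])) := rfl
@[simp] theorem choices_mems : choices.mems = choice.mems ++ [] := rfl
@[simp] theorem choices_rmems : choices.rmems = choice.rmems ++ [] := rfl

theorem exists_trace (Y : H.Layout xs par L sh) (Z : Finset ℕ) :
    ∃ A < 2 ^ (L - sh), IsTrace xs L sh A Z := by
  classical
  refine ⟨_, Nat.ofBits_lt_two_pow fun j : Fin (L - sh) => decide (∃ p < L, p - sh = j ∧ xs p ∈ Z),
    fun j => ?_⟩
  by_cases h : j < L - sh
  · rw [Nat.testBit_ofBits_lt _ _ h]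
    simp
  · rw [Nat.testBit_ofBits_ge _ _ (by omega)]
    have := Y.sh_lt
    simp only [Bool.false_eq_true, false_iff, not_exists, not_and]
    intro p hp hj
    omega

/-- A cover `Z` is dominated, because its trace on the list is one of the choices. -/
theorem Setup.runs_choices (S : Setup M I H m k off) (Y : Small H k xs par L sh) {σ : State}
    (hB : BuildState xs par L sh H k H.n σ) :
    Runs M I choices σ fun τ t =>
      t ≤ 3000 * ((if sh = 0 then k + 1 else 1) * (2 ^ k * (H.n + 2 * m))) ∧
      BestState xs L sh H k τ ∧
      ∀ Z, H.CVC Z → Z.card ≤ k + sh → (sh = 0 ∨ ∀ p ≤ sh, xs p ∈ Z) → Dominates sh H τ Z := by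
  classical
  have hw := S.word_le
  have hcw := S.cells_le
  have hc := S.le_cells
  have hp := S.two_pow_le
  have hk := S.k_le
  have hn1 := S.n_pos
  have hk1 := S.k_pos
  have h2s := Y.two_pow_le
  have hs := Y.le_s
  have hsh := Y.sh_lt
  set D := if sh = 0 then k + 1 else 1 with hDdef
  have hD1 : 1 ≤ D := by rw [hDdef]; split_ifs <;> omega
  have hDk : sh = 0 → D = k + 1 := fun h => by rw [hDdef, if_pos h]
  have hDk' : D ≤ 2 * k := by rw [hDdef]; split_ifs <;> omega
  have hD : 2 ^ (L - sh) * D ≤ 4 * (2 ^ k * k) := by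
    calc 2 ^ (L - sh) * D ≤ 2 * 2 ^ k * (2 * k) := Nat.mul_le_mul h2s hDk'
      _ = 4 * (2 ^ k * k) := by ring
  rw [choices]
  have hpw := hB.consts.pw (L - sh) hs
  simp only [runs_seq (p := Prog.assign _ _), runs_assign, safe_const, safe_load, safe_reg, val_const,
    val_load, val_reg, setReg_reg, setReg_mem, hB.reg_s, hpw, true_and, if_false,
    show (18 : ℕ) ≠ 40 by decide, cost_const, cost_load, cost_reg]
  refine ⟨by omega, by omega, ?_⟩
  rw [runs_seq]
  have hite : Runs M I (.ite (.lt (.const 0) (.reg 5)) (.assign 30 (.const 1))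
      (.assign 30 (.reg 3 + .const 1))) ((σ.setReg 40 0).setReg 44 (2 ^ (L - sh))) fun τ t =>
      t ≤ 20 ∧ τ.reg 30 = D := by
    simp only [runs_ite, runs_assign, csafe_lt, safe_const, safe_reg, safe_add, holds_lt, val_const,
      val_reg, val_add, setReg_reg, hB.reg_sh, hB.consts.reg_k, true_and, and_true, if_false, if_true,
      show (5 : ℕ) ≠ 44 by decide, show (5 : ℕ) ≠ 40 by decide, show (3 : ℕ) ≠ 44 by decide,
      show (3 : ℕ) ≠ 40 by decide, ccost_lt, cost_const, cost_reg, cost_add]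
    refine ⟨by omega, fun h => ⟨by omega, by omega, ?_⟩, fun h => ⟨by omega, by omega, ?_⟩⟩
    · rw [hDdef, if_neg (by omega)]
    · rw [hDdef, if_pos (by omega)]
  refine hite.mono fun τ t hf ⟨ht, e30⟩ => ?_
  have hBτ : BuildState xs par L sh H k H.n τ :=
    ((hB.setReg _ (by simp)).setReg _ (by simp)).frame_of_disjoint hf (by simp) (by simp) (by simp)
  have e40 : τ.reg 40 = 0 := by rw [hf.reg 40 (by simp)]; simp
  have e44 : τ.reg 44 = 2 ^ (L - sh) := by rw [hf.reg 44 (by simp)]; simp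
  refine Runs.for 0 (2 ^ (L - sh)) (fun a υ => BestState xs L sh H k υ ∧
      ∀ Z, H.CVC Z → Z.card ≤ k + sh → (sh = 0 ∨ ∀ p ≤ sh, xs p ∈ Z) →
        (∃ A < a, IsTrace xs L sh A Z) → Dominates sh H υ Z)
    (fun A => 320 * (H.n + 2 * m) +
      (if TreeValid par sh A (L - sh) then 2 ^ tops par sh A (L - sh) else 0) * (450 * (D * H.n)))
    (by simp; omega) rfl e44 (by omega) (by omega) (by decide) (by simp) (by simp) ?_ ?_ ?_
  · exact ⟨Or.inl (by simp [e40]), fun Z _ _ _ ⟨A, hA, _⟩ => by omega⟩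
  · rintro A υ - hA hfυ h23 ⟨i1, i2⟩
    have f30 : υ.reg 30 = D := by rw [hfυ.reg 30 (by simp), e30]
    have hBυ : BuildState xs par L sh H k H.n υ :=
      hBτ.frame_of_disjoint hfυ (by simp) (by simp) (by simp)
    refine (S.runs_choice Y hBυ h23 hA hD1 hD hDk f30 i1).mono ?_
    rintro ρ t' - ⟨ht', h1, h2, h3⟩
    refine ⟨ht', h1.congr (by simp) rfl rfl, fun Z hZ hcard hU ⟨A', hA', htr⟩ => ?_⟩
    refine Dominates.congr ?_ (by simp) rfl
    rcases Nat.lt_succ_iff_lt_or_eq.1 hA' with hA' | rfl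
    · exact (i2 Z hZ hcard hU ⟨A', hA', htr⟩).mono h2
    · exact h3 Z hZ hcard htr hU
  · rintro υ t' - - ⟨i1, i2⟩ ht'
    refine ⟨?_, i1, fun Z hZ hcard hU => i2 Z hZ hcard hU (exists_trace Y.toLayout Z)⟩
    have hsum := sum_two_pow_tops_le (par := par) (sh := sh) (L - sh) (by omega) Y.toLayout.par_lt'
    have e : ∑ A ∈ Finset.Ico 0 (2 ^ (L - sh)), (320 * (H.n + 2 * m) +
        (if TreeValid par sh A (L - sh) then 2 ^ tops par sh A (L - sh) else 0) *
          (450 * (D * H.n)) + 8) = 2 ^ (L - sh) * (320 * (H.n + 2 * m) + 8) +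
        (∑ A ∈ Finset.range (2 ^ (L - sh)),
          (if TreeValid par sh A (L - sh) then 2 ^ tops par sh A (L - sh) else 0)) *
          (450 * (D * H.n)) := by
      rw [← Finset.range_eq_Ico, Finset.sum_add_distrib, Finset.sum_add_distrib, Finset.sum_mul]
      simp only [Finset.sum_const, Finset.card_range, smul_eq_mul]
      rw [Nat.add_right_comm, ← Nat.mul_add (2 ^ (L - sh))]
    rw [e] at ht'
    -- All choices are evaluated, but the chains are computed for valid choices only.
    have h1 : 2 ^ (L - sh) * (320 * (H.n + 2 * m) + 8) ≤ 2 * 2 ^ k * (328 * (H.n + 2 * m)) :=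
      Nat.mul_le_mul h2s (by omega)
    have h2 := Nat.mul_le_mul hsum (le_refl (450 * (D * H.n)))
    have h3 : 2 ^ (L - sh + 1) * (450 * (D * H.n)) ≤ 4 * 2 ^ k * (450 * (D * (H.n + 2 * m))) :=
      Nat.mul_le_mul (by rw [pow_succ]; omega)
        (Nat.mul_le_mul_left _ (Nat.mul_le_mul_left _ (by omega)))
    have h4 : 2 ^ k * (H.n + 2 * m) ≤ D * (2 ^ k * (H.n + 2 * m)) := Nat.le_mul_of_pos_left _ hD1
    have h5 : 4 * 2 ^ k * (450 * (D * (H.n + 2 * m))) = 1800 * (D * (2 ^ k * (H.n + 2 * m))) := by ring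
    have h6 : 2 * 2 ^ k * (328 * (H.n + 2 * m)) = 656 * (2 ^ k * (H.n + 2 * m)) := by ring
    have h7 : 1 ≤ 2 ^ k * (H.n + 2 * m) := Nat.mul_pos (by positivity) (by omega)
    simp only [cost_const] at ht'
    omega

end WCVC

/-! ### Listing the best cover -/

namespace WCVC

open RealRAM

variable {M : Limits} {I : Input} {H : Net} {m k : ℕ} {off : ℕ → ℕ} {xs par : ℕ → ℕ} {L sh A D : ℕ}

/-- The first `c` entries of `ys` are the elements of `X`, each once. -/
structure Lists (ys : ℕ → ℕ) (c : ℕ) (X : Finset ℕ) : Prop where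
  mem : ∀ v, In ys c v ↔ v ∈ X
  inj : ∀ p < c, ∀ q < c, ys p = ys q → p = q

theorem Lists.image_eq {ys : ℕ → ℕ} {c : ℕ} {X : Finset ℕ} (h : Lists ys c X) :
    (Finset.range c).image ys = X := by
  ext v
  rw [← h.mem, Finset.mem_image]
  simp [In]

theorem Lists.card {ys : ℕ → ℕ} {c : ℕ} {X : Finset ℕ} (h : Lists ys c X) : c = X.card := by
  rw [← h.image_eq, Finset.card_image_of_injOn, Finset.card_range]
  intro p hp q hq
  exact h.inj p (by simpa using hp) q (by simpa using hq)

theorem Lists.append {ys : ℕ → ℕ} {c : ℕ} {X : Finset ℕ} (h : Lists ys c X) {v : ℕ} (hv : v ∉ X) :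
    Lists (Function.update ys c v) (c + 1) (insert v X) := by
  refine ⟨fun w => ?_, fun p hp q hq => ?_⟩
  · rw [in_update_iff, h.mem, Finset.mem_insert, or_comm]
  · have hne : ∀ r < c, ys r ≠ v := fun r hr h' => hv ((h.mem v).1 ⟨r, hr, h'⟩)
    rcases Nat.lt_succ_iff_lt_or_eq.1 hp with hp | rfl <;>
      rcases Nat.lt_succ_iff_lt_or_eq.1 hq with hq | rfl
    · rw [Function.update_of_ne (by omega), Function.update_of_ne (by omega)]
      exact h.inj p hp q hq
    · rw [Function.update_self, Function.update_of_ne (by omega)]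
      exact fun h' => absurd h' (hne p hp)
    · rw [Function.update_self, Function.update_of_ne (by omega)]
      exact fun h' => absurd h'.symm (hne q hq)
    · exact fun _ => rfl

/-- Register `45` becomes `1` if the vertex in register `6` belongs to the best cover because of the
choice in register `41`. -/
def baseTest : Prog :=
  find 6 ;; .ite (.lt (.reg 11) (.reg 4))
    (.assign 45 (.reg 41 / .load 3 (.reg 11 - .reg 5) % .const 2))
    (nbscan ;; .ite (.lt (.op .land (.reg 14) (.reg 41)) (.reg 14)) (.assign 45 (.const 1))
      (.assign 45 (.const 0)))

/-- Register `45` becomes `1` if the vertex in register `6` is listed in array `15`. -/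
def extraTest : Prog :=
  .for 46 (.const 0) 42 (.ite (.eq (.load 15 (.reg 46)) (.reg 6)) (.assign 45 (.const 1)) .skip)

/-- Append the vertex in register `6` to the output if it belongs to the best cover. -/
def collectBody : Prog :=
  baseTest ;; extraTest ;; .ite (.lt (.const 0) (.reg 45))
    (.store 0 (.reg 1) (.reg 6) ;; .assign 1 (.reg 1 + .const 1)) .skip

/-- List the best cover in array `0`, with its size in register `1`. -/
def collect : Prog := .assign 1 (.const 0) ;; .for 6 (.const 0) 2 collectBody

@[simp] theorem baseTest_regs : baseTest.regs =
    [11, 10, 11, 10] ++ (45 :: (nbscan.regs ++ [45, 45])) := rfl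
@[simp] theorem baseTest_mems : baseTest.mems = [] := rfl
@[simp] theorem extraTest_regs : extraTest.regs = [46, 45, 46] := rfl
@[simp] theorem extraTest_mems : extraTest.mems = [] := rfl
@[simp] theorem collectBody_regs : collectBody.regs = baseTest.regs ++ [46, 45, 46, 1] := rfl
@[simp] theorem collectBody_mems : collectBody.mems = [0] := rfl
@[simp] theorem collectBody_rmems : collectBody.rmems = [] := rfl
@[simp] theorem collect_regs : collect.regs = 1 :: 6 :: (collectBody.regs ++ [6]) := rfl
@[simp] theorem collect_mems : collect.mems = [0] := rfl
@[simp] theorem collect_rmems : collect.rmems = [] := rfl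

theorem and_lt_iff {a b : ℕ} : a &&& b < a ↔ ∃ j, a.testBit j = true ∧ b.testBit j = false := by
  have hle : a &&& b ≤ a := Nat.and_le_left
  constructor
  · intro h
    by_contra hno
    push Not at hno
    refine h.ne (Nat.eq_of_testBit_eq fun j => ?_)
    rw [Nat.testBit_and]
    by_cases ha : a.testBit j = true
    · simpa [ha] using hno j ha
    · simp [ha]
  · rintro ⟨j, ha, hb⟩
    refine lt_of_le_of_ne hle fun h => ?_
    have := Nat.testBit_and a b j
    rw [h, ha, hb] at this
    simp at this

theorem Setup.runs_baseTest (S : Setup M I H m k off) (Y : Small H k xs par L sh) {σ : State} {v : ℕ}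
    (hB : BuildState xs par L sh H k H.n σ) (hv : σ.reg 6 = v) (hvn : v < H.n) (h41 : σ.reg 41 = A)
    (hA : A < 2 ^ (L - sh)) :
    Runs M I baseTest σ fun τ t => t ≤ (H.deg v + 1) * (44 * k + 100) + 44 * k + 100 ∧
      τ.reg 45 ≤ 1 ∧ (τ.reg 45 = 1 ↔ H.Base xs L sh A v) := by
  have hw := S.word_le
  have hcw := S.cells_le
  have hk := S.k_le
  have hk1 := S.k_pos
  have hL := Y.le_L
  have hs := Y.le_s
  have hsh := Y.sh_lt
  have h2s := Y.two_pow_le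
  have hp2 := S.two_pow_le
  rw [baseTest, runs_seq]
  refine runs_find (by decide) (by rw [hB.reg_L]; omega) hcw fun τ t hf hF ht => ?_
  rw [hB.mem_xs, hB.reg_L, hv] at hF
  rw [hB.reg_L] at ht
  have hBτ := hB.frame hf (by simp) (by simp) (by simp)
  have e6 : τ.reg 6 = v := by rw [hf.reg 6 (by simp), hv]
  have e41 : τ.reg 41 = A := by rw [hf.reg 41 (by simp), h41]
  have hd : H.deg v * (22 * L + 50) ≤ (H.deg v + 1) * (44 * k + 100) :=
    Nat.mul_le_mul (by omega) (by omega)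
  rw [runs_ite]
  simp only [csafe_lt, safe_reg, holds_lt, val_reg, hBτ.reg_L, true_and, and_true, ccost_lt, cost_reg]
  refine ⟨fun hlt => ?_, fun hlt => ?_⟩
  · have hx : xs (τ.reg 11) = v := by
      rcases hF with hF | hF
      · exact hF.2
      · omega
    have hpw := hBτ.consts.pw (τ.reg 11 - sh) (by omega)
    have h2 : 2 ^ (τ.reg 11 - sh) > 0 := by positivity
    have hdiv : A / 2 ^ (τ.reg 11 - sh) % 2 < 2 := Nat.mod_lt _ (by norm_num)
    have hbit : H.Base xs L sh A v ↔ A / 2 ^ (τ.reg 11 - sh) % 2 = 1 := by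
      rw [← hx, Y.base_xs hlt, Nat.testBit_eq_decide_div_mod_eq, decide_eq_true_eq]
    rw [runs_assign]
    simp only [safe_mod, safe_div, safe_load, safe_sub, safe_reg, safe_const, val_mod, val_div, val_load,
      val_sub, val_reg, val_const, hBτ.reg_sh, hpw, e41, setReg_reg, if_true, true_and, cost_mod,
      cost_div, cost_load, cost_sub, cost_reg, cost_const, hbit]
    have h3 : A / 2 ^ (τ.reg 11 - sh) ≤ A := Nat.div_le_self _ _
    exact ⟨⟨⟨by omega, by omega⟩, by omega⟩, by omega, by omega, trivial⟩
  · have hin : ¬ In xs L v := by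
      rcases hF with hF | hF
      · exact absurd hF.1 hlt
      · exact hF.2
    rw [runs_seq]
    refine S.runs_nbscan (by rw [e6]; exact hvn) (by rw [hBτ.reg_L]; omega) ?_ hBτ.consts.pw ?_
      fun υ t' hf' hS ht' => ?_
    · intro p hp
      rw [hBτ.reg_L] at hp
      rw [hBτ.reg_sh]
      omega
    · rw [hBτ.reg_L, hBτ.mem_xs]
      exact Y.inj
    rw [hBτ.mem_xs, hBτ.reg_L, hBτ.reg_sh, e6] at hS
    rw [e6, hBτ.reg_L] at ht'
    have f41 : υ.reg 41 = A := by rw [hf'.reg 41 (by simp), e41]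
    have hbase : H.Base xs L sh A v ↔ υ.reg 14 &&& A < υ.reg 14 := by
      rw [and_lt_iff, Net.Base]
      simp only [hin, false_and, not_false_eq_true, true_and, false_or, hS.mask]
    have hand : υ.reg 14 &&& A ≤ A := Nat.and_le_right
    simp only [runs_ite, runs_assign, csafe_lt, safe_land, safe_reg, safe_const, holds_lt, val_land,
      val_reg, val_const, f41, setReg_reg, if_true, true_and, and_true, ccost_lt, cost_op, cost_reg,
      cost_const, hbase]
    exact ⟨by omega, fun h => ⟨by omega, by omega, le_rfl, by simp [h]⟩,
      fun h => ⟨by omega, by omega, by omega, by simp [h]⟩⟩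

theorem runs_extraTest {σ : State} {v c : ℕ} (hcw : M.cells ≤ M.word) (hc : c < M.cells)
    (h1 : 1 < M.word) (hv : σ.reg 6 = v) (h42 : σ.reg 42 = c) (h45 : σ.reg 45 ≤ 1) :
    Runs M I extraTest σ fun τ t => t ≤ 30 * c + 10 ∧ τ.reg 45 ≤ 1 ∧
      (τ.reg 45 = 1 ↔ σ.reg 45 = 1 ∨ In (σ.mem 15) c v) := by
  rw [extraTest]
  refine Runs.for_const 0 c (fun j τ => τ.reg 45 ≤ 1 ∧
    (τ.reg 45 = 1 ↔ σ.reg 45 = 1 ∨ In (σ.mem 15) j v)) 20 (by simp; omega) rfl h42 (by omega)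
    (by omega) (by decide) (by simp) (by simp) ?_ ?_ ?_
  · simpa [In] using h45
  · rintro j τ _ hj hf h46 ⟨i1, i2⟩
    have e15 : τ.mem 15 = σ.mem 15 := hf.mem 15 (by simp)
    have e6 : τ.reg 6 = v := by rw [hf.reg 6 (by simp), hv]
    have hin : In (σ.mem 15) (j + 1) v ↔ In (σ.mem 15) j v ∨ σ.mem 15 j = v := by
      constructor
      · rintro ⟨p, hp, h⟩
        rcases Nat.lt_succ_iff_lt_or_eq.1 hp with hp | rfl
        · exact Or.inl ⟨p, hp, h⟩
        · exact Or.inr h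
      · rintro (⟨p, hp, h⟩ | h)
        · exact ⟨p, by omega, h⟩
        · exact ⟨j, by omega, h⟩
    simp only [runs_ite, runs_assign, runs_skip, csafe_eq, safe_load, safe_reg, safe_const, holds_eq,
      val_load, val_reg, val_const, h46, e15, e6, setReg_reg, if_true, if_false, true_and, and_true,
      show (45 : ℕ) ≠ 46 by decide, ccost_eq, cost_load, cost_reg, cost_const, hin]
    refine ⟨by omega, fun h => ⟨by omega, by omega, le_rfl, by simp [h]⟩,
      fun h => ⟨by omega, i1, by simp [h, i2]⟩⟩
  · rintro τ t - - ⟨i1, i2⟩ ht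
    simp only [cost_const] at ht
    exact ⟨by omega, i1, i2⟩

theorem Setup.runs_collect (S : Setup M I H m k off) (Y : Small H k xs par L sh) {σ : State}
    (hB : BuildState xs par L sh H k H.n σ) (hBest : BestState xs L sh H k σ) (h40 : σ.reg 40 = 1) :
    Runs M I collect σ fun τ t => t ≤ (H.n + 2 * m) * (200 * k + 400) ∧
      ∃ X, Lists (τ.mem 0) (τ.reg 1) X ∧ H.CVC X ∧ X.card ≤ k + sh ∧
        (sh = 0 ∨ ∀ p ≤ sh, xs p ∈ X) ∧ (sh = 0 → ∑ v ∈ X, H.ω v ≤ σ.rmem 5 0) := by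
  have hw := S.word_le
  have hcw := S.cells_le
  have hk := S.k_le
  have hk1 := S.k_pos
  have hL := Y.le_L
  have hs := Y.le_s
  have hsh := Y.sh_lt
  obtain ⟨hA, h42, X, hXd, hX, hXk, hXU, hXw⟩ : Describes xs L sh H k σ (σ.rmem 5 0) := by
    rcases hBest with h | h
    · omega
    · exact h.2
  rw [collect]
  simp only [runs_seq (p := Prog.assign _ _), runs_assign, safe_const, val_const, cost_const]
  refine ⟨by omega, ?_⟩
  refine S.runs_vertices (fun v τ => Lists (τ.mem 0) (τ.reg 1) (X.filter (· < v))) (200 * k + 300)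
    (by simp [hB.consts.reg_n]) (by simp) (by simp) ?_ ?_ ?_
  · refine ⟨fun v => ?_, fun p hp => ?_⟩
    · simp [In]
    · simp at hp
  · intro v τ hvn hf h6 hI
    have hf' : Frame collect σ τ := by
      refine ⟨fun x hx => ?_, fun x hx => ?_, fun x hx => ?_⟩
      · simp only [collect_regs, List.mem_cons, not_or] at hx
        rw [hf.reg x (by simp only [regs_for, List.mem_cons, not_or]; exact hx.2)]
        simp [hx.1]
      · exact hf.mem x (by simpa using hx)
      · exact hf.rmem x (by simp)
    have hBτ := hB.frame_of_disjoint hf' (by simp) (by simp) (by simp)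
    have e41 : τ.reg 41 = σ.reg 41 := hf'.reg 41 (by simp)
    have e42 : τ.reg 42 = σ.reg 42 := hf'.reg 42 (by simp)
    have e15 : τ.mem 15 = σ.mem 15 := hf'.mem 15 (by simp)
    rw [collectBody, runs_seq]
    refine (S.runs_baseTest Y hBτ h6 hvn e41 hA).mono ?_
    rintro υ t1 hf1 ⟨ht1, hle1, hb1⟩
    have f15 : υ.mem 15 = σ.mem 15 := by rw [hf1.mem 15 (by simp), e15]
    rw [runs_seq]
    refine (runs_extraTest (c := σ.reg 42) hcw (by omega) (by omega) (by rw [hf1.reg 6 (by simp), h6])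
      (by rw [hf1.reg 42 (by simp), e42]) hle1).mono ?_
    rintro ρ t2 hf2 ⟨ht2, hle2, hb2⟩
    rw [hb1, f15] at hb2
    have hmem : ρ.reg 45 = 1 ↔ v ∈ X := by
      rw [hb2, hXd]
      simp [hvn]
    have g6 : ρ.reg 6 = v := by rw [hf2.reg 6 (by simp), hf1.reg 6 (by simp), h6]
    have g1 : ρ.reg 1 = τ.reg 1 := by rw [hf2.reg 1 (by simp), hf1.reg 1 (by simp)]
    have g0 : ρ.mem 0 = τ.mem 0 := by rw [hf2.mem 0 (by simp), hf1.mem 0 (by simp)]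
    have hcard : τ.reg 1 ≤ k + sh := by
      rw [hI.card]
      exact (Finset.card_filter_le _ _).trans hXk
    have htime : t1 + t2 + 30 ≤ (H.deg v + 1) * (200 * k + 300) := by nlinarith
    simp only [runs_ite, runs_seq, runs_assign, runs_store, runs_skip, csafe_lt, safe_reg, safe_const,
      safe_add, holds_lt, val_reg, val_const, val_add, setMem_reg, setMem_mem, setReg_reg, setReg_mem, g6,
      g1, g0, if_true, if_false, true_and, and_true, show (1 : ℕ) ≠ 6 by decide, ccost_lt, cost_reg,
      cost_const, cost_add]
    refine ⟨by omega, fun h => ⟨by omega, by omega, by omega, ?_⟩, fun h => ⟨by omega, ?_⟩⟩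
    · have e : X.filter (· < v + 1) = insert v (X.filter (· < v)) := by
        ext w
        simp only [Finset.mem_filter, Finset.mem_insert]
        constructor
        · rintro ⟨h1, h2⟩
          rcases Nat.lt_succ_iff_lt_or_eq.1 h2 with h2 | rfl
          · exact Or.inr ⟨h1, h2⟩
          · exact Or.inl rfl
        · rintro (rfl | ⟨h1, h2⟩)
          · exact ⟨hmem.1 (by omega), by omega⟩
          · exact ⟨h1, by omega⟩
      rw [e]
      exact hI.append (by simp)
    · have e : X.filter (· < v + 1) = X.filter (· < v) := by
        refine Finset.filter_congr fun w hw => ⟨fun h1 => ?_, fun h1 => by omega⟩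
        rcases Nat.lt_succ_iff_lt_or_eq.1 h1 with h1 | rfl
        · exact h1
        · exact absurd (hmem.2 hw) (by omega)
      rw [e]
      exact hI
  · intro τ t _ hI ht
    have hXX : X.filter (· < H.n) = X := Finset.filter_true_of_mem fun v hv => hX.lt v hv
    rw [hXX] at hI
    refine ⟨?_, X, hI, hX, hXk, hXU, hXw⟩
    nlinarith [S.n_pos]

end WCVC

/-! ### Ordering a connected vertex cover -/

namespace WCVC

open RealRAM

variable {M : Limits} {I : Input} {H : Net} {m k : ℕ} {off : ℕ → ℕ} {sh : ℕ}

/-- Move the vertex in cell `48` of the array `0` to the end of the ordered list, if it has a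
neighbour there and does not belong to it. -/
def orderBody : Prog :=
  .assign 6 (.load 0 (.reg 48)) ;; find 6 ;; .ite (.lt (.reg 11) (.reg 4)) .skip
    (nbscan ;; .ite (.lt (.reg 12) (.reg 4))
      (.store 1 (.reg 4) (.reg 6) ;; .store 2 (.reg 4) (.reg 12) ;; .assign 4 (.reg 4 + .const 1))
      .skip)

/-- Order the cover in array `0`, keeping the contracted vertices. -/
def order : Prog :=
  .assign 4 (.reg 5 + .const 1) ;; .loop (.lt (.reg 4) (.reg 1)) (.for 48 (.const 0) 1 orderBody)

@[simp] theorem orderBody_regs : orderBody.regs = [6, 11, 10, 11, 10] ++ (nbscan.regs ++ [4]) := rfl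
@[simp] theorem orderBody_mems : orderBody.mems = [1, 2] := rfl
@[simp] theorem order_regs : order.regs = 4 :: 48 :: (orderBody.regs ++ [48]) := rfl
@[simp] theorem order_mems : order.mems = [1, 2] := rfl

/-- The list is a part of the cover `X`, and contains the first `sh + 1` entries of `xs`. -/
structure OrderInv (H : Net) (X : Finset ℕ) (sh : ℕ) (σ : State) : Prop where
  ordered : H.Ordered (σ.mem 1) (σ.mem 2) (σ.reg 4)
  sub : ∀ v, In (σ.mem 1) (σ.reg 4) v → v ∈ X
  sh_lt : sh < σ.reg 4

theorem OrderInv.le_card {X : Finset ℕ} {σ : State} (h : OrderInv H X sh σ) : σ.reg 4 ≤ X.card := by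
  have h1 := Finset.card_le_card_of_injOn (s := Finset.range (σ.reg 4)) (t := X) (σ.mem 1)
    (fun p hp => h.sub _ ⟨p, by simpa using hp, rfl⟩)
    (fun p hp q hq h' => h.ordered.inj p (by simpa using hp) q (by simpa using hq) h')
  simpa using h1

/-- A list that has no neighbours in the rest of the connected set `X` contains `X`. -/
theorem Net.CVC.in_of_closed {xs : ℕ → ℕ} {L : ℕ} {X : Finset ℕ} (hX : H.CVC X) (h0 : 0 < L)
    (hsub : ∀ v, In xs L v → v ∈ X)
    (hcl : ∀ v ∈ X, In xs L v ∨ ∀ u ∈ H.nbr v, ¬ In xs L u) : ∀ v ∈ X, In xs L v := by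
  refine hX.conn {a | In xs L a} ⟨xs 0, hsub _ ⟨0, h0, rfl⟩, 0, h0, rfl⟩ ?_
  intro a _ ha b hb hab
  exact (hcl b hb).resolve_right fun h => h a (H.symm hab) ha

theorem Setup.runs_orderBody (S : Setup M I H m k off) {σ : State} {X : Finset ℕ} {j : ℕ}
    (hX : H.CVC X) (hC : Consts H k σ) (h0 : Lists (σ.mem 0) (σ.reg 1) X) (h5 : σ.reg 5 = sh)
    (h48 : σ.reg 48 = j) (hj : j < σ.reg 1) (hXk : X.card ≤ k + sh) (hX2 : X.card ≤ 2 * k + 2)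
    (hI : OrderInv H X sh σ) :
    Runs M I orderBody σ fun τ t => t ≤ (H.deg (σ.mem 0 j) + 1) * (200 * k + 300) ∧
      OrderInv H X sh τ ∧ (σ.reg 4 < τ.reg 4 ∨
        τ.reg 4 = σ.reg 4 ∧ τ.mem 1 = σ.mem 1 ∧ (In (σ.mem 1) (σ.reg 4) (σ.mem 0 j) ∨
          ∀ u ∈ H.nbr (σ.mem 0 j), ¬ In (σ.mem 1) (σ.reg 4) u)) := by
  have hw := S.word_le
  have hcw := S.cells_le
  have hk := S.k_le
  have hk1 := S.k_pos
  have hLc := hI.le_card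
  have hcard := h0.card
  set v := σ.mem 0 j with hv
  have hvX : v ∈ X := (h0.mem v).1 ⟨j, hj, rfl⟩
  have hvn := hX.lt v hvX
  set L := σ.reg 4 with hL
  set xs := σ.mem 1 with hxs
  rw [orderBody]
  simp only [runs_seq (p := Prog.assign _ _), runs_assign, safe_load, safe_reg, val_load, val_reg, h48,
    ← hv, true_and, cost_load, cost_reg]
  refine ⟨by omega, ?_⟩
  rw [runs_seq]
  refine runs_find (by decide) (by simp; omega) hcw fun τ t hf hF ht => ?_
  simp only [setReg_mem, setReg_reg, if_true, show (4 : ℕ) ≠ 6 by decide, if_false, ← hL, ← hxs] at hF ht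
  have e : ∀ x, x ∉ (find 6).regs → x ≠ 6 → τ.reg x = σ.reg x := fun x hx h6 => by
    rw [hf.reg x hx]
    simp [h6]
  have e4 : τ.reg 4 = L := e 4 (by simp) (by decide)
  have e5 : τ.reg 5 = sh := by rw [e 5 (by simp) (by decide), h5]
  have e6 : τ.reg 6 = v := by rw [hf.reg 6 (by simp)]; simp
  have em : τ.mem = σ.mem := by funext a; rw [hf.mem a (by simp)]; simp
  have hd : H.deg v * (22 * L + 50) + 44 * L + 200 ≤ (H.deg v + 1) * (200 * k + 300) := by
    have : H.deg v * (22 * L + 50) ≤ H.deg v * (200 * k + 300) := Nat.mul_le_mul_left _ (by omega)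
    rw [Nat.add_mul, Nat.one_mul]
    omega
  rw [runs_ite]
  simp only [csafe_lt, safe_reg, holds_lt, val_reg, e4, true_and, and_true, ccost_lt, cost_reg]
  refine ⟨fun hlt => ?_, fun hlt => ?_⟩
  · rw [runs_skip]
    refine ⟨by omega, ⟨?_, ?_, ?_⟩, Or.inr ⟨e4, by rw [em], Or.inl ?_⟩⟩
    · rw [em, e4]; exact hI.ordered
    · rw [em, e4]; exact hI.sub
    · rw [e4]; exact hI.sh_lt
    · rcases hF with hF | hF
      · exact ⟨_, hF⟩
      · omega
  · have hin : ¬ In xs L v := by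
      rcases hF with hF | hF
      · exact absurd hF.1 hlt
      · exact hF.2
    rw [runs_seq]
    refine S.runs_nbscan (by rw [e6]; exact hvn) (by rw [e4]; omega) ?_ (by rw [em]; exact hC.pw) ?_
      fun υ t' hf' hS ht' => ?_
    · intro p hp
      rw [e4] at hp
      rw [e5]
      omega
    · rw [e4, em]
      exact hI.ordered.inj
    rw [em, e4, e5, e6] at hS
    rw [e6, e4] at ht'
    have g4 : υ.reg 4 = L := by rw [hf'.reg 4 (by simp), e4]
    have g6 : υ.reg 6 = v := by rw [hf'.reg 6 (by simp), e6]
    have gm : υ.mem = σ.mem := by funext a; rw [hf'.mem a (by simp), em]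
    rw [runs_ite]
    simp only [csafe_lt, safe_reg, holds_lt, val_reg, g4, true_and, and_true, ccost_lt, cost_reg]
    refine ⟨fun h12 => ?_, fun h12 => ?_⟩
    · have hhit : xs (υ.reg 12) ∈ H.nbr v := by
        rcases hS.hit with h | h
        · omega
        · exact h.2
      have hlt4 : L < X.card := by
        have h1 : insert v ((Finset.range L).image xs) ⊆ X := by
          intro w hw
          rcases Finset.mem_insert.1 hw with rfl | hw
          · exact hvX
          · obtain ⟨p, hp, rfl⟩ := Finset.mem_image.1 hw
            exact hI.sub _ ⟨p, Finset.mem_range.1 hp, rfl⟩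
        have h2 := Finset.card_le_card h1
        rw [Finset.card_insert_of_notMem, Finset.card_image_of_injOn, Finset.card_range] at h2
        · omega
        · intro p hp q hq
          exact hI.ordered.inj p (by simpa using hp) q (by simpa using hq)
        · intro h
          obtain ⟨p, hp, h⟩ := Finset.mem_image.1 h
          exact hin ⟨p, Finset.mem_range.1 hp, h⟩
      have := hI.ordered.append hin h12 hhit
      have hsl := hI.sh_lt
      simp only [runs_seq, runs_assign, runs_store, safe_reg, safe_add, safe_const, val_reg, val_add,
        val_const, setMem_reg, setReg_reg, g4, g6, true_and, if_true, cost_reg, cost_add, cost_const]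
      refine ⟨by omega, by omega, by omega, by omega, ⟨?_, ?_, ?_⟩, Or.inl (by omega)⟩
      · simpa [gm] using this
      · intro w hw
        simp [gm, in_update_iff] at hw
        rcases hw with hw | rfl
        · exact hI.sub w hw
        · exact hvX
      · simp
        omega
    · rw [runs_skip]
      refine ⟨by omega, ⟨?_, ?_, ?_⟩, Or.inr ⟨g4, by rw [gm], Or.inr ?_⟩⟩
      · rw [gm, g4]; exact hI.ordered
      · rw [gm, g4]; exact hI.sub
      · rw [g4]; exact hI.sh_lt
      · rcases hS.hit with h | h
        · exact h.2
        · omega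

theorem Setup.runs_order (S : Setup M I H m k off) {σ : State} {X : Finset ℕ} {L : ℕ}
    (hX : H.CVC X) (hC : Consts H k σ) (h0 : Lists (σ.mem 0) (σ.reg 1) X) (h5 : σ.reg 5 = sh)
    (hXk : X.card ≤ k + sh) (hX2 : X.card ≤ 2 * k + 2)
    (hO : H.Ordered (σ.mem 1) (σ.mem 2) L) (hsh : sh < L) (hU : ∀ p ≤ sh, σ.mem 1 p ∈ X) :
    Runs M I order σ fun τ t => t ≤ (2 * k + 3) * ((H.n + 2 * m) * (200 * k + 320)) + 20 ∧
      H.Ordered (τ.mem 1) (τ.mem 2) (τ.reg 4) ∧ (∀ v, In (τ.mem 1) (τ.reg 4) v ↔ v ∈ X) ∧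
      τ.reg 4 = X.card := by
  have hw := S.word_le
  have hcw := S.cells_le
  have hk := S.k_le
  have hk1 := S.k_pos
  have hn1 := S.n_pos
  have hcard := h0.card
  have hI0 : OrderInv H X sh (σ.setReg 4 (sh + 1)) := by
    refine ⟨?_, ?_, by simp⟩
    · simpa using hO.mono hsh
    · rintro v ⟨p, hp, rfl⟩
      simp at hp ⊢
      exact hU p (by omega)
  have hle0 := hI0.le_card
  simp at hle0
  rw [order]
  simp only [runs_seq (p := Prog.assign _ _), runs_assign, safe_add, safe_reg, safe_const, val_add,
    val_reg, val_const, h5, true_and, cost_add, cost_reg, cost_const]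
  refine ⟨by omega, ?_⟩
  have hdeg : ∑ j ∈ Finset.range (σ.reg 1), H.deg (σ.mem 0 j) ≤ 2 * m := by
    rw [← S.sum_deg, ← Finset.sum_image (f := H.deg) (g := σ.mem 0) (s := Finset.range (σ.reg 1))
      fun p hp q hq => h0.inj p (by simpa using hp) q (by simpa using hq), h0.image_eq]
    exact Finset.sum_le_sum_of_subset fun v hv => Finset.mem_range.2 (hX.lt v hv)
  have hXn : X.card ≤ H.n := by
    have := Finset.card_le_card (t := Finset.range H.n) fun v hv => Finset.mem_range.2 (hX.lt v hv)
    simpa using this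
  refine Runs.loop (OrderInv H X sh) (fun τ => 2 * k + 2 - τ.reg 4)
    ((H.n + 2 * m) * (200 * k + 308) + 6) hI0 (fun _ _ _ => by simp) ?_ ?_
  · intro τ hf hI hlt
    have c1 : τ.reg 1 = σ.reg 1 := by rw [hf.reg 1 (by simp)]; simp
    have c0 : τ.mem 0 = σ.mem 0 := by rw [hf.mem 0 (by simp)]; simp
    have c5 : τ.reg 5 = sh := by rw [hf.reg 5 (by simp)]; simp [h5]
    have cC : Consts H k τ := by
      refine Consts.frame (σ := σ.setReg 4 (sh + 1)) ⟨?_, ?_, hC.pw⟩ hf (by simp) (by simp) (by simp)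
      · simp [hC.reg_n]
      · simp [hC.reg_k]
    simp only [holds_lt, val_reg, c1] at hlt
    refine Runs.for 0 (σ.reg 1) (fun j υ => OrderInv H X sh υ ∧ (τ.reg 4 < υ.reg 4 ∨
        υ.reg 4 = τ.reg 4 ∧ υ.mem 1 = τ.mem 1 ∧ ∀ i < j, In (τ.mem 1) (τ.reg 4) (σ.mem 0 i) ∨
          ∀ u ∈ H.nbr (σ.mem 0 i), ¬ In (τ.mem 1) (τ.reg 4) u))
      (fun j => (H.deg (σ.mem 0 j) + 1) * (200 * k + 300)) (by simp; omega) rfl c1 (by omega)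
      (by omega) (by decide) (by simp) (by simp) ?_ ?_ ?_
    · exact ⟨⟨by simpa using hI.ordered, by simpa using hI.sub, by simpa using hI.sh_lt⟩,
        Or.inr ⟨by simp, rfl, by simp⟩⟩
    · rintro j υ - hj hfυ h48 ⟨hIυ, hor⟩
      have d0 : υ.mem 0 = σ.mem 0 := by rw [hfυ.mem 0 (by simp), c0]
      have d1 : υ.reg 1 = σ.reg 1 := by rw [hfυ.reg 1 (by simp), c1]
      have d5 : υ.reg 5 = sh := by rw [hfυ.reg 5 (by simp), c5]
      refine (S.runs_orderBody hX (cC.frame hfυ (by simp) (by simp) (by simp)) (by rwa [d0, d1]) d5 h48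
        (by omega) hXk hX2 hIυ).mono ?_
      rintro ρ t - ⟨ht, hIρ, hor'⟩
      rw [d0] at ht hor'
      refine ⟨ht, ⟨by simpa using hIρ.ordered, by simpa using hIρ.sub, by simpa using hIρ.sh_lt⟩, ?_⟩
      simp only [setReg_reg, setReg_mem, show (4 : ℕ) ≠ 48 by decide, if_false]
      rcases hor with hor | ⟨o1, o2, o3⟩
      · left
        rcases hor' with h | h
        · omega
        · omega
      · rcases hor' with h | ⟨h1, h2, h3⟩
        · exact Or.inl (by omega)
        · refine Or.inr ⟨by omega, by rw [h2, o2], fun i hi => ?_⟩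
          rcases Nat.lt_succ_iff_lt_or_eq.1 hi with hi | rfl
          · exact o3 i hi
          · rwa [o1, o2] at h3
    · rintro υ t - - ⟨hIυ, hor⟩ ht
      have hlt' : τ.reg 4 < υ.reg 4 := by
        rcases hor with h | ⟨o1, o2, o3⟩
        · exact h
        · exfalso
          have := hX.in_of_closed (by have := hI.sh_lt; omega) hI.sub fun v hv => by
            obtain ⟨i, hi, rfl⟩ := (h0.mem v).2 hv
            exact o3 i hi
          have h2 : X ⊆ (Finset.range (τ.reg 4)).image (τ.mem 1) := fun v hv => by
            obtain ⟨p, hp, rfl⟩ := this v hv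
            exact Finset.mem_image_of_mem _ (Finset.mem_range.2 hp)
          have h3 := (Finset.card_le_card h2).trans Finset.card_image_le
          rw [Finset.card_range] at h3
          omega
      have := hIυ.le_card
      refine ⟨?_, hIυ, by omega⟩
      refine ht.trans ?_
      rw [← Finset.range_eq_Ico, Finset.sum_add_distrib, ← Finset.sum_mul, Finset.sum_add_distrib]
      simp only [Finset.sum_const, Finset.card_range, smul_eq_mul, mul_one, cost_const]
      have h1 : (∑ j ∈ Finset.range (σ.reg 1), H.deg (σ.mem 0 j) + σ.reg 1) * (200 * k + 300) ≤
        (2 * m + H.n) * (200 * k + 300) := Nat.mul_le_mul_right _ (by omega)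
      nlinarith
  · intro τ t hf hI hge ht
    have c1 : τ.reg 1 = σ.reg 1 := by rw [hf.reg 1 (by simp)]; simp
    simp only [holds_lt, val_reg, c1] at hge
    have hle := hI.le_card
    refine ⟨?_, hI.ordered, fun v => ⟨hI.sub v, fun hv => ?_⟩, by omega⟩
    · simp only [setReg_reg, if_true, ccost_lt, cost_reg] at ht
      have h1 : (2 * k + 2 - (sh + 1)) * ((H.n + 2 * m) * (200 * k + 308) + 6 + (1 + 1 + 1) + 1) ≤
        (2 * k + 3) * ((H.n + 2 * m) * (200 * k + 320)) := Nat.mul_le_mul (by omega) (by nlinarith)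
      omega
    · have h2 : (Finset.range (τ.reg 4)).image (τ.mem 1) = X := by
        refine Finset.eq_of_subset_of_card_le (fun w hw => ?_) ?_
        · obtain ⟨p, hp, rfl⟩ := Finset.mem_image.1 hw
          exact hI.sub _ ⟨p, Finset.mem_range.1 hp, rfl⟩
        · rw [Finset.card_image_of_injOn, Finset.card_range]
          · omega
          · intro p hp q hq
            exact hI.ordered.inj p (by simpa using hp) q (by simpa using hq)
      rw [← h2] at hv
      obtain ⟨p, hp, rfl⟩ := Finset.mem_image.1 hv
      exact ⟨p, Finset.mem_range.1 hp, rfl⟩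

end WCVC

/-! ### The iterative algorithm -/

namespace WCVC

open RealRAM

variable {M : Limits} {I : Input} {H : Net} {m k : ℕ} {off : ℕ → ℕ}

/-- Solve the problem relative to the current list. -/
def findBest : Prog := build ;; choices

/-- Replace the current list by a smaller cover if it is too long for the next round, and contract
one vertex less. Register `0` becomes `0` if there is no small cover. -/
def improve : Prog :=
  .ite (.lt (.reg 3 + .reg 5) (.reg 4))
    (findBest ;; .ite (.lt (.const 0) (.reg 40)) (collect ;; order) (.assign 0 (.const 0))) .skip ;;
  .assign 5 (.reg 5 - .const 1)

/-- The algorithm for graphs with edges and positive parameter. -/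
def iterate : Prog :=
  growth ;; .ite (.lt (.const 0) (.reg 0)) (.assign 5 (.reg 4 - .const 2)) (.assign 5 (.const 0)) ;;
  .loop (.and (.lt (.const 0) (.reg 5)) (.lt (.const 0) (.reg 0))) improve ;;
  .ite (.lt (.const 0) (.reg 0))
    (findBest ;; .ite (.lt (.const 0) (.reg 40)) collect (.assign 0 (.const 0))) .skip

@[simp] theorem findBest_regs : findBest.regs = build.regs ++ choices.regs := rfl

/-- The invariant of the main loop. -/
def MainInv (H : Net) (k : ℕ) (σ : State) : Prop :=
  Consts H k σ ∧ ((σ.reg 0 = 0 ∧ ∀ Z, H.CVC Z → k < Z.card) ∨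
    (σ.reg 0 = 1 ∧ Small H k (σ.mem 1) (σ.mem 2) (σ.reg 4) (σ.reg 5)))

theorem Setup.runs_findBest (S : Setup M I H m k off) {σ : State} (hC : Consts H k σ)
    (Y : Small H k (σ.mem 1) (σ.mem 2) (σ.reg 4) (σ.reg 5)) :
    Runs M I findBest σ fun τ t =>
      t ≤ (2000 + 3000 * (if σ.reg 5 = 0 then k + 1 else 1)) * (2 ^ k * (H.n + 2 * m)) ∧
      BuildState (σ.mem 1) (σ.mem 2) (σ.reg 4) (σ.reg 5) H k H.n τ ∧
      BestState (σ.mem 1) (σ.reg 4) (σ.reg 5) H k τ ∧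
      ∀ Z, H.CVC Z → Z.card ≤ k + σ.reg 5 → (σ.reg 5 = 0 ∨ ∀ p ≤ σ.reg 5, σ.mem 1 p ∈ Z) →
        Dominates (σ.reg 5) H τ Z := by
  rw [findBest, runs_seq]
  refine (S.runs_build Y.toLayout Y.le_L Y.le_s hC).mono ?_
  rintro τ t - ⟨ht, hB⟩
  refine (S.runs_choices Y hB).mono ?_
  rintro υ t' hf' ⟨ht', hBest, hdom⟩
  refine ⟨?_, hB.frame_of_disjoint hf' (by simp) (by simp) (by simp), hBest, hdom⟩
  rw [Nat.add_mul, Nat.mul_assoc 3000]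
  exact Nat.add_le_add ht ht'

theorem sq_le_two_pow (k : ℕ) : k * k ≤ 2 * 2 ^ k := by
  induction k with
  | zero => simp
  | succ k ih =>
    have : k + 1 ≤ 2 ^ k := Nat.lt_two_pow_self
    rw [pow_succ]
    rcases Nat.lt_or_ge k 3 with h | h
    · interval_cases k <;> norm_num
    · nlinarith

/-- A quadratic polynomial of the parameter times the size of the graph is a lower order term. -/
theorem sq_mul_le (k N : ℕ) : k * k * N ≤ 2 * (2 ^ k * N) := by
  rw [← Nat.mul_assoc]
  exact Nat.mul_le_mul_right _ (sq_le_two_pow k)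

theorem Setup.runs_improve (S : Setup M I H m k off) {σ : State} (hI : MainInv H k σ)
    (h0 : 0 < σ.reg 0) (h5 : 0 < σ.reg 5) :
    Runs M I improve σ fun τ t => t ≤ 20000 * (2 ^ k * (H.n + 2 * m)) ∧ MainInv H k τ ∧
      τ.reg 5 < σ.reg 5 := by
  have hw := S.word_le
  have hk1 := S.k_pos
  have hn1 := S.n_pos
  have hcw := S.cells_le
  have hk := S.k_le
  obtain ⟨hC, h | ⟨hr0, Y⟩⟩ := hI
  · omega
  have hB1 : 1 ≤ 2 ^ k * (H.n + 2 * m) := Nat.mul_pos (by positivity) (by omega)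
  have hL := Y.le_L
  have hs := Y.le_s
  have hsh := Y.sh_lt
  rw [improve, runs_seq]
  suffices h : Runs M I (.ite (.lt (.reg 3 + .reg 5) (.reg 4))
      (findBest ;; .ite (.lt (.const 0) (.reg 40)) (collect ;; order) (.assign 0 (.const 0))) .skip)
      σ fun τ t => t + 4 ≤ 20000 * (2 ^ k * (H.n + 2 * m)) ∧ τ.reg 5 = σ.reg 5 ∧ Consts H k τ ∧
        ((τ.reg 0 = 0 ∧ ∀ Z, H.CVC Z → k < Z.card) ∨
        (τ.reg 0 = 1 ∧ Small H k (τ.mem 1) (τ.mem 2) (τ.reg 4) (σ.reg 5 - 1))) by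
    refine h.mono fun τ t _ ⟨ht, e5, hC', hor⟩ => ?_
    simp only [runs_assign, safe_sub, safe_reg, safe_const, val_sub, val_reg, val_const, e5, true_and,
      cost_sub, cost_reg, cost_const]
    refine ⟨by omega, by omega, ⟨⟨?_, ?_, hC'.pw⟩, ?_⟩, ?_⟩
    · simpa using hC'.reg_n
    · simpa using hC'.reg_k
    · simpa using hor
    · simpa using h5
  rw [runs_ite]
  simp only [csafe_lt, safe_add, safe_reg, holds_lt, val_add, val_reg, hC.reg_k, true_and, and_true,
    ccost_lt, cost_add, cost_reg]
  refine ⟨by omega, fun hlt => ?_, fun hlt => ?_⟩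
  · rw [runs_seq]
    refine (S.runs_findBest hC Y).mono ?_
    rintro τ t hf ⟨ht, hB, hBest, hdom⟩
    rw [if_neg (by omega)] at ht
    have e0 : τ.reg 0 = 1 := by rw [hf.reg 0 (by simp), hr0]
    have e5 : τ.reg 5 = σ.reg 5 := hf.reg 5 (by simp)
    rw [runs_ite]
    simp only [csafe_lt, safe_const, safe_reg, holds_lt, val_const, val_reg, and_true, ccost_lt, cost_reg,
      cost_const]
    refine ⟨by omega, fun h40 => ?_, fun h40 => ?_⟩
    · rw [runs_seq]
      refine (S.runs_collect Y hB hBest (by rcases hBest with h | h <;> omega)).mono ?_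
      rintro υ t' hf' ⟨ht', X, hX0, hX, hXk, hXU, -⟩
      have hU := hXU.resolve_left (by omega)
      have hCυ := hB.consts.frame hf' (by simp) (by simp) (by simp)
      have f5 : υ.reg 5 = σ.reg 5 := by rw [hf'.reg 5 (by simp), e5]
      have f1 : υ.mem 1 = σ.mem 1 := by rw [hf'.mem 1 (by simp), hB.mem_xs]
      have f2 : υ.mem 2 = σ.mem 2 := by rw [hf'.mem 2 (by simp), hB.mem_par]
      refine (S.runs_order hX hCυ hX0 f5 hXk (by omega) (L := σ.reg 4)
        (by rw [f1, f2]; exact Y.toOrdered) hsh (by rwa [f1])).mono ?_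
      rintro ρ t'' hf'' ⟨ht'', hO, hin, hcard⟩
      have hsX : σ.reg 5 + 1 ≤ X.card := by
        have h1 : (Finset.range (σ.reg 5 + 1)).image (σ.mem 1) ⊆ X := fun v hv => by
          obtain ⟨p, hp, rfl⟩ := Finset.mem_image.1 hv
          exact hU p (by simp at hp; omega)
        have h2 := Finset.card_le_card h1
        rw [Finset.card_image_of_injOn, Finset.card_range] at h2
        · exact h2
        · intro p hp q hq
          simp at hp hq
          exact Y.inj p (by omega) q (by omega)
      refine ⟨?_, by rw [hf''.reg 5 (by simp), f5], hCυ.frame hf'' (by simp) (by simp) (by simp), Or.inr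
        ⟨by rw [hf''.reg 0 (by simp), hf'.reg 0 (by simp), e0], ⟨⟨hO, by omega, by omega, ?_⟩, ?_, ?_⟩⟩⟩
      · have h1 := sq_mul_le k (H.n + 2 * m)
        have h2 : (H.n + 2 * m) * (200 * k + 400) ≤ 600 * (k * k * (H.n + 2 * m)) := by
          rw [Nat.mul_comm, ← Nat.mul_assoc]
          exact Nat.mul_le_mul_right _ (by nlinarith)
        have h3 : (2 * k + 3) * ((H.n + 2 * m) * (200 * k + 320)) ≤
            2600 * (k * k * (H.n + 2 * m)) := by
          calc (2 * k + 3) * ((H.n + 2 * m) * (200 * k + 320))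
              = (2 * k + 3) * (200 * k + 320) * (H.n + 2 * m) := by ring
            _ ≤ 2600 * (k * k) * (H.n + 2 * m) := Nat.mul_le_mul_right _ (by nlinarith)
            _ = 2600 * (k * k * (H.n + 2 * m)) := by ring
        omega
      · intro u v h
        rw [hin, hin]
        exact hX.cover u v h
      · omega
      · omega
    · rw [runs_assign]
      simp only [safe_const, val_const, setReg_reg, setReg_mem, if_true, cost_const,
        show (5 : ℕ) ≠ 0 by decide, if_false]
      have hC' := hB.consts
      refine ⟨by omega, by omega, e5, ⟨?_, ?_, hC'.pw⟩, Or.inl ⟨trivial, fun Z hZ => ?_⟩⟩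
      · simpa using hC'.reg_n
      · simpa using hC'.reg_k
      · by_contra hk'
        -- A small cover together with the contracted vertices would have been found.
        obtain ⟨Z', hZ', hU', hcard'⟩ := (Y.toOrdered.mono (L' := σ.reg 5 + 1) (by omega)).exists_union
          (by omega) hZ
        have := hdom Z' hZ' (by omega) (Or.inr fun p hp => hU' p (by omega))
        exact h40 (by rw [this.1]; exact one_pos)
  · rw [runs_skip]
    exact ⟨by omega, rfl, hC, Or.inr ⟨hr0, ⟨⟨Y.toOrdered, Y.two_le, by omega, Y.cover⟩, hL, by omega⟩⟩⟩

/-- The memory holds a solution, or reports that there is none. -/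
def Solved (H : Net) (k : ℕ) (σ : State) : Prop :=
  (σ.reg 0 = 1 ∧ ∃ X, Lists (σ.mem 0) (σ.reg 1) X ∧ H.CVC X ∧ X.card ≤ k ∧
    ∀ Z, H.CVC Z → Z.card ≤ k → ∑ v ∈ X, H.ω v ≤ ∑ v ∈ Z, H.ω v) ∨
  (σ.reg 0 = 0 ∧ ∀ Z, H.CVC Z → k < Z.card)

theorem Setup.runs_iterate (S : Setup M I H m k off) (hm : 1 ≤ m) {σ : State} (hC : Consts H k σ) :
    Runs M I iterate σ fun τ t => t ≤ 70000 * (2 ^ k * k * (H.n + 2 * m)) ∧ Solved H k τ := by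
  have hw := S.word_le
  have hk1 := S.k_pos
  have hn1 := S.n_pos
  have hcw := S.cells_le
  have hk := S.k_le
  set B := 2 ^ k * (H.n + 2 * m) with hB
  have hB1 : 1 ≤ B := Nat.mul_pos (by positivity) (by omega)
  have hkB : 2 ^ k * k * (H.n + 2 * m) = k * B := by rw [hB]; ring
  have hkB1 : B ≤ k * B := Nat.le_mul_of_pos_left _ hk1
  have hsq := sq_mul_le k (H.n + 2 * m)
  rw [hkB, iterate, runs_seq]
  refine (S.runs_growth hm hC).mono ?_
  rintro τ t hf ⟨ht, hor⟩
  have ht2 : t ≤ 4000 * B + 50 := by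
    have h3 : (2 * k + 4) * ((H.n + 2 * m) * (100 * k + 220)) ≤
        2000 * (k * k * (H.n + 2 * m)) := by
      calc (2 * k + 4) * ((H.n + 2 * m) * (100 * k + 220))
          = (2 * k + 4) * (100 * k + 220) * (H.n + 2 * m) := by ring
        _ ≤ 2000 * (k * k) * (H.n + 2 * m) := Nat.mul_le_mul_right _ (by nlinarith)
        _ = 2000 * (k * k * (H.n + 2 * m)) := by ring
    omega
  have hCτ := hC.frame hf (by simp) (by simp) (by simp)
  rw [runs_seq]
  have hstart : Runs M I (.ite (.lt (.const 0) (.reg 0)) (.assign 5 (.reg 4 - .const 2))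
      (.assign 5 (.const 0))) τ fun υ t' => t' ≤ 20 ∧ MainInv H k υ ∧ υ.reg 5 ≤ 2 * k := by
    simp only [runs_ite, runs_assign, csafe_lt, safe_sub, safe_reg, safe_const, holds_lt, val_sub, val_reg,
      val_const, setReg_reg, if_true, true_and, and_true, ccost_lt, cost_sub, cost_reg, cost_const]
    have hC5 : ∀ a, Consts H k (τ.setReg 5 a) := fun a =>
      ⟨by simpa using hCτ.reg_n, by simpa using hCτ.reg_k, hCτ.pw⟩
    refine ⟨by omega, fun h => ?_, fun h => ?_⟩
    · rcases hor with hor | ⟨o1, o2, o3, o4, o5⟩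
      · omega
      · refine ⟨by omega, by omega, ⟨hC5 _, Or.inr ⟨by simpa using o1, ?_⟩⟩, by omega⟩
        simp only [setReg_mem, setReg_reg, if_true, show (4 : ℕ) ≠ 5 by decide, if_false]
        exact ⟨⟨o4, o3, by omega, o5⟩, o2, by omega⟩
    · rcases hor with hor | hor
      · exact ⟨by omega, by omega, ⟨hC5 _, Or.inl (by simpa using hor)⟩, by omega⟩
      · omega
  refine hstart.mono ?_
  rintro υ t' - ⟨ht', hI, h5⟩
  rw [runs_seq]
  refine Runs.loop (MainInv H k) (fun ρ => ρ.reg 5) (20000 * B) hI (fun ρ _ _ => by simp; omega) ?_ ?_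
  · intro ρ _ hIρ hb
    simp only [holds_and, holds_lt, val_const, val_reg] at hb
    exact S.runs_improve hIρ hb.2 hb.1
  intro ρ t2 _ hIρ hb ht3
  simp only [holds_and, holds_lt, val_const, val_reg, ccost_and, ccost_lt, cost_const, cost_reg]
    at hb ht3
  -- There are at most `2 * k` rounds, because `sh` starts at the length of the list minus two.
  have ht4 : t2 ≤ 40100 * (k * B) := by
    have h1 : υ.reg 5 * (20000 * B + (1 + 1 + 1 + (1 + 1 + 1) + 1) + 1) ≤ 2 * k * (20008 * B) :=
      Nat.mul_le_mul h5 (by omega)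
    have h2 : 2 * k * (20008 * B) = 40016 * (k * B) := by ring
    omega
  obtain ⟨hCρ, hor⟩ := hIρ
  rw [runs_ite]
  simp only [csafe_lt, safe_const, safe_reg, holds_lt, val_const, val_reg, and_true, ccost_lt, cost_const,
    cost_reg]
  refine ⟨by omega, fun h0 => ?_, fun h0 => ?_⟩
  · obtain ⟨hr0, Y⟩ := hor.resolve_left (by omega)
    have h50 : ρ.reg 5 = 0 := by omega
    rw [runs_seq]
    refine (S.runs_findBest hCρ Y).mono ?_
    rintro π t3 hfπ ⟨ht3', hBd, hBest, hdom⟩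
    rw [h50] at hBd hBest hdom
    rw [if_pos h50] at ht3'
    have ht5 : t3 ≤ 8000 * (k * B) := by
      have : (2000 + 3000 * (k + 1)) * B ≤ 8000 * k * B := Nat.mul_le_mul_right _ (by omega)
      have h2 : 8000 * k * B = 8000 * (k * B) := by ring
      exact ht3'.trans (this.trans h2.le)
    rw [h50] at Y
    have hdom' : ∀ Z, H.CVC Z → Z.card ≤ k → Dominates 0 H π Z := fun Z hZ hc =>
      hdom Z hZ (by omega) (Or.inl rfl)
    rw [runs_ite]
    simp only [csafe_lt, safe_const, safe_reg, holds_lt, val_const, val_reg, and_true, ccost_lt,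
      cost_const, cost_reg]
    refine ⟨by omega, fun h40 => ?_, fun h40 => ?_⟩
    · refine (S.runs_collect Y hBd hBest (by rcases hBest with h | h <;> omega)).mono ?_
      rintro κ t4 hfκ ⟨ht4', X, hX0, hX, hXk, -, hXw⟩
      refine ⟨?_, Or.inl ⟨?_, X, hX0, hX, by omega, fun Z hZ hc => ?_⟩⟩
      · have h1 : (H.n + 2 * m) * (200 * k + 400) ≤ 600 * (k * k * (H.n + 2 * m)) := by
          rw [Nat.mul_comm, ← Nat.mul_assoc]
          exact Nat.mul_le_mul_right _ (by nlinarith)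
        omega
      · rw [hfκ.reg 0 (by simp), hfπ.reg 0 (by simp), hr0]
      · exact (hXw rfl).trans ((hdom' Z hZ hc).2 rfl)
    · rw [runs_assign]
      refine ⟨by simp; omega, by simp; omega, Or.inr ⟨by simp, fun Z hZ => ?_⟩⟩
      by_contra hc
      exact h40 (by rw [(hdom' Z hZ (by omega)).1]; exact one_pos)
  · rw [runs_skip]
    rcases hor with h | h
    · exact ⟨by omega, Or.inr h⟩
    · omega

end WCVC

/-! ### The encoding of an instance -/

namespace WCVC

open RealRAM

/-- The graph on `Fin n` with adjacency lists `nb` as a graph on natural numbers. -/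
noncomputable def toNet {n : ℕ} {G : SimpleGraph (Fin n)} {nb : Fin n → List (Fin n)} {ω : Fin n → ℝ}
    (hnb : IsAdjacencyLists G nb) (hω : ∀ v, 0 < ω v) : Net where
  n := n
  nbr v := if h : v < n then (nb ⟨v, h⟩).map Fin.val else []
  ω v := if h : v < n then ω ⟨v, h⟩ else 0
  lt := by
    intro u v h
    split_ifs at h with hv
    · obtain ⟨w, -, rfl⟩ := List.mem_map.1 h
      exact w.2
    · simp at h
  symm := by
    intro u v h
    split_ifs at h with hv
    · obtain ⟨w, hw, rfl⟩ := List.mem_map.1 h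
      rw [dif_pos w.2]
      exact List.mem_map.2 ⟨⟨v, hv⟩, ((hnb _).2 _).2 (((hnb _).2 _).1 hw).symm, rfl⟩
    · simp at h
  irrefl := by
    intro v h
    split_ifs at h with hv
    · obtain ⟨w, hw, rfl⟩ := List.mem_map.1 h
      exact G.irrefl (((hnb _).2 _).1 hw)
    · simp at h
  nodup := by
    intro v
    split_ifs with hv
    · exact (hnb _).1.map Fin.val_injective
    · exact List.nodup_nil
  pos := by
    intro v hv
    rw [dif_pos hv]
    exact hω _

section Encode

variable {n : ℕ} {G : SimpleGraph (Fin n)} {nb : Fin n → List (Fin n)} {ω : Fin n → ℝ}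
  (hnb : IsAdjacencyLists G nb) (hω : ∀ v, 0 < ω v)

theorem toNet_nbr (v : Fin n) : (toNet hnb hω).nbr v = (nb v).map Fin.val := dif_pos v.2

theorem toNet_deg (v : Fin n) : (toNet hnb hω).deg v = (nb v).length := by
  rw [Net.deg, toNet_nbr, List.length_map]

theorem toNet_ω (v : Fin n) : (toNet hnb hω).ω v = ω v := dif_pos v.2

theorem toNet_mem_nbr {u v : Fin n} : (u : ℕ) ∈ (toNet hnb hω).nbr v ↔ G.Adj v u := by
  rw [toNet_nbr, List.mem_map_of_injective Fin.val_injective, (hnb v).2]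

theorem mem_map_val {X : Finset (Fin n)} (v : Fin n) : (v : ℕ) ∈ X.map Fin.valEmbedding ↔ v ∈ X :=
  Finset.mem_map' Fin.valEmbedding

/-- Connected vertex covers of the two representations of the graph correspond to each other. -/
theorem cvc_map_iff {X : Finset (Fin n)} :
    (toNet hnb hω).CVC (X.map Fin.valEmbedding) ↔ IsConnectedVertexCover G X := by
  constructor
  · rintro ⟨-, hc, hconn⟩
    refine ⟨fun u v h => ?_, fun a b => ?_⟩
    · have := hc u v ((toNet_mem_nbr hnb hω).2 h.symm)
      rwa [mem_map_val, mem_map_val] at this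
    · have := hconn {v | ∃ (h : v < n) (hX : (⟨v, h⟩ : Fin n) ∈ (X : Set (Fin n))),
        (G.induce (X : Set (Fin n))).Reachable a ⟨⟨v, h⟩, hX⟩}
        ⟨a.1, (mem_map_val _).2 a.2, a.1.2, a.2, .refl _⟩ ?_ b.1 ((mem_map_val _).2 b.2)
      · obtain ⟨h, hX, hr⟩ := this
        exact hr
      · rintro x - ⟨hx, hxX, hr⟩ y hy hxy
        obtain ⟨w, hw, rfl⟩ := Finset.mem_map.1 hy
        refine ⟨w.2, hw, hr.trans (SimpleGraph.Adj.reachable ?_)⟩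
        exact (toNet_mem_nbr hnb hω (v := ⟨x, hx⟩)).1 hxy
  · rintro ⟨hc, hconn⟩
    refine ⟨fun v hv => ?_, fun u v h => ?_, ?_⟩
    · obtain ⟨w, -, rfl⟩ := Finset.mem_map.1 hv
      exact w.2
    · have hv := (toNet hnb hω).lt ((toNet hnb hω).symm h)
      have hu := (toNet hnb hω).lt h
      have := hc ((toNet_mem_nbr hnb hω (u := ⟨u, hu⟩) (v := ⟨v, hv⟩)).1 h)
      exact Or.imp (mem_map_val ⟨u, hu⟩).2 (mem_map_val ⟨v, hv⟩).2 this.symm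
    · rintro R ⟨r, hr, hrR⟩ hR x hx
      obtain ⟨a, ha, rfl⟩ := Finset.mem_map.1 hr
      obtain ⟨b, hb, rfl⟩ := Finset.mem_map.1 hx
      have h := (SimpleGraph.reachable_iff_reflTransGen _ _).1 (hconn ⟨a, ha⟩ ⟨b, hb⟩)
      have key : ∀ c : (X : Set (Fin n)), Relation.ReflTransGen (G.induce (X : Set (Fin n))).Adj ⟨a, ha⟩ c →
          ((c : Fin n) : ℕ) ∈ R := by
        intro c hc
        induction hc with
        | refl => exact hrR
        | @tail c d _ hcd ih =>
          refine hR c ((mem_map_val _).2 c.2) ih d ((mem_map_val _).2 d.2) ((toNet_mem_nbr hnb hω).2 ?_)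
          exact hcd
      exact key _ h

theorem exists_map {X : Finset ℕ} (hX : ∀ v ∈ X, v < n) :
    ∃ Y : Finset (Fin n), Y.map Fin.valEmbedding = X := by
  refine ⟨Finset.univ.filter fun v => (v : ℕ) ∈ X, ?_⟩
  ext v
  simp only [Finset.mem_map, Finset.mem_filter, Finset.mem_univ, true_and, Fin.valEmbedding_apply]
  constructor
  · rintro ⟨w, hw, rfl⟩
    exact hw
  · exact fun h => ⟨⟨v, hX v h⟩, h, rfl⟩

theorem sum_map (X : Finset (Fin n)) :
    ∑ v ∈ X.map Fin.valEmbedding, (toNet hnb hω).ω v = ∑ v ∈ X, ω v := by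
  rw [Finset.sum_map]
  exact Finset.sum_congr rfl fun v _ => toNet_ω hnb hω v

variable (nb) in
/-- The position at which the adjacency list of the vertex `i` starts. -/
def offset (i : ℕ) : ℕ := ∑ v : Fin n with v.val < i, (nb v).length

theorem offset_succ (v : Fin n) : offset nb (v + 1) = offset nb v + (nb v).length := by
  have : (Finset.univ.filter fun w : Fin n => w.val < v + 1) =
      insert v (Finset.univ.filter fun w : Fin n => w.val < v) := by
    ext w
    simp only [Finset.mem_filter, Finset.mem_univ, true_and, Finset.mem_insert, Fin.ext_iff]
    omega
  rw [offset, this, Finset.sum_insert (by simp), offset, add_comm]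

theorem offset_last (hnb : IsAdjacencyLists G nb) : offset nb n = 2 * G.edgeSet.ncard := by
  classical
  have h1 : ∀ v, (nb v).length = G.degree v := by
    intro v
    rw [← SimpleGraph.card_neighborFinset_eq_degree, ← List.toFinset_card_of_nodup (hnb v).1]
    congr 1
    ext u
    simp [(hnb v).2]
  have h2 := G.sum_degrees_eq_twice_card_edges
  rw [offset, Finset.filter_true_of_mem fun v _ => v.2, Finset.sum_congr rfl fun v _ => h1 v, h2,
    ← SimpleGraph.coe_edgeFinset, Set.ncard_coe_finset]

theorem getElem?_flatten {α : Type*} (l : List (List α)) (i d : ℕ) (hi : i < l.length)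
    (hd : d < l[i].length) : l.flatten[((l.take i).map List.length).sum + d]? = some l[i][d] := by
  induction l generalizing i with
  | nil => simp at hi
  | cons a l ih =>
    cases i with
    | zero =>
      simp only [List.getElem_cons_zero] at hd
      simp [List.getElem?_append_left, hd]
    | succ i =>
      simp only [List.getElem_cons_succ] at hd ⊢
      rw [List.take_succ_cons, List.map_cons, List.sum_cons, List.flatten_cons, Nat.add_assoc,
        List.getElem?_append_right (by omega), Nat.add_sub_cancel_left]
      exact ih i (by simpa using hi) hd

theorem offset_eq (i : ℕ) (hi : i ≤ n) :
    offset nb i = (((List.ofFn nb).take i).map List.length).sum := by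
  induction i with
  | zero => simp [offset]
  | succ i ih =>
    have := offset_succ (nb := nb) ⟨i, hi⟩
    rw [this, ih (by omega), List.take_add_one, List.map_append, List.sum_append]
    simp [show i < n by omega]

theorem encode_setup {k C : ℕ} (hk : 1 ≤ k) (hm : 1 ≤ G.edgeSet.ncard) (hC : 200 ≤ C) :
    Setup { cells := C * (2 ^ k * k + 1), word := C * (2 ^ k * k + n + G.edgeSet.ncard + 1) }
      (encode G nb ω k) (toNet hnb hω) G.edgeSet.ncard k (offset nb) := by
  have hn : 1 ≤ n := by
    by_contra h
    obtain rfl : n = 0 := by omega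
    have := offset_last hnb
    simp [offset] at this
    omega
  have hflat : ∀ v : Fin n, ∀ d (hd : d < (nb v).length),
      ((List.ofFn nb).flatten.map Fin.val)[offset nb v + d]? = some ((nb v)[d] : ℕ) := by
    intro v d hd
    have := getElem?_flatten (List.ofFn nb) v d (by simp) (by simpa using hd)
    rw [List.getElem?_map, offset_eq v v.2.le, this]
    simp
  refine ⟨hk, hn, fun v hv => ?_, fun v hv => ?_, ?_, fun v hv => ?_, offset_last hnb,
    fun v hv d hd => ?_, fun v hv d hd => ?_, fun v hv => ?_, fun v hv => ?_, ?_, ?_, ?_⟩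
  · change v ≤ n at hv
    simp [Input.HasWord, encode]
    omega
  · change v ≤ n at hv
    change List.getD (List.ofFn fun i : Fin (n + 1) =>
      ∑ v : Fin n with v.val < i.val, (nb v).length) v 0 = offset nb v
    rw [List.getD_eq_getElem?_getD, List.getElem?_ofFn, dif_pos (Nat.lt_succ_of_le hv)]
    rfl
  · simp [offset]
  · rw [toNet_deg hnb hω ⟨v, hv⟩]
    exact offset_succ ⟨v, hv⟩
  · rw [toNet_deg hnb hω ⟨v, hv⟩] at hd
    have := hflat ⟨v, hv⟩ d hd
    refine ⟨by simp [encode], ?_⟩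
    exact (List.getElem?_eq_some_iff.1 this).1
  · change v < n at hv
    have hd' := hd
    rw [toNet_deg hnb hω ⟨v, hv⟩] at hd'
    have := hflat ⟨v, hv⟩ d hd'
    rw [Net.nth, toNet_nbr hnb hω ⟨v, hv⟩, Input.word]
    change List.getD _ _ 0 = _
    rw [List.getD_eq_getElem?_getD, List.getD_eq_getElem?_getD]
    change Option.getD (((List.ofFn nb).flatten.map Fin.val)[offset nb v + d]?) 0 = _
    rw [this]
    simp [List.getD_eq_getElem?_getD, hd']
  · change v < n at hv
    simpa [encode] using hv
  · rw [toNet_ω hnb hω ⟨v, hv⟩]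
    change v < n at hv
    simp [encode, List.getD_eq_getElem?_getD, hv]
  · have h : 100 * (n + 2 * G.edgeSet.ncard + 1) ≤ 200 * (2 ^ k * k + n + G.edgeSet.ncard + 1) := by
      omega
    exact h.trans (Nat.mul_le_mul_right _ hC)
  · exact Nat.mul_le_mul_left _ (by omega)
  · exact Nat.mul_le_mul (by omega) (by omega)

end Encode

/-- Tabulate the powers of two up to `2 ^ (k + 1)`. -/
def powers : Prog :=
  .store 3 (.const 0) (.const 1) ;; .assign 49 (.reg 3 + .const 2) ;;
  .for 50 (.const 1) 49
    (.store 3 (.reg 50) (.load 3 (.reg 50 - .const 1) + .load 3 (.reg 50 - .const 1)))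

theorem Setup.runs_powers {M : Limits} {I : Input} {H : Net} {m k : ℕ} {off : ℕ → ℕ}
    (S : Setup M I H m k off) {σ : State} (h2 : σ.reg 2 = H.n) (h3 : σ.reg 3 = k) :
    Runs M I powers σ fun τ t => t ≤ 100 * k ∧ Consts H k τ := by
  have hw := S.word_le
  have hk1 := S.k_pos
  have hcw := S.cells_le
  have hk := S.k_le
  have hp := S.two_pow_le
  rw [powers]
  simp only [runs_seq (p := Prog.assign _ _), runs_seq (p := Prog.store _ _ _), runs_assign, runs_store,
    safe_const, safe_add, safe_reg, val_const, val_add, val_reg, setMem_reg, h3, true_and, cost_const,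
    cost_add, cost_reg]
  refine ⟨by omega, by omega, by omega, by omega, ?_⟩
  refine Runs.for_const 1 (k + 2) (fun i τ => ∀ j < i, τ.mem 3 j = 2 ^ j) 20 (by simp; omega) rfl
    (by simp) (by omega) (by omega) (by decide) (by simp) (by simp) ?_ ?_ ?_
  · intro j hj
    obtain rfl : j = 0 := by omega
    simp
  · intro i τ h1 hi hf h50 hI
    have hIi := hI (i - 1) (by omega)
    have hlt : 2 ^ (i - 1) ≤ 2 ^ k := Nat.pow_le_pow_right (by omega) (by omega)
    simp only [runs_store, safe_reg, safe_add, safe_load, safe_sub, safe_const, val_reg, val_add, val_load,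
      val_sub, val_const, h50, hIi, true_and, cost_reg, cost_add, cost_load, cost_sub, cost_const]
    refine ⟨by omega, by omega, by omega, fun j hj => ?_⟩
    simp only [setReg_mem, setMem_mem, if_true]
    by_cases h : j = i
    · subst h
      rw [Function.update_self, ← two_mul, ← pow_succ']
      congr 1
      omega
    · rw [Function.update_of_ne h]
      exact hI j (by omega)
  · intro τ t hf _ hI ht
    simp only [cost_const] at ht
    refine ⟨by omega, ?_, ?_, fun j hj => hI j (by omega)⟩
    · rw [hf.reg 2 (by simp)]
      simpa using h2
    · rw [hf.reg 3 (by simp)]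
      simpa using h3

/-- The program that solves Weighted Connected Vertex Cover. The main computation presupposes
`1 ≤ k` and an edge; the other cases are decided directly. -/
def solve : Prog :=
  .assign 2 (.input 0 (.const 0)) ;; .assign 3 (.input 0 (.const 2)) ;;
  .ite (.lt (.const 0) (.input 0 (.const 1)))
    (.ite (.lt (.const 0) (.reg 3)) (powers ;; iterate) (.assign 0 (.const 0)))
    (.assign 0 (.const 1))

/-- A final memory that is correct for the graph on natural numbers is correct for `G`. -/
theorem Solved.correct {n : ℕ} {G : SimpleGraph (Fin n)} {nb : Fin n → List (Fin n)} {ω : Fin n → ℝ}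
    {hnb : IsAdjacencyLists G nb} {hω : ∀ v, 0 < ω v} {k : ℕ} {σ : State}
    (h : Solved (toNet hnb hω) k σ) :
    (∃ X : Finset (Fin n), IsSolution G ω k X ∧ Reports σ X) ∨
      ((∀ X : Finset (Fin n), IsConnectedVertexCover G X → k < X.card) ∧ ReportsNone σ) := by
  rcases h with ⟨h0, X, hX, hc, hXk, hmin⟩ | ⟨h0, hnone⟩
  · left
    obtain ⟨Y, rfl⟩ := exists_map (n := n) hc.lt
    have hcard := hX.card
    rw [Finset.card_map] at hcard hXk
    refine ⟨Y, ⟨(cvc_map_iff hnb hω).1 hc, hXk, fun Z hZ hZk => ?_⟩, h0, hcard, ?_⟩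
    · rw [← sum_map hnb hω, ← sum_map hnb hω]
      exact hmin _ ((cvc_map_iff hnb hω).2 hZ) (by rwa [Finset.card_map])
    · rw [← hcard]
      exact hX.image_eq
  · right
    refine ⟨fun X hX => ?_, h0⟩
    have := hnone _ ((cvc_map_iff hnb hω).2 hX)
    rwa [Finset.card_map] at this

theorem isSolution_empty {n : ℕ} {G : SimpleGraph (Fin n)} {ω : Fin n → ℝ} (hω : ∀ v, 0 < ω v)
    (k : ℕ) (hG : G.edgeSet.ncard = 0) : IsSolution G ω k ∅ := by
  have hG' : G.edgeSet = ∅ := (Set.ncard_eq_zero (Set.toFinite _)).1 hG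
  refine ⟨⟨fun u v h => ?_, fun a => ?_⟩, by simp, fun Y _ _ => ?_⟩
  · have : s(u, v) ∈ G.edgeSet := h
    simp [hG'] at this
  · simp
  · simpa using Finset.sum_nonneg fun v _ => (hω v).le

theorem card_pos_of_cover {n : ℕ} {G : SimpleGraph (Fin n)} (hG : G.edgeSet.ncard ≠ 0)
    {X : Finset (Fin n)} (hX : IsConnectedVertexCover G X) : 0 < X.card := by
  rw [Finset.card_pos, Finset.nonempty_iff_ne_empty]
  rintro rfl
  obtain ⟨e, he⟩ := Set.nonempty_of_ncard_ne_zero hG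
  induction e with
  | h u v =>
    have := hX.1 (v := u) (w := v) he
    simp at this

theorem runs_solve {n : ℕ} {G : SimpleGraph (Fin n)} {nb : Fin n → List (Fin n)} {ω : Fin n → ℝ}
    (k : ℕ) (hnb : IsAdjacencyLists G nb) (hω : ∀ v, 0 < ω v) {C : ℕ} (hC : 200000 ≤ C) :
    Runs { cells := C * (2 ^ k * k + 1), word := C * (2 ^ k * k + n + G.edgeSet.ncard + 1) }
      (encode G nb ω k) solve State.init fun σ t =>
        t ≤ C * (2 ^ k * k * (n + G.edgeSet.ncard) + 1) ∧
        ((∃ X : Finset (Fin n), IsSolution G ω k X ∧ Reports σ X) ∨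
          ((∀ X : Finset (Fin n), IsConnectedVertexCover G X → k < X.card) ∧ ReportsNone σ)) := by
  have hk : k ≤ 2 ^ k * k := Nat.le_mul_of_pos_left _ (by positivity)
  have hCt := Nat.mul_le_mul_right (2 ^ k * k * (n + G.edgeSet.ncard) + 1) hC
  have hCw := Nat.mul_le_mul_right (2 ^ k * k + n + G.edgeSet.ncard + 1) hC
  set M : Limits :=
    { cells := C * (2 ^ k * k + 1), word := C * (2 ^ k * k + n + G.edgeSet.ncard + 1) } with hM
  have hw : 200000 * (2 ^ k * k + n + G.edgeSet.ncard + 1) ≤ M.word := hCw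
  have h0 : (encode G nb ω k).word 0 0 = n := rfl
  have h1 : (encode G nb ω k).word 0 1 = G.edgeSet.ncard := rfl
  have h2 : (encode G nb ω k).word 0 2 = k := rfl
  have hW : ∀ i < 3, (encode G nb ω k).HasWord 0 i := fun i hi => ⟨by simp [encode], hi⟩
  rw [solve]
  simp only [runs_seq (p := Prog.assign _ _), runs_assign, runs_ite, safe_input, safe_const, safe_reg,
    val_input, val_const, val_reg, csafe_lt, holds_lt, cost_input, cost_const, cost_reg, ccost_lt, h0, h1,
    h2, setReg_reg, if_true]
  refine ⟨⟨by omega, hW 0 (by omega), by omega⟩, ⟨by omega, hW 2 (by omega), by omega⟩,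
    ⟨by omega, by omega, hW 1 (by omega), by omega⟩, ?_⟩
  refine ⟨fun hm => ⟨⟨by omega, trivial⟩, fun hk0 => ?_, fun hk0 => ?_⟩, fun hm => ?_⟩
  · have S := encode_setup (k := k) hnb hω hk0 hm (by omega : 200 ≤ C)
    rw [← hM] at S
    rw [runs_seq]
    refine (S.runs_powers (by simp [toNet]) (by simp)).mono fun τ t _ ⟨ht, hτ⟩ => ?_
    refine (S.runs_iterate hm hτ).mono fun υ u _ ⟨hu, hυ⟩ => ⟨?_, hυ.correct⟩
    have hkn : k ≤ 2 ^ k * k * (n + G.edgeSet.ncard) :=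
      hk.trans (Nat.le_mul_of_pos_right _ (by omega))
    have hu' : u ≤ 70000 * (2 ^ k * k * (n + 2 * G.edgeSet.ncard)) := hu
    have h3 : 2 ^ k * k * (n + 2 * G.edgeSet.ncard) ≤ 2 * (2 ^ k * k * (n + G.edgeSet.ncard)) := by
      nlinarith [Nat.zero_le (2 ^ k * k * n)]
    omega
  · refine ⟨by omega, by omega, Or.inr ⟨fun X hX => ?_, by simp [ReportsNone]⟩⟩
    have := card_pos_of_cover (by omega) hX
    omega
  · refine ⟨by omega, by omega, Or.inl ⟨∅, isSolution_empty hω k (by omega), ?_⟩⟩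
    simp [Reports, State.init]

end WCVC

theorem theorem1 :
    ∃ (p : RealRAM.Prog) (C : ℕ),
      ∀ (n : ℕ) (G : SimpleGraph (Fin n)) (nb : Fin n → List (Fin n)) (ω : Fin n → ℝ) (k : ℕ),
        WCVC.IsAdjacencyLists G nb → (∀ v, 0 < ω v) →
        ∃ (σ : RealRAM.State) (t : ℕ),
          RealRAM.Exec
            { cells := C * (2 ^ k * k + 1)
              word := C * (2 ^ k * k + n + G.edgeSet.ncard + 1) }
            (WCVC.encode G nb ω k) p RealRAM.State.init σ t ∧
          t ≤ C * (2 ^ k * k * (n + G.edgeSet.ncard) + 1) ∧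
          ((∃ X : Finset (Fin n), WCVC.IsSolution G ω k X ∧ WCVC.Reports σ X) ∨
            ((∀ X : Finset (Fin n), WCVC.IsConnectedVertexCover G X → k < X.card) ∧
              WCVC.ReportsNone σ)) := by
  refine ⟨WCVC.solve, 200000, fun n G nb ω k hnb hω => ?_⟩
  obtain ⟨σ, t, h, ht, hσ⟩ := WCVC.runs_solve k hnb hω le_rfl
  exact ⟨σ, t, h, ht, hσ⟩
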